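/- **Spaces.** Let $\mathbb T=[-\infty,\infty)$ with its usual topology, $\mathbb T^r$ with the product topology, $\operatorname{sed}(x)=\{i: x_i=-\infty\}$ and $\mathbb R^r_I=\{x\in\mathbb T^r:\operatorname{sed}(x)=I\}$. A rational polyhedron in $\mathbb T^r$ is the closure of a set $\{x\in\mathbb R^r_I:(w_a,x)\le c_a,\ a=1,\dots,k\}$ with $w_a\in\mathbb Z^r$, $c_a\in\mathbb R$; its faces are the nonempty closures of the faces of its intersections with the $\mathbb R^r_J$ (a face being obtained by turning finitely many, possibly no, valid integral inequalities into equalities). A rational polyhedral complex is a locally finite, face-closed collection of rational polyhedra, any two of which are disjoint or meet in a common face. An open rational polyhedron is a connected open subset $\sigma$ of a rational polyhedron; if $\sigma$ is a connected component of $P\cap U$ with $P$ a rational polyhedron and $U\subset\mathbb T^r$ open, its faces are the subsets of $\sigma$ that are connected components of $Q\cap U$ for a face $Q$ of $P$. An open rational polyhedral complex is a collection of open rational polyhedra, locally finite along its support, face-closed, and such that every connected component of the intersection of two members is a face of both. A rational polyhedral space is a paracompact second countable Hausdorff space $X$ with an atlas of homeomorphisms from open subsets of $X$ onto open subsets of supports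 of rational polyhedral complexes in spaces $\mathbb T^{r}$, of dimension bounded by a common constant, whose transition maps have the form $x\mapsto Ax+b$ with $A$ an integral matrix and $b$ real (with $0\cdot(-\infty)=0$). An open face structure is a locally finite cover $\mathcal C$ of $X$ by nonempty closed sets (cells) together with, for each $\sigma\in\mathcal C$, a chart of the atlas whose domain contains the closed star $\{\tau\in\mathcal C:\exists\sigma'\in\mathcal C,\ \tau\cap\sigma'\ne\emptyset\ne\sigma\cap\sigma'\}$ and which maps the cells of the star and the cells contained in them (their faces) to an open rational polyhedral complex. The relative interior of a cell is the set of its points lying in no cell properly contained in it. Let $X$ moreover be filtered by closed sets $X=X^n\supset X^{n-1}\supset\dots\supset X^{-1}=\emptyset$. Strata are the connected components $S$ of the $X^i\smallsetminus X^{i-1}$, with $\dim S=i$ and $\operatorname{codim}S=n-i$, and $\Sigma=X^{n-1}$. The open face structure is required to be stratified: the relative interior of each cell $\sigma$ lies in a stratum $S_\sigma$ with $\dim\sigma\le\dim S_\sigma$, and $\dim S_\tau\le\dim S_\sigma$ if $\tau$ is a face of $\sigma$. A perversity $\bar p$ is any $\mathbb Z$-valued function on strata that vanishes on strata of dimension $n$.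 Let $Q$ be a Dedekind domain (fields included) with $\mathbb Z\subset Q\subset\mathbb R$, and let $p\ge0$. **Chains.** For a cell $\sigma$ (viewed in its chart, with $\operatorname{sed}(\sigma)=I$) put $\mathbf F^{\mathbb Z}_p(\sigma)=\bigl(\sum_{\sigma'}\bigwedge^p\mathbb L(\sigma')\bigr)\cap\bigwedge^p\mathbb Z^r_I$, the sum over the cells $\sigma'$ of sedentarity $I$ having $\sigma$ as a face, where $\mathbb L(\sigma')$ is the tangent space of $\sigma'$; put $\mathbf F^Q_p(\sigma)=Q\otimes\mathbf F^{\mathbb Z}_p(\sigma)$. For a face $\tau$ of $\sigma$ there is a natural map $\mathbf F^Q_p(\sigma)\to\mathbf F^Q_p(\tau)$. A simplex is a continuous map $\delta\colon\Delta_q\to X$ that sends the relative interior of each face of $\Delta_q$ into the relative interior of some cell. GM $(p,q)$-chains are finite sums $\sum a_\delta\,\delta$ over $q$-simplices, where $a_\delta\in\mathbf F^Q_p(\sigma_\delta)$ and $\sigma_\delta$ is the cell whose relative interior contains $\delta(\operatorname{relint}\Delta_q)$; the boundary is $\partial(a\,\delta)=\sum_j(-1)^j a|_{\sigma_{\delta_j}}\,\delta_j$,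 with $\delta_j$ the $j$-th face of $\delta$. In the non-GM version, simplices contained in $\Sigma$ are excluded from chains and omitted from boundaries. A $q$-simplex is allowable if $\delta^{-1}(S)$ is contained in the $(q-\operatorname{codim}S+\bar p(S))$-skeleton of $\Delta_q$ for every stratum $S$. For $U\subset X$ open, $IC_{p,q}(U)$ consists of the chains of simplices in $U$ such that all simplices occurring in the chain or in its boundary (in the version in question) are allowable. For open $A\subset U$ put $IC_{p,\bullet}(U,A)=IC_{p,\bullet}(U)/IC_{p,\bullet}(A)$ and $IC^{p,\bullet}(U,A)=\operatorname{Hom}_Q(IC_{p,\bullet}(U,A),Q)$; their (co)homology is $IH_{p,q}(U,A)$ and $IH^{p,q}(U,A)$. Finally $IH^{BM}_{p,q}(U)$ and $IH^{p,q}_c(U)$ are the (co)homology of $\varprojlim_K IC_{p,\bullet}(U,U\smallsetminus K)$ and $\varinjlim_K IC^{p,\bullet}(U,U\smallsetminus K)$, with $K$ running over the compact subsets of $U$. **Proposition.** Let $X$ be a filtered rational polyhedral space with an open face structure, and fix $p$, $Q$, a perversity, and the version (GM or non-GM). Let $U,V\subset X$ be open with $U\cup V=X$, and let $A\subset U$,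 $B\subset V$ be open. *Excision.* The inclusion induces isomorphisms $IH_{p,q}(V,U\cap V)\cong IH_{p,q}(X,U)$ for all $q\ge0$. *Mayer–Vietoris.* There are connecting homomorphisms (the last arrow of each line) making the following long exact sequences. 1. $\cdots\to IH_{p,q}(U\cap V,A\cap B)\to IH_{p,q}(U,A)\oplus IH_{p,q}(V,B)\to IH_{p,q}(X,A\cup B)\to IH_{p,q-1}(U\cap V,A\cap B)\to\cdots$ 2. $\cdots\to IH^{p,q}(X,A\cup B)\to IH^{p,q}(U,A)\oplus IH^{p,q}(V,B)\to IH^{p,q}(U\cap V,A\cap B)\to IH^{p,q+1}(X,A\cup B)\to\cdots$ 3. $\cdots\to IH^{BM}_{p,q}(X)\to IH^{BM}_{p,q}(U)\oplus IH^{BM}_{p,q}(V)\to IH^{BM}_{p,q}(U\cap V)\to IH^{BM}_{p,q-1}(X)\to\cdots$ 4. $\cdots\to IH_c^{p,q}(U\cap V)\to IH_c^{p,q}(U)\oplus IH_c^{p,q}(V)\to IH_c^{p,q}(X)\to IH_c^{p,q+1}(U\cap V)\to\cdots$ Groups in negative degree are zero, so that the sequences include their ends. In each sequence the first map is $x\mapsto(f_1x,-f_2x)$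 and the second $(y,z)\mapsto g_1y+g_2z$, where $f_i,g_i$ are the following natural maps: induced by inclusion in 1; restriction in 2; restriction to open subsets in 3; extension from open subsets in 4. The last two are defined as follows. For open $W\subset Y\subset X$, and $K$ running over the compact subsets of $W$, the inclusions induce isomorphisms $$IH^{BM}_{p,q}(W)\to H_q\bigl(\varprojlim_{K}IC_{p,\bullet}(Y,Y\smallsetminus K)\bigr),\qquad H^q\bigl(\varinjlim_{K}IC^{p,\bullet}(Y,Y\smallsetminus K)\bigr)\to IH_c^{p,q}(W),$$ which is part of the claim. Restriction $IH^{BM}_{p,q}(Y)\to IH^{BM}_{p,q}(W)$ is the map $IH^{BM}_{p,q}(Y)\to H_q(\varprojlim_{K\subset W}IC_{p,\bullet}(Y,Y\smallsetminus K))$ that restricts the index set, followed by the inverse of the first isomorphism. Extension $IH^{p,q}_c(W)\to IH^{p,q}_c(Y)$ is the inverse of the second isomorphism followed by the map $H^q(\varinjlim_{K\subset W}IC^{p,\bullet}(Y,Y\smallsetminus K))\to IH^{p,q}_c(Y)$ that enlarges the index set. -/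

import Mathlib

open TopologicalSpace Topology
open scoped TensorProduct

universe u

/-- The tropical line `[-∞, ∞)` with its usual topology. -/
abbrev Trop : Type := Set.Iio (⊤ : EReal)

/-- The tropical affine space `[-∞, ∞)^r` with the product topology. -/
abbrev TropSpace (r : ℕ) : Type := Fin r → Trop

namespace TropSpace

variable {r : ℕ}

/-- The sedentarity of a point: the set of coordinates equal to `-∞`. -/
def sed (x : TropSpace r) : Set (Fin r) := {i | (x i : EReal) = ⊥}

/-- The real coordinates of a point, with `-∞` replaced by `0`.  On the stratum of points of
sedentarity `I` this identifies that stratum with the vectors in `ℝ^r` vanishing on `I`. -/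
noncomputable def re (x : TropSpace r) : Fin r → ℝ := fun i => (x i : EReal).toReal

/-- The value `(w, x)` of an integral linear form on the finite coordinates of `x`. -/
noncomputable def dot (w : Fin r → ℤ) (x : TropSpace r) : ℝ := ∑ i, (w i : ℝ) * re x i

/-- A rational polyhedron in `[-∞, ∞)^r`: the closure of a rational polyhedron (finitely many
inequalities with integral linear parts) in one of the strata `{sed = I}`. -/
def IsPolyhedron (P : Set (TropSpace r)) : Prop :=
  ∃ (I : Set (Fin r)) (k : ℕ) (w : Fin k → Fin r → ℤ) (c : Fin k → ℝ),
    P = closure {x | sed x = I ∧ ∀ a, dot (w a) x ≤ c a}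

/-- `Q` is a (nonempty) face of the rational polyhedron `P`: the closure of a face of `P ∩ {sed = J}`
for some `J`, where a face is obtained by turning finitely many (possibly no) integral
inequalities that hold on `P ∩ {sed = J}` into equalities. -/
def IsPolyFace (Q P : Set (TropSpace r)) : Prop :=
  Q.Nonempty ∧ ∃ (J : Set (Fin r)) (k : ℕ) (w : Fin k → Fin r → ℤ) (c : Fin k → ℝ),
    (∀ x ∈ P, sed x = J → ∀ a, dot (w a) x ≤ c a) ∧
    Q = closure {x | x ∈ P ∧ sed x = J ∧ ∀ a, dot (w a) x = c a}

/-- The sedentarity of a set: the coordinates that are `-∞` on all of it.  For an (open)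
polyhedron this is the sedentarity of all points of its relative interior. -/
def setSed (S : Set (TropSpace r)) : Set (Fin r) := {i | ∀ x ∈ S, i ∈ sed x}

/-- The tangent space of an (open) polyhedron: the direction of the affine span of its part of
minimal sedentarity, as a space of vectors in `ℝ^r` that vanish on the sedentarity. -/
noncomputable def tangent (S : Set (TropSpace r)) : Submodule ℝ (Fin r → ℝ) :=
  Submodule.span ℝ {v | ∃ x ∈ S, ∃ y ∈ S, sed x = setSed S ∧ sed y = setSed S ∧ v = re x - re y}

/-- The dimension of an (open) polyhedron. -/
noncomputable def polyDim (S : Set (TropSpace r)) : ℕ := Module.finrank ℝ (tangent S)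

/-- A rational polyhedral complex in `[-∞, ∞)^r`. -/
structure IsPolyComplex (C : Set (Set (TropSpace r))) : Prop where
  isPolyhedron : ∀ σ ∈ C, IsPolyhedron σ
  locallyFinite : LocallyFinite (fun σ : C => (σ : Set (TropSpace r)))
  face_mem : ∀ σ ∈ C, ∀ τ, IsPolyFace τ σ → τ ∈ C
  inter : ∀ σ ∈ C, ∀ σ' ∈ C, (σ ∩ σ').Nonempty → IsPolyFace (σ ∩ σ') σ ∧ IsPolyFace (σ ∩ σ') σ'

/-- `s` is a connected component of the subset `t`. -/
def IsComponentOf {Y : Type*} [TopologicalSpace Y] (s t : Set Y) : Prop :=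
  ∃ x ∈ t, s = connectedComponentIn t x

/-- An open rational polyhedron: a connected (in particular nonempty) open subset of a rational
polyhedron. -/
def IsOpenPolyhedron (σ : Set (TropSpace r)) : Prop :=
  IsConnected σ ∧ ∃ P U, IsPolyhedron P ∧ IsOpen U ∧ σ = P ∩ U

/-- `τ` is a face of the open rational polyhedron `σ`: for a polyhedron `P` and an open set `U`
such that `σ` is a connected component of `P ∩ U`, the subset `τ` of `σ` is a connected component
of `Q ∩ U` for some face `Q` of `P`. -/
def IsOpenPolyFace (τ σ : Set (TropSpace r)) : Prop :=
  τ ⊆ σ ∧ ∃ P U Q, IsPolyhedron P ∧ IsOpen U ∧ IsComponentOf σ (P ∩ U) ∧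
    IsPolyFace Q P ∧ IsComponentOf τ (Q ∩ U)

/-- An open rational polyhedral complex in `[-∞, ∞)^r`: a collection of open rational polyhedra,
locally finite along its support, closed under faces, in which any two members meet along common
faces (open polyhedra are not convex, so that an intersection may have several components). -/
structure IsOpenPolyComplex (C : Set (Set (TropSpace r))) : Prop where
  isOpenPolyhedron : ∀ σ ∈ C, IsOpenPolyhedron σ
  locallyFinite : ∀ x ∈ ⋃₀ C, ∃ W ∈ 𝓝 x, {σ | σ ∈ C ∧ (σ ∩ W).Nonempty}.Finite
  face_mem : ∀ σ ∈ C, ∀ τ, IsOpenPolyFace τ σ → τ ∈ C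
  inter : ∀ σ ∈ C, ∀ σ' ∈ C, ∀ ρ, IsComponentOf ρ (σ ∩ σ') →
    IsOpenPolyFace ρ σ ∧ IsOpenPolyFace ρ σ'

/-! ### Convexity in tropical affine space -/

open Classical in
/-- Convex combination, equal to `-∞` where one of the two coordinates is `-∞`. -/
noncomputable def comb (ε : ℝ) (x z : TropSpace r) : TropSpace r := fun i =>
  if i ∈ sed x ∪ sed z then ⟨⊥, Set.mem_Iio.2 bot_lt_top⟩
  else ⟨((ε * re x i + (1 - ε) * re z i : ℝ) : EReal), Set.mem_Iio.2 (EReal.coe_lt_top _)⟩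

lemma sed_comb (ε : ℝ) (x z : TropSpace r) : sed (comb ε x z) = sed x ∪ sed z := by
  ext i
  by_cases h : i ∈ sed x ∪ sed z
  · simp only [h, iff_true]
    change (comb ε x z i : EReal) = ⊥
    simp only [comb, if_pos h]
  · simp only [h, iff_false]
    change ¬ (comb ε x z i : EReal) = ⊥
    simp only [comb, if_neg h]
    exact EReal.coe_ne_bot _

lemma re_of_mem {x : TropSpace r} {i : Fin r} (h : i ∈ sed x) : re x i = 0 := by
  have : (x i : EReal) = ⊥ := h
  simp [re, this]

lemma coe_re {x : TropSpace r} {i : Fin r} (h : i ∉ sed x) :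
    ((re x i : ℝ) : EReal) = x i :=
  EReal.coe_toReal (ne_of_lt (x i).2) h

lemma re_comb {ε : ℝ} {x z : TropSpace r} {i : Fin r} (h : i ∉ sed x ∪ sed z) :
    re (comb ε x z) i = ε * re x i + (1 - ε) * re z i := by
  simp only [re, comb, if_neg h, EReal.toReal_coe]

lemma coe_comb {ε : ℝ} (h0 : 0 < ε) (h1 : ε < 1) (x z : TropSpace r) (i : Fin r) :
    (comb ε x z i : EReal) = (ε : EReal) * x i + ((1 - ε : ℝ) : EReal) * z i := by
  by_cases hx : i ∈ sed x
  · have : (x i : EReal) = ⊥ := hx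
    simp [comb, hx, this, EReal.coe_mul_bot_of_pos h0]
  by_cases hz : i ∈ sed z
  · have : (z i : EReal) = ⊥ := hz
    simp only [comb, hz, Set.mem_union, or_true, if_true, this]
    rw [EReal.coe_mul_bot_of_pos (by linarith)]
    simp
  · have h : i ∉ sed x ∪ sed z := by simp [hx, hz]
    simp only [comb, if_neg h]
    rw [← coe_re hx, ← coe_re hz]
    push_cast; rfl

lemma continuous_comb {ε : ℝ} (h0 : 0 < ε) (h1 : ε < 1) :
    Continuous (fun p : TropSpace r × TropSpace r => comb ε p.1 p.2) := by
  have hm : ∀ c : ℝ, 0 < c → Continuous (fun y : Trop => (c : EReal) * (y : EReal)) := by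
    intro c hc
    rw [continuous_iff_continuousAt]
    intro y
    have hc' : ((c : ℝ) : EReal) ≠ 0 := by exact_mod_cast hc.ne'
    have := EReal.continuousAt_mul (p := ((c : EReal), (y : EReal))) (Or.inl hc') (Or.inl hc')
      (Or.inl (EReal.coe_ne_bot c)) (Or.inl (EReal.coe_ne_top c))
    exact this.comp (f := fun y : Trop => ((c : EReal), (y : EReal)))
      (continuous_const.prodMk continuous_subtype_val).continuousAt
  have hlt : ∀ c : ℝ, 0 < c → ∀ y : Trop, (c : EReal) * (y : EReal) ≠ ⊤ := by
    intro c hc y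
    have := y.2
    induction hy : (y : EReal) with
    | bot => rw [EReal.coe_mul_bot_of_pos hc]; simp
    | coe a => rw [← EReal.coe_mul]; exact EReal.coe_ne_top _
    | top => rw [hy] at this; exact absurd this (lt_irrefl (⊤ : EReal))
  refine continuous_pi fun i => ?_
  refine Continuous.subtype_mk (f := fun p : TropSpace r × TropSpace r =>
    (comb ε p.1 p.2 i : EReal)) ?_ (fun p => (comb ε p.1 p.2 i).2)
  simp_rw [coe_comb h0 h1]
  rw [continuous_iff_continuousAt]
  intro p
  have := EReal.continuousAt_add (p := ((ε : EReal) * p.1 i, ((1 - ε : ℝ) : EReal) * p.2 i))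
    (Or.inl (hlt ε h0 _)) (Or.inr (hlt _ (by linarith) _))
  refine this.comp (f := fun p : TropSpace r × TropSpace r =>
    ((ε : EReal) * (p.1 i : EReal), ((1 - ε : ℝ) : EReal) * (p.2 i : EReal))) ?_
  exact (((hm ε h0).comp ((continuous_apply i).comp continuous_fst)).prodMk
    ((hm (1 - ε) (by linarith)).comp ((continuous_apply i).comp continuous_snd))).continuousAt

lemma continuous_comb_weight (y z : TropSpace r) : Continuous (fun ε : ℝ => comb ε y z) := by
  refine continuous_pi fun i => ?_
  by_cases hi : i ∈ sed y ∪ sed z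
  · simp only [comb, if_pos hi]; exact continuous_const
  · simp only [comb, if_neg hi]
    exact Continuous.subtype_mk (continuous_coe_real_ereal.comp (by fun_prop)) _

lemma comb_zero {y z : TropSpace r} (h : sed y ⊆ sed z) : comb 0 y z = z := by
  funext i
  by_cases hi : i ∈ sed y ∪ sed z
  · have : (z i : EReal) = ⊥ := by rw [Set.union_eq_self_of_subset_left h] at hi; exact hi
    simp only [comb, if_pos hi]; exact Subtype.ext this.symm
  · simp only [comb, if_neg hi]; refine Subtype.ext ?_
    simpa using coe_re (x := z) (i := i) (fun h => hi (Or.inr h))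

/-- Closed under convex combinations. -/
def CombClosed (F : Set (TropSpace r)) : Prop :=
  ∀ ε : ℝ, 0 < ε → ε < 1 → ∀ x ∈ F, ∀ z ∈ F, comb ε x z ∈ F

lemma CombClosed.closure {F : Set (TropSpace r)} (h : CombClosed F) : CombClosed (closure F) := by
  intro ε h0 h1 x hx z hz
  have := map_mem_closure₂ (f := fun x z => comb ε x z) (continuous_comb h0 h1) hx hz
    (fun a ha b hb => h ε h0 h1 a ha b hb)
  exact this

lemma dot_comb {ε : ℝ} {x z : TropSpace r} (h : sed x = sed z) (w : Fin r → ℤ) :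
    dot w (comb ε x z) = ε * dot w x + (1 - ε) * dot w z := by
  unfold dot
  rw [Finset.mul_sum, Finset.mul_sum, ← Finset.sum_add_distrib]
  refine Finset.sum_congr rfl fun i _ => ?_
  by_cases hi : i ∈ sed x
  · rw [re_of_mem hi, re_of_mem (x := z) (h ▸ hi), re_of_mem (x := comb ε x z) (by rw [sed_comb]; exact Or.inl hi)]; ring
  · rw [re_comb (by rw [← h]; simpa using hi)]; ring

lemma IsPolyhedron.combClosed {P : Set (TropSpace r)} (h : IsPolyhedron P) : CombClosed P := by
  obtain ⟨I, k, w, c, rfl⟩ := h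
  refine CombClosed.closure ?_
  rintro ε h0 h1 x ⟨hx, hx'⟩ z ⟨hz, hz'⟩
  refine ⟨by rw [sed_comb, hx, hz, Set.union_self], fun a => ?_⟩
  rw [dot_comb (hx.trans hz.symm)]
  nlinarith [hx' a, hz' a, mul_le_mul_of_nonneg_left (hx' a) h0.le,
    mul_le_mul_of_nonneg_left (hz' a) (by linarith : (0 : ℝ) ≤ 1 - ε)]

lemma IsPolyhedron.isClosed {P : Set (TropSpace r)} (h : IsPolyhedron P) : IsClosed P := by
  obtain ⟨I, k, w, c, rfl⟩ := h
  exact isClosed_closure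

/-- Points of the closure of a set of constant sedentarity `J` have sedentarity at least `J`. -/
lemma subset_sed_of_mem_closure {F : Set (TropSpace r)} {J : Set (Fin r)}
    (hF : ∀ x ∈ F, sed x = J) {x : TropSpace r} (hx : x ∈ closure F) : J ⊆ sed x := by
  intro i hi
  have hc : IsClosed {y : TropSpace r | (y i : EReal) = ⊥} :=
    isClosed_eq (continuous_subtype_val.comp (continuous_apply i)) continuous_const
  have : closure F ⊆ {y : TropSpace r | (y i : EReal) = ⊥} :=
    closure_minimal (fun y hy => by have := hF y hy; rw [← this] at hi; exact hi) hc
  exact this hx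

/-- Closures of convex sets of constant sedentarity are locally connected. -/
lemma exists_nhds_subset_component {F : Set (TropSpace r)} {J : Set (Fin r)}
    (hF : ∀ x ∈ F, sed x = J) (hc : CombClosed F) {U : Set (TropSpace r)} (hU : IsOpen U)
    {x : TropSpace r} (hx : x ∈ closure F) (hxU : x ∈ U) :
    ∃ B ∈ 𝓝 x, closure F ∩ B ⊆ connectedComponentIn (closure F ∩ U) x := by
  obtain ⟨I, -, t, htn, htU⟩ : ∃ I : Set (Fin r), I.Finite ∧ ∃ t : Fin r → Set Trop,
      (∀ i, t i ∈ 𝓝 (x i)) ∧ I.pi t ⊆ U := by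
    have := hU.mem_nhds hxU
    rw [nhds_pi, Filter.mem_pi] at this
    exact this
  choose b c hmem hnhds hsub using fun i => exists_Icc_mem_subset_of_mem_nhds (htn i)
  set B : Set (TropSpace r) := Set.univ.pi fun i => Set.Icc (b i) (c i) with hB
  have hBn : B ∈ 𝓝 x := set_pi_mem_nhds Set.finite_univ fun i _ => hnhds i
  have hBU : B ⊆ U := fun y hy => htU fun i _ => hsub i (hy i trivial)
  have hpre : IsPreconnected (F ∩ B) := by
    refine isPreconnected_of_forall_pair ?_
    rintro y ⟨hyF, hyB⟩ z ⟨hzF, hzB⟩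
    have hsed : sed y = sed z := (hF y hyF).trans (hF z hzF).symm
    have hcont : Continuous (fun ε : ℝ => comb ε y z) := continuous_comb_weight y z
    have h0 : comb 0 y z = z := comb_zero hsed.subset
    have h1 : comb 1 y z = y := by
      funext i
      by_cases hi : i ∈ sed y ∪ sed z
      · have : (y i : EReal) = ⊥ := by rw [← hsed, Set.union_self] at hi; exact hi
        simp only [comb, if_pos hi]; exact Subtype.ext this.symm
      · simp only [comb, if_neg hi]; refine Subtype.ext ?_
        simpa using coe_re (x := y) (i := i) (fun h => hi (Or.inl h))
    refine ⟨(fun ε : ℝ => comb ε y z) '' Set.Icc 0 1, ?_, ⟨1, by simp, h1⟩, ⟨0, by simp, h0⟩,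
      isPreconnected_Icc.image _ hcont.continuousOn⟩
    rintro _ ⟨ε, ⟨he0, he1⟩, rfl⟩
    rcases he0.eq_or_lt with rfl | he0'
    · simp only [h0]; exact ⟨hzF, hzB⟩
    rcases he1.eq_or_lt with rfl | he1'
    · simp only [h1]; exact ⟨hyF, hyB⟩
    refine ⟨hc ε he0' he1' y hyF z hzF, fun i _ => ?_⟩
    by_cases hi : i ∈ sed y ∪ sed z
    · have hy' : (y i : EReal) = ⊥ := by rw [← hsed, Set.union_self] at hi; exact hi
      have : comb ε y z i = y i := by
        simp only [comb, if_pos hi]; exact Subtype.ext hy'.symm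
      simp only [this]; exact hyB i trivial
    · have hy' : ((re y i : ℝ) : EReal) = y i := coe_re fun h => hi (Or.inl h)
      have hz' : ((re z i : ℝ) : EReal) = z i := coe_re fun h => hi (Or.inr h)
      have key : (comb ε y z i : EReal) = ((ε * re y i + (1 - ε) * re z i : ℝ) : EReal) := by
        simp only [comb, if_neg hi]
      have hyb := hyB i trivial
      have hzb := hzB i trivial
      constructor
      · rw [← Subtype.coe_le_coe, key]
        rcases le_total (re y i) (re z i) with h | h
        · refine le_trans (Subtype.coe_le_coe.2 hyb.1) ?_
          rw [← hy']; exact EReal.coe_le_coe_iff.2 (by nlinarith)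
        · refine le_trans (Subtype.coe_le_coe.2 hzb.1) ?_
          rw [← hz']; exact EReal.coe_le_coe_iff.2 (by nlinarith)
      · rw [← Subtype.coe_le_coe, key]
        rcases le_total (re y i) (re z i) with h | h
        · refine le_trans ?_ (Subtype.coe_le_coe.2 hzb.2)
          rw [← hz']; exact EReal.coe_le_coe_iff.2 (by nlinarith)
        · refine le_trans ?_ (Subtype.coe_le_coe.2 hyb.2)
          rw [← hy']; exact EReal.coe_le_coe_iff.2 (by nlinarith)
  have hint : interior B ∈ 𝓝 x := interior_mem_nhds.2 hBn
  refine ⟨interior B, hint, ?_⟩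
  have hcl : closure F ∩ interior B ⊆ closure (F ∩ B) :=
    fun y hy => by
      have := isOpen_interior.closure_inter ⟨hy.1, hy.2⟩
      exact closure_mono (Set.inter_subset_inter_right _ interior_subset) this
  have hS : IsPreconnected ((F ∩ B) ∪ (closure F ∩ interior B)) :=
    hpre.subset_closure Set.subset_union_left
      (Set.union_subset subset_closure hcl)
  refine Set.subset_union_right.trans (hS.subset_connectedComponentIn
    (Or.inr ⟨hx, mem_of_mem_nhds hint⟩) ?_)
  rintro y (⟨h1, h2⟩ | ⟨h1, h2⟩)
  · exact ⟨subset_closure h1, hBU h2⟩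
  · exact ⟨h1, hBU (interior_subset h2)⟩

/-- An open polyhedron has points whose sedentarity is the sedentarity of the polyhedron, and it
is contained in the closure of the set of these points. -/
lemma IsOpenPolyhedron.subset_closure_generic {σ : Set (TropSpace r)} (h : IsOpenPolyhedron σ) :
    σ ⊆ closure {x | x ∈ σ ∧ sed x = setSed σ} := by
  obtain ⟨hc, P, U, ⟨I, k, w, c, rfl⟩, hU, rfl⟩ := h
  set F : Set (TropSpace r) := {x | sed x = I ∧ ∀ a, dot (w a) x ≤ c a} with hF
  have hsub : ∀ x ∈ closure F, I ⊆ sed x := fun x hx =>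
    subset_sed_of_mem_closure (fun y hy => hy.1) hx
  have hS : setSed (closure F ∩ U) = I := by
    refine Set.Subset.antisymm ?_ fun i hi x hx => hsub x hx.1 hi
    obtain ⟨x, hx, hxU⟩ := hc.nonempty
    obtain ⟨y, hyU, hyF⟩ := mem_closure_iff.1 hx U hU hxU
    exact fun i hi => hyF.1 ▸ hi y ⟨subset_closure hyF, hyU⟩
  intro x hx
  refine closure_mono ?_ (hU.closure_inter hx)
  intro y hy
  exact ⟨⟨subset_closure hy.1, hy.2⟩, hy.1.1.trans hS.symm⟩

lemma IsOpenPolyhedron.exists_generic {σ : Set (TropSpace r)} (h : IsOpenPolyhedron σ) :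
    ∃ x ∈ σ, sed x = setSed σ := by
  obtain ⟨x, hx⟩ := h.1.nonempty
  obtain ⟨y, hy⟩ := closure_nonempty_iff.1 ⟨x, h.subset_closure_generic hx⟩
  exact ⟨y, hy.1, hy.2⟩

lemma setSed_anti {S T : Set (TropSpace r)} (h : S ⊆ T) : setSed T ⊆ setSed S :=
  fun _ hi x hx => hi x (h hx)

lemma isComponentOf_self {Y : Type*} [TopologicalSpace Y] {s : Set Y} (h : IsConnected s) :
    IsComponentOf s s := by
  obtain ⟨x, hx⟩ := h.nonempty
  exact ⟨x, hx, (h.isPreconnected.connectedComponentIn hx).symm⟩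

/-- In an open polyhedral complex, a member contained in another one is a face of it. -/
lemma IsOpenPolyComplex.face_of_subset {C : Set (Set (TropSpace r))} (hC : IsOpenPolyComplex C)
    {t s : Set (TropSpace r)} (ht : t ∈ C) (hs : s ∈ C) (hts : t ⊆ s) : IsOpenPolyFace t s := by
  refine (hC.inter t ht s hs t ?_).2
  rw [Set.inter_eq_self_of_subset_left hts]
  exact isComponentOf_self (hC.isOpenPolyhedron t ht).1

open Classical in
/-- Setting the coordinates in `J` to zero. -/
noncomputable def zeroOut (J : Set (Fin r)) (v : Fin r → ℝ) : Fin r → ℝ :=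
  fun i => if i ∈ J then 0 else v i

/-- If `t` is a face of `s`, then among the members of the complex with the sedentarity of `t` and
containing `t` there is one whose tangent space contains the projection of that of `s`. -/
lemma IsOpenPolyComplex.exists_face {C : Set (Set (TropSpace r))} (hC : IsOpenPolyComplex C)
    {t s : Set (TropSpace r)} (ht : t ∈ C) (hs : s ∈ C) (hts : t ⊆ s) :
    ∃ t' ∈ C, t ⊆ t' ∧ setSed t' = setSed t ∧
      ∀ v ∈ tangent s, zeroOut (setSed t) v ∈ tangent t' := by
  obtain ⟨-, P, U, Q, hP, hU, ⟨x0, hx0, hs'⟩, hQ, ⟨y0, hy0, ht'⟩⟩ := hC.face_of_subset ht hs hts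
  obtain ⟨z, hzt, hzJ⟩ := (hC.isOpenPolyhedron t ht).exists_generic
  have hsPU : s ⊆ P ∩ U := hs' ▸ connectedComponentIn_subset _ _
  set J := setSed t with hJ
  set G : Set (TropSpace r) := {x | x ∈ P ∧ sed x = J} with hG
  have hGc : CombClosed G := by
    rintro ε h0 h1 x ⟨hx, hxJ⟩ y ⟨hy, hyJ⟩
    exact ⟨hP.combClosed ε h0 h1 x hx y hy, by rw [sed_comb, hxJ, hyJ, Set.union_self]⟩
  have hGJ : ∀ x ∈ G, sed x = J := fun x hx => hx.2
  have hGP : closure G ⊆ P := closure_minimal (fun x hx => hx.1) hP.isClosed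
  have htG : t ⊆ closure G := by
    refine (hC.isOpenPolyhedron t ht).subset_closure_generic.trans (closure_mono ?_)
    exact fun x hx => ⟨(hsPU (hts hx.1)).1, hx.2⟩
  have htU : t ⊆ U := fun x hx => (hsPU (hts hx)).2
  set t' := connectedComponentIn (closure G ∩ U) z with ht'def
  have hzmem : z ∈ closure G ∩ U := ⟨htG hzt, htU hzt⟩
  have htt' : t ⊆ t' := (hC.isOpenPolyhedron t ht).1.isPreconnected.subset_connectedComponentIn
    hzt fun x hx => ⟨htG hx, htU hx⟩
  have hface : IsPolyFace (closure G) P := by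
    refine ⟨⟨z, htG hzt⟩, J, 0, Fin.elim0, Fin.elim0, fun _ _ _ a => a.elim0, ?_⟩
    congr 1
    ext x
    simp [hG]
  have ht's : t' ⊆ s := by
    have hzs : z ∈ connectedComponentIn (P ∩ U) x0 := hs' ▸ hts hzt
    rw [hs', connectedComponentIn_eq hzs]
    exact connectedComponentIn_mono _ (Set.inter_subset_inter_left _ hGP)
  have ht'C : t' ∈ C :=
    hC.face_mem s hs t' ⟨ht's, P, U, closure G, hP, hU, ⟨x0, hx0, hs'⟩, hface, z, hzmem, rfl⟩
  have hsed' : setSed t' = J := by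
    refine Set.Subset.antisymm (setSed_anti htt') fun i hi x hx => ?_
    exact subset_sed_of_mem_closure hGJ (connectedComponentIn_subset _ _ hx).1 hi
  refine ⟨t', ht'C, htt', hsed', ?_⟩
  obtain ⟨B, hB, hBt⟩ := exists_nhds_subset_component hGJ hGc hU hzmem.1 hzmem.2
  have hzt' : z ∈ t' := htt' hzt
  -- displacement from `z` towards the projection of a point of `s`
  have hdisp : ∀ x ∈ s, sed x = setSed s → zeroOut J (re x - re z) ∈ tangent t' := by
    intro x hx hxs
    have hxJ : sed x ⊆ sed z := by rw [hxs, hzJ]; exact setSed_anti hts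
    have hlim : ∀ᶠ ε in 𝓝[>] (0 : ℝ), comb ε x z ∈ B := by
      have h := (continuous_comb_weight x z).tendsto 0
      rw [comb_zero hxJ] at h
      exact (h.mono_left nhdsWithin_le_nhds).eventually hB
    have hlt : ∀ᶠ ε in 𝓝[>] (0 : ℝ), ε < 1 :=
      nhdsWithin_le_nhds (eventually_lt_nhds one_pos)
    obtain ⟨ε, ⟨hεB, hε1⟩, hε0⟩ := ((hlim.and hlt).and self_mem_nhdsWithin).exists
    have hε0 : 0 < ε := hε0
    have hcomb : comb ε x z ∈ G :=
      ⟨hP.combClosed ε hε0 hε1 x (hsPU hx).1 z (hsPU (hts hzt)).1,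
        by rw [sed_comb, Set.union_eq_self_of_subset_left hxJ, hzJ]⟩
    have hin : comb ε x z ∈ t' := hBt ⟨subset_closure hcomb, hεB⟩
    have hv : re (comb ε x z) - re z ∈ tangent t' :=
      Submodule.subset_span ⟨_, hin, z, hzt', hcomb.2.trans hsed'.symm, hzJ.trans hsed'.symm, rfl⟩
    have : zeroOut J (re x - re z) = ε⁻¹ • (re (comb ε x z) - re z) := by
      funext i
      by_cases hi : i ∈ J
      · have h1 : i ∈ sed z := hzJ ▸ hi
        have h2 : i ∈ sed (comb ε x z) := by rw [hcomb.2]; exact hi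
        simp [zeroOut, hi, re_of_mem h1, re_of_mem h2]
      · have h1 : i ∉ sed x ∪ sed z := by
          rw [Set.union_eq_self_of_subset_left hxJ, hzJ]; exact hi
        simp only [zeroOut, if_neg hi, Pi.smul_apply, Pi.sub_apply, re_comb h1, smul_eq_mul]
        field_simp
        ring
    rw [this]
    exact Submodule.smul_mem _ _ hv
  intro v hv
  induction hv using Submodule.span_induction with
  | mem v hv =>
    obtain ⟨x, hx, y, hy, hxs, hys, rfl⟩ := hv
    have := Submodule.sub_mem _ (hdisp x hx hxs) (hdisp y hy hys)
    convert this using 1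
    funext i
    by_cases hi : i ∈ J <;> simp [zeroOut, hi]
  | zero =>
    have : zeroOut J (0 : Fin r → ℝ) = 0 := by funext i; simp [zeroOut]
    rw [this]; exact Submodule.zero_mem _
  | add a b _ _ ha hb =>
    have : zeroOut J (a + b) = zeroOut J a + zeroOut J b := by
      funext i; by_cases hi : i ∈ J <;> simp [zeroOut, hi]
    rw [this]; exact Submodule.add_mem _ ha hb
  | smul c a _ ha =>
    have : zeroOut J (c • a) = c • zeroOut J a := by
      funext i; by_cases hi : i ∈ J <;> simp [zeroOut, hi]
    rw [this]; exact Submodule.smul_mem _ _ ha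

/-- The exterior power `⋀^p L` of a subspace, inside `⋀^p ℝ^r`. -/
noncomputable def wedge (p : ℕ) (L : Submodule ℝ (Fin r → ℝ)) :
    Submodule ℝ (⋀[ℝ]^p (Fin r → ℝ)) :=
  Submodule.span ℝ {ω | ∃ v : Fin p → Fin r → ℝ, (∀ a, v a ∈ L) ∧
    ω = exteriorPower.ιMulti ℝ p v}

/-- The lattice `⋀^p ℤ^r_I`, where `ℤ^r_I` are the integral vectors vanishing on `I`, inside
`⋀^p ℝ^r`. -/
noncomputable def wedgeLattice (p : ℕ) (I : Set (Fin r)) :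
    Submodule ℤ (⋀[ℝ]^p (Fin r → ℝ)) :=
  Submodule.span ℤ {ω | ∃ v : Fin p → Fin r → ℤ, (∀ a, ∀ i ∈ I, v a i = 0) ∧
    ω = exteriorPower.ιMulti ℝ p (fun a i => (v a i : ℝ))}

end TropSpace

/-- `y = A x + b` for points of tropical affine spaces, with the conventions `0 · (-∞) = 0` and
`a · (-∞) = -∞` for `a > 0`; a negative multiple of `-∞` is not allowed. -/
def IsAffineImage {m n : ℕ} (A : Matrix (Fin n) (Fin m) ℤ) (b : Fin n → ℝ)
    (x : TropSpace m) (y : TropSpace n) : Prop :=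
  ∀ j, (∀ i ∈ TropSpace.sed x, 0 ≤ A j i) ∧
    (y j : EReal) = ∑ i, (((A j i : ℤ) : ℝ) : EReal) * (x i : EReal) + ((b j : ℝ) : EReal)

namespace IsAffineImage

open TropSpace

variable {m n : ℕ} {A : Matrix (Fin n) (Fin m) ℤ} {b : Fin n → ℝ} {x : TropSpace m}
  {y : TropSpace n}

lemma of_forall (h : IsAffineImage A b x y) {j : Fin n} (hj : ∀ i ∈ sed x, A j i = 0) :
    (y j : EReal) = ((∑ i, (A j i : ℝ) * re x i + b j : ℝ) : EReal) := by
  have hsum : ∀ s : Finset (Fin m), ∑ i ∈ s, (((A j i : ℤ) : ℝ) : EReal) * (x i : EReal) =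
      ((∑ i ∈ s, (A j i : ℝ) * re x i : ℝ) : EReal) := by
    intro s
    induction s using Finset.induction_on with
    | empty => simp
    | insert a s ha ih =>
      rw [Finset.sum_insert ha, Finset.sum_insert ha, ih, EReal.coe_add]
      congr 1
      by_cases hi : a ∈ sed x
      · simp [hj a hi]
      · rw [EReal.coe_mul, coe_re hi]
  rw [(h j).2, hsum, ← EReal.coe_add]

lemma mem_sed (h : IsAffineImage A b x y) {j : Fin n} :
    j ∈ sed y ↔ ∃ i ∈ sed x, A j i ≠ 0 := by
  constructor
  · intro hj
    by_contra! hne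
    have := h.of_forall hne
    rw [show (y j : EReal) = ⊥ from hj] at this
    exact EReal.coe_ne_bot _ this.symm
  · rintro ⟨i, hi, hA⟩
    have hpos : (0 : ℝ) < (A j i : ℝ) := by
      exact_mod_cast lt_of_le_of_ne ((h j).1 i hi) (Ne.symm hA)
    change (y j : EReal) = ⊥
    rw [(h j).2, ← Finset.add_sum_erase _ _ (Finset.mem_univ i),
      show (x i : EReal) = ⊥ from hi, EReal.coe_mul_bot_of_pos hpos, EReal.bot_add, EReal.bot_add]

lemma re_eq (h : IsAffineImage A b x y) {j : Fin n} (hj : j ∉ sed y) :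
    re y j = ∑ i, (A j i : ℝ) * re x i + b j := by
  have : ∀ i ∈ sed x, A j i = 0 := by
    intro i hi
    by_contra hA
    exact hj (h.mem_sed.2 ⟨i, hi, hA⟩)
  rw [re, h.of_forall this, EReal.toReal_coe]

end IsAffineImage

/-- A chart: a homeomorphism from an open subset of `X` onto a subset of `[-∞, ∞)^r`
(the values of `toFun` outside `source` are irrelevant). -/
structure TropChart (X : Type u) [TopologicalSpace X] where
  r : ℕ
  source : Opens X
  toFun : X → TropSpace r
  isEmbedding : IsEmbedding (fun x : source => toFun x)

/-- An atlas of a rational polyhedral space: the charts cover `X`, their images are open subsets of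
rational polyhedral subspaces of `[-∞, ∞)^r` of bounded dimension, and the transition maps are
extended affine `ℤ`-linear. -/
structure PolyAtlas (X : Type u) [TopologicalSpace X] where
  charts : Set (TropChart X)
  cover : ∀ x : X, ∃ φ ∈ charts, x ∈ φ.source
  polyhedral : ∃ N : ℕ, ∀ φ ∈ charts, ∃ C : Set (Set (TropSpace φ.r)),
    TropSpace.IsPolyComplex C ∧ (∀ σ ∈ C, TropSpace.polyDim σ ≤ N) ∧
    ∃ W, IsOpen W ∧ φ.toFun '' φ.source = ⋃₀ C ∩ W
  transition : ∀ φ ∈ charts, ∀ ψ ∈ charts, ∃ (A : Matrix (Fin ψ.r) (Fin φ.r) ℤ) (b : Fin ψ.r → ℝ),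
    ∀ x, x ∈ φ.source → x ∈ ψ.source → IsAffineImage A b (φ.toFun x) (ψ.toFun x)

/-- The closed star of `σ` in a family of sets: the members meeting some member that meets `σ`. -/
def starFamily {X : Type u} (cells : Set (Set X)) (σ : Set X) : Set (Set X) :=
  {τ | τ ∈ cells ∧ ∃ σ' ∈ cells, (τ ∩ σ').Nonempty ∧ (σ ∩ σ').Nonempty}

/-- An open face structure on a rational polyhedral space: a locally finite cover by closed sets
(cells) such that, for each cell `σ`, some chart contains the closed star of `σ` and maps the cells
of the star, together with the cells contained in them (their faces), to an open rational
polyhedral complex. -/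
structure OpenFaceStructure {X : Type u} [TopologicalSpace X] (𝒜 : PolyAtlas X) where
  cells : Set (Set X)
  nonempty : ∀ σ ∈ cells, σ.Nonempty
  isClosed : ∀ σ ∈ cells, IsClosed σ
  locallyFinite : LocallyFinite (fun σ : cells => (σ : Set X))
  cover : ⋃₀ cells = Set.univ
  chart : cells → TropChart X
  chart_mem : ∀ σ, chart σ ∈ 𝒜.charts
  star_subset : ∀ σ : cells, ∀ τ ∈ starFamily cells σ, τ ⊆ ((chart σ).source : Set X)
  isComplex : ∀ σ : cells, TropSpace.IsOpenPolyComplex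
    {s | ∃ τ ∈ cells, (∃ τ' ∈ starFamily cells σ, τ ⊆ τ') ∧ s = (chart σ).toFun '' τ}

namespace OpenFaceStructure

open TropSpace

variable {X : Type u} [TopologicalSpace X] {𝒜 : PolyAtlas X} (𝒞 : OpenFaceStructure 𝒜)

/-- The image of a cell `τ` in the chart attached to `σ`. -/
def img (σ τ : 𝒞.cells) : Set (TropSpace (𝒞.chart σ).r) := (𝒞.chart σ).toFun '' τ

/-- The relative interior of a cell: the points not contained in any proper face, the faces of a
cell being the cells contained in it. -/
def relint (σ : Set X) : Set X := {x | x ∈ σ ∧ ∀ τ ∈ 𝒞.cells, τ ⊂ σ → x ∉ τ}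

/-- The dimension of a cell. -/
noncomputable def cellDim (σ : 𝒞.cells) : ℕ := polyDim (𝒞.img σ σ)

/-- The sum of the `⋀^p 𝕃(σ')` over the cells `σ'` having `σ` as a face and the same
sedentarity as `σ`. -/
noncomputable def realMultiTangent (p : ℕ) (σ : 𝒞.cells) :
    Submodule ℝ (⋀[ℝ]^p (Fin (𝒞.chart σ).r → ℝ)) :=
  ⨆ σ' ∈ {σ' : 𝒞.cells | (σ : Set X) ⊆ σ' ∧ setSed (𝒞.img σ σ') = setSed (𝒞.img σ σ)},
    wedge p (tangent (𝒞.img σ σ'))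

/-- The `p`-th integral multi-tangent module of `σ`. -/
noncomputable def multiTangent (p : ℕ) (σ : 𝒞.cells) :
    Submodule ℤ (⋀[ℝ]^p (Fin (𝒞.chart σ).r → ℝ)) :=
  (𝒞.realMultiTangent p σ).restrictScalars ℤ ⊓ wedgeLattice p (setSed (𝒞.img σ σ))

/-- The linear part of the transition map from the chart of `σ` to the chart of `τ`. -/
noncomputable def transMatrix (σ τ : 𝒞.cells) :
    Matrix (Fin (𝒞.chart τ).r) (Fin (𝒞.chart σ).r) ℤ :=
  (𝒜.transition _ (𝒞.chart_mem σ) _ (𝒞.chart_mem τ)).choose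

open Classical in
/-- The linear map on tangent vectors from the chart of `σ` to the chart of `τ`: the linear part of
the transition map followed by the projection forgetting the coordinates in the sedentarity
of `τ`. -/
noncomputable def transLinear (σ τ : 𝒞.cells) :
    (Fin (𝒞.chart σ).r → ℝ) →ₗ[ℝ] (Fin (𝒞.chart τ).r → ℝ) :=
  Matrix.toLin' (Matrix.of fun j i =>
    if j ∈ setSed (𝒞.img τ τ) then (0 : ℝ) else (𝒞.transMatrix σ τ j i : ℝ))

variable {𝒞}

lemma mem_star_self_of_inter {σ τ : 𝒞.cells} (h : ((σ : Set X) ∩ τ).Nonempty) :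
    (τ : Set X) ∈ starFamily 𝒞.cells σ :=
  ⟨τ.2, τ, τ.2, by simpa using 𝒞.nonempty τ τ.2, h⟩

lemma subset_source_of_inter {σ τ : 𝒞.cells} (h : ((σ : Set X) ∩ τ).Nonempty) :
    (τ : Set X) ⊆ (𝒞.chart σ).source :=
  𝒞.star_subset σ τ (mem_star_self_of_inter h)

lemma img_mem {σ τ : 𝒞.cells} (h : ((σ : Set X) ∩ τ).Nonempty) :
    𝒞.img σ τ ∈ {s | ∃ τ ∈ 𝒞.cells, (∃ τ' ∈ starFamily 𝒞.cells σ, τ ⊆ τ') ∧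
      s = (𝒞.chart σ).toFun '' τ} :=
  ⟨τ, τ.2, ⟨τ, mem_star_self_of_inter h, subset_rfl⟩, rfl⟩

lemma inter_of_subset {τ σ : 𝒞.cells} (h : (τ : Set X) ⊆ σ) : ((σ : Set X) ∩ τ).Nonempty := by
  obtain ⟨x, hx⟩ := 𝒞.nonempty τ τ.2
  exact ⟨x, h hx, hx⟩

lemma inter_of_subset' {τ σ : 𝒞.cells} (h : (τ : Set X) ⊆ σ) : ((τ : Set X) ∩ σ).Nonempty := by
  rw [Set.inter_comm]; exact inter_of_subset h

lemma isOpenPolyhedron_img {σ τ : 𝒞.cells} (h : ((σ : Set X) ∩ τ).Nonempty) :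
    IsOpenPolyhedron (𝒞.img σ τ) :=
  (𝒞.isComplex σ).isOpenPolyhedron _ (img_mem h)

lemma injOn_source (φ : TropChart X) : Set.InjOn φ.toFun φ.source := by
  intro x hx y hy hxy
  have := φ.isEmbedding.injective (a₁ := ⟨x, hx⟩) (a₂ := ⟨y, hy⟩) hxy
  exact congrArg Subtype.val this

lemma exists_trans (σ τ : 𝒞.cells) : ∃ b, ∀ x, x ∈ (𝒞.chart σ).source →
    x ∈ (𝒞.chart τ).source →
    IsAffineImage (𝒞.transMatrix σ τ) b ((𝒞.chart σ).toFun x) ((𝒞.chart τ).toFun x) :=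
  (𝒜.transition _ (𝒞.chart_mem σ) _ (𝒞.chart_mem τ)).choose_spec

lemma transLinear_apply (σ τ : 𝒞.cells) (v : Fin (𝒞.chart σ).r → ℝ) :
    𝒞.transLinear σ τ v = zeroOut (setSed (𝒞.img τ τ))
      (fun j => ∑ i, (𝒞.transMatrix σ τ j i : ℝ) * v i) := by
  funext j
  by_cases hj : j ∈ setSed (𝒞.img τ τ) <;>
    simp [transLinear, zeroOut, hj, Matrix.mulVec, dotProduct]

/-- Sedentarity of a cell `κ` in the chart of `τ`, computed from the chart of `σ`. -/
lemma mem_setSed_trans {σ τ κ : 𝒞.cells} (hσ : ((σ : Set X) ∩ κ).Nonempty)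
    (hτ : ((τ : Set X) ∩ κ).Nonempty) {j : Fin (𝒞.chart τ).r} :
    j ∈ setSed (𝒞.img τ κ) ↔ ∃ i ∈ setSed (𝒞.img σ κ), 𝒞.transMatrix σ τ j i ≠ 0 := by
  obtain ⟨b, hb⟩ := exists_trans σ τ
  have hs := subset_source_of_inter hσ
  have ht := subset_source_of_inter hτ
  constructor
  · intro hj
    obtain ⟨_, ⟨x, hx, rfl⟩, hxs⟩ := (isOpenPolyhedron_img hσ).exists_generic
    rw [← hxs]
    exact (hb x (hs hx) (ht hx)).mem_sed.1 (hj _ ⟨x, hx, rfl⟩)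
  · rintro ⟨i, hi, hA⟩ _ ⟨x, hx, rfl⟩
    exact (hb x (hs hx) (ht hx)).mem_sed.2 ⟨i, hi _ ⟨x, hx, rfl⟩, hA⟩

/-- The matrix entries from coordinates in the sedentarity of `τ` to coordinates outside vanish. -/
lemma transMatrix_eq_zero {σ τ : 𝒞.cells} (h : ((σ : Set X) ∩ τ).Nonempty)
    {i : Fin (𝒞.chart σ).r} (hi : i ∈ setSed (𝒞.img σ τ)) {j : Fin (𝒞.chart τ).r}
    (hj : j ∉ setSed (𝒞.img τ τ)) : 𝒞.transMatrix σ τ j i = 0 := by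
  by_contra hA
  refine hj ((mem_setSed_trans h ?_).2 ⟨i, hi, hA⟩)
  simpa using 𝒞.nonempty τ τ.2

lemma transLinear_zeroOut {σ τ : 𝒞.cells} (h : ((σ : Set X) ∩ τ).Nonempty)
    {J : Set (Fin (𝒞.chart σ).r)} (hJ : J ⊆ setSed (𝒞.img σ τ)) (v : Fin (𝒞.chart σ).r → ℝ) :
    𝒞.transLinear σ τ (zeroOut J v) = 𝒞.transLinear σ τ v := by
  rw [transLinear_apply, transLinear_apply]
  funext j
  by_cases hj : j ∈ setSed (𝒞.img τ τ)
  · simp [zeroOut, hj]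
  · simp only [zeroOut, if_neg hj]
    refine Finset.sum_congr rfl fun i _ => ?_
    by_cases hi : i ∈ J
    · simp [transMatrix_eq_zero h (hJ hi) hj]
    · simp [hi]

/-- The transition of a difference of generic points of a cell `κ` around a face `τ` of `κ`. -/
lemma transLinear_sub {σ τ κ : 𝒞.cells} (hσ : ((σ : Set X) ∩ κ).Nonempty) (hτ : (τ : Set X) ⊆ κ)
    {x y : X} (hx : x ∈ (κ : Set X)) (hy : y ∈ (κ : Set X))
    (hxs : sed ((𝒞.chart σ).toFun x) = setSed (𝒞.img σ κ))
    (hys : sed ((𝒞.chart σ).toFun y) = setSed (𝒞.img σ κ)) :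
    𝒞.transLinear σ τ (re ((𝒞.chart σ).toFun x) - re ((𝒞.chart σ).toFun y)) =
      zeroOut (setSed (𝒞.img τ τ)) (re ((𝒞.chart τ).toFun x) - re ((𝒞.chart τ).toFun y)) := by
  obtain ⟨b, hb⟩ := exists_trans σ τ
  have hs := subset_source_of_inter hσ
  have ht := subset_source_of_inter (inter_of_subset' hτ)
  rw [transLinear_apply]
  funext j
  by_cases hj : j ∈ setSed (𝒞.img τ τ)
  · simp [zeroOut, hj]
  have hjκ : j ∉ setSed (𝒞.img τ κ) := fun h => hj (setSed_anti (Set.image_mono hτ) h)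
  have key : ∀ z ∈ (κ : Set X), sed ((𝒞.chart σ).toFun z) = setSed (𝒞.img σ κ) →
      j ∉ sed ((𝒞.chart τ).toFun z) := by
    intro z hz hzs hj'
    obtain ⟨i, hi, hA⟩ := (hb z (hs hz) (ht hz)).mem_sed.1 hj'
    rw [hzs] at hi
    exact hjκ ((mem_setSed_trans hσ (inter_of_subset' hτ)).2 ⟨i, hi, hA⟩)
  simp only [zeroOut, if_neg hj, Pi.sub_apply,
    (hb x (hs hx) (ht hx)).re_eq (key x hx hxs), (hb y (hs hy) (ht hy)).re_eq (key y hy hys)]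
  rw [add_sub_add_right_eq_sub, ← Finset.sum_sub_distrib]
  exact Finset.sum_congr rfl fun i _ => mul_sub _ _ _

/-- The generic points of `κ` are the same in all charts. -/
lemma sed_trans {σ τ κ : 𝒞.cells} (hσ : ((σ : Set X) ∩ κ).Nonempty)
    (hτ : ((τ : Set X) ∩ κ).Nonempty) {x : X} (hx : x ∈ (κ : Set X))
    (hxs : sed ((𝒞.chart σ).toFun x) = setSed (𝒞.img σ κ)) :
    sed ((𝒞.chart τ).toFun x) = setSed (𝒞.img τ κ) := by
  obtain ⟨b, hb⟩ := exists_trans σ τ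
  ext j
  rw [mem_setSed_trans hσ hτ,
    (hb x (subset_source_of_inter hσ hx) (subset_source_of_inter hτ hx)).mem_sed, hxs]

lemma transLinear_tangent {σ τ κ : 𝒞.cells} (hσ : ((σ : Set X) ∩ κ).Nonempty)
    (hτ : (τ : Set X) ⊆ κ) (hsed : setSed (𝒞.img τ κ) = setSed (𝒞.img τ τ))
    {v : Fin (𝒞.chart σ).r → ℝ} (hv : v ∈ tangent (𝒞.img σ κ)) :
    𝒞.transLinear σ τ v ∈ tangent (𝒞.img τ κ) := by
  induction hv using Submodule.span_induction with
  | mem v hv =>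
    obtain ⟨_, ⟨x, hx, rfl⟩, _, ⟨y, hy, rfl⟩, hxs, hys, rfl⟩ := hv
    rw [transLinear_sub hσ hτ hx hy hxs hys]
    have hx' := sed_trans hσ (inter_of_subset' hτ) hx hxs
    have hy' := sed_trans hσ (inter_of_subset' hτ) hy hys
    have : zeroOut (setSed (𝒞.img τ τ)) (re ((𝒞.chart τ).toFun x) - re ((𝒞.chart τ).toFun y)) =
        re ((𝒞.chart τ).toFun x) - re ((𝒞.chart τ).toFun y) := by
      funext j
      by_cases hj : j ∈ setSed (𝒞.img τ τ)
      · have h1 : j ∈ sed ((𝒞.chart τ).toFun x) := by rw [hx', hsed]; exact hj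
        have h2 : j ∈ sed ((𝒞.chart τ).toFun y) := by rw [hy', hsed]; exact hj
        simp [zeroOut, hj, re_of_mem h1, re_of_mem h2]
      · simp [zeroOut, hj]
    rw [this]
    exact Submodule.subset_span ⟨_, ⟨x, hx, rfl⟩, _, ⟨y, hy, rfl⟩, hx', hy', rfl⟩
  | zero => rw [map_zero]; exact Submodule.zero_mem _
  | add a b _ _ ha hb => rw [map_add]; exact Submodule.add_mem _ ha hb
  | smul c a _ ha => rw [map_smul]; exact Submodule.smul_mem _ _ ha

lemma wedge_mono {r p : ℕ} {L L' : Submodule ℝ (Fin r → ℝ)} (h : L ≤ L') : wedge p L ≤ wedge p L' :=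
  Submodule.span_mono fun _ ⟨v, hv, hω⟩ => ⟨v, fun a => h (hv a), hω⟩

/-- The map of exterior powers induced by the transition sends the real multi-tangent space of `σ`
into that of a face `τ`. -/
lemma map_realMultiTangent_le (p : ℕ) {σ τ : 𝒞.cells} (h : (τ : Set X) ⊆ σ) :
    𝒞.realMultiTangent p σ ≤
      (𝒞.realMultiTangent p τ).comap (exteriorPower.map p (𝒞.transLinear σ τ)) := by
  refine iSup₂_le fun σ' hσ' => ?_
  obtain ⟨hσσ', hsed⟩ := hσ'
  have hστ := inter_of_subset h
  have hσσ := inter_of_subset' hσσ'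
  obtain ⟨t', ⟨τ', hτ'c, hτ'star, rfl⟩, htt', hsed', htan⟩ := (𝒞.isComplex σ).exists_face
    (img_mem hστ) (img_mem hσσ) (Set.image_mono (h.trans hσσ'))
  have hττ' : (τ : Set X) ⊆ τ' := by
    intro x hx
    obtain ⟨y, hy, hxy⟩ := htt' ⟨x, hx, rfl⟩
    obtain ⟨ρ, hρ, hτρ⟩ := hτ'star
    have := injOn_source _ (𝒞.star_subset σ ρ hρ (hτρ hy)) (subset_source_of_inter hστ hx) hxy
    exact this ▸ hy
  set κ : 𝒞.cells := ⟨τ', hτ'c⟩ with hκ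
  have hσκ : ((σ : Set X) ∩ κ).Nonempty := by
    obtain ⟨x, hx⟩ := 𝒞.nonempty τ τ.2
    exact ⟨x, h hx, hττ' hx⟩
  have hττ : ((τ : Set X) ∩ τ).Nonempty := by simpa using 𝒞.nonempty τ τ.2
  have hsedκ : setSed (𝒞.img τ κ) = setSed (𝒞.img τ τ) := by
    ext j
    rw [mem_setSed_trans hσκ (inter_of_subset' hττ'), mem_setSed_trans hστ hττ]
    have : setSed (𝒞.img σ κ) = setSed (𝒞.img σ τ) := hsed'
    rw [this]
  refine Submodule.span_le.2 ?_
  rintro _ ⟨v, hv, rfl⟩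
  change exteriorPower.map p (𝒞.transLinear σ τ) _ ∈ 𝒞.realMultiTangent p τ
  rw [exteriorPower.map_apply_ιMulti]
  refine (le_iSup₂_of_le (f := fun (σ' : 𝒞.cells) (_ : σ' ∈ {σ' : 𝒞.cells | (τ : Set X) ⊆ σ' ∧
    setSed (𝒞.img τ σ') = setSed (𝒞.img τ τ)}) => wedge p (tangent (𝒞.img τ σ'))) κ
    ⟨hττ', hsedκ⟩ le_rfl) ?_
  refine Submodule.subset_span ⟨_, fun a => ?_, rfl⟩
  change 𝒞.transLinear σ τ (v a) ∈ _
  rw [← transLinear_zeroOut hστ subset_rfl (v a)]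
  exact transLinear_tangent hσκ hττ' hsedκ (htan _ (hv a))

lemma map_wedgeLattice_le (p : ℕ) (σ τ : 𝒞.cells) (I : Set (Fin (𝒞.chart σ).r)) :
    wedgeLattice p I ≤ (wedgeLattice p (setSed (𝒞.img τ τ))).comap
      ((exteriorPower.map p (𝒞.transLinear σ τ)).restrictScalars ℤ) := by
  classical
  refine Submodule.span_le.2 ?_
  rintro _ ⟨v, -, rfl⟩
  change exteriorPower.map p (𝒞.transLinear σ τ) _ ∈ wedgeLattice p _
  rw [exteriorPower.map_apply_ιMulti]
  refine Submodule.subset_span ⟨fun a j => if j ∈ setSed (𝒞.img τ τ) then 0 else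
    ∑ i, 𝒞.transMatrix σ τ j i * v a i, fun a j hj => if_pos hj, ?_⟩
  congr 1
  funext a j
  simp only [Function.comp_apply, transLinear_apply, zeroOut]
  split_ifs <;> simp

variable (𝒞)

/-- The natural map of multi-tangent modules from a cell `σ` to a face `τ` of `σ`. -/
noncomputable def multiTangentMap (p : ℕ) {σ τ : 𝒞.cells} (h : (τ : Set X) ⊆ σ) :
    𝒞.multiTangent p σ →ₗ[ℤ] 𝒞.multiTangent p τ :=
  ((exteriorPower.map p (𝒞.transLinear σ τ)).restrictScalars ℤ).restrict fun _ hω =>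
    ⟨map_realMultiTangent_le p h hω.1, map_wedgeLattice_le p σ τ _ hω.2⟩

lemma multiTangentMap_comp (p : ℕ) {σ τ ρ : 𝒞.cells} (h : (τ : Set X) ⊆ σ) (h' : (ρ : Set X) ⊆ τ)
    (h'' : (ρ : Set X) ⊆ σ) :
    𝒞.multiTangentMap p h' ∘ₗ 𝒞.multiTangentMap p h = 𝒞.multiTangentMap p h'' := by
  have hvec : ∀ σ' : 𝒞.cells, (σ : Set X) ⊆ σ' → ∀ v ∈ tangent (𝒞.img σ σ'),
      𝒞.transLinear τ ρ (𝒞.transLinear σ τ v) = 𝒞.transLinear σ ρ v := by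
    intro σ' hσ' v hv
    induction hv using Submodule.span_induction with
    | mem v hv =>
      obtain ⟨_, ⟨x, hx, rfl⟩, _, ⟨y, hy, rfl⟩, hxs, hys, rfl⟩ := hv
      have hσ := inter_of_subset' hσ'
      have hτ := inter_of_subset' (h.trans hσ')
      rw [transLinear_sub hσ (h.trans hσ') hx hy hxs hys,
        transLinear_zeroOut (J := setSed (𝒞.img τ τ)) (inter_of_subset h')
          (setSed_anti (Set.image_mono h')),
        transLinear_sub hτ (h''.trans hσ') hx hy (sed_trans hσ hτ hx hxs) (sed_trans hσ hτ hy hys),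
        transLinear_sub hσ (h''.trans hσ') hx hy hxs hys]
    | zero => simp
    | add a b _ _ ha hb => simp only [map_add, ha, hb]
    | smul c a _ ha => simp only [map_smul, ha]
  have hreal : 𝒞.realMultiTangent p σ ≤ LinearMap.eqLocus
      (exteriorPower.map p (𝒞.transLinear τ ρ) ∘ₗ exteriorPower.map p (𝒞.transLinear σ τ))
      (exteriorPower.map p (𝒞.transLinear σ ρ)) := by
    refine iSup₂_le fun σ' hσ' => Submodule.span_le.2 ?_
    rintro _ ⟨v, hv, rfl⟩
    change exteriorPower.map p _ (exteriorPower.map p _ _) = exteriorPower.map p _ _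
    simp only [exteriorPower.map_apply_ιMulti]
    congr 1
    funext a
    exact hvec σ' hσ'.1 _ (hv a)
  ext ⟨ω, hω⟩ : 1
  exact Subtype.ext (hreal hω.1)

end OpenFaceStructure

/-- A filtration `X = X^n ⊇ X^{n-1} ⊇ ⋯ ⊇ X^0 ⊇ X^{-1} = ∅` by closed sets, of formal
dimension `n`. -/
structure ClosedFiltration (X : Type u) [TopologicalSpace X] where
  n : ℕ
  skel : ℤ → Set X
  isClosed : ∀ i, IsClosed (skel i)
  mono : Monotone skel
  skel_neg_one : skel (-1) = ∅
  skel_n : skel n = Set.univ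

namespace ClosedFiltration

variable {X : Type u} [TopologicalSpace X] (F : ClosedFiltration X)

/-- The difference `X_i = X^i ∖ X^{i-1}`. -/
def diff (i : ℤ) : Set X := F.skel i \ F.skel (i - 1)

/-- The singular locus `X^{n-1}`. -/
def singular : Set X := F.skel (F.n - 1)

/-- A stratum: a connected component of some `X_i`, where `i` is its formal dimension. -/
structure Stratum where
  carrier : Set X
  dim : ℤ
  isComponentOf : TropSpace.IsComponentOf carrier (F.diff dim)

/-- A perversity: a function on strata that vanishes on the regular strata. -/
structure Perversity where
  toFun : F.Stratum → ℤ
  eq_zero : ∀ S : F.Stratum, S.dim = F.n → toFun S = 0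

end ClosedFiltration

/-- An open face structure is stratified with respect to a filtration if the relative interior of
each cell `σ` is contained in a stratum `S_σ` with `dim σ ≤ dim S_σ`, and `dim S_τ ≤ dim S_σ` for
each face `τ` of `σ`. -/
def OpenFaceStructure.IsStratified {X : Type u} [TopologicalSpace X] {𝒜 : PolyAtlas X}
    (𝒞 : OpenFaceStructure 𝒜) (F : ClosedFiltration X) : Prop :=
  ∃ S : 𝒞.cells → F.Stratum,
    (∀ σ : 𝒞.cells, 𝒞.relint σ ⊆ (S σ).carrier ∧ (𝒞.cellDim σ : ℤ) ≤ (S σ).dim) ∧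
    ∀ τ σ : 𝒞.cells, (τ : Set X) ⊆ σ → (S τ).dim ≤ (S σ).dim

namespace OpenFaceStructure

open TropSpace

variable {X : Type u} [TopologicalSpace X] {𝒜 : PolyAtlas X} (𝒞 : OpenFaceStructure 𝒜)

/-- The support of a point of the standard simplex: the vertices of the face in whose relative
interior the point lies. -/
noncomputable def bary {q : ℕ} (t : stdSimplex ℝ (Fin (q + 1))) : Finset (Fin (q + 1)) :=
  Finset.univ.filter fun i => t i ≠ 0

/-- A stratified singular `q`-simplex: a continuous map from the standard `q`-simplex that maps the
relative interior of each face into the relative interior of some cell. -/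
structure Simplex (q : ℕ) where
  toFun : C(stdSimplex ℝ (Fin (q + 1)), X)
  stratified : ∀ s : Finset (Fin (q + 1)), s.Nonempty →
    ∃ τ ∈ 𝒞.cells, ∀ t, bary t = s → toFun t ∈ 𝒞.relint τ

namespace Simplex

variable {𝒞} {q : ℕ}

/-- The cell whose relative interior contains the image of the relative interior of the simplex. -/
noncomputable def cell (δ : 𝒞.Simplex q) : 𝒞.cells :=
  ⟨(δ.stratified Finset.univ Finset.univ_nonempty).choose,
    (δ.stratified Finset.univ Finset.univ_nonempty).choose_spec.1⟩

/-- The image of a simplex. -/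
def image (δ : 𝒞.Simplex q) : Set X := Set.range δ.toFun

lemma map_succAbove_apply (j : Fin (q + 2)) (t : stdSimplex ℝ (Fin (q + 1))) :
    (∀ i, stdSimplex.map (Fin.succAbove j) t (j.succAbove i) = t i) ∧
      stdSimplex.map (Fin.succAbove j) t j = 0 := by
  classical
  constructor
  · intro i
    rw [stdSimplex.map_coe, FunOnFinite.linearMap_apply_apply]
    rw [Finset.sum_eq_single i]
    · intro b hb hbi
      simp only [Finset.mem_filter, Finset.mem_univ, true_and] at hb
      exact absurd (Fin.succAbove_right_injective hb) hbi
    · intro h; simp at h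
  · rw [stdSimplex.map_coe, FunOnFinite.linearMap_apply_apply]
    refine Finset.sum_eq_zero fun i hi => ?_
    simp only [Finset.mem_filter, Finset.mem_univ, true_and] at hi
    exact absurd hi (Fin.succAbove_ne j i)

lemma bary_map (j : Fin (q + 2)) (t : stdSimplex ℝ (Fin (q + 1))) :
    bary (stdSimplex.map (Fin.succAbove j) t) = (bary t).map (Fin.succAboveEmb j) := by
  obtain ⟨h1, h2⟩ := map_succAbove_apply j t
  ext k
  simp only [bary, Finset.mem_map, Finset.mem_filter, Finset.mem_univ, true_and,
    Fin.succAboveEmb_apply]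
  rcases Fin.eq_self_or_eq_succAbove j k with rfl | ⟨i, rfl⟩
  · simp only [h2, ne_eq, not_true_eq_false, false_iff, not_exists, not_and]
    exact fun i _ => Fin.succAbove_ne k i
  · rw [h1]
    exact ⟨fun h => ⟨i, h, rfl⟩, fun ⟨i', h, e⟩ => Fin.succAbove_right_injective e ▸ h⟩

/-- The `j`-th face of a simplex. -/
noncomputable def face (δ : 𝒞.Simplex (q + 1)) (j : Fin (q + 2)) : 𝒞.Simplex q where
  toFun := δ.toFun.comp ⟨stdSimplex.map (Fin.succAbove j), stdSimplex.continuous_map _⟩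
  stratified s hs := by
    obtain ⟨τ, hτ, h⟩ := δ.stratified (s.map (Fin.succAboveEmb j)) (hs.map)
    refine ⟨τ, hτ, fun t ht => h _ ?_⟩
    rw [← ht]
    exact bary_map j t

lemma image_face_subset (δ : 𝒞.Simplex (q + 1)) (j : Fin (q + 2)) :
    (δ.face j).image ⊆ δ.image := by
  rintro _ ⟨t, rfl⟩
  exact ⟨_, rfl⟩

lemma ext' {δ δ' : 𝒞.Simplex q} (h : ∀ t, δ.toFun t = δ'.toFun t) : δ = δ' := by
  cases δ; cases δ'
  congr
  exact ContinuousMap.ext h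

lemma face_face (δ : 𝒞.Simplex (q + 2)) {i j : Fin (q + 2)} (h : i ≤ j) :
    (δ.face j.succ).face i = (δ.face i.castSucc).face j := by
  refine ext' fun t => ?_
  change δ.toFun (stdSimplex.map _ (stdSimplex.map _ t)) =
    δ.toFun (stdSimplex.map _ (stdSimplex.map _ t))
  rw [stdSimplex.map_comp_apply, stdSimplex.map_comp_apply]
  congr 2
  funext k
  have := SimplexCategory.δ_comp_δ h
  have := congrArg (fun f => f.toOrderHom k) this
  exact this

lemma mem_relint_cell (δ : 𝒞.Simplex q) {t : stdSimplex ℝ (Fin (q + 1))}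
    (ht : bary t = Finset.univ) : δ.toFun t ∈ 𝒞.relint (δ.cell : Set X) :=
  (δ.stratified Finset.univ Finset.univ_nonempty).choose_spec.2 t ht

lemma bary_barycenter : bary (stdSimplex.barycenter : stdSimplex ℝ (Fin (q + 1))) =
    Finset.univ := by
  ext i
  simp only [bary, Finset.mem_filter, Finset.mem_univ, true_and, iff_true]
  change (Fintype.card (Fin (q + 1)) : ℝ)⁻¹ ≠ 0
  simp
  positivity

lemma image_subset_cell (δ : 𝒞.Simplex q) : δ.image ⊆ (δ.cell : Set X) := by
  rintro _ ⟨t, rfl⟩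
  -- the segment from the barycenter to `t` stays in the relative interior up to its end point
  set c : stdSimplex ℝ (Fin (q + 1)) := stdSimplex.barycenter
  let γ : ℕ → stdSimplex ℝ (Fin (q + 1)) := fun m =>
    ⟨(1 / ((m : ℝ) + 1)) • c.1 + (1 - 1 / ((m : ℝ) + 1)) • t.1,
      convex_stdSimplex ℝ (Fin (q + 1)) c.2 t.2 (by positivity)
        (by rw [sub_nonneg, div_le_one (by positivity)]; linarith [m.cast_nonneg (α := ℝ)])
        (by ring)⟩
  have hlim : Filter.Tendsto γ Filter.atTop (𝓝 t) := by
    rw [tendsto_subtype_rng]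
    have h1 : Filter.Tendsto (fun m : ℕ => 1 / ((m : ℝ) + 1)) Filter.atTop (𝓝 0) :=
      tendsto_one_div_add_atTop_nhds_zero_nat
    have h2 := (h1.smul_const c.1).add ((tendsto_const_nhds (x := (1 : ℝ))).sub h1 |>.smul_const t.1)
    change Filter.Tendsto (fun m : ℕ => (1 / ((m : ℝ) + 1)) • c.1 + (1 - 1 / ((m : ℝ) + 1)) • t.1)
      Filter.atTop (𝓝 t.1)
    simpa using h2
  have hin : ∀ m, δ.toFun (γ m) ∈ (δ.cell : Set X) := by
    intro m
    refine (δ.mem_relint_cell ?_).1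
    ext i
    simp only [bary, Finset.mem_filter, Finset.mem_univ, true_and, iff_true]
    change (1 / ((m : ℝ) + 1)) * c.1 i + (1 - 1 / ((m : ℝ) + 1)) * t.1 i ≠ 0
    have hc : 0 < c.1 i := by
      change 0 < (Fintype.card (Fin (q + 1)) : ℝ)⁻¹
      simp
      positivity
    have ht0 : 0 ≤ t.1 i := t.2.1 i
    have hm : (0 : ℝ) ≤ 1 - 1 / ((m : ℝ) + 1) := by
      rw [sub_nonneg, div_le_one (by positivity)]; linarith [m.cast_nonneg (α := ℝ)]
    have : 0 < 1 / ((m : ℝ) + 1) * c.1 i := by positivity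
    have := mul_nonneg hm ht0
    linarith
  exact (𝒞.isClosed _ δ.cell.2).mem_of_tendsto
    ((δ.toFun.continuous.tendsto t).comp hlim) (Filter.Eventually.of_forall hin)

/-- A cell meeting the relative interior of `τ` contains `τ`. -/
lemma _root_.OpenFaceStructure.subset_of_mem_relint {τ σ : 𝒞.cells} {x : X}
    (hx : x ∈ 𝒞.relint (τ : Set X)) (hxσ : x ∈ (σ : Set X)) : (τ : Set X) ⊆ σ := by
  have hττ : ((τ : Set X) ∩ τ).Nonempty := ⟨x, hx.1, hx.1⟩
  have hτσ : ((τ : Set X) ∩ σ).Nonempty := ⟨x, hx.1, hxσ⟩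
  set φ := 𝒞.chart τ
  have hxm : φ.toFun x ∈ 𝒞.img τ τ ∩ 𝒞.img τ σ := ⟨⟨x, hx.1, rfl⟩, ⟨x, hxσ, rfl⟩⟩
  have hface := ((𝒞.isComplex τ).inter _ (img_mem hττ) _ (img_mem hτσ) _
    ⟨_, hxm, rfl⟩).1
  obtain ⟨ρ, hρ, ⟨ρ', hρ', hρρ'⟩, hρeq⟩ := (𝒞.isComplex τ).face_mem _ (img_mem hττ) _ hface
  have hρsrc : ρ ⊆ φ.source := hρρ'.trans (𝒞.star_subset τ ρ' hρ')
  have hin : φ.toFun x ∈ φ.toFun '' ρ := hρeq ▸ mem_connectedComponentIn hxm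
  have hsub : φ.toFun '' ρ ⊆ 𝒞.img τ τ ∩ 𝒞.img τ σ := hρeq ▸ connectedComponentIn_subset _ _
  have hback : ∀ κ : 𝒞.cells, ((τ : Set X) ∩ κ).Nonempty → ∀ y ∈ φ.source,
      φ.toFun y ∈ 𝒞.img τ κ → y ∈ (κ : Set X) := by
    rintro κ hκ y hy ⟨z, hz, hzy⟩
    exact injOn_source φ (subset_source_of_inter hκ hz) hy hzy ▸ hz
  have hxρ : x ∈ ρ := by
    obtain ⟨y, hy, hyx⟩ := hin
    exact injOn_source φ (hρsrc hy) (subset_source_of_inter hττ hx.1) hyx ▸ hy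
  have hρτ : ρ ⊆ τ := fun y hy => hback τ hττ y (hρsrc hy) (hsub ⟨y, hy, rfl⟩).1
  have hρσ : ρ ⊆ σ := fun y hy => hback σ hτσ y (hρsrc hy) (hsub ⟨y, hy, rfl⟩).2
  rcases hρτ.eq_or_ssubset with h | h
  · exact h ▸ hρσ
  · exact absurd hxρ (hx.2 ρ hρ h)

lemma cell_face_subset (δ : 𝒞.Simplex (q + 1)) (j : Fin (q + 2)) :
    ((δ.face j).cell : Set X) ⊆ δ.cell :=
  subset_of_mem_relint ((δ.face j).mem_relint_cell bary_barycenter)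
    (δ.image_subset_cell (δ.image_face_subset j ⟨_, rfl⟩))

end Simplex

/-- The coefficient module `F_p^Q(σ) = Q ⊗ F_p^ℤ(σ)`. -/
def Coeff (Q : Subring ℝ) (p : ℕ) (σ : 𝒞.cells) : Type := Q ⊗[ℤ] 𝒞.multiTangent p σ

noncomputable instance (Q : Subring ℝ) (p : ℕ) (σ : 𝒞.cells) : AddCommGroup (𝒞.Coeff Q p σ) :=
  inferInstanceAs (AddCommGroup (Q ⊗[ℤ] 𝒞.multiTangent p σ))

noncomputable instance (Q : Subring ℝ) (p : ℕ) (σ : 𝒞.cells) : Module Q (𝒞.Coeff Q p σ) :=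
  inferInstanceAs (Module Q (Q ⊗[ℤ] 𝒞.multiTangent p σ))

/-- The natural map of coefficient modules from a cell to one of its faces. -/
noncomputable def coeffMap (Q : Subring ℝ) (p : ℕ) {σ τ : 𝒞.cells} (h : (τ : Set X) ⊆ σ) :
    𝒞.Coeff Q p σ →ₗ[Q] 𝒞.Coeff Q p τ :=
  (𝒞.multiTangentMap p h).baseChange Q

lemma coeffMap_comp (Q : Subring ℝ) (p : ℕ) {σ τ ρ : 𝒞.cells} (h : (τ : Set X) ⊆ σ)
    (h' : (ρ : Set X) ⊆ τ) (h'' : (ρ : Set X) ⊆ σ) (a : 𝒞.Coeff Q p σ) :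
    𝒞.coeffMap Q p h' (𝒞.coeffMap Q p h a) = 𝒞.coeffMap Q p h'' a := by
  have := congrArg (LinearMap.baseChange Q) (𝒞.multiTangentMap_comp p h h' h'')
  rw [LinearMap.baseChange_comp] at this
  exact LinearMap.congr_fun this a

/-- Finite formal sums of stratified `q`-simplices `δ` with coefficients in `F_p^Q` of the cell whose
relative interior contains the interior of `δ`: the GM tropical `(p, q)`-chains. -/
abbrev Chain (Q : Subring ℝ) (p q : ℕ) : Type u :=
  Π₀ δ : 𝒞.Simplex q, 𝒞.Coeff Q p δ.cell

open Classical in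
/-- The coefficient `a` of a simplex `δ` goes to the chain `a δ_j`, or to zero if the face `δ_j` is
contained in the closed set `D`. -/
noncomputable def faceTerm (Q : Subring ℝ) (D : Set X) (p q : ℕ) (j : Fin (q + 2))
    (δ : 𝒞.Simplex (q + 1)) : 𝒞.Coeff Q p δ.cell →ₗ[Q] 𝒞.Chain Q p q :=
  if (δ.face j).image ⊆ D then 0 else
    DFinsupp.lsingle (δ.face j) ∘ₗ 𝒞.coeffMap Q p (δ.cell_face_subset j)

open Classical in
/-- The `j`-th face operator on chains, where faces contained in `D` are discarded. -/
noncomputable def faceMap (Q : Subring ℝ) (D : Set X) (p q : ℕ) (j : Fin (q + 2)) :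
    𝒞.Chain Q p (q + 1) →ₗ[Q] 𝒞.Chain Q p q :=
  DFinsupp.lsum ℕ (𝒞.faceTerm Q D p q j)

/-- The boundary operator `∂`, with the faces contained in `D` discarded. -/
noncomputable def boundary (Q : Subring ℝ) (D : Set X) (p q : ℕ) :
    𝒞.Chain Q p (q + 1) →ₗ[Q] 𝒞.Chain Q p q :=
  ∑ j : Fin (q + 2), (-1 : ℤ) ^ (j : ℕ) • 𝒞.faceMap Q D p q j

lemma faceMap_single (Q : Subring ℝ) (D : Set X) (p q : ℕ) (j : Fin (q + 2))
    [inst : DecidableEq (𝒞.Simplex (q + 1))] (δ : 𝒞.Simplex (q + 1)) (a : 𝒞.Coeff Q p δ.cell) :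
    𝒞.faceMap Q D p q j (DFinsupp.single δ a) = 𝒞.faceTerm Q D p q j δ a := by
  obtain rfl : inst = fun _ _ => Classical.propDecidable _ := Subsingleton.elim _ _
  classical
  exact DFinsupp.lsum_single ℕ (𝒞.faceTerm Q D p q j) δ a

lemma faceMap_single_of_subset (Q : Subring ℝ) (D : Set X) (p q : ℕ) {j : Fin (q + 2)}
    [DecidableEq (𝒞.Simplex (q + 1))] {δ : 𝒞.Simplex (q + 1)} (a : 𝒞.Coeff Q p δ.cell)
    (h : (δ.face j).image ⊆ D) : 𝒞.faceMap Q D p q j (DFinsupp.single δ a) = 0 := by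
  rw [faceMap_single, faceTerm, if_pos h]
  rfl

lemma faceMap_single_of_not_subset (Q : Subring ℝ) (D : Set X) (p q : ℕ) {j : Fin (q + 2)}
    [DecidableEq (𝒞.Simplex (q + 1))] [inst : DecidableEq (𝒞.Simplex q)]
    {δ : 𝒞.Simplex (q + 1)} (a : 𝒞.Coeff Q p δ.cell) (h : ¬ (δ.face j).image ⊆ D) :
    𝒞.faceMap Q D p q j (DFinsupp.single δ a) =
      DFinsupp.single (δ.face j) (𝒞.coeffMap Q p (δ.cell_face_subset j) a) := by
  obtain rfl : inst = fun _ _ => Classical.propDecidable _ := Subsingleton.elim _ _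
  rw [faceMap_single, faceTerm, if_neg h]
  rfl

lemma single_coeffMap_congr (Q : Subring ℝ) (p q : ℕ) {σ : 𝒞.cells} (a : 𝒞.Coeff Q p σ)
    [DecidableEq (𝒞.Simplex q)] {δ δ' : 𝒞.Simplex q} (e : δ = δ') (h : (δ.cell : Set X) ⊆ σ)
    (h' : (δ'.cell : Set X) ⊆ σ) :
    (DFinsupp.single δ (𝒞.coeffMap Q p h a) : 𝒞.Chain Q p q) =
      DFinsupp.single δ' (𝒞.coeffMap Q p h' a) := by
  subst e; rfl

lemma faceMap_faceMap_single (Q : Subring ℝ) (D : Set X) (p q : ℕ) {i j : Fin (q + 2)} (h : i ≤ j)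
    [DecidableEq (𝒞.Simplex (q + 2))] (δ : 𝒞.Simplex (q + 2)) (a : 𝒞.Coeff Q p δ.cell) :
    𝒞.faceMap Q D p q i (𝒞.faceMap Q D p (q + 1) j.succ (DFinsupp.single δ a)) =
      𝒞.faceMap Q D p q j (𝒞.faceMap Q D p (q + 1) i.castSucc (DFinsupp.single δ a)) := by
  classical
  have zero : ∀ (k : Fin (q + 2)) (l : Fin (q + 3)), ((δ.face l).face k).image ⊆ D →
      𝒞.faceMap Q D p q k (𝒞.faceMap Q D p (q + 1) l (DFinsupp.single δ a)) = 0 := by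
    intro k l hk
    by_cases h1 : (δ.face l).image ⊆ D
    · rw [faceMap_single_of_subset _ _ _ _ _ _ h1, map_zero]
    · rw [faceMap_single_of_not_subset _ _ _ _ _ _ h1, faceMap_single_of_subset _ _ _ _ _ _ hk]
  have nonzero : ∀ (k : Fin (q + 2)) (l : Fin (q + 3)), ¬ ((δ.face l).face k).image ⊆ D →
      𝒞.faceMap Q D p q k (𝒞.faceMap Q D p (q + 1) l (DFinsupp.single δ a)) =
        DFinsupp.single ((δ.face l).face k)
          (𝒞.coeffMap Q p (((δ.face l).cell_face_subset k).trans (δ.cell_face_subset l)) a) := by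
    intro k l hk
    have h1 : ¬ (δ.face l).image ⊆ D := fun h1 => hk (((δ.face l).image_face_subset k).trans h1)
    rw [faceMap_single_of_not_subset _ _ _ _ _ _ h1, faceMap_single_of_not_subset _ _ _ _ _ _ hk,
      coeffMap_comp]
  have e := δ.face_face h
  by_cases h2 : ((δ.face j.succ).face i).image ⊆ D
  · rw [zero _ _ h2, zero _ _ (e ▸ h2)]
  · rw [nonzero _ _ h2, nonzero _ _ (e ▸ h2)]
    exact 𝒞.single_coeffMap_congr Q p q a e _ _

/-- Alternating sums of face operators square to zero. -/
lemma _root_.alternating_sum_comp_eq_zero {R M₀ M₁ M₂ : Type*} [Ring R] [AddCommGroup M₀]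
    [Module R M₀] [AddCommGroup M₁] [Module R M₁] [AddCommGroup M₂] [Module R M₂] {n : ℕ}
    (f : Fin (n + 3) → M₂ →ₗ[R] M₁) (g : Fin (n + 2) → M₁ →ₗ[R] M₀)
    (h : ∀ i j : Fin (n + 2), i ≤ j → ∀ x, g i (f j.succ x) = g j (f i.castSucc x)) (x : M₂) :
    (∑ i : Fin (n + 2), (-1 : ℤ) ^ (i : ℕ) • g i)
      ((∑ j : Fin (n + 3), (-1 : ℤ) ^ (j : ℕ) • f j) x) = 0 := by
  let P := Fin (n + 2) × Fin (n + 3)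
  have hP : (∑ i : Fin (n + 2), (-1 : ℤ) ^ (i : ℕ) • g i)
      ((∑ j : Fin (n + 3), (-1 : ℤ) ^ (j : ℕ) • f j) x) =
      ∑ ij : P, ((-1 : ℤ) ^ (ij.1 : ℕ) * (-1) ^ (ij.2 : ℕ)) • g ij.1 (f ij.2 x) := by
    rw [Fintype.sum_prod_type]
    simp only [LinearMap.sum_apply, LinearMap.smul_apply]
    refine Finset.sum_congr rfl fun i _ => ?_
    rw [map_sum, Finset.smul_sum]
    exact Finset.sum_congr rfl fun j _ => by rw [map_zsmul, smul_smul]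
  rw [hP]
  let S : Finset P := {ij : P | (ij.2 : ℕ) ≤ (ij.1 : ℕ)}
  rw [← Finset.sum_add_sum_compl S, ← eq_neg_iff_add_eq_zero,
    ← Finset.sum_neg_distrib]
  let φ : ∀ ij : P, ij ∈ S → P := fun ij hij =>
    (Fin.castLT ij.2 (lt_of_le_of_lt (Finset.mem_filter.mp hij).right (Fin.is_lt ij.1)), ij.1.succ)
  apply Finset.sum_bij φ
  · intro ij hij
    simp_rw [S, φ, Finset.compl_filter, Finset.mem_filter_univ, Fin.val_succ,
      Fin.val_castLT] at hij ⊢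
    lia
  · rintro ⟨i, j⟩ hij ⟨i', j'⟩ hij' h
    rw [Prod.mk_inj]
    exact ⟨by simpa [φ] using! congr_arg Prod.snd h,
      by simpa [φ, Fin.castSucc_castLT] using! congr_arg Fin.castSucc (congr_arg Prod.fst h)⟩
  · rintro ⟨i', j'⟩ hij'
    simp_rw [S, Finset.compl_filter, Finset.mem_filter_univ, not_le] at hij'
    refine ⟨(j'.pred <| ?_, Fin.castSucc i'), ?_, ?_⟩
    · rintro rfl
      simp only [Fin.val_zero, not_lt_zero] at hij'
    · simpa [S] using! Nat.le_sub_one_of_lt hij'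
    · simp only [φ, Fin.castLT_castSucc, Fin.succ_pred]
  · rintro ⟨i, j⟩ hij
    have hle : (j : ℕ) ≤ i := by simpa [S] using! hij
    have hj := h (Fin.castLT j (lt_of_le_of_lt hle i.is_lt)) i hle x
    rw [Fin.castSucc_castLT] at hj
    simp only [φ, hj, ← neg_smul, Fin.val_succ, Fin.val_castLT, pow_add, pow_one]
    congr 1
    ring

lemma boundary_boundary (Q : Subring ℝ) (D : Set X) (p q : ℕ) (ξ : 𝒞.Chain Q p (q + 2)) :
    𝒞.boundary Q D p q (𝒞.boundary Q D p (q + 1) ξ) = 0 := by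
  classical
  refine alternating_sum_comp_eq_zero _ _ (fun i j h x => ?_) ξ
  have : 𝒞.faceMap Q D p q i ∘ₗ 𝒞.faceMap Q D p (q + 1) j.succ =
      𝒞.faceMap Q D p q j ∘ₗ 𝒞.faceMap Q D p (q + 1) i.castSucc :=
    DFinsupp.lhom_ext fun δ a => 𝒞.faceMap_faceMap_single Q D p q h δ a
  exact LinearMap.congr_fun this x

end OpenFaceStructure

/-- The two versions of tropical intersection homology. -/
inductive ICVersion
  | GM
  | nonGM

/-- A filtered rational polyhedral space with an open face structure. -/
structure FilteredPolySpace (X : Type u) [TopologicalSpace X] where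
  atlas : PolyAtlas X
  filtration : ClosedFiltration X
  faces : OpenFaceStructure atlas
  isStratified : faces.IsStratified filtration

/-- A filtered rational polyhedral space with an open face structure, together with the data that
enter the definition of tropical intersection chains: a perversity, the version (GM or non-GM), the
coefficient ring `Q` and the degree `p` of the multi-tangent coefficients. -/
structure ICData (X : Type u) [TopologicalSpace X] extends FilteredPolySpace X where
  perv : filtration.Perversity
  version : ICVersion
  Q : Subring ℝ
  p : ℕ

namespace ICData

open CategoryTheory CategoryTheory.Limits Opposite OpenFaceStructure

variable {X : Type u} [TopologicalSpace X] (𝒳 : ICData X)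

/-- Stratified simplices. -/
abbrev Simplex (q : ℕ) : Type u := 𝒳.faces.Simplex q

/-- Chains of stratified simplices. -/
abbrev Chain (q : ℕ) : Type u := 𝒳.faces.Chain 𝒳.Q 𝒳.p q

/-- Simplices contained in this set do not occur in chains and are omitted from boundaries: the
singular locus in the non-GM version, nothing in the GM version. -/
def discard : Set X :=
  match 𝒳.version with
  | .GM => ∅
  | .nonGM => 𝒳.filtration.singular

/-- The boundary operator (`∂` in the GM version, `∂̂` in the non-GM version). -/
noncomputable def bdry (q : ℕ) : 𝒳.Chain (q + 1) →ₗ[𝒳.Q] 𝒳.Chain q :=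
  𝒳.faces.boundary 𝒳.Q 𝒳.discard 𝒳.p q

/-- A `q`-simplex `δ` is allowable if for each stratum `S` the preimage `δ⁻¹(S)` is contained in the
`(q - codim S + perv S)`-skeleton; a point of the standard simplex lies in the `k`-skeleton if and
only if it has at most `k + 1` nonzero barycentric coordinates. -/
def IsAllowable {q : ℕ} (δ : 𝒳.Simplex q) : Prop :=
  ∀ (S : 𝒳.filtration.Stratum) (t : stdSimplex ℝ (Fin (q + 1))), δ.toFun t ∈ S.carrier →
    ((bary t).card : ℤ) ≤ (q - (𝒳.filtration.n - S.dim) + 𝒳.perv.toFun S) + 1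

/-- The chains all of whose constituting simplices lie in a given set of simplices. -/
def chainsOn {q : ℕ} (T : Set (𝒳.Simplex q)) : Submodule 𝒳.Q (𝒳.Chain q) where
  carrier := {ξ | ∀ δ, ξ δ ≠ 0 → δ ∈ T}
  add_mem' {ξ ζ} hξ hζ δ h := by
    by_contra hT
    have h1 : ξ δ = 0 := by_contra fun h => hT (hξ δ h)
    have h2 : ζ δ = 0 := by_contra fun h => hT (hζ δ h)
    exact h (by rw [DFinsupp.add_apply, h1, h2, add_zero])
  zero_mem' δ h := absurd rfl h
  smul_mem' c ξ hξ δ h := hξ δ fun h0 => h (by rw [DFinsupp.smul_apply, h0, smul_zero])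

/-- The simplices that may constitute an intersection chain of the open subset `U`: they are
contained in `U`, are not contained in the discarded locus, and are allowable. -/
def goodSimplices (U : Opens X) (q : ℕ) : Set (𝒳.Simplex q) :=
  {δ | δ.image ⊆ U ∧ ¬ δ.image ⊆ 𝒳.discard ∧ 𝒳.IsAllowable δ}

/-- The tropical intersection `(p, q)`-chains of the open subset `U`: chains of simplices in `U`
such that all constituting simplices, and all simplices constituting the boundary, are
allowable. -/
noncomputable def IC (U : Opens X) : (q : ℕ) → Submodule 𝒳.Q (𝒳.Chain q)
  | 0 => 𝒳.chainsOn (𝒳.goodSimplices U 0)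
  | q + 1 => 𝒳.chainsOn (𝒳.goodSimplices U (q + 1)) ⊓
      (𝒳.chainsOn {δ | 𝒳.IsAllowable δ}).comap (𝒳.bdry q)

variable {𝒳}

lemma chainsOn_mono {q : ℕ} {T T' : Set (𝒳.Simplex q)} (h : T ⊆ T') :
    𝒳.chainsOn T ≤ 𝒳.chainsOn T' := fun _ hξ δ hδ => h (hξ δ hδ)

lemma goodSimplices_mono {U U' : Opens X} (h : U ≤ U') (q : ℕ) :
    𝒳.goodSimplices U q ⊆ 𝒳.goodSimplices U' q :=
  fun _ hδ => ⟨hδ.1.trans h, hδ.2⟩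

lemma IC_mono {U U' : Opens X} (h : U ≤ U') : ∀ q, 𝒳.IC U q ≤ 𝒳.IC U' q
  | 0 => chainsOn_mono (goodSimplices_mono h 0)
  | q + 1 => inf_le_inf_right _ (chainsOn_mono (goodSimplices_mono h (q + 1)))

lemma bdry_bdry (q : ℕ) (ξ : 𝒳.Chain (q + 2)) : 𝒳.bdry q (𝒳.bdry (q + 1) ξ) = 0 :=
  𝒳.faces.boundary_boundary _ _ _ _ ξ

lemma bdry_mem_chainsOn {U : Set X} {q : ℕ} {ξ : 𝒳.Chain (q + 1)}
    (hξ : ξ ∈ 𝒳.chainsOn {δ | δ.image ⊆ U}) :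
    𝒳.bdry q ξ ∈ 𝒳.chainsOn {δ | δ.image ⊆ U ∧ ¬ δ.image ⊆ 𝒳.discard} := by
  classical
  have hsum : ξ = ∑ δ ∈ ξ.support, DFinsupp.single δ (ξ δ) := (DFinsupp.sum_single (f := ξ)).symm
  rw [hsum, map_sum]
  refine Submodule.sum_mem _ fun δ hδ => ?_
  have hδU : δ.image ⊆ U := hξ δ (DFinsupp.mem_support_iff.1 hδ)
  rw [bdry, boundary, LinearMap.sum_apply]
  refine Submodule.sum_mem _ fun j _ => ?_
  rw [LinearMap.smul_apply]
  refine zsmul_mem ?_ _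
  by_cases h : (δ.face j).image ⊆ 𝒳.discard
  · rw [faceMap_single_of_subset _ _ _ _ _ _ h]
    exact Submodule.zero_mem _
  · rw [faceMap_single_of_not_subset _ _ _ _ _ _ h]
    intro δ' hδ'
    by_cases he : δ.face j = δ'
    · subst he
      exact ⟨(δ.image_face_subset j).trans hδU, h⟩
    · exact absurd (DFinsupp.single_eq_of_ne (Ne.symm he)) hδ'

lemma bdry_mem_IC {U : Opens X} {q : ℕ} {ξ : 𝒳.Chain (q + 1)} (hξ : ξ ∈ 𝒳.IC U (q + 1)) :
    𝒳.bdry q ξ ∈ 𝒳.IC U q := by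
  have h1 : 𝒳.bdry q ξ ∈ 𝒳.chainsOn (𝒳.goodSimplices U q) := by
    intro δ hδ
    have hU : ξ ∈ 𝒳.chainsOn (𝒳.goodSimplices U (q + 1)) := hξ.1
    have h := bdry_mem_chainsOn (U := (U : Set X)) (chainsOn_mono (T := 𝒳.goodSimplices U (q + 1))
      (T' := {δ | δ.image ⊆ (U : Set X)}) (fun δ hδ => hδ.1) hU) δ hδ
    exact ⟨h.1, h.2, hξ.2 δ hδ⟩
  cases q with
  | zero => exact h1
  | succ q =>
    refine ⟨h1, ?_⟩
    change 𝒳.bdry q (𝒳.bdry (q + 1) ξ) ∈ 𝒳.chainsOn {δ | 𝒳.IsAllowable δ}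
    rw [bdry_bdry]
    exact Submodule.zero_mem _

variable (𝒳)

/-- The relative chains `IC(U) / IC(A)` (for `A ⊆ U`). -/
abbrev relChain (U A : Opens X) (q : ℕ) : Type u :=
  𝒳.IC U q ⧸ (𝒳.IC A q).submoduleOf (𝒳.IC U q)

/-- The boundary operator on the chains of `U`. -/
noncomputable def bdryIC (U : Opens X) (q : ℕ) : 𝒳.IC U (q + 1) →ₗ[𝒳.Q] 𝒳.IC U q :=
  (𝒳.bdry q).restrict fun _ h => bdry_mem_IC h

/-- The boundary operator on relative chains. -/
noncomputable def relBdry (U A : Opens X) (q : ℕ) :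
    𝒳.relChain U A (q + 1) →ₗ[𝒳.Q] 𝒳.relChain U A q :=
  Submodule.mapQ _ _ (𝒳.bdryIC U q) fun _ h => bdry_mem_IC h

/-- The complex of relative tropical intersection chains of the pair `(U, A)`; the absolute complex
of `U` is the case `A = ∅`. -/
noncomputable def relComplex (U A : Opens X) : ChainComplex (ModuleCat.{u} 𝒳.Q) ℕ :=
  ChainComplex.of (fun q => ModuleCat.of 𝒳.Q (𝒳.relChain U A q))
    (fun q => ModuleCat.ofHom (𝒳.relBdry U A q)) (fun q => by
      refine ModuleCat.hom_ext (LinearMap.ext fun x => ?_)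
      obtain ⟨⟨ξ, hξ⟩, rfl⟩ := Submodule.Quotient.mk_surjective _ x
      change Submodule.Quotient.mk (⟨𝒳.bdry q (𝒳.bdry (q + 1) ξ), _⟩ : 𝒳.IC U q) = 0
      rw [Submodule.Quotient.mk_eq_zero]
      change 𝒳.bdry q (𝒳.bdry (q + 1) ξ) ∈ 𝒳.IC A q
      rw [bdry_bdry]
      exact Submodule.zero_mem _)

lemma relComplex_d (U A : Opens X) (q : ℕ) :
    (𝒳.relComplex U A).d (q + 1) q = ModuleCat.ofHom (𝒳.relBdry U A q) :=
  ChainComplex.of_d (fun q => ModuleCat.of 𝒳.Q (𝒳.relChain U A q))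
    (fun q => ModuleCat.ofHom (𝒳.relBdry U A q)) q

/-- The map of relative chains induced by an inclusion of pairs. -/
noncomputable def relChainMap {U U' A A' : Opens X} (hU : U ≤ U') (hA : A ≤ A') (q : ℕ) :
    𝒳.relChain U A q →ₗ[𝒳.Q] 𝒳.relChain U' A' q :=
  Submodule.mapQ _ _ (Submodule.inclusion (IC_mono hU q)) fun _ h => IC_mono hA q h

/-- The map of relative complexes induced by an inclusion of pairs `(U, A) ⊆ (U', A')`. -/
noncomputable def relMap {U U' A A' : Opens X} (hU : U ≤ U') (hA : A ≤ A') :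
    𝒳.relComplex U A ⟶ 𝒳.relComplex U' A' :=
  ChainComplex.ofHom (fun q => ModuleCat.ofHom (𝒳.relChainMap hU hA q)) (fun q => by
    rw [relComplex_d, relComplex_d]
    refine ModuleCat.hom_ext (LinearMap.ext fun x => ?_)
    obtain ⟨⟨ξ, hξ⟩, rfl⟩ := Submodule.Quotient.mk_surjective _ x
    rfl)

lemma relMap_id (U A : Opens X) : 𝒳.relMap (le_refl U) (le_refl A) = 𝟙 _ := by
  refine HomologicalComplex.hom_ext _ _ fun q => ModuleCat.hom_ext (LinearMap.ext fun x => ?_)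
  obtain ⟨⟨ξ, hξ⟩, rfl⟩ := Submodule.Quotient.mk_surjective _ x
  rfl

lemma relMap_comp {U U' U'' A A' A'' : Opens X} (hU : U ≤ U') (hA : A ≤ A') (hU' : U' ≤ U'')
    (hA' : A' ≤ A'') :
    𝒳.relMap hU hA ≫ 𝒳.relMap hU' hA' = 𝒳.relMap (hU.trans hU') (hA.trans hA') := by
  refine HomologicalComplex.hom_ext _ _ fun q => ModuleCat.hom_ext (LinearMap.ext fun x => ?_)
  obtain ⟨⟨ξ, hξ⟩, rfl⟩ := Submodule.Quotient.mk_surjective _ x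
  rfl

/-- The `Q`-dual cochain complex of a chain complex of `Q`-modules. -/
noncomputable def dualComplex {R : Type} [CommRing R] (C : ChainComplex (ModuleCat.{u} R) ℕ) :
    CochainComplex (ModuleCat.{u} R) ℕ :=
  CochainComplex.of (fun q => ModuleCat.of R (Module.Dual R (C.X q)))
    (fun q => ModuleCat.ofHom (C.d (q + 1) q).hom.dualMap) (fun q => by
      refine ModuleCat.hom_ext (LinearMap.ext fun φ => LinearMap.ext fun x => ?_)
      have h := LinearMap.congr_fun
        (congrArg ModuleCat.Hom.hom (C.d_comp_d (q + 2) (q + 1) q)) x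
      exact (congrArg (fun y => (φ : Module.Dual R (C.X q)) y) h).trans
        (LinearMap.map_zero (φ : Module.Dual R (C.X q))))

lemma dualComplex_d {R : Type} [CommRing R] (C : ChainComplex (ModuleCat.{u} R) ℕ) (q : ℕ) :
    (dualComplex C).d q (q + 1) = ModuleCat.ofHom (C.d (q + 1) q).hom.dualMap :=
  CochainComplex.of_d (fun q => ModuleCat.of R (Module.Dual R (C.X q)))
    (fun q => ModuleCat.ofHom (C.d (q + 1) q).hom.dualMap) q

/-- The map of dual complexes induced by a map of chain complexes. -/
noncomputable def dualMap {R : Type} [CommRing R] {C D : ChainComplex (ModuleCat.{u} R) ℕ}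
    (f : C ⟶ D) : dualComplex D ⟶ dualComplex C :=
  CochainComplex.ofHom (fun q => ModuleCat.ofHom (f.f q).hom.dualMap) (fun q => by
    rw [dualComplex_d, dualComplex_d]
    refine ModuleCat.hom_ext (LinearMap.ext fun φ => LinearMap.ext fun x => ?_)
    have h := LinearMap.congr_fun (congrArg ModuleCat.Hom.hom (f.comm (q + 1) q)) x
    exact congrArg (show Module.Dual R (D.X q) from φ) h.symm)

lemma dualMap_id {R : Type} [CommRing R] (C : ChainComplex (ModuleCat.{u} R) ℕ) :
    dualMap (𝟙 C) = 𝟙 _ := by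
  exact HomologicalComplex.hom_ext _ _ fun q => ModuleCat.hom_ext (LinearMap.ext fun φ => rfl)

lemma dualMap_comp {R : Type} [CommRing R] {C D E : ChainComplex (ModuleCat.{u} R) ℕ}
    (f : C ⟶ D) (g : D ⟶ E) : dualMap (f ≫ g) = dualMap g ≫ dualMap f := by
  exact HomologicalComplex.hom_ext _ _ fun q => ModuleCat.hom_ext (LinearMap.ext fun φ => rfl)

/-- The compact subsets of `W`, ordered by inclusion. -/
abbrev CompactsIn (W : Opens X) : Type u := {K : Compacts X // (K : Set X) ⊆ W}

variable [T2Space X]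

/-- The open subset `Y ∖ K`. -/
def sdiffOpens (Y : Opens X) (K : Compacts X) : Opens X :=
  ⟨Y \ K, Y.isOpen.sdiff K.isCompact.isClosed⟩

lemma sdiffOpens_mono {Y Y' : Opens X} {K K' : Compacts X} (h : Y ≤ Y') (hK : K' ≤ K) :
    sdiffOpens Y K ≤ sdiffOpens Y' K' :=
  Set.sdiff_subset_sdiff h hK

/-- The inverse system of the complexes `IC(Y, Y ∖ K)` over the compact subsets `K` of `W`. -/
noncomputable def bmSystem (Y W : Opens X) :
    (CompactsIn W)ᵒᵖ ⥤ ChainComplex (ModuleCat.{u} 𝒳.Q) ℕ where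
  obj K := 𝒳.relComplex Y (sdiffOpens Y K.unop.1)
  map f := 𝒳.relMap le_rfl (sdiffOpens_mono le_rfl (leOfHom f.unop))
  map_id _ := 𝒳.relMap_id _ _
  map_comp _ _ := (𝒳.relMap_comp _ _ _ _).symm

/-- The inverse limit of the complexes `IC(Y, Y ∖ K)` over the compact subsets `K` of `W ⊆ Y`.  For
`W = Y` this is the Borel–Moore intersection chain complex of `Y`. -/
noncomputable def bmComplex (Y W : Opens X) : ChainComplex (ModuleCat.{u} 𝒳.Q) ℕ :=
  limit (𝒳.bmSystem Y W)

/-- Restriction of the index set from the compact subsets of `W` to those of `W' ⊆ W`. -/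
noncomputable def bmRestrict (Y : Opens X) {W' W : Opens X} (h : W' ≤ W) :
    𝒳.bmComplex Y W ⟶ 𝒳.bmComplex Y W' :=
  limit.lift (𝒳.bmSystem Y W')
    { pt := 𝒳.bmComplex Y W
      π := { app := fun K => limit.π (𝒳.bmSystem Y W) (op ⟨K.unop.1, K.unop.2.trans h⟩)
             naturality := fun K L f => by
              exact (Category.id_comp _).trans (limit.w (𝒳.bmSystem Y W)
                (homOfLE (leOfHom f.unop) :
                  (⟨L.unop.1, L.unop.2.trans h⟩ : CompactsIn W) ⟶ ⟨K.unop.1, K.unop.2.trans h⟩).op).symm } }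

/-- The map induced by the inclusions `(Y', Y' ∖ K) ⊆ (Y, Y ∖ K)`. -/
noncomputable def bmExtend {Y' Y : Opens X} (h : Y' ≤ Y) (W : Opens X) :
    𝒳.bmComplex Y' W ⟶ 𝒳.bmComplex Y W :=
  limMap { app := fun K => 𝒳.relMap h (sdiffOpens_mono h le_rfl)
           naturality := fun _ _ f => by
            change 𝒳.relMap le_rfl (sdiffOpens_mono le_rfl (leOfHom f.unop)) ≫
                𝒳.relMap h (sdiffOpens_mono h le_rfl) =
              𝒳.relMap h (sdiffOpens_mono h le_rfl) ≫
                𝒳.relMap le_rfl (sdiffOpens_mono le_rfl (leOfHom f.unop))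
            rw [relMap_comp, relMap_comp] }

/-- The direct system of the cochain complexes of the pairs `(Y, Y ∖ K)` over the compact
subsets `K` of `W`. -/
noncomputable def ccSystem (Y W : Opens X) :
    CompactsIn W ⥤ CochainComplex (ModuleCat.{u} 𝒳.Q) ℕ where
  obj K := dualComplex (𝒳.relComplex Y (sdiffOpens Y K.1))
  map f := dualMap (𝒳.relMap le_rfl (sdiffOpens_mono le_rfl (leOfHom f)))
  map_id _ := by rw [relMap_id, dualMap_id]
  map_comp _ _ := by rw [← dualMap_comp, relMap_comp]

/-- The direct limit of the cochain complexes of the pairs `(Y, Y ∖ K)` over the compact subsets `K`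
of `W ⊆ Y`.  For `W = Y` this is the compactly supported intersection cochain complex of `Y`. -/
noncomputable def ccComplex (Y W : Opens X) : CochainComplex (ModuleCat.{u} 𝒳.Q) ℕ :=
  colimit (𝒳.ccSystem Y W)

/-- Extension of the index set from the compact subsets of `W` to those of `W' ⊇ W`. -/
noncomputable def ccExtend (Y : Opens X) {W W' : Opens X} (h : W ≤ W') :
    𝒳.ccComplex Y W ⟶ 𝒳.ccComplex Y W' :=
  colimit.desc (𝒳.ccSystem Y W)
    { pt := 𝒳.ccComplex Y W'
      ι := { app := fun K => colimit.ι (𝒳.ccSystem Y W') ⟨K.1, K.2.trans h⟩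
             naturality := fun K L f => by
              exact (colimit.w (𝒳.ccSystem Y W')
                (homOfLE (leOfHom f) :
                  (⟨K.1, K.2.trans h⟩ : CompactsIn W') ⟶ ⟨L.1, L.2.trans h⟩)).trans
                (Category.comp_id _).symm } }

/-- The map induced by restricting cochains along `(Y', Y' ∖ K) ⊆ (Y, Y ∖ K)`. -/
noncomputable def ccRestrict {Y' Y : Opens X} (h : Y' ≤ Y) (W : Opens X) :
    𝒳.ccComplex Y W ⟶ 𝒳.ccComplex Y' W :=
  colimMap { app := fun K => dualMap (𝒳.relMap h (sdiffOpens_mono h le_rfl))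
             naturality := fun _ _ f => by
              change dualMap (𝒳.relMap le_rfl (sdiffOpens_mono le_rfl (leOfHom f))) ≫
                  dualMap (𝒳.relMap h (sdiffOpens_mono h le_rfl)) =
                dualMap (𝒳.relMap h (sdiffOpens_mono h le_rfl)) ≫
                  dualMap (𝒳.relMap le_rfl (sdiffOpens_mono le_rfl (leOfHom f)))
              rw [← dualMap_comp, ← dualMap_comp, relMap_comp, relMap_comp] }

/-- The relative tropical intersection homology of the pair `(U, A)`. -/
noncomputable abbrev IH (U A : Opens X) (q : ℕ) : ModuleCat.{u} 𝒳.Q :=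
  (𝒳.relComplex U A).homology q

/-- The map in homology induced by an inclusion of pairs. -/
noncomputable def mapIH {U U' A A' : Opens X} (hU : U ≤ U') (hA : A ≤ A') (q : ℕ) :
    𝒳.IH U A q →ₗ[𝒳.Q] 𝒳.IH U' A' q :=
  (HomologicalComplex.homologyMap (𝒳.relMap hU hA) q).hom

/-- The relative tropical intersection cohomology of the pair `(U, A)`. -/
noncomputable abbrev CoIH (U A : Opens X) (q : ℕ) : ModuleCat.{u} 𝒳.Q :=
  (dualComplex (𝒳.relComplex U A)).homology q

/-- The restriction map in cohomology induced by an inclusion of pairs. -/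
noncomputable def mapCoIH {U U' A A' : Opens X} (hU : U ≤ U') (hA : A ≤ A') (q : ℕ) :
    𝒳.CoIH U' A' q →ₗ[𝒳.Q] 𝒳.CoIH U A q :=
  (HomologicalComplex.homologyMap (dualMap (𝒳.relMap hU hA)) q).hom

/-- The homology of the inverse limit of the complexes `IC(Y, Y ∖ K)`, `K ⊆ W` compact. -/
noncomputable abbrev BMPair (Y W : Opens X) (q : ℕ) : ModuleCat.{u} 𝒳.Q :=
  (𝒳.bmComplex Y W).homology q

/-- The tropical intersection Borel–Moore homology of `Y`. -/
noncomputable abbrev BM (Y : Opens X) (q : ℕ) : ModuleCat.{u} 𝒳.Q := 𝒳.BMPair Y Y q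

/-- The map in homology induced by restriction of the index set. -/
noncomputable def mapBMRestrict {W Y : Opens X} (h : W ≤ Y) (q : ℕ) :
    𝒳.BM Y q →ₗ[𝒳.Q] 𝒳.BMPair Y W q :=
  (HomologicalComplex.homologyMap (𝒳.bmRestrict Y h) q).hom

/-- The map in homology induced by the inclusions `(W, W ∖ K) ⊆ (Y, Y ∖ K)`, `K ⊆ W` compact. -/
noncomputable def mapBMExtend {W Y : Opens X} (h : W ≤ Y) (q : ℕ) :
    𝒳.BM W q →ₗ[𝒳.Q] 𝒳.BMPair Y W q :=
  (HomologicalComplex.homologyMap (𝒳.bmExtend h W) q).hom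

/-- The cohomology of the direct limit of the cochain complexes of `(Y, Y ∖ K)`, `K ⊆ W` compact. -/
noncomputable abbrev CcPair (Y W : Opens X) (q : ℕ) : ModuleCat.{u} 𝒳.Q :=
  (𝒳.ccComplex Y W).homology q

/-- The compactly supported tropical intersection cohomology of `Y`. -/
noncomputable abbrev Cc (Y : Opens X) (q : ℕ) : ModuleCat.{u} 𝒳.Q := 𝒳.CcPair Y Y q

/-- The map in cohomology induced by extension of the index set. -/
noncomputable def mapCcExtend {W Y : Opens X} (h : W ≤ Y) (q : ℕ) :
    𝒳.CcPair Y W q →ₗ[𝒳.Q] 𝒳.Cc Y q :=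
  (HomologicalComplex.homologyMap (𝒳.ccExtend Y h) q).hom

/-- The map in cohomology induced by the inclusions `(W, W ∖ K) ⊆ (Y, Y ∖ K)`, `K ⊆ W` compact. -/
noncomputable def mapCcRestrict {W Y : Opens X} (h : W ≤ Y) (q : ℕ) :
    𝒳.CcPair Y W q →ₗ[𝒳.Q] 𝒳.Cc W q :=
  (HomologicalComplex.homologyMap (𝒳.ccRestrict h W) q).hom

end ICData

section LongExact

variable {R : Type} [CommRing R] {A B C : ℕ → Type u}
  [∀ q, AddCommGroup (A q)] [∀ q, AddCommGroup (B q)] [∀ q, AddCommGroup (C q)]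
  [∀ q, Module R (A q)] [∀ q, Module R (B q)] [∀ q, Module R (C q)]

/-- The sequence `⋯ → A_q → B_q → C_q → A_{q-1} → ⋯ → A_0 → B_0 → C_0 → 0` is exact. -/
structure IsLongExactDown (f : ∀ q, A q →ₗ[R] B q) (g : ∀ q, B q →ₗ[R] C q)
    (δ : ∀ q, C (q + 1) →ₗ[R] A q) : Prop where
  exact_fg : ∀ q, Function.Exact (f q) (g q)
  exact_gδ : ∀ q, Function.Exact (g (q + 1)) (δ q)
  exact_δf : ∀ q, Function.Exact (δ q) (f q)
  surjective : Function.Surjective (g 0)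

/-- The sequence `0 → A⁰ → B⁰ → C⁰ → A¹ → ⋯ → A^q → B^q → C^q → A^{q+1} → ⋯` is exact. -/
structure IsLongExactUp (f : ∀ q, A q →ₗ[R] B q) (g : ∀ q, B q →ₗ[R] C q)
    (δ : ∀ q, C q →ₗ[R] A (q + 1)) : Prop where
  injective : Function.Injective (f 0)
  exact_fg : ∀ q, Function.Exact (f q) (g q)
  exact_gδ : ∀ q, Function.Exact (g q) (δ q)
  exact_δf : ∀ q, Function.Exact (δ q) (f (q + 1))

end LongExact

/-! A commutative square of complexes P → R₁, R₂ → S yields a long exact Mayer–Vietoris sequence as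
soon as its iterated mapping cone is acyclic; the complexes P, R₁ ⊕ R₂, S need not form a short
exact sequence. All claims are of this kind, excision being the case in which two adjacent corners
of the square vanish. Forgetting the grading, the cone is a single module with differential `totD`;
`Exact` says that its cycles are boundaries, `Acyclic` says so for bounded cycles, and
`Acyclic.exists_delta` extracts the connecting homomorphism.

The geometric input is the square of IC(U ∩ V), IC(U), IC(V) and IC(U ∪ V). It is a pullback, so its
exactness (`icSquare_exact`) comes down to a theorem on small chains, `mem_sup_of_mem_relCycles`.
Barycentric subdivision and its homotopy to the identity preserve allowability, and iterated
subdivision makes simplices small. The difficulty is that a piece of an intersection chain is in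
general not an intersection chain: non-allowable faces that cancel in the boundary of the whole may
survive in the boundary of the piece. The vertices of the subdivision are therefore ordered with the
barycenter of the whole simplex first. For a simplex in the subdivision of an allowable simplex, the
face opposite to the last vertex is then allowable on its own, and all other faces have the same
last vertex. Cutting a subdivided chain according to the position of the last vertices consequently
loses no cancellation that matters (`bdry_lastIn_mem`).

Everything else follows from stability properties of exactness. Quotients give pairs
(`relSquare_exact`). Duals are acyclic because the relative chains embed into a projective module
and submodules of projective modules over a Dedekind domain are projective (`Acyclic.dual`). Inverse
limits of sequences with surjective transition maps are treated by a Mittag-Leffler argument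
(`Exact.of_isSeqLimit`), directed colimits by choosing representatives (`Acyclic.of_isDirLimit`).
For K ⊆ U and L ⊆ V compact, the squares of the pairs with K ∪ L, K, L, K ∩ L removed from a fixed
ambient space give the last two sequences in the limit, and excision identifies their terms with
groups of the open subsets themselves. -/

section Homology

open CategoryTheory

variable {R : Type} [CommRing R] {c : ComplexShape ℕ}

/-! ### Ungraded families of elements and homology classes -/

namespace HomologicalComplex

variable (C : HomologicalComplex (ModuleCat.{u} R) c)

/-- Families of elements of a complex, one in each degree. -/
abbrev Family : Type u := ∀ q, C.X q

/-- The differential on families of elements of a complex. -/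
noncomputable def familyD : C.Family →ₗ[R] C.Family :=
  LinearMap.pi fun j => (C.d (c.prev j) j).hom ∘ₗ LinearMap.proj (c.prev j)

variable {C}

lemma familyD_of_rel {i j : ℕ} (h : c.Rel i j) (x : C.Family) :
    C.familyD x j = C.d i j (x i) := by
  obtain rfl := c.prev_eq' h
  rfl

lemma familyD_of_not_rel {j : ℕ} (h : ∀ i, ¬ c.Rel i j) (x : C.Family) : C.familyD x j = 0 := by
  change C.d (c.prev j) j (x _) = 0
  -- Without a predecessor `c.prev j` is the default value `j`, and the differential between
  -- unrelated degrees is zero.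
  rw [C.shape _ _ (h _)]
  rfl

lemma d_d_apply (i j k : ℕ) (x : C.X i) : C.d j k (C.d i j x) = 0 := by
  rw [← ConcreteCategory.comp_apply, C.d_comp_d]
  rfl

lemma familyD_familyD (x : C.Family) : C.familyD (C.familyD x) = 0 :=
  funext fun j => by
    change C.d (c.prev j) j (C.d _ _ (x _)) = 0
    exact d_d_apply _ _ _ _

lemma familyD_single {i j : ℕ} (h : c.Rel i j) (x : C.X i) :
    C.familyD (Pi.single i x) = Pi.single j (C.d i j x) := by
  funext k
  by_cases hk : ∃ l, c.Rel l k
  · obtain ⟨l, hl⟩ := hk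
    rw [familyD_of_rel hl]
    by_cases hli : l = i
    · subst hli
      obtain rfl := c.next_eq hl h
      simp
    · have hkj : k ≠ j := by
        rintro rfl
        exact hli (c.prev_eq hl h)
      simp [Pi.single_eq_of_ne hli, Pi.single_eq_of_ne hkj]
  · push Not at hk
    rw [familyD_of_not_rel hk, Pi.single_eq_of_ne]
    rintro rfl
    exact hk _ h

lemma familyD_single_of_not_rel {i : ℕ} (h : ∀ j, ¬ c.Rel i j) (x : C.X i) :
    C.familyD (Pi.single i x) = 0 := by
  funext k
  by_cases hk : ∃ l, c.Rel l k
  · obtain ⟨l, hl⟩ := hk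
    have hli : l ≠ i := by
      rintro rfl
      exact h _ hl
    rw [familyD_of_rel hl, Pi.single_eq_of_ne hli, map_zero]
    rfl
  · push Not at hk
    exact familyD_of_not_rel hk _

/-- The map of families of elements induced by a map of complexes. -/
noncomputable def familyMap {C' : HomologicalComplex (ModuleCat.{u} R) c} (f : C ⟶ C') :
    C.Family →ₗ[R] C'.Family :=
  LinearMap.pi fun j => (f.f j).hom ∘ₗ LinearMap.proj j

section

variable {C' : HomologicalComplex (ModuleCat.{u} R) c} (f : C ⟶ C')

lemma familyMap_apply (x : C.Family) (j : ℕ) : familyMap f x j = f.f j (x j) := rfl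

lemma comm_apply (i j : ℕ) (x : C.X i) : C'.d i j (f.f i x) = f.f j (C.d i j x) := by
  rw [← ConcreteCategory.comp_apply, ← ConcreteCategory.comp_apply, f.comm]

lemma familyD_familyMap (x : C.Family) : C'.familyD (familyMap f x) = familyMap f (C.familyD x) :=
  funext fun _ => comm_apply f _ _ _

lemma familyMap_single (j : ℕ) (x : C.X j) :
    familyMap f (Pi.single j x) = Pi.single j (f.f j x) := by
  funext k
  rw [familyMap_apply]
  exact (Pi.apply_single (fun k => (f.f k).hom) (fun _ => map_zero _) j x k)

end

variable (C)

/-- The cycles of a complex of modules in a given degree. -/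
noncomputable abbrev cyclesSubmodule (q : ℕ) : Submodule R (C.X q) := LinearMap.ker (C.d q (c.next q)).hom

/-- The elements of the kernel of the differential as elements of the object of cycles. -/
noncomputable def cycleOfMem (q : ℕ) : C.cyclesSubmodule q →ₗ[R] C.cycles q :=
  (C.liftCycles (ModuleCat.ofHom (C.cyclesSubmodule q).subtype) _ rfl (by ext x; exact x.2)).hom

lemma iCycles_cycleOfMem {q : ℕ} (x : C.cyclesSubmodule q) : C.iCycles q (C.cycleOfMem q x) = x :=
  LinearMap.congr_fun (congrArg ModuleCat.Hom.hom (C.liftCycles_i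
    (ModuleCat.ofHom (C.cyclesSubmodule q).subtype) _ rfl (by ext x; exact x.2))) x

/-- The homology class of a cycle. -/
noncomputable def homologyClass (q : ℕ) : C.cyclesSubmodule q →ₗ[R] C.homology q :=
  (C.homologyπ q).hom ∘ₗ C.cycleOfMem q

variable {C}

/-- This translates between homogeneous cycles and cycles of the ungraded module of families. In a
degree without successor both sides hold automatically. -/
lemma mem_cyclesSubmodule_iff {q : ℕ} {x : C.X q} :
    x ∈ C.cyclesSubmodule q ↔ C.familyD (Pi.single q x) = 0 := by
  rw [LinearMap.mem_ker]
  by_cases h : ∃ j, c.Rel q j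
  · obtain ⟨j, hj⟩ := h
    obtain rfl := c.next_eq' hj
    rw [familyD_single hj, Pi.single_eq_zero_iff]
  · push Not at h
    simp [familyD_single_of_not_rel h, C.shape _ _ (h _)]

lemma mem_cyclesSubmodule_of_familyD {x : C.Family} (hx : C.familyD x = 0) (q : ℕ) :
    x q ∈ C.cyclesSubmodule q := by
  rw [LinearMap.mem_ker]
  by_cases h : ∃ j, c.Rel q j
  · obtain ⟨j, hj⟩ := h
    obtain rfl := c.next_eq' hj
    have := congrFun hx (c.next q)
    rwa [familyD_of_rel hj] at this
  · push Not at h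
    simp [C.shape _ _ (h _)]

lemma homologyClass_surjective (q : ℕ) : Function.Surjective (C.homologyClass q) := by
  intro a
  have he : Function.Surjective (C.homologyπ q) := (ModuleCat.epi_iff_surjective _).1 inferInstance
  have hi : Function.Injective (C.iCycles q) := (ModuleCat.mono_iff_injective _).1 inferInstance
  obtain ⟨z, rfl⟩ := he a
  have hz : C.iCycles q z ∈ C.cyclesSubmodule q := by
    rw [LinearMap.mem_ker]
    change (C.iCycles q ≫ C.d q (c.next q)) z = 0
    rw [C.iCycles_d]
    rfl
  refine ⟨⟨_, hz⟩, ?_⟩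
  exact congrArg (C.homologyπ q) (hi (C.iCycles_cycleOfMem ⟨_, hz⟩))

lemma homologyClass_eq_zero_iff' {q : ℕ} (x : C.cyclesSubmodule q) :
    C.homologyClass q x = 0 ↔ ∃ y, (x : C.X q) = C.d (c.prev q) q y := by
  have hi : Function.Injective (C.iCycles q) := (ModuleCat.mono_iff_injective _).1 inferInstance
  have hex : (ShortComplex.mk (C.toCycles (c.prev q) q) (C.homologyπ q)
      (C.toCycles_comp_homologyπ _ _)).Exact :=
    ShortComplex.exact_of_g_is_cokernel _ (C.homologyIsCokernel _ _ rfl)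
  rw [ShortComplex.moduleCat_exact_iff] at hex
  set z := C.cycleOfMem q x with hz
  have hzi : C.iCycles q z = x := C.iCycles_cycleOfMem x
  have h0 : C.homologyClass q x = C.homologyπ q z := rfl
  rw [h0]
  constructor
  · intro h
    obtain ⟨y, hy⟩ := hex z h
    refine ⟨y, ?_⟩
    rw [← hzi, ← C.toCycles_i, ConcreteCategory.comp_apply]
    exact congrArg _ hy.symm
  · rintro ⟨y, hy⟩
    have : z = C.toCycles (c.prev q) q y := by
      apply hi
      rw [hzi, hy, ← ConcreteCategory.comp_apply, C.toCycles_i]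
    rw [this, ← ConcreteCategory.comp_apply, C.toCycles_comp_homologyπ]
    rfl

/-- A family with finitely many nonzero members. -/
def IsBdd (x : C.Family) : Prop := ∃ N, ∀ q ≥ N, x q = 0

lemma isBdd_zero : IsBdd (0 : C.Family) := ⟨0, fun _ _ => rfl⟩

lemma isBdd_single (q : ℕ) (x : C.X q) : IsBdd (Pi.single q x : C.Family) :=
  ⟨q + 1, fun _ hk => Pi.single_eq_of_ne (by omega) _⟩

lemma IsBdd.neg {x : C.Family} (hx : IsBdd x) : IsBdd (-x) := by
  obtain ⟨N, hN⟩ := hx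
  exact ⟨N, fun q hq => by rw [Pi.neg_apply, hN q hq, neg_zero]⟩

/-- The primitive can be concentrated in one degree, hence is bounded, so that acyclicity, which
concerns bounded families only, applies to quadruples containing it. -/
lemma exists_familyD_of_homologyClass_eq_zero {q : ℕ} {x : C.cyclesSubmodule q}
    (h : C.homologyClass q x = 0) :
    ∃ y : C.Family, IsBdd y ∧ C.familyD y = Pi.single q (x : C.X q) := by
  obtain ⟨y, hy⟩ := (homologyClass_eq_zero_iff' x).1 h
  by_cases hq : ∃ i, c.Rel i q
  · obtain ⟨i, hi⟩ := hq
    obtain rfl := c.prev_eq' hi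
    exact ⟨Pi.single _ y, isBdd_single _ _, by rw [familyD_single hi, hy]⟩
  · push Not at hq
    refine ⟨0, isBdd_zero, ?_⟩
    rw [hy, C.shape _ _ (hq _), map_zero]
    exact (Pi.single_zero q).symm

lemma homologyClass_eq_zero_of_familyD {q : ℕ} {x : C.cyclesSubmodule q} {y : C.Family}
    (h : C.familyD y q = x) : C.homologyClass q x = 0 :=
  (homologyClass_eq_zero_iff' x).2 ⟨y _, h.symm⟩

lemma map_mem_cyclesSubmodule {C' : HomologicalComplex (ModuleCat.{u} R) c} (f : C ⟶ C') {q : ℕ}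
    {x : C.X q} (hx : x ∈ C.cyclesSubmodule q) : f.f q x ∈ C'.cyclesSubmodule q := by
  rw [LinearMap.mem_ker] at hx ⊢
  change C'.d _ _ (f.f q x) = 0
  rw [comm_apply]
  exact (congrArg _ hx).trans (map_zero _)

lemma homologyMap_homologyClass {C' : HomologicalComplex (ModuleCat.{u} R) c} (f : C ⟶ C') {q : ℕ}
    (x : C.cyclesSubmodule q) :
    (homologyMap f q).hom (C.homologyClass q x) =
      C'.homologyClass q ⟨f.f q x, map_mem_cyclesSubmodule f x.2⟩ := by
  have hi : Function.Injective (C'.iCycles q) := (ModuleCat.mono_iff_injective _).1 inferInstance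
  change homologyMap f q (C.homologyπ q (C.cycleOfMem q x)) = C'.homologyπ q _
  rw [← ConcreteCategory.comp_apply, homologyπ_naturality, ConcreteCategory.comp_apply]
  congr 1
  apply hi
  rw [← ConcreteCategory.comp_apply, cyclesMap_i, ConcreteCategory.comp_apply,
    iCycles_cycleOfMem, iCycles_cycleOfMem]

end HomologicalComplex

/-! ### Acyclic squares of complexes and their long exact sequences -/

open HomologicalComplex

/-- A commutative square of complexes of modules. -/
structure ComplexSquare (R : Type) [CommRing R] (c : ComplexShape ℕ) where
  (P R₁ R₂ S : HomologicalComplex (ModuleCat.{u} R) c)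
  (f₁ : P ⟶ R₁) (f₂ : P ⟶ R₂) (g₁ : R₁ ⟶ S) (g₂ : R₂ ⟶ S)
  comm : f₁ ≫ g₁ = f₂ ≫ g₂

namespace ComplexSquare

variable (Sq : ComplexSquare.{u} R c)

lemma comm_apply (q : ℕ) (x : Sq.P.X q) :
    Sq.g₁.f q (Sq.f₁.f q x) = Sq.g₂.f q (Sq.f₂.f q x) := by
  rw [← ConcreteCategory.comp_apply, ← ConcreteCategory.comp_apply, ← HomologicalComplex.comp_f,
    ← HomologicalComplex.comp_f, Sq.comm]

lemma familyMap_comm (x : Sq.P.Family) :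
    familyMap Sq.g₁ (familyMap Sq.f₁ x) = familyMap Sq.g₂ (familyMap Sq.f₂ x) :=
  funext fun q => Sq.comm_apply q _

/-- The total object of a square: quadruples of families. -/
abbrev Tot : Type u := Sq.P.Family × Sq.R₁.Family × Sq.R₂.Family × Sq.S.Family

/-- The differential of the total object of a square. -/
noncomputable def totD : Sq.Tot →ₗ[R] Sq.Tot where
  -- This is the differential of the iterated mapping cone. The signs on `f₂` and on the
  -- differentials of the middle terms make it square to zero, and they produce the sign in `homF`.
  toFun t := (Sq.P.familyD t.1, familyMap Sq.f₁ t.1 - Sq.R₁.familyD t.2.1,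
    -familyMap Sq.f₂ t.1 - Sq.R₂.familyD t.2.2.1,
    familyMap Sq.g₁ t.2.1 + familyMap Sq.g₂ t.2.2.1 + Sq.S.familyD t.2.2.2)
  map_add' s t := by
    simp only [Prod.fst_add, Prod.snd_add, map_add, Prod.mk_add_mk, Prod.mk.injEq]
    refine ⟨trivial, ?_, ?_, ?_⟩ <;> abel
  map_smul' a t := by
    simp only [Prod.smul_fst, Prod.smul_snd, map_smul, RingHom.id_apply, Prod.smul_mk, smul_sub,
      smul_add, smul_neg]

lemma totD_totD (t : Sq.Tot) : Sq.totD (Sq.totD t) = 0 := by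
  simp only [totD, LinearMap.coe_mk, AddHom.coe_mk, familyD_familyD, familyD_familyMap, map_sub,
    map_add, map_neg, familyMap_comm, Prod.mk_eq_zero]
  refine ⟨trivial, ?_, ?_, ?_⟩ <;> abel

/-- Boundedness of a quadruple of families. -/
def TotBdd (t : Sq.Tot) : Prop := IsBdd t.1 ∧ IsBdd t.2.1 ∧ IsBdd t.2.2.1 ∧ IsBdd t.2.2.2

/-- A square is acyclic if every bounded cycle of its total object is a boundary. -/
def Acyclic : Prop := ∀ t : Sq.Tot, Sq.TotBdd t → Sq.totD t = 0 → ∃ t', Sq.totD t' = t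

/-- The map from the corner to the two middle terms. -/
noncomputable def homF (q : ℕ) : Sq.P.homology q →ₗ[R] Sq.R₁.homology q × Sq.R₂.homology q :=
  LinearMap.prod (homologyMap Sq.f₁ q).hom (-(homologyMap Sq.f₂ q).hom)

/-- The map from the two middle terms to the opposite corner. -/
noncomputable def homG (q : ℕ) : Sq.R₁.homology q × Sq.R₂.homology q →ₗ[R] Sq.S.homology q :=
  LinearMap.coprod (homologyMap Sq.g₁ q).hom (homologyMap Sq.g₂ q).hom

variable {Sq}

lemma homF_class {q : ℕ} (x : Sq.P.cyclesSubmodule q) : Sq.homF q (Sq.P.homologyClass q x) =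
    (Sq.R₁.homologyClass q ⟨Sq.f₁.f q x, map_mem_cyclesSubmodule _ x.2⟩,
      -Sq.R₂.homologyClass q ⟨Sq.f₂.f q x, map_mem_cyclesSubmodule _ x.2⟩) := by
  rw [← homologyMap_homologyClass, ← homologyMap_homologyClass]
  rfl

lemma homG_class {q : ℕ} (x : Sq.R₁.cyclesSubmodule q) (y : Sq.R₂.cyclesSubmodule q) :
    Sq.homG q (Sq.R₁.homologyClass q x, Sq.R₂.homologyClass q y) =
    Sq.S.homologyClass q ⟨Sq.g₁.f q x + Sq.g₂.f q y,
      add_mem (map_mem_cyclesSubmodule _ x.2) (map_mem_cyclesSubmodule _ y.2)⟩ := by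
  change (homologyMap Sq.g₁ q).hom (Sq.R₁.homologyClass q x) +
    (homologyMap Sq.g₂ q).hom (Sq.R₂.homologyClass q y) = _
  rw [homologyMap_homologyClass, homologyMap_homologyClass, ← map_add]
  rfl

lemma homologyClass_eq_of_sub {C : HomologicalComplex (ModuleCat.{u} R) c} {q : ℕ}
    {x y : C.cyclesSubmodule q} {w : C.Family} (h : (x : C.X q) - y = C.familyD w q) :
    C.homologyClass q x = C.homologyClass q y := by
  rw [← sub_eq_zero, ← map_sub]
  exact homologyClass_eq_zero_of_familyD h.symm

lemma homG_homF (q : ℕ) (a : Sq.P.homology q) : Sq.homG q (Sq.homF q a) = 0 := by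
  obtain ⟨x, rfl⟩ := homologyClass_surjective q a
  rw [homF_class, ← map_neg, homG_class, ← map_zero (Sq.S.homologyClass q)]
  congr 1
  ext
  change Sq.g₁.f q (Sq.f₁.f q x) + Sq.g₂.f q (-Sq.f₂.f q x) = 0
  rw [map_neg, comm_apply, add_neg_cancel]

/-- If g₁x + g₂y = dw, then (0, x, y, -w) is a cycle of the total object. The corner component p of
a primitive is a cycle with f₁p homologous to x and -f₂p homologous to y. -/
lemma Acyclic.exact_homF_homG (h : Sq.Acyclic) (q : ℕ) :
    Function.Exact (Sq.homF q) (Sq.homG q) := by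
  rintro ⟨a, b⟩
  constructor
  · obtain ⟨x, rfl⟩ := homologyClass_surjective q a
    obtain ⟨y, rfl⟩ := homologyClass_surjective q b
    rw [homG_class]
    intro h0
    obtain ⟨w, hw, hwD⟩ := exists_familyD_of_homologyClass_eq_zero h0
    obtain ⟨⟨p, r₁, r₂, s⟩, ht⟩ := h (0, Pi.single q x, Pi.single q y, -w)
      ⟨isBdd_zero, isBdd_single _ _, isBdd_single _ _, hw.neg⟩ (by
        simp only [totD, LinearMap.coe_mk, AddHom.coe_mk, map_zero, map_neg, hwD, familyMap_single,
          mem_cyclesSubmodule_iff.1 x.2, mem_cyclesSubmodule_iff.1 y.2, Prod.mk_eq_zero]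
        refine ⟨trivial, by simp, by simp, ?_⟩
        rw [← Pi.single_add]
        exact add_neg_cancel _)
    simp only [totD, LinearMap.coe_mk, AddHom.coe_mk, Prod.mk.injEq] at ht
    obtain ⟨h1, h2, h3, -⟩ := ht
    refine ⟨Sq.P.homologyClass q ⟨p q, mem_cyclesSubmodule_of_familyD h1 q⟩, ?_⟩
    rw [homF_class, ← map_neg, Prod.mk.injEq]
    constructor
    · refine homologyClass_eq_of_sub (w := r₁) ?_
      have := congrFun h2 q
      rw [Pi.single_eq_same] at this
      rw [← this]
      exact sub_sub_cancel _ _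
    · refine homologyClass_eq_of_sub (w := r₂) ?_
      have := congrFun h3 q
      rw [Pi.single_eq_same] at this
      rw [← this]
      exact sub_sub_cancel _ _
  · rintro ⟨d, hd⟩
    rw [← hd, homG_homF]

variable (Sq) in
/-- The graph of the connecting homomorphism. -/
def deltaGraph (i j : ℕ) : Submodule R (Sq.S.homology i × Sq.P.homology j) where
  carrier := {ab | ∃ (s : Sq.S.cyclesSubmodule i) (p : Sq.P.cyclesSubmodule j) (r₁ : Sq.R₁.X i)
    (r₂ : Sq.R₂.X i), ab = (Sq.S.homologyClass i s, Sq.P.homologyClass j p) ∧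
    Sq.R₁.d i j r₁ = Sq.f₁.f j p ∧ Sq.R₂.d i j r₂ = -Sq.f₂.f j p ∧
    (s : Sq.S.X i) = Sq.g₁.f i r₁ + Sq.g₂.f i r₂}
  add_mem' := by
    rintro _ _ ⟨s, p, r₁, r₂, rfl, h1, h2, h3⟩ ⟨s', p', r₁', r₂', rfl, h1', h2', h3'⟩
    refine ⟨s + s', p + p', r₁ + r₁', r₂ + r₂', by simp, ?_, ?_, ?_⟩
    · simp [h1, h1']
    · simp only [map_add, h2, h2', Submodule.coe_add, neg_add_rev]; abel
    · simp only [map_add, h3, h3', Submodule.coe_add]; abel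
  zero_mem' := ⟨0, 0, 0, 0, by simp; rfl, by simp, by simp, by simp⟩
  smul_mem' := by
    rintro a _ ⟨s, p, r₁, r₂, rfl, h1, h2, h3⟩
    exact ⟨a • s, a • p, a • r₁, a • r₂, by simp, by simp [h1], by simp [h2], by simp [h3]⟩

/-- A primitive of (0, 0, 0, s) is precisely the zig-zag of the snake lemma: it replaces s by a
homologous g₁r₁ + g₂r₂, and the cycle p which r₁ and r₂ determine represents the image of s under
the connecting homomorphism. -/
lemma Acyclic.exists_class (h : Sq.Acyclic) {i : ℕ} (s : Sq.S.cyclesSubmodule i) :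
    ∃ (p : Sq.P.Family) (r₁ : Sq.R₁.Family) (r₂ : Sq.R₂.Family) (w : Sq.S.Family),
      Sq.P.familyD p = 0 ∧ Sq.R₁.familyD r₁ = familyMap Sq.f₁ p ∧
      Sq.R₂.familyD r₂ = -familyMap Sq.f₂ p ∧
      (s : Sq.S.X i) - (Sq.g₁.f i (r₁ i) + Sq.g₂.f i (r₂ i)) = Sq.S.familyD w i := by
  obtain ⟨⟨p, r₁, r₂, w⟩, ht⟩ := h (0, 0, 0, Pi.single i s)
    ⟨isBdd_zero, isBdd_zero, isBdd_zero, isBdd_single _ _⟩ (by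
      simp [totD, mem_cyclesSubmodule_iff.1 s.2])
  simp only [totD, LinearMap.coe_mk, AddHom.coe_mk, Prod.mk.injEq] at ht
  obtain ⟨h1, h2, h3, h4⟩ := ht
  refine ⟨p, r₁, r₂, w, h1, (sub_eq_zero.1 h2).symm, (sub_eq_zero.1 h3).symm, ?_⟩
  have := congrFun h4 i
  rw [Pi.single_eq_same] at this
  rw [← this]
  exact add_sub_cancel_left _ _

/-- The zig-zags form a linear relation `deltaGraph` between the two homology modules. Acyclicity
makes it the graph of a map, which is therefore linear without any choice: existence of values is
`Acyclic.exists_class`, uniqueness is one more application of acyclicity. The two exactness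
statements are then manipulations of zig-zags. -/
lemma Acyclic.exists_delta (h : Sq.Acyclic) {i j : ℕ} (hij : c.Rel i j) :
    ∃ δ : Sq.S.homology i →ₗ[R] Sq.P.homology j,
      Function.Exact (Sq.homG i) δ ∧ Function.Exact δ (Sq.homF j) := by
  have hinj : Function.Bijective (LinearMap.fst R _ _ ∘ₗ (Sq.deltaGraph i j).subtype) := by
    constructor
    · rw [← LinearMap.ker_eq_bot, LinearMap.ker_eq_bot']
      rintro ⟨_, s, p, r₁, r₂, rfl, h1, h2, h3⟩ h0
      change Sq.S.homologyClass i s = 0 at h0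
      obtain ⟨w, hw, hwD⟩ := exists_familyD_of_homologyClass_eq_zero h0
      -- The zig-zag equations and s = dw say that this quadruple is a total cycle; the first
      -- component of a primitive bounds `p`.
      obtain ⟨⟨p', r₁', r₂', s'⟩, ht⟩ := h (Pi.single j p, Pi.single i r₁, Pi.single i r₂, -w)
        ⟨isBdd_single _ _, isBdd_single _ _, isBdd_single _ _, hw.neg⟩ (by
          simp only [totD, LinearMap.coe_mk, AddHom.coe_mk, map_neg, hwD, familyMap_single,
            mem_cyclesSubmodule_iff.1 p.2, familyD_single hij, h1, h2, h3, Prod.mk_eq_zero,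
            ← Pi.single_add, ← Pi.single_neg, sub_self, add_neg_cancel, Pi.single_zero, and_self])
      simp only [totD, LinearMap.coe_mk, AddHom.coe_mk, Prod.mk.injEq] at ht
      have hp : Sq.P.homologyClass j p = 0 := by
        refine homologyClass_eq_zero_of_familyD (y := p') ?_
        rw [ht.1, Pi.single_eq_same]
      ext <;> simp [h0, hp]
    · intro a
      obtain ⟨s, rfl⟩ := homologyClass_surjective i a
      obtain ⟨p, r₁, r₂, w, h1, h2, h3, h4⟩ := h.exists_class s
      have hj1 : Sq.R₁.d i j (r₁ i) = Sq.f₁.f j (p j) := by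
        rw [← familyD_of_rel hij, h2]; rfl
      have hj2 : Sq.R₂.d i j (r₂ i) = -Sq.f₂.f j (p j) := by
        rw [← familyD_of_rel hij, h3]; rfl
      have hs : Sq.g₁.f i (r₁ i) + Sq.g₂.f i (r₂ i) ∈ Sq.S.cyclesSubmodule i := by
        rw [LinearMap.mem_ker]
        obtain rfl := c.next_eq' hij
        change Sq.S.d _ _ _ = 0
        rw [map_add, HomologicalComplex.comm_apply, HomologicalComplex.comm_apply, hj1, hj2,
          map_neg, Sq.comm_apply, add_neg_cancel]
      refine ⟨⟨_, ⟨_, hs⟩, ⟨p j, mem_cyclesSubmodule_of_familyD h1 j⟩, r₁ i, r₂ i, rfl, hj1, hj2,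
        rfl⟩, ?_⟩
      exact (homologyClass_eq_of_sub h4).symm
  let e := LinearEquiv.ofBijective _ hinj
  let δ := LinearMap.snd R _ _ ∘ₗ (Sq.deltaGraph i j).subtype ∘ₗ e.symm.toLinearMap
  have hδ : ∀ a b, δ a = b ↔ (a, b) ∈ Sq.deltaGraph i j := by
    intro a b
    constructor
    · rintro rfl
      have h1 : (e.symm a).1.1 = a := e.apply_symm_apply a
      have h2 : (a, δ a) = (e.symm a).1 := Prod.ext h1.symm rfl
      rw [h2]
      exact (e.symm a).2
    · intro hab
      have : e.symm a = ⟨(a, b), hab⟩ := by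
        rw [LinearEquiv.symm_apply_eq]
        rfl
      change (e.symm a).1.2 = b
      rw [this]
  refine ⟨δ, fun a => ?_, fun b => ?_⟩
  · rw [hδ]
    constructor
    · rintro ⟨s, p, r₁, r₂, hab, h1, h2, h3⟩
      obtain ⟨rfl, hb⟩ := Prod.mk.inj hab
      obtain ⟨w, -, hwD⟩ := exists_familyD_of_homologyClass_eq_zero hb.symm
      have hw : Sq.P.d i j (w i) = p := by
        rw [← familyD_of_rel hij, hwD, Pi.single_eq_same]
      obtain rfl := c.next_eq' hij
      -- Since p = dw, these corrections turn `r₁` and `r₂` into cycles, and they cancel in g₁r₁ +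
      -- g₂r₂.
      have hx : r₁ - Sq.f₁.f i (w i) ∈ Sq.R₁.cyclesSubmodule i := by
        rw [LinearMap.mem_ker]
        change Sq.R₁.d _ _ _ = 0
        rw [map_sub, HomologicalComplex.comm_apply, hw, h1, sub_self]
      have hy : r₂ + Sq.f₂.f i (w i) ∈ Sq.R₂.cyclesSubmodule i := by
        rw [LinearMap.mem_ker]
        change Sq.R₂.d _ _ _ = 0
        rw [map_add, HomologicalComplex.comm_apply, hw, h2, neg_add_cancel]
      refine ⟨(Sq.R₁.homologyClass i ⟨_, hx⟩, Sq.R₂.homologyClass i ⟨_, hy⟩), ?_⟩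
      rw [homG_class]
      congr 1
      ext
      change Sq.g₁.f i (r₁ - _) + Sq.g₂.f i (r₂ + _) = s
      rw [h3, map_sub, map_add, comm_apply]
      abel
    · rintro ⟨⟨x, y⟩, rfl⟩
      obtain ⟨x, rfl⟩ := homologyClass_surjective i x
      obtain ⟨y, rfl⟩ := homologyClass_surjective i y
      obtain rfl := c.next_eq' hij
      refine ⟨⟨_, add_mem (map_mem_cyclesSubmodule _ x.2) (map_mem_cyclesSubmodule _ y.2)⟩, 0, x, y,
        by rw [homG_class, map_zero], ?_, ?_, rfl⟩
      · have := x.2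
        rw [LinearMap.mem_ker] at this
        rw [Submodule.coe_zero, map_zero]
        exact this
      · have := y.2
        rw [LinearMap.mem_ker] at this
        rw [Submodule.coe_zero, map_zero, neg_zero]
        exact this
  · constructor
    · obtain ⟨p, rfl⟩ := homologyClass_surjective j b
      intro h0
      rw [homF_class, Prod.mk_eq_zero, neg_eq_zero] at h0
      obtain ⟨w₁, -, h1⟩ := exists_familyD_of_homologyClass_eq_zero h0.1
      obtain ⟨w₂, -, h2⟩ := exists_familyD_of_homologyClass_eq_zero h0.2
      have h1' : Sq.R₁.d i j (w₁ i) = Sq.f₁.f j p := by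
        rw [← familyD_of_rel hij, h1, Pi.single_eq_same]
      have h2' : Sq.R₂.d i j (-w₂ i) = -Sq.f₂.f j p := by
        rw [map_neg, ← familyD_of_rel hij, h2, Pi.single_eq_same]
      -- A primitive of f₁p and the negative of a primitive of f₂p complete `p` to a zig-zag.
      have hs : Sq.g₁.f i (w₁ i) + Sq.g₂.f i (-w₂ i) ∈ Sq.S.cyclesSubmodule i := by
        rw [LinearMap.mem_ker]
        obtain rfl := c.next_eq' hij
        change Sq.S.d _ _ _ = 0
        rw [map_add, HomologicalComplex.comm_apply, HomologicalComplex.comm_apply, h1', h2',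
          map_neg, Sq.comm_apply, add_neg_cancel]
      exact ⟨Sq.S.homologyClass i ⟨_, hs⟩, (hδ _ _).2 ⟨_, p, _, _, rfl, h1', h2', rfl⟩⟩
    · rintro ⟨a, ha⟩
      obtain ⟨s, p, r₁, r₂, hab, h1, h2, h3⟩ := (hδ _ _).1 ha
      obtain ⟨rfl, rfl⟩ := Prod.mk.inj hab
      rw [homF_class, Prod.mk_eq_zero, neg_eq_zero]
      constructor
      · exact homologyClass_eq_zero_of_familyD (y := Pi.single i r₁) (by
          rw [familyD_single hij, Pi.single_eq_same, h1])
      · exact homologyClass_eq_zero_of_familyD (y := -Pi.single i r₂) (by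
          rw [map_neg, familyD_single hij, Pi.neg_apply, Pi.single_eq_same, h2, neg_neg])

/-- In a degree without outgoing differential the middle terms of a zig-zag are cycles already, so
they have homology classes. -/
lemma Acyclic.surjective_homG (h : Sq.Acyclic) {i : ℕ} (hi : ∀ j, ¬ c.Rel i j) :
    Function.Surjective (Sq.homG i) := by
  intro a
  obtain ⟨s, rfl⟩ := homologyClass_surjective i a
  obtain ⟨p, r₁, r₂, w, -, -, -, h4⟩ := h.exists_class s
  have hc : ∀ (C : HomologicalComplex (ModuleCat.{u} R) c) (x : C.X i),
      x ∈ C.cyclesSubmodule i := by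
    intro C x
    rw [LinearMap.mem_ker, C.shape _ _ (hi _)]
    rfl
  refine ⟨(Sq.R₁.homologyClass i ⟨r₁ i, hc _ _⟩, Sq.R₂.homologyClass i ⟨r₂ i, hc _ _⟩), ?_⟩
  rw [homG_class]
  exact (homologyClass_eq_of_sub h4).symm

/-- In a degree without incoming differential a class vanishes only if its representative does.
Hence f₁p = f₂p = 0 on the nose, and (p, 0, 0, 0) is a total cycle. -/
lemma Acyclic.injective_homF (h : Sq.Acyclic) {j : ℕ} (hj : ∀ i, ¬ c.Rel i j) :
    Function.Injective (Sq.homF j) := by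
  rw [← LinearMap.ker_eq_bot, LinearMap.ker_eq_bot']
  intro b hb
  obtain ⟨p, rfl⟩ := homologyClass_surjective j b
  rw [homF_class, Prod.mk_eq_zero, neg_eq_zero] at hb
  obtain ⟨w₁, -, h1⟩ := exists_familyD_of_homologyClass_eq_zero hb.1
  obtain ⟨w₂, -, h2⟩ := exists_familyD_of_homologyClass_eq_zero hb.2
  have h1' := congrFun h1 j
  have h2' := congrFun h2 j
  rw [familyD_of_not_rel hj, Pi.single_eq_same] at h1' h2'
  dsimp only at h1' h2'
  obtain ⟨⟨p', r₁', r₂', s'⟩, ht⟩ := h (Pi.single j p, 0, 0, 0)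
    ⟨isBdd_single _ _, isBdd_zero, isBdd_zero, isBdd_zero⟩ (by
      simp only [totD, LinearMap.coe_mk, AddHom.coe_mk, map_zero, familyMap_single,
        mem_cyclesSubmodule_iff.1 p.2, ← h1', ← h2', Pi.single_zero, neg_zero, sub_zero, add_zero,
        Prod.mk_eq_zero, and_self])
  simp only [totD, LinearMap.coe_mk, AddHom.coe_mk, Prod.mk.injEq] at ht
  refine homologyClass_eq_zero_of_familyD (y := p') ?_
  rw [ht.1, Pi.single_eq_same]

lemma Acyclic.exists_isLongExactDown {Sq : ComplexSquare.{u} R (ComplexShape.down ℕ)}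
    (h : Sq.Acyclic) : ∃ δ, IsLongExactDown Sq.homF Sq.homG δ := by
  choose δ hδ using fun q : ℕ => h.exists_delta (i := q + 1) (j := q) rfl
  exact ⟨δ, h.exact_homF_homG, fun q => (hδ q).1, fun q => (hδ q).2,
    h.surjective_homG fun j hj => by simp at hj⟩

lemma Acyclic.exists_isLongExactUp {Sq : ComplexSquare.{u} R (ComplexShape.up ℕ)}
    (h : Sq.Acyclic) : ∃ δ, IsLongExactUp Sq.homF Sq.homG δ := by
  choose δ hδ using fun q : ℕ => h.exists_delta (i := q) (j := q + 1) rfl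
  exact ⟨δ, h.injective_homF fun j hj => by simp at hj, h.exact_homF_homG, fun q => (hδ q).1,
    fun q => (hδ q).2⟩

/-- If the source of one side of an acyclic square and its target vanish, then the opposite side
induces isomorphisms in homology. -/
lemma Acyclic.bijective_of_subsingleton (h : Sq.Acyclic) (hP : ∀ q, Subsingleton (Sq.P.X q))
    (hR : ∀ q, Subsingleton (Sq.R₁.X q)) (q : ℕ) :
    Function.Bijective (homologyMap Sq.g₂ q).hom := by
  have hR' : Subsingleton (Sq.R₁.homology q) :=
    (homologyClass_surjective (C := Sq.R₁) q).subsingleton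
  have key : ∀ x, Sq.homG q (0, x) = (homologyMap Sq.g₂ q).hom x := fun x => by simp [homG]
  constructor
  · rw [← LinearMap.ker_eq_bot, LinearMap.ker_eq_bot']
    intro b hb
    have := (h.exact_homF_homG q (0, b)).1 ((key b).trans hb)
    obtain ⟨d, hd⟩ := this
    have hd0 : d = 0 := by
      obtain ⟨x, rfl⟩ := homologyClass_surjective q d
      rw [Subsingleton.elim x 0, map_zero]
    rw [hd0, map_zero] at hd
    exact (congrArg Prod.snd hd).symm
  · intro a
    obtain ⟨s, rfl⟩ := homologyClass_surjective q a
    by_cases hq : ∃ j, c.Rel q j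
    · obtain ⟨j, hj⟩ := hq
      obtain ⟨δ, h1, -⟩ := h.exists_delta hj
      have hP' : Subsingleton (Sq.P.homology j) :=
        (homologyClass_surjective (C := Sq.P) j).subsingleton
      obtain ⟨⟨x, y⟩, hxy⟩ := (h1 (Sq.S.homologyClass q s)).1 (Subsingleton.elim _ _)
      exact ⟨y, by rw [← key, ← hxy, Subsingleton.elim x 0]⟩
    · push Not at hq
      obtain ⟨⟨x, y⟩, hxy⟩ := h.surjective_homG hq (Sq.S.homologyClass q s)
      exact ⟨y, by rw [← key, ← hxy, Subsingleton.elim x 0]⟩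

end ComplexSquare

end Homology

/-! ### Submodules of projective modules over Dedekind domains -/

section Hereditary

/-- Ideals of a Dedekind domain are projective modules. -/
lemma Ideal.projective_of_isDedekindDomain {R : Type*} [CommRing R] [IsDedekindDomain R]
    (I : Ideal R) : Module.Projective R I := by
  by_cases hI : I = ⊥
  · subst hI
    infer_instance
  · let K := FractionRing R
    -- A nonzero ideal is invertible as a fractional ideal, hence as a submodule of the fraction
    -- field, and invertible submodules are projective.
    have hu : IsUnit (I : FractionalIdeal (nonZeroDivisors R) K) :=
      IsUnit.mk0 _ (FractionalIdeal.coeIdeal_ne_zero.2 hI)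
    have hu' := hu.map (FractionalIdeal.coeSubmoduleHom (nonZeroDivisors R) K)
    have := Submodule.projective_of_isUnit hu'
    let e : I ≃ₗ[R] Submodule.map (Algebra.linearMap R K) (I : Submodule R R) :=
      Submodule.equivMapOfInjective (Algebra.linearMap R K) (IsFractionRing.injective R K)
        (I : Submodule R R)
    have hP : Module.Projective R (Submodule.map (Algebra.linearMap R K) (I : Submodule R R)) := this
    exact Module.Projective.of_equiv e.symm

/-- A triangular family of maps into a module of finitely supported functions, which hits all leading
coefficients, gives a direct sum decomposition. -/
lemma bijective_lsum_of_leadingCoeff {R ι : Type*} [CommRing R] [LinearOrder ι] [WellFoundedLT ι]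
    {N : Submodule R (ι →₀ R)} {J : ι → Type*} [∀ i, AddCommGroup (J i)] [∀ i, Module R (J i)]
    (σ : ∀ i, J i →ₗ[R] N) (hinj : ∀ i (a : J i), (σ i a : ι →₀ R) i = 0 → a = 0)
    (h0 : ∀ i (a : J i) j, i < j → (σ i a : ι →₀ R) j = 0)
    (hsurj : ∀ i, ∀ f ∈ N, (∀ j, i < j → f j = 0) → ∃ a, (σ i a : ι →₀ R) i = f i) :
    Function.Bijective (DFinsupp.lsum ℕ (R := R) σ) := by
  classical
  constructor
  · refine (injective_iff_map_eq_zero _).2 fun x hx => ?_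
    by_contra hx0
    have hne : x.support.Nonempty := by
      rw [Finset.nonempty_iff_ne_empty, Ne, DFinsupp.support_eq_empty]
      exact hx0
    -- At the largest index of the support only one summand contributes, so the sum has a nonzero
    -- leading coefficient.
    set i := x.support.max' hne with hi
    have hmem : i ∈ x.support := Finset.max'_mem _ _
    have h1 : (DFinsupp.lsum ℕ (R := R) σ x : ι →₀ R) i = (σ i (x i) : ι →₀ R) i := by
      have : (DFinsupp.lsum ℕ (R := R) σ x : ι →₀ R) =
          ∑ j ∈ x.support, (σ j (x j) : ι →₀ R) := by
        rw [DFinsupp.lsum_apply_apply, DFinsupp.sumAddHom_apply, DFinsupp.sum,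
          AddSubmonoidClass.coe_finsetSum]
        rfl
      rw [this, Finsupp.finsetSum_apply, Finset.sum_eq_single i]
      · intro j hj hji
        exact h0 j _ i (lt_of_le_of_ne (Finset.le_max' _ _ hj) hji)
      · intro h
        exact absurd hmem h
    rw [hx] at h1
    exact DFinsupp.mem_support_iff.1 hmem (hinj i _ h1.symm)
  -- Well-founded induction on a bound for the leading index: subtracting a suitable `σ i a` removes
  -- the coefficient at `i`.
  · have key : ∀ i, ∀ f : N, (∀ j, i < j → (f : ι →₀ R) j = 0) →
        ∃ x, DFinsupp.lsum ℕ (R := R) σ x = f := by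
      intro i
      induction i using WellFoundedLT.induction with
      | ind i ih =>
        intro f hf
        obtain ⟨a, ha⟩ := hsurj i f f.2 hf
        have hg : ∀ j, i ≤ j → ((f - σ i a : N) : ι →₀ R) j = 0 := by
          intro j hj
          rw [Submodule.coe_sub, Finsupp.sub_apply]
          rcases hj.eq_or_lt with rfl | hj
          · rw [ha, sub_self]
          · rw [hf j hj, h0 i a j hj, sub_self]
        obtain ⟨x, hx⟩ : ∃ x, DFinsupp.lsum ℕ (R := R) σ x = f - σ i a := by
          by_cases hs : ((f - σ i a : N) : ι →₀ R).support.Nonempty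
          · refine ih (((f - σ i a : N) : ι →₀ R).support.max' hs) ?_ _ fun j hj => ?_
            · by_contra hlt
              exact Finsupp.mem_support_iff.1 (Finset.max'_mem _ hs) (hg _ (not_lt.1 hlt))
            · by_contra hne
              exact absurd (Finset.le_max' _ _ (Finsupp.mem_support_iff.2 hne)) (not_le.2 hj)
          · rw [Finset.not_nonempty_iff_eq_empty, Finsupp.support_eq_empty] at hs
            exact ⟨0, by rw [map_zero]; exact Subtype.ext hs.symm⟩
        refine ⟨x + DFinsupp.single i a, ?_⟩
        rw [map_add, hx, DFinsupp.lsum_single]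
        exact sub_add_cancel f _
    intro f
    by_cases hs : (f : ι →₀ R).support.Nonempty
    · refine key ((f : ι →₀ R).support.max' hs) f fun j hj => ?_
      by_contra hne
      exact absurd (Finset.le_max' _ _ (Finsupp.mem_support_iff.2 hne)) (not_le.2 hj)
    · rw [Finset.not_nonempty_iff_eq_empty, Finsupp.support_eq_empty] at hs
      exact ⟨0, by rw [map_zero]; exact Subtype.ext hs.symm⟩

/-- Over a Dedekind domain, submodules of modules of finitely supported functions are
projective. -/
lemma Submodule.projective_of_finsupp {R ι : Type*} [CommRing R] [IsDedekindDomain R]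
    (N : Submodule R (ι →₀ R)) : Module.Projective R N := by
  classical
  -- This is Kaplansky's argument. With the basis well-ordered, the elements of `N` supported up to
  -- `i` have as coefficients at `i` an ideal. Ideals being projective, the evaluation at `i` splits
  -- over this ideal, and `N` is isomorphic to the direct sum of all these ideals.
  obtain ⟨_, hwo⟩ := exists_wellFoundedLT ι
  have key : ∀ i, ∃ (J : Ideal R) (σ : J →ₗ[R] N), (∀ a, (σ a : ι →₀ R) i = a) ∧
      (∀ a j, i < j → (σ a : ι →₀ R) j = 0) ∧
      ∀ f ∈ N, (∀ j, i < j → f j = 0) → f i ∈ J := by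
    intro i
    let F : Submodule R (ι →₀ R) := N ⊓ Finsupp.supported R R (Set.Iic i)
    let ev : F →ₗ[R] R := Finsupp.lapply i ∘ₗ F.subtype
    have hJ : Module.Projective R (LinearMap.range ev) :=
      Ideal.projective_of_isDedekindDomain (LinearMap.range ev)
    obtain ⟨σ, hσ⟩ := Module.projective_lifting_property ev.rangeRestrict LinearMap.id
      ev.surjective_rangeRestrict
    refine ⟨LinearMap.range ev, Submodule.inclusion (inf_le_left : F ≤ N) ∘ₗ σ, fun a => ?_,
      fun a j hij => ?_, fun f hf h => ?_⟩
    · exact congrArg Subtype.val (LinearMap.congr_fun hσ a)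
    · by_contra h
      exact absurd hij (not_lt.2 ((Finsupp.mem_supported _ _).1 (σ a).2.2
        (Finsupp.mem_support_iff.2 h)))
    · refine ⟨⟨f, hf, (Finsupp.mem_supported _ _).2 fun j hj => ?_⟩, rfl⟩
      by_contra hij
      exact Finsupp.mem_support_iff.1 hj (h j (not_le.1 hij))
  choose J σ h1 h2 h3 using key
  have hJ : ∀ i, Module.Projective R (J i) := fun i => (J i).projective_of_isDedekindDomain
  exact Module.Projective.of_equiv (LinearEquiv.ofBijective _ (bijective_lsum_of_leadingCoeff σ
    (fun i a h => Subtype.ext ((h1 i a).symm.trans h)) h2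
    (fun i f hf h => ⟨⟨f i, h3 i f hf h⟩, h1 i _⟩)))

/-- Over a Dedekind domain, a module that embeds into a projective module is projective. -/
lemma Module.Projective.of_injective_of_isDedekindDomain {R M N : Type*} [CommRing R]
    [IsDedekindDomain R] [AddCommGroup M] [AddCommGroup N] [Module R M] [Module R N]
    [Module.Projective R M] (f : N →ₗ[R] M) (hf : Function.Injective f) :
    Module.Projective R N := by
  obtain ⟨s, hs⟩ := Module.projective_def.1 (inferInstance : Module.Projective R M)
  have hinj : Function.Injective (s ∘ₗ f) := hs.injective.comp hf
  have := (LinearMap.range (s ∘ₗ f)).projective_of_finsupp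
  exact Module.Projective.of_equiv (LinearEquiv.ofInjective _ hinj).symm

/-- Over a Dedekind domain, the functionals on an acyclic projective differential module that
vanish on the boundaries factor through the differential. -/
lemma exists_functional_comp_of_acyclic {R M : Type*} [CommRing R]
    [IsDedekindDomain R] [AddCommGroup M] [Module R M] [Module.Projective R M] (D : M →ₗ[R] M)
    (hD : ∀ x, D (D x) = 0) (hex : ∀ x, D x = 0 → ∃ y, D y = x) (φ : M →ₗ[R] R)
    (hφ : ∀ x, φ (D x) = 0) : ∃ ψ : M →ₗ[R] R, ∀ x, ψ (D x) = φ x := by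
  have hp : Module.Projective R (LinearMap.range D) :=
    Module.Projective.of_injective_of_isDedekindDomain (LinearMap.range D).subtype
      Subtype.val_injective
  obtain ⟨s, hs⟩ := Module.projective_lifting_property D.rangeRestrict LinearMap.id
    D.surjective_rangeRestrict
  have hs' : ∀ y : LinearMap.range D, D (s y) = y := fun y =>
    congrArg Subtype.val (LinearMap.congr_fun hs y)
  have hmem : ∀ x, x - s (D.rangeRestrict x) ∈ LinearMap.range D := by
    intro x
    obtain ⟨y, hy⟩ := hex (x - s (D.rangeRestrict x)) (by
      rw [map_sub, hs']
      exact sub_self _)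
    exact ⟨y, hy⟩
  -- The projection onto the cycles along the image of the section `s`; by acyclicity the cycles are
  -- the range of `D`.
  let h : M →ₗ[R] LinearMap.range D :=
    LinearMap.codRestrict _ (LinearMap.id - s ∘ₗ D.rangeRestrict) hmem
  refine ⟨φ ∘ₗ s ∘ₗ h, fun x => ?_⟩
  have h1 : D.rangeRestrict (D x) = 0 := Subtype.ext (hD x)
  have h2 : h (D x) = D.rangeRestrict x := by
    ext
    change D x - s (D.rangeRestrict (D x)) = D x
    rw [h1, map_zero, sub_zero]
  change φ (s (h (D x))) = φ x
  rw [h2]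
  -- The elements x and s(Dx) differ by a boundary, on which `φ` vanishes.
  obtain ⟨y, hy⟩ := hmem x
  have := hφ y
  rw [hy, map_sub, sub_eq_zero] at this
  exact this.symm

end Hereditary

/-! ### Duals of acyclic squares -/

section Dual

open CategoryTheory HomologicalComplex

variable {R : Type} [CommRing R]

namespace ComplexSquare

/-- The dual of a square of chain complexes. -/
noncomputable def dual (Sq : ComplexSquare.{u} R (ComplexShape.down ℕ)) :
    ComplexSquare.{u} R (ComplexShape.up ℕ) where
  P := ICData.dualComplex Sq.S
  R₁ := ICData.dualComplex Sq.R₁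
  R₂ := ICData.dualComplex Sq.R₂
  S := ICData.dualComplex Sq.P
  f₁ := ICData.dualMap Sq.g₁
  f₂ := ICData.dualMap Sq.g₂
  g₁ := ICData.dualMap Sq.f₁
  g₂ := ICData.dualMap Sq.f₂
  comm := by rw [← ICData.dualMap_comp, ← ICData.dualMap_comp, Sq.comm]

end ComplexSquare

variable {C : ChainComplex (ModuleCat.{u} R) ℕ}

/-- The differential on finitely supported families of elements of a chain complex. -/
noncomputable def dfinsuppD (C : ChainComplex (ModuleCat.{u} R) ℕ) :
    (Π₀ q, C.X q) →ₗ[R] Π₀ q, C.X q where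
  toFun x := DFinsupp.mapRange (fun q => (C.d (q + 1) q).hom) (fun _ => map_zero _)
    (DFinsupp.comapDomain (β := fun q => C.X q) Nat.succ Nat.succ_injective x)
  map_add' x y := by ext q; simp
  map_smul' a x := by ext q; simp

lemma dfinsuppD_apply (x : Π₀ q, C.X q) (q : ℕ) : dfinsuppD C x q = C.d (q + 1) q (x (q + 1)) :=
  rfl

lemma coe_dfinsuppD (x : Π₀ q, C.X q) : (⇑(dfinsuppD C x) : C.Family) = C.familyD ⇑x :=
  funext fun q => (familyD_of_rel (C := C) (i := q + 1) (j := q) rfl _).symm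

/-- The map of finitely supported families induced by a chain map. -/
noncomputable def dfinsuppMap {C C' : ChainComplex (ModuleCat.{u} R) ℕ} (f : C ⟶ C') :
    (Π₀ q, C.X q) →ₗ[R] Π₀ q, C'.X q :=
  DFinsupp.mapRange.linearMap fun q => (f.f q).hom

lemma coe_dfinsuppMap {C' : ChainComplex (ModuleCat.{u} R) ℕ} (f : C ⟶ C') (x : Π₀ q, C.X q) :
    (⇑(dfinsuppMap f x) : C'.Family) = familyMap f ⇑x := rfl


/-- An element of a dual complex as a functional. -/
def cochainFunctional {q : ℕ} (σ : (ICData.dualComplex C).X q) : C.X q →ₗ[R] R := σ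

/-- A functional as an element of a dual complex. -/
def functionalCochain {q : ℕ} (σ : C.X q →ₗ[R] R) : (ICData.dualComplex C).X q := σ

/-- The evaluation of a family of cochains on finitely supported families of chains. -/
noncomputable def evalFamily (C : ChainComplex (ModuleCat.{u} R) ℕ)
    (σ : (ICData.dualComplex C).Family) : (Π₀ q, C.X q) →ₗ[R] R :=
  DFinsupp.lsum ℕ fun q => cochainFunctional (σ q)

lemma evalFamily_single (σ : (ICData.dualComplex C).Family) (q : ℕ) (x : C.X q) :
    evalFamily C σ (DFinsupp.single q x) = cochainFunctional (σ q) x :=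
  DFinsupp.lsum_single ℕ (fun q => cochainFunctional (σ q)) q x

lemma evalFamily_add (σ σ' : (ICData.dualComplex C).Family) (x : Π₀ q, C.X q) :
    evalFamily C (σ + σ') x = evalFamily C σ x + evalFamily C σ' x := by
  have : evalFamily C (σ + σ') = evalFamily C σ + evalFamily C σ' :=
    DFinsupp.lhom_ext fun q x => by
      rw [LinearMap.add_apply, evalFamily_single, evalFamily_single, evalFamily_single]
      rfl
  exact LinearMap.congr_fun this x

lemma evalFamily_neg (σ : (ICData.dualComplex C).Family) (x : Π₀ q, C.X q) :
    evalFamily C (-σ) x = -evalFamily C σ x := by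
  have : evalFamily C (-σ) = -evalFamily C σ :=
    DFinsupp.lhom_ext fun q x => by
      rw [LinearMap.neg_apply, evalFamily_single, evalFamily_single]
      rfl
  exact LinearMap.congr_fun this x

lemma evalFamily_zero (x : Π₀ q, C.X q) : evalFamily C 0 x = 0 := by
  have := evalFamily_add (0 : (ICData.dualComplex C).Family) 0 x
  rwa [add_zero, left_eq_add] at this

lemma evalFamily_sub (σ σ' : (ICData.dualComplex C).Family) (x : Π₀ q, C.X q) :
    evalFamily C (σ - σ') x = evalFamily C σ x - evalFamily C σ' x := by
  rw [sub_eq_add_neg, evalFamily_add, evalFamily_neg, sub_eq_add_neg]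

/-- The cochain differential is the plain transpose of the chain differential, with no sign.
Evaluation therefore identifies families of cochains with functionals on an ungraded differential
module. -/
lemma evalFamily_familyD (σ : (ICData.dualComplex C).Family) (x : Π₀ q, C.X q) :
    evalFamily C ((ICData.dualComplex C).familyD σ) x = evalFamily C σ (dfinsuppD C x) := by
  have : evalFamily C ((ICData.dualComplex C).familyD σ) = evalFamily C σ ∘ₗ dfinsuppD C := by
    refine DFinsupp.lhom_ext fun q x => ?_
    rw [LinearMap.comp_apply, evalFamily_single]
    cases q with
    | zero =>
      have h1 : dfinsuppD C (DFinsupp.single 0 x) = 0 := by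
        ext q
        rw [dfinsuppD_apply, DFinsupp.single_eq_of_ne (by omega), map_zero]
        rfl
      -- No cochain differential arrives in degree 0, just as the differential kills chains of
      -- degree 0.
      rw [h1, map_zero, familyD_of_not_rel (fun i => by simp)]
      rfl
    | succ q =>
      have h1 : dfinsuppD C (DFinsupp.single (q + 1) x) =
          DFinsupp.single q (C.d (q + 1) q x) := by
        ext k
        rw [dfinsuppD_apply]
        by_cases hk : k = q
        · subst hk; simp
        · rw [DFinsupp.single_eq_of_ne (by omega), DFinsupp.single_eq_of_ne (by omega), map_zero]
      rw [h1, evalFamily_single, familyD_of_rel (i := q) (j := q + 1) rfl, ICData.dualComplex_d]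
      rfl
  exact LinearMap.congr_fun this x

lemma evalFamily_familyMap {C' : ChainComplex (ModuleCat.{u} R) ℕ} (f : C ⟶ C')
    (σ : (ICData.dualComplex C').Family) (x : Π₀ q, C.X q) :
    evalFamily C (familyMap (ICData.dualMap f) σ) x = evalFamily C' σ (dfinsuppMap f x) := by
  have : evalFamily C (familyMap (ICData.dualMap f) σ) = evalFamily C' σ ∘ₗ dfinsuppMap f := by
    refine DFinsupp.lhom_ext fun q x => ?_
    have h1 : dfinsuppMap f (DFinsupp.single q x) = DFinsupp.single q (f.f q x) :=
      DFinsupp.mapRange_single (hf := fun q => map_zero (f.f q).hom)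
    rw [LinearMap.comp_apply, evalFamily_single, h1, evalFamily_single]
    rfl
  exact LinearMap.congr_fun this x

lemma evalFamily_injective {σ σ' : (ICData.dualComplex C).Family}
    (h : ∀ x, evalFamily C σ x = evalFamily C σ' x) : σ = σ' := by
  funext q
  refine LinearMap.ext (f := cochainFunctional (σ q)) (g := cochainFunctional (σ' q))
    fun x => ?_
  rw [← evalFamily_single, h, evalFamily_single]

/-- The dual of a direct sum is the product of the duals. This is why chains have to be finitely
supported here, while families of cochains are arbitrary. -/
lemma exists_evalFamily (ψ : (Π₀ q, C.X q) →ₗ[R] R) :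
    ∃ σ : (ICData.dualComplex C).Family, evalFamily C σ = ψ :=
  ⟨fun q => functionalCochain (ψ ∘ₗ DFinsupp.lsingle (M := fun q => C.X q) q), DFinsupp.lhom_ext fun q x => by
    rw [evalFamily_single]; rfl⟩

/-- Truncation of a family of elements. -/
noncomputable def truncFamily (N : ℕ) (x : C.Family) : Π₀ q, C.X q :=
  DFinsupp.mk (Finset.range N) fun i => x i

lemma truncFamily_of_lt {N : ℕ} (x : C.Family) {q : ℕ} (h : q < N) : truncFamily N x q = x q :=
  DFinsupp.mk_of_mem (Finset.mem_range.2 h)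

lemma truncFamily_of_le {N : ℕ} (x : C.Family) {q : ℕ} (h : N ≤ q) : truncFamily N x q = 0 :=
  DFinsupp.mk_of_notMem (by simpa using h)

lemma exists_bound (x : Π₀ q, C.X q) : ∃ N, ∀ q ≥ N, x q = 0 := by
  classical
  obtain ⟨N, hN⟩ := x.support.bddAbove
  refine ⟨N + 1, fun q hq => ?_⟩
  by_contra h
  have := hN (DFinsupp.mem_support_iff.2 h)
  omega

namespace ComplexSquare

variable (Sq : ComplexSquare.{u} R (ComplexShape.down ℕ))

/-- The quadruples of finitely supported families of a square. -/
abbrev FinTot : Type u :=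
  (Π₀ q, Sq.P.X q) × (Π₀ q, Sq.R₁.X q) × (Π₀ q, Sq.R₂.X q) × (Π₀ q, Sq.S.X q)

/-- The differential on quadruples of finitely supported families. -/
noncomputable def finTotD : Sq.FinTot →ₗ[R] Sq.FinTot where
  toFun t := (dfinsuppD _ t.1, dfinsuppMap Sq.f₁ t.1 - dfinsuppD _ t.2.1,
    -dfinsuppMap Sq.f₂ t.1 - dfinsuppD _ t.2.2.1,
    dfinsuppMap Sq.g₁ t.2.1 + dfinsuppMap Sq.g₂ t.2.2.1 + dfinsuppD _ t.2.2.2)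
  map_add' s t := by
    simp only [Prod.fst_add, Prod.snd_add, map_add, Prod.mk_add_mk, Prod.mk.injEq]
    refine ⟨trivial, ?_, ?_, ?_⟩ <;> abel
  map_smul' a t := by
    simp only [Prod.smul_fst, Prod.smul_snd, map_smul, RingHom.id_apply, Prod.smul_mk, smul_sub,
      smul_add, smul_neg]

/-- A quadruple of finitely supported families as a quadruple of families. -/
def finTotCoe (t : Sq.FinTot) : Sq.Tot := (⇑t.1, ⇑t.2.1, ⇑t.2.2.1, ⇑t.2.2.2)

variable {Sq}

lemma finTotCoe_injective : Function.Injective Sq.finTotCoe := by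
  rintro ⟨p, r₁, r₂, s⟩ ⟨p', r₁', r₂', s'⟩ h
  simp only [finTotCoe, Prod.mk.injEq, DFunLike.coe_fn_eq] at h
  obtain ⟨rfl, rfl, rfl, rfl⟩ := h
  rfl

lemma finTotCoe_finTotD (t : Sq.FinTot) : Sq.finTotCoe (Sq.finTotD t) = Sq.totD (Sq.finTotCoe t) := by
  simp only [finTotCoe, finTotD, totD, LinearMap.coe_mk, AddHom.coe_mk, DFinsupp.coe_sub,
    DFinsupp.coe_add, DFinsupp.coe_neg, coe_dfinsuppD, coe_dfinsuppMap]

/-- Acyclicity provides a primitive that may be infinite. As the differential lowers or keeps the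
degree of each component, cutting off high degrees repairs this without affecting the equations in
low degrees. -/
lemma Acyclic.exists_finTotD (h : Sq.Acyclic) {t : Sq.FinTot} (ht : Sq.finTotD t = 0) :
    ∃ w, Sq.finTotD w = t := by
  obtain ⟨N₁, h1⟩ := exists_bound t.1
  obtain ⟨N₂, h2⟩ := exists_bound t.2.1
  obtain ⟨N₃, h3⟩ := exists_bound t.2.2.1
  obtain ⟨N₄, h4⟩ := exists_bound t.2.2.2
  obtain ⟨⟨p, r₁, r₂, s⟩, hw⟩ := h (Sq.finTotCoe t) ⟨⟨N₁, h1⟩, ⟨N₂, h2⟩, ⟨N₃, h3⟩, ⟨N₄, h4⟩⟩ (by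
    rw [← finTotCoe_finTotD, ht]
    rfl)
  simp only [totD, LinearMap.coe_mk, AddHom.coe_mk, finTotCoe, Prod.mk.injEq] at hw
  obtain ⟨e1, e2, e3, e4⟩ := hw
  obtain ⟨N, hN⟩ : ∃ N, N₁ ≤ N ∧ N₂ ≤ N ∧ N₃ ≤ N ∧ N₄ ≤ N :=
    ⟨N₁ + N₂ + N₃ + N₄, by omega, by omega, by omega, by omega⟩
  -- The cut-offs grow by one along the square, so that in each degree the terms of every component
  -- of the differential are either all kept or all dropped, and where they are dropped `t`
  -- vanishes.
  refine ⟨(truncFamily (N + 1) p, truncFamily (N + 2) r₁, truncFamily (N + 2) r₂,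
    truncFamily (N + 3) s), finTotCoe_injective ?_⟩
  simp only [finTotCoe, finTotD, LinearMap.coe_mk, AddHom.coe_mk, DFinsupp.coe_sub,
    DFinsupp.coe_add, DFinsupp.coe_neg, coe_dfinsuppD, coe_dfinsuppMap, Prod.mk.injEq]
  refine ⟨funext fun q => ?_, funext fun q => ?_, funext fun q => ?_, funext fun q => ?_⟩
  · rw [familyD_of_rel (i := q + 1) rfl]
    by_cases hq : q < N
    · rw [truncFamily_of_lt _ (by omega), ← e1, familyD_of_rel (i := q + 1) rfl]
    · rw [truncFamily_of_le _ (by omega), map_zero, h1 q (by omega)]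
  · rw [Pi.sub_apply, familyD_of_rel (i := q + 1) rfl, familyMap_apply]
    by_cases hq : q < N + 1
    · rw [truncFamily_of_lt _ (by omega), truncFamily_of_lt _ (by omega), ← e2, Pi.sub_apply,
        familyD_of_rel (i := q + 1) rfl, familyMap_apply]
    · rw [truncFamily_of_le _ (by omega), truncFamily_of_le _ (by omega), map_zero, map_zero,
        h2 q (by omega), sub_zero]
  · rw [Pi.sub_apply, Pi.neg_apply, familyD_of_rel (i := q + 1) rfl, familyMap_apply]
    by_cases hq : q < N + 1
    · rw [truncFamily_of_lt _ (by omega), truncFamily_of_lt _ (by omega), ← e3, Pi.sub_apply,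
        Pi.neg_apply, familyD_of_rel (i := q + 1) rfl, familyMap_apply]
    · rw [truncFamily_of_le _ (by omega), truncFamily_of_le _ (by omega), map_zero, map_zero,
        h3 q (by omega), neg_zero, sub_zero]
  · rw [Pi.add_apply, Pi.add_apply, familyD_of_rel (i := q + 1) rfl, familyMap_apply,
      familyMap_apply]
    by_cases hq : q < N + 2
    · rw [truncFamily_of_lt _ (by omega), truncFamily_of_lt _ (by omega),
        truncFamily_of_lt _ (by omega), ← e4, Pi.add_apply, Pi.add_apply,
        familyD_of_rel (i := q + 1) rfl, familyMap_apply, familyMap_apply]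
    · rw [truncFamily_of_le _ (by omega), truncFamily_of_le _ (by omega),
        truncFamily_of_le _ (by omega), map_zero, map_zero, map_zero,
        h4 q (by omega), add_zero, add_zero]

/-- The functional on quadruples of finitely supported families of chains that is given by a
quadruple of families of cochains. -/
noncomputable def evalTot (φ : Sq.dual.Tot) : Sq.FinTot →ₗ[R] R :=
  LinearMap.coprod (evalFamily Sq.P φ.2.2.2) (LinearMap.coprod (evalFamily Sq.R₁ φ.2.1)
    (LinearMap.coprod (-evalFamily Sq.R₂ φ.2.2.1) (evalFamily Sq.S φ.1)))

lemma evalTot_mk (φ : Sq.dual.Tot) (t : Sq.FinTot) : evalTot φ t =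
    evalFamily Sq.P φ.2.2.2 t.1 + (evalFamily Sq.R₁ φ.2.1 t.2.1 +
      (-evalFamily Sq.R₂ φ.2.2.1 t.2.2.1 + evalFamily Sq.S φ.1 t.2.2.2)) := rfl

/-- Dualizing exchanges the maps f and g, but the total differential has a sign on f₂ and none on
g₂. The sign of the R₂-term in `evalTot` compensates for this and makes the two total differentials
transposes of each other. -/
lemma evalTot_totD (φ : Sq.dual.Tot) (t : Sq.FinTot) :
    evalTot (Sq.dual.totD φ) t = evalTot φ (Sq.finTotD t) := by
  obtain ⟨σ, ρ₁, ρ₂, π⟩ := φ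
  obtain ⟨p, r₁, r₂, s⟩ := t
  rw [evalTot_mk, evalTot_mk]
  have e1 := evalFamily_familyD (C := Sq.S) σ s
  have e2 := evalFamily_familyD (C := Sq.R₁) ρ₁ r₁
  have e3 := evalFamily_familyD (C := Sq.R₂) ρ₂ r₂
  have e4 := evalFamily_familyD (C := Sq.P) π p
  have f1 := evalFamily_familyMap Sq.f₁ ρ₁ p
  have f2 := evalFamily_familyMap Sq.f₂ ρ₂ p
  have g1 := evalFamily_familyMap Sq.g₁ σ r₁
  have g2 := evalFamily_familyMap Sq.g₂ σ r₂
  change evalFamily Sq.P (familyMap (ICData.dualMap Sq.f₁) ρ₁ +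
      familyMap (ICData.dualMap Sq.f₂) ρ₂ + (ICData.dualComplex Sq.P).familyD π) p +
    (evalFamily Sq.R₁ (familyMap (ICData.dualMap Sq.g₁) σ -
      (ICData.dualComplex Sq.R₁).familyD ρ₁) r₁ +
    (-evalFamily Sq.R₂ (-familyMap (ICData.dualMap Sq.g₂) σ -
      (ICData.dualComplex Sq.R₂).familyD ρ₂) r₂ +
      evalFamily Sq.S ((ICData.dualComplex Sq.S).familyD σ) s)) =
    evalFamily Sq.P π (dfinsuppD _ p) + (evalFamily Sq.R₁ ρ₁ (dfinsuppMap Sq.f₁ p -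
      dfinsuppD _ r₁) + (-evalFamily Sq.R₂ ρ₂ (-dfinsuppMap Sq.f₂ p - dfinsuppD _ r₂) +
      evalFamily Sq.S σ (dfinsuppMap Sq.g₁ r₁ + dfinsuppMap Sq.g₂ r₂ + dfinsuppD _ s)))
  simp only [evalFamily_add, evalFamily_sub, evalFamily_neg, e1, e2, e3, e4, f1, f2, g1, g2,
    map_add, map_sub, map_neg]
  abel

lemma evalTot_injective {φ φ' : Sq.dual.Tot} (h : ∀ t, evalTot φ t = evalTot φ' t) : φ = φ' := by
  simp only [evalTot_mk] at h
  refine Prod.ext ?_ (Prod.ext ?_ (Prod.ext ?_ ?_))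
  · exact evalFamily_injective (C := Sq.S) fun x => by simpa using h (0, 0, 0, x)
  · exact evalFamily_injective (C := Sq.R₁) fun x => by simpa using h (0, x, 0, 0)
  · exact evalFamily_injective (C := Sq.R₂) fun x => by simpa using h (0, 0, x, 0)
  · exact evalFamily_injective (C := Sq.P) fun x => by simpa using h (x, 0, 0, 0)

lemma exists_evalTot (ψ : Sq.FinTot →ₗ[R] R) : ∃ φ : Sq.dual.Tot, evalTot φ = ψ := by
  obtain ⟨σ, hσ⟩ := exists_evalFamily (C := Sq.S)
    (ψ ∘ₗ LinearMap.inr R _ _ ∘ₗ LinearMap.inr R _ _ ∘ₗ LinearMap.inr R _ _)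
  obtain ⟨ρ₁, hρ₁⟩ := exists_evalFamily (C := Sq.R₁)
    (ψ ∘ₗ LinearMap.inr R _ _ ∘ₗ LinearMap.inl R _ _)
  obtain ⟨ρ₂, hρ₂⟩ := exists_evalFamily (C := Sq.R₂)
    (-(ψ ∘ₗ LinearMap.inr R _ _ ∘ₗ LinearMap.inr R _ _ ∘ₗ LinearMap.inl R _ _))
  obtain ⟨π, hπ⟩ := exists_evalFamily (C := Sq.P) (ψ ∘ₗ LinearMap.inl R _ _)
  refine ⟨(σ, ρ₁, ρ₂, π), LinearMap.ext fun t => ?_⟩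
  rw [evalTot_mk]
  dsimp only
  rw [hσ, hρ₁, hρ₂, hπ]
  simp only [LinearMap.comp_apply, LinearMap.neg_apply, neg_neg, ← map_add]
  congr 1
  simp

/-- The dual of an acyclic square of complexes of projective modules over a Dedekind domain is
acyclic. -/
theorem Acyclic.dual [IsDedekindDomain R] (h : Sq.Acyclic)
    (hP : ∀ q, Module.Projective R (Sq.P.X q)) (hR₁ : ∀ q, Module.Projective R (Sq.R₁.X q))
    (hR₂ : ∀ q, Module.Projective R (Sq.R₂.X q)) (hS : ∀ q, Module.Projective R (Sq.S.X q)) :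
    Sq.dual.Acyclic := by
  intro φ _ hφ
  -- A cycle `φ` of the dual square is a functional that vanishes on the boundaries of the acyclic
  -- projective module `FinTot`; factoring it through the differential means finding a primitive.
  obtain ⟨ψ, hψ⟩ := exists_functional_comp_of_acyclic Sq.finTotD
    (fun t => finTotCoe_injective (by rw [finTotCoe_finTotD, finTotCoe_finTotD, totD_totD]; rfl))
    (fun t ht => h.exists_finTotD ht) (evalTot φ) (fun t => by
      rw [← evalTot_totD, hφ]
      have h1 := evalFamily_zero (C := Sq.P) t.1
      have h2 := evalFamily_zero (C := Sq.R₁) t.2.1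
      have h3 := evalFamily_zero (C := Sq.R₂) t.2.2.1
      have h4 := evalFamily_zero (C := Sq.S) t.2.2.2
      rw [evalTot_mk]
      change evalFamily Sq.P 0 t.1 + (evalFamily Sq.R₁ 0 t.2.1 +
        (-evalFamily Sq.R₂ 0 t.2.2.1 + evalFamily Sq.S 0 t.2.2.2)) = 0
      rw [h1, h2, h3, h4, neg_zero, add_zero, add_zero, add_zero])
  obtain ⟨φ', rfl⟩ := exists_evalTot ψ
  exact ⟨φ', evalTot_injective fun t => by rw [evalTot_totD, hψ]⟩

end ComplexSquare

end Dual

/-! ### Elements of limits and colimits of complexes -/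

section LimitElements

open CategoryTheory CategoryTheory.Limits Opposite

variable {R : Type} [CommRing R] {c : ComplexShape ℕ} {J : Type u} [Preorder J]

/-- Elements of an inverse limit of complexes are determined by their components along a cofinal
sequence. -/
lemma limit_element_ext (F : Jᵒᵖ ⥤ HomologicalComplex (ModuleCat.{u} R) c) {κ : ℕ → J}
    (hκ : ∀ j, ∃ n, j ≤ κ n) {q : ℕ} {x y : (limit F).X q}
    (h : ∀ n, (limit.π F (op (κ n))).f q x = (limit.π F (op (κ n))).f q y) : x = y := by
  refine Concrete.isLimit_ext _ (isLimitOfPreserves (HomologicalComplex.eval _ _ q)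
    (limit.isLimit F)) _ _ fun j => ?_
  obtain ⟨n, hn⟩ := hκ j.unop
  have hw : ∀ z : (limit F).X q, (limit.π F j).f q z =
      (F.map (homOfLE hn).op).f q ((limit.π F (op (κ n))).f q z) := fun z => by
    rw [← ConcreteCategory.comp_apply, ← HomologicalComplex.comp_f, limit.w]
  change (limit.π F j).f q x = (limit.π F j).f q y
  rw [hw, hw, h]

/-- A compatible sequence of elements along a cofinal sequence comes from an element of the inverse
limit. -/
lemma exists_limit_element (F : Jᵒᵖ ⥤ HomologicalComplex (ModuleCat.{u} R) c) {κ : ℕ → J}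
    (hm : Monotone κ) (hκ : ∀ j, ∃ n, j ≤ κ n) {q : ℕ} (y : ∀ n, (F.obj (op (κ n))).X q)
    (hy : ∀ n, (F.map (homOfLE (hm n.le_succ)).op).f q (y (n + 1)) = y n) :
    ∃ x : (limit F).X q, ∀ n, (limit.π F (op (κ n))).f q x = y n := by
  have hy' : ∀ m n (hmn : m ≤ n), (F.map (homOfLE (hm hmn)).op).f q (y n) = y m := by
    intro m n hmn
    induction n, hmn using Nat.le_induction with
    | base =>
      have : (homOfLE (hm le_rfl)).op = 𝟙 (op (κ m)) := rfl
      rw [this, F.map_id]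
      rfl
    | succ n hmn ih =>
      have : (homOfLE (hm (hmn.trans n.le_succ))).op =
        (homOfLE (hm n.le_succ)).op ≫ (homOfLE (hm hmn)).op := rfl
      rw [this, F.map_comp, HomologicalComplex.comp_f, ConcreteCategory.comp_apply, hy, ih]
  choose ν hν using hκ
  -- The coordinate of the limit element at an arbitrary index `j` is read off from any later term
  -- of the cofinal sequence; it does not depend on the term chosen.
  have hind : ∀ (j : J) n (hn : j ≤ κ n), (F.map (homOfLE hn).op).f q (y n) =
      (F.map (homOfLE (hν j)).op).f q (y (ν j)) := by
    intro j n hn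
    have key : ∀ m (hjm : j ≤ κ m) l (hml : m ≤ l), (F.map (homOfLE hjm).op).f q (y m) =
        (F.map (homOfLE (hjm.trans (hm hml))).op).f q (y l) := by
      intro m hjm l hml
      have : (homOfLE (hjm.trans (hm hml))).op = (homOfLE (hm hml)).op ≫ (homOfLE hjm).op := rfl
      rw [this, F.map_comp, HomologicalComplex.comp_f, ConcreteCategory.comp_apply, hy' m l hml]
    rw [key n hn (max n (ν j)) (le_max_left _ _), key (ν j) (hν j) _ (le_max_right n (ν j))]
  have hlim := isLimitOfPreserves (forget (ModuleCat.{u} R))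
    (isLimitOfPreserves (HomologicalComplex.eval _ _ q) (limit.isLimit F))
  let s : ((F ⋙ HomologicalComplex.eval _ _ q) ⋙ forget (ModuleCat.{u} R)).sections :=
    ⟨fun j => (F.map (homOfLE (hν j.unop)).op).f q (y (ν j.unop)), fun {i j} f => by
      change (F.map f).f q ((F.map (homOfLE (hν i.unop)).op).f q (y (ν i.unop))) =
        (F.map (homOfLE (hν j.unop)).op).f q (y (ν j.unop))
      rw [← ConcreteCategory.comp_apply, ← HomologicalComplex.comp_f, ← F.map_comp,
        ← hind j.unop (ν i.unop) ((leOfHom f.unop).trans (hν i.unop))]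
      rfl⟩
  obtain ⟨x, hx⟩ : ∃ x : (limit F).X q, ∀ j, (limit.π F j).f q x = s.1 j := by
    refine ⟨(Types.isLimitEquivSections hlim).symm s, fun j => ?_⟩
    exact Types.isLimitEquivSections_symm_apply hlim s j
  refine ⟨x, fun n => ?_⟩
  rw [hx]
  change (F.map (homOfLE (hν (κ n))).op).f q (y (ν (κ n))) = y n
  rw [← hind (κ n) n le_rfl]
  have : (homOfLE (le_refl (κ n))).op = 𝟙 (op (κ n)) := rfl
  rw [this, F.map_id]
  rfl

variable [IsDirected J (· ≤ ·)] [Nonempty J]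

/-- Evaluation in a degree preserves colimits, and the forgetful functor from modules to sets
preserves directed ones, so elements of the colimit come from a stage of the system. -/
lemma exists_colimit_rep (F : J ⥤ HomologicalComplex (ModuleCat.{u} R) c) {q : ℕ}
    (x : (colimit F).X q) : ∃ (j : J) (y : (F.obj j).X q), (colimit.ι F j).f q y = x :=
  haveI : PreservesColimitsOfShape J (forget (ModuleCat.{u} R)) :=
    comp_preservesColimitsOfShape (forget₂ (ModuleCat.{u} R) AddCommGrpCat.{u})
      (forget AddCommGrpCat.{u})
  Concrete.isColimit_exists_rep _ (isColimitOfPreserves (HomologicalComplex.eval _ _ q)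
    (colimit.isColimit F)) x

lemma exists_map_eq_zero_of_colimit (F : J ⥤ HomologicalComplex (ModuleCat.{u} R) c) {q : ℕ}
    {j : J} {y : (F.obj j).X q} (h : (colimit.ι F j).f q y = 0) :
    ∃ (k : J) (hjk : j ≤ k), (F.map (homOfLE hjk)).f q y = 0 := by
  have : PreservesColimitsOfShape J (forget (ModuleCat.{u} R)) :=
    comp_preservesColimitsOfShape (forget₂ (ModuleCat.{u} R) AddCommGrpCat.{u})
      (forget AddCommGrpCat.{u})
  have hc := isColimitOfPreserves (HomologicalComplex.eval _ _ q) (colimit.isColimit F)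
  obtain ⟨k, f, hf⟩ := (IsColimit.eq_iff' hc (i := j) y 0).1 (by
    refine Eq.trans ?_ (map_zero ((colimit.ι F j).f q).hom).symm
    exact h)
  exact ⟨k, leOfHom f, hf.trans (map_zero ((F.map f).f q).hom)⟩

end LimitElements

/-! ### Limits and colimits of squares -/

section Systems

open CategoryTheory HomologicalComplex

variable {R : Type} [CommRing R] {c : ComplexShape ℕ}

namespace ComplexSquare

variable {A B : ComplexSquare.{u} R c}

/-- A map of squares of complexes. -/
structure Hom (A B : ComplexSquare.{u} R c) where
  P : A.P ⟶ B.P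
  R₁ : A.R₁ ⟶ B.R₁
  R₂ : A.R₂ ⟶ B.R₂
  S : A.S ⟶ B.S
  comm_f₁ : A.f₁ ≫ R₁ = P ≫ B.f₁
  comm_f₂ : A.f₂ ≫ R₂ = P ≫ B.f₂
  comm_g₁ : A.g₁ ≫ S = R₁ ≫ B.g₁
  comm_g₂ : A.g₂ ≫ S = R₂ ≫ B.g₂

lemma _root_.HomologicalComplex.familyMap_comp {C C' C'' : HomologicalComplex (ModuleCat.{u} R) c}
    (f : C ⟶ C') (g : C' ⟶ C'') (x : C.Family) :
    familyMap (f ≫ g) x = familyMap g (familyMap f x) := rfl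

/-- The map of total objects induced by a map of squares. -/
noncomputable def Hom.tot (φ : Hom A B) : A.Tot →ₗ[R] B.Tot :=
  LinearMap.prodMap (familyMap φ.P) (LinearMap.prodMap (familyMap φ.R₁)
    (LinearMap.prodMap (familyMap φ.R₂) (familyMap φ.S)))

lemma Hom.tot_mk (φ : Hom A B) (t : A.Tot) : φ.tot t =
    (familyMap φ.P t.1, familyMap φ.R₁ t.2.1, familyMap φ.R₂ t.2.2.1, familyMap φ.S t.2.2.2) := rfl

lemma Hom.tot_totD (φ : Hom A B) (t : A.Tot) : φ.tot (A.totD t) = B.totD (φ.tot t) := by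
  simp only [Hom.tot_mk, totD, LinearMap.coe_mk, AddHom.coe_mk, map_add, map_sub, map_neg,
    familyD_familyMap, ← familyMap_comp, φ.comm_f₁, φ.comm_f₂, φ.comm_g₁, φ.comm_g₂]

/-- Every cycle of the total object of the square is a boundary. -/
def Exact (Sq : ComplexSquare.{u} R c) : Prop :=
  ∀ t : Sq.Tot, Sq.totD t = 0 → ∃ t', Sq.totD t' = t

lemma Exact.acyclic {Sq : ComplexSquare.{u} R c} (h : Sq.Exact) : Sq.Acyclic :=
  fun t _ ht => h t ht

end ComplexSquare

/-- A complex that is the inverse limit of a sequence of complexes with surjective transition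
maps, described in terms of elements. -/
structure IsSeqLimit {L : HomologicalComplex (ModuleCat.{u} R) c}
    {C : ℕ → HomologicalComplex (ModuleCat.{u} R) c} (π : ∀ n, L ⟶ C n)
    (ρ : ∀ n, C (n + 1) ⟶ C n) : Prop where
  comp : ∀ n, π (n + 1) ≫ ρ n = π n
  ext : ∀ q (x y : L.X q), (∀ n, (π n).f q x = (π n).f q y) → x = y
  exists_lift : ∀ q (y : ∀ n, (C n).X q), (∀ n, (ρ n).f q (y (n + 1)) = y n) →
    ∃ x, ∀ n, (π n).f q x = y n
  surjective : ∀ n q, Function.Surjective ((ρ n).f q)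

namespace IsSeqLimit

variable {L : HomologicalComplex (ModuleCat.{u} R) c}
    {C : ℕ → HomologicalComplex (ModuleCat.{u} R) c} {π : ∀ n, L ⟶ C n}
    {ρ : ∀ n, C (n + 1) ⟶ C n} (h : IsSeqLimit π ρ)

include h

lemma family_comp (n : ℕ) (x : L.Family) :
    familyMap (ρ n) (familyMap (π (n + 1)) x) = familyMap (π n) x := by
  rw [← familyMap_comp, h.comp]

lemma family_ext {x y : L.Family} (hxy : ∀ n, familyMap (π n) x = familyMap (π n) y) : x = y :=
  funext fun q => h.ext q _ _ fun n => congrFun (hxy n) q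

lemma family_exists_lift (y : ∀ n, (C n).Family) (hy : ∀ n, familyMap (ρ n) (y (n + 1)) = y n) :
    ∃ x, ∀ n, familyMap (π n) x = y n := by
  choose x hx using fun q => h.exists_lift q (fun n => y n q) fun n => congrFun (hy n) q
  exact ⟨x, fun n => funext fun q => hx q n⟩

lemma family_surjective (n : ℕ) : Function.Surjective (familyMap (ρ n)) := by
  intro y
  choose x hx using fun q => h.surjective n q (y q)
  exact ⟨x, funext hx⟩

end IsSeqLimit

open ComplexSquare in
/-- An inverse limit of a sequence of exact squares with surjective transition maps is exact. -/
theorem ComplexSquare.Exact.of_isSeqLimit {Sq : ComplexSquare.{u} R c}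
    {Sq' : ℕ → ComplexSquare.{u} R c} (π : ∀ n, Hom Sq (Sq' n)) (ρ : ∀ n, Hom (Sq' (n + 1)) (Sq' n))
    (hP : IsSeqLimit (fun n => (π n).P) (fun n => (ρ n).P))
    (hR₁ : IsSeqLimit (fun n => (π n).R₁) (fun n => (ρ n).R₁))
    (hR₂ : IsSeqLimit (fun n => (π n).R₂) (fun n => (ρ n).R₂))
    (hS : IsSeqLimit (fun n => (π n).S) (fun n => (ρ n).S))
    (h : ∀ n, (Sq' n).Exact) : Sq.Exact := by
  have hcomp : ∀ n t, (ρ n).tot ((π (n + 1)).tot t) = (π n).tot t := by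
    intro n t
    simp only [Hom.tot_mk, hP.family_comp n, hR₁.family_comp n, hR₂.family_comp n,
      hS.family_comp n]
  have hext : ∀ s t : Sq.Tot, (∀ n, (π n).tot s = (π n).tot t) → s = t := by
    intro s t hst
    simp only [Hom.tot_mk, Prod.mk.injEq, forall_and] at hst
    exact Prod.ext (hP.family_ext hst.1) (Prod.ext (hR₁.family_ext hst.2.1)
      (Prod.ext (hR₂.family_ext hst.2.2.1) (hS.family_ext hst.2.2.2)))
  have hlift : ∀ w : ∀ n, (Sq' n).Tot, (∀ n, (ρ n).tot (w (n + 1)) = w n) →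
      ∃ t, ∀ n, (π n).tot t = w n := by
    intro w hw
    have hw' := fun n => Prod.ext_iff.1 (hw n)
    have hw'' := fun n => Prod.ext_iff.1 (hw' n).2
    have hw''' := fun n => Prod.ext_iff.1 (hw'' n).2
    obtain ⟨p, hp⟩ := hP.family_exists_lift (fun n => (w n).1) fun n => (hw' n).1
    obtain ⟨r₁, hr₁⟩ := hR₁.family_exists_lift (fun n => (w n).2.1) fun n => (hw'' n).1
    obtain ⟨r₂, hr₂⟩ := hR₂.family_exists_lift (fun n => (w n).2.2.1) fun n => (hw''' n).1
    obtain ⟨s, hs⟩ := hS.family_exists_lift (fun n => (w n).2.2.2) fun n => (hw''' n).2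
    exact ⟨(p, r₁, r₂, s), fun n => Prod.ext (hp n) (Prod.ext (hr₁ n) (Prod.ext (hr₂ n) (hs n)))⟩
  have hsurj : ∀ n, Function.Surjective (ρ n).tot := by
    rintro n ⟨p, r₁, r₂, s⟩
    obtain ⟨p', hp⟩ := hP.family_surjective n p
    obtain ⟨r₁', hr₁⟩ := hR₁.family_surjective n r₁
    obtain ⟨r₂', hr₂⟩ := hR₂.family_surjective n r₂
    obtain ⟨s', hs⟩ := hS.family_surjective n s
    exact ⟨(p', r₁', r₂', s'), Prod.ext hp (Prod.ext hr₁ (Prod.ext hr₂ hs))⟩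
  intro t ht
  have hcyc : ∀ n, (Sq' n).totD ((π n).tot t) = 0 := fun n => by
    rw [← Hom.tot_totD, ht, map_zero]
  -- The Mittag-Leffler step. A primitive at stage n + 1 maps to the given one up to a cycle, which
  -- is a boundary by exactness of stage n. A primitive of that cycle lifts along the surjective
  -- transition map, and the boundary of the lift corrects the new primitive. The cycle need not be
  -- bounded, which is why `Exact` is used and not `Acyclic`.
  have step : ∀ n (w : (Sq' n).Tot), (Sq' n).totD w = (π n).tot t →
      ∃ w', (Sq' (n + 1)).totD w' = (π (n + 1)).tot t ∧ (ρ n).tot w' = w := by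
    intro n w hw
    obtain ⟨v, hv⟩ := h (n + 1) _ (hcyc (n + 1))
    obtain ⟨y, hy⟩ := h n ((ρ n).tot v - w) (by
      rw [map_sub, ← Hom.tot_totD, hv, hcomp, hw, sub_self])
    obtain ⟨y', rfl⟩ := hsurj n y
    exact ⟨v - (Sq' (n + 1)).totD y', by rw [map_sub, totD_totD, sub_zero, hv],
      by rw [map_sub, Hom.tot_totD, hy, sub_sub_cancel]⟩
  choose next hnext₁ hnext₂ using step
  obtain ⟨w₀, hw₀⟩ := h 0 _ (hcyc 0)
  -- Dependent choice gives a compatible sequence of primitives, that is, a primitive in the limit.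
  let w : ∀ n, {w : (Sq' n).Tot // (Sq' n).totD w = (π n).tot t} := fun n =>
    Nat.rec ⟨w₀, hw₀⟩ (fun n w => ⟨next n w.1 w.2, hnext₁ n w.1 w.2⟩) n
  obtain ⟨t', ht'⟩ := hlift (fun n => (w n).1) fun n => hnext₂ n (w n).1 (w n).2
  exact ⟨t', hext _ _ fun n => by rw [Hom.tot_totD, ht', (w n).2]⟩

/-- A complex that is the direct limit of a directed system of complexes, described in terms of
elements. -/
structure IsDirLimit {I : Type u} [Preorder I] {L : HomologicalComplex (ModuleCat.{u} R) c}
    {C : I → HomologicalComplex (ModuleCat.{u} R) c} (ι : ∀ i, C i ⟶ L)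
    (ρ : ∀ i j, i ≤ j → (C i ⟶ C j)) : Prop where
  comp : ∀ i j (h : i ≤ j), ρ i j h ≫ ι j = ι i
  map_comp : ∀ i j k (h : i ≤ j) (h' : j ≤ k), ρ i j h ≫ ρ j k h' = ρ i k (h.trans h')
  exists_rep : ∀ q (x : L.X q), ∃ i y, (ι i).f q y = x
  eq_zero : ∀ q i (y : (C i).X q), (ι i).f q y = 0 → ∃ (j : I) (h : i ≤ j), (ρ i j h).f q y = 0

namespace IsDirLimit

variable {I : Type u} [Preorder I]
    {L : HomologicalComplex (ModuleCat.{u} R) c}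
    {C : I → HomologicalComplex (ModuleCat.{u} R) c} {ι : ∀ i, C i ⟶ L}
    {ρ : ∀ i j, i ≤ j → (C i ⟶ C j)} (h : IsDirLimit ι ρ)

include h

lemma family_comp {i j : I} (hij : i ≤ j) (x : (C i).Family) :
    familyMap (ι j) (familyMap (ρ i j hij) x) = familyMap (ι i) x := by
  rw [← familyMap_comp, h.comp]

lemma family_map_comp {i j k : I} (hij : i ≤ j) (hjk : j ≤ k) (x : (C i).Family) :
    familyMap (ρ j k hjk) (familyMap (ρ i j hij) x) = familyMap (ρ i k (hij.trans hjk)) x := by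
  rw [← familyMap_comp, h.map_comp]

variable [IsDirected I (· ≤ ·)] [Nonempty I]

/-- Boundedness is essential: only finitely many degrees need a representative, so a single index of
the directed system serves all of them. -/
lemma family_exists_rep {x : L.Family} (hx : IsBdd x) :
    ∃ i, ∃ y : (C i).Family, IsBdd y ∧ familyMap (ι i) y = x := by
  classical
  obtain ⟨N, hN⟩ := hx
  choose i y hy using fun q => h.exists_rep q (x q)
  obtain ⟨j, hj⟩ := ((Finset.range N).image i).exists_le
  have hj' : ∀ q, q < N → i q ≤ j := fun q hq =>
    hj _ (Finset.mem_image_of_mem _ (Finset.mem_range.2 hq))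
  refine ⟨j, fun q => if hq : q < N then (ρ (i q) j (hj' q hq)).f q (y q) else 0,
    ⟨N, fun q hq => dif_neg (not_lt.2 hq)⟩, funext fun q => ?_⟩
  rw [familyMap_apply]
  split_ifs with hq
  · rw [← ConcreteCategory.comp_apply, ← comp_f, h.comp, hy]
  · rw [map_zero, hN q (not_lt.1 hq)]

/-- Again only finitely many degrees matter, so one later index kills all components simultaneously.
-/
lemma family_eq_zero {i : I} {y : (C i).Family} (hy : IsBdd y) (h0 : familyMap (ι i) y = 0) :
    ∃ (j : I) (hij : i ≤ j), familyMap (ρ i j hij) y = 0 := by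
  classical
  obtain ⟨N, hN⟩ := hy
  choose k hk hk0 using fun q => h.eq_zero q i (y q) (congrFun h0 q)
  obtain ⟨j, hj⟩ := (insert i ((Finset.range N).image k)).exists_le
  have hij : i ≤ j := hj _ (Finset.mem_insert_self _ _)
  refine ⟨j, hij, funext fun q => ?_⟩
  rw [familyMap_apply]
  by_cases hq : q < N
  · have hkj : k q ≤ j := hj _ (Finset.mem_insert_of_mem
      (Finset.mem_image_of_mem _ (Finset.mem_range.2 hq)))
    rw [← h.map_comp i (k q) j (hk q) hkj, comp_f, ConcreteCategory.comp_apply, hk0, map_zero]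
    rfl
  · rw [hN q (not_lt.1 hq), map_zero]
    rfl

end IsDirLimit

lemma isBdd_familyMap {C C' : HomologicalComplex (ModuleCat.{u} R) c} (f : C ⟶ C') {x : C.Family}
    (hx : IsBdd x) : IsBdd (familyMap f x) := by
  obtain ⟨N, hN⟩ := hx
  exact ⟨N, fun q hq => by rw [familyMap_apply, hN q hq, map_zero]⟩

lemma isBdd_familyD {C : CochainComplex (ModuleCat.{u} R) ℕ} {x : C.Family}
    (hx : IsBdd x) : IsBdd (C.familyD x) := by
  obtain ⟨N, hN⟩ := hx
  refine ⟨N + 1, fun q hq => ?_⟩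
  obtain ⟨k, rfl⟩ : ∃ k, q = k + 1 := ⟨q - 1, by omega⟩
  rw [familyD_of_rel (i := k) (j := k + 1) rfl, hN k (by omega), map_zero]

lemma HomologicalComplex.IsBdd.add {C : HomologicalComplex (ModuleCat.{u} R) c} {x y : C.Family}
    (hx : IsBdd x) (hy : IsBdd y) : IsBdd (x + y) := by
  obtain ⟨N, hN⟩ := hx
  obtain ⟨M, hM⟩ := hy
  exact ⟨max N M, fun q hq => by
    rw [Pi.add_apply, hN q (by omega), hM q (by omega), add_zero]⟩

lemma HomologicalComplex.IsBdd.sub {C : HomologicalComplex (ModuleCat.{u} R) c} {x y : C.Family}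
    (hx : IsBdd x) (hy : IsBdd y) : IsBdd (x - y) := by
  rw [sub_eq_add_neg]
  exact hx.add hy.neg

lemma ComplexSquare.totBdd_totD {Sq : ComplexSquare.{u} R (ComplexShape.up ℕ)} {t : Sq.Tot}
    (h : Sq.TotBdd t) : Sq.TotBdd (Sq.totD t) :=
  ⟨isBdd_familyD h.1, (isBdd_familyMap _ h.1).sub (isBdd_familyD h.2.1),
    (isBdd_familyMap _ h.1).neg.sub (isBdd_familyD h.2.2.1),
    ((isBdd_familyMap _ h.2.1).add (isBdd_familyMap _ h.2.2.1)).add (isBdd_familyD h.2.2.2)⟩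

open ComplexSquare in
/-- A directed colimit of acyclic squares of cochain complexes is acyclic. -/
theorem ComplexSquare.Acyclic.of_isDirLimit {I : Type u} [Preorder I] [IsDirected I (· ≤ ·)]
    [Nonempty I] {Sq : ComplexSquare.{u} R (ComplexShape.up ℕ)}
    {Sq' : I → ComplexSquare.{u} R (ComplexShape.up ℕ)} (ι : ∀ i, Hom (Sq' i) Sq)
    (ρ : ∀ i j, i ≤ j → Hom (Sq' i) (Sq' j))
    (hP : IsDirLimit (fun i => (ι i).P) (fun i j h => (ρ i j h).P))
    (hR₁ : IsDirLimit (fun i => (ι i).R₁) (fun i j h => (ρ i j h).R₁))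
    (hR₂ : IsDirLimit (fun i => (ι i).R₂) (fun i j h => (ρ i j h).R₂))
    (hS : IsDirLimit (fun i => (ι i).S) (fun i j h => (ρ i j h).S))
    (h : ∀ i, (Sq' i).Acyclic) : Sq.Acyclic := by
  have hcomp : ∀ i j (hij : i ≤ j) t, (ι j).tot ((ρ i j hij).tot t) = (ι i).tot t := by
    intro i j hij t
    simp only [Hom.tot_mk, hP.family_comp hij, hR₁.family_comp hij, hR₂.family_comp hij,
      hS.family_comp hij]
  have hbdd : ∀ i j (hij : i ≤ j) t, (Sq' i).TotBdd t → (Sq' j).TotBdd ((ρ i j hij).tot t) :=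
    fun i j hij t ht => ⟨isBdd_familyMap _ ht.1, isBdd_familyMap _ ht.2.1,
      isBdd_familyMap _ ht.2.2.1, isBdd_familyMap _ ht.2.2.2⟩
  intro t ht htD
  obtain ⟨i, t', ht', hti⟩ : ∃ i, ∃ t' : (Sq' i).Tot, (Sq' i).TotBdd t' ∧ (ι i).tot t' = t := by
    obtain ⟨i₁, p, hpb, hp⟩ := hP.family_exists_rep ht.1
    obtain ⟨i₂, r₁, hr₁b, hr₁⟩ := hR₁.family_exists_rep ht.2.1
    obtain ⟨i₃, r₂, hr₂b, hr₂⟩ := hR₂.family_exists_rep ht.2.2.1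
    obtain ⟨i₄, s, hsb, hs⟩ := hS.family_exists_rep ht.2.2.2
    obtain ⟨j, hj₁, hj₂⟩ := exists_ge_ge i₁ i₂
    obtain ⟨k, hk₁, hk₂⟩ := exists_ge_ge i₃ i₄
    obtain ⟨l, hl₁, hl₂⟩ := exists_ge_ge j k
    refine ⟨l, (familyMap (ρ i₁ l (hj₁.trans hl₁)).P p, familyMap (ρ i₂ l (hj₂.trans hl₁)).R₁ r₁,
      familyMap (ρ i₃ l (hk₁.trans hl₂)).R₂ r₂, familyMap (ρ i₄ l (hk₂.trans hl₂)).S s),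
      ⟨isBdd_familyMap _ hpb, isBdd_familyMap _ hr₁b, isBdd_familyMap _ hr₂b,
        isBdd_familyMap _ hsb⟩, ?_⟩
    exact Prod.ext ((hP.family_comp _ _).trans hp) (Prod.ext ((hR₁.family_comp _ _).trans hr₁)
      (Prod.ext ((hR₂.family_comp _ _).trans hr₂) ((hS.family_comp _ _).trans hs)))
  -- The representative is a cycle only in the colimit; it becomes a cycle at a later index.
  obtain ⟨j, hij, hj⟩ : ∃ (j : I) (hij : i ≤ j), (ρ i j hij).tot ((Sq' i).totD t') = 0 := by
    have hb := totBdd_totD ht'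
    have h0 : (ι i).tot ((Sq' i).totD t') = 0 := by rw [Hom.tot_totD, hti, htD]
    simp only [Hom.tot_mk, Prod.mk_eq_zero] at h0
    obtain ⟨j₁, h₁, e₁⟩ := hP.family_eq_zero hb.1 h0.1
    obtain ⟨j₂, h₂, e₂⟩ := hR₁.family_eq_zero hb.2.1 h0.2.1
    obtain ⟨j₃, h₃, e₃⟩ := hR₂.family_eq_zero hb.2.2.1 h0.2.2.1
    obtain ⟨j₄, h₄, e₄⟩ := hS.family_eq_zero hb.2.2.2 h0.2.2.2
    obtain ⟨j, hj₁, hj₂⟩ := exists_ge_ge j₁ j₂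
    obtain ⟨k, hk₁, hk₂⟩ := exists_ge_ge j₃ j₄
    obtain ⟨l, hl₁, hl₂⟩ := exists_ge_ge j k
    refine ⟨l, h₁.trans (hj₁.trans hl₁), ?_⟩
    rw [Hom.tot_mk, Prod.mk_eq_zero, Prod.mk_eq_zero, Prod.mk_eq_zero]
    refine ⟨?_, ?_, ?_, ?_⟩
    · rw [← hP.family_map_comp h₁ (hj₁.trans hl₁), e₁, map_zero]
    · rw [← hR₁.family_map_comp h₂ (hj₂.trans hl₁), e₂, map_zero]
    · rw [← hR₂.family_map_comp h₃ (hk₁.trans hl₂), e₃, map_zero]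
    · rw [← hS.family_map_comp h₄ (hk₂.trans hl₂), e₄, map_zero]
  obtain ⟨w, hw⟩ := h j ((ρ i j hij).tot t') (hbdd _ _ _ _ ht') (by rw [← Hom.tot_totD, hj])
  exact ⟨(ι j).tot w, by rw [← Hom.tot_totD, hw, hcomp, hti]⟩

namespace ComplexSquare

/-- If the target of an acyclic square and one of its middle terms vanish, then the opposite
side induces isomorphisms in homology. -/
lemma Acyclic.bijective_of_subsingleton' {Sq : ComplexSquare.{u} R c} (h : Sq.Acyclic)
    (hS : ∀ q, Subsingleton (Sq.S.X q)) (hR : ∀ q, Subsingleton (Sq.R₁.X q)) (q : ℕ) :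
    Function.Bijective (homologyMap Sq.f₂ q).hom := by
  have hR' : Subsingleton (Sq.R₁.homology q) :=
    (homologyClass_surjective (C := Sq.R₁) q).subsingleton
  have hS' : ∀ q, Subsingleton (Sq.S.homology q) := fun q =>
    (homologyClass_surjective (C := Sq.S) q).subsingleton
  have key : ∀ x, Sq.homF q x = (0, -(homologyMap Sq.f₂ q).hom x) := fun x =>
    Prod.ext (Subsingleton.elim _ _) rfl
  have hinj : Function.Injective (Sq.homF q) := by
    by_cases hq : ∃ i, c.Rel i q
    · obtain ⟨i, hi⟩ := hq
      obtain ⟨δ, -, h2⟩ := h.exists_delta hi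
      refine (injective_iff_map_eq_zero _).2 fun x hx => ?_
      obtain ⟨y, rfl⟩ := (h2 x).1 hx
      rw [(hS' i).elim y 0, map_zero]
    · push Not at hq
      exact h.injective_homF hq
  constructor
  · intro x y hxy
    exact hinj (by rw [key, key, hxy])
  · intro y
    obtain ⟨x, hx⟩ := (h.exact_homF_homG q (0, -y)).1 ((hS' q).elim _ _)
    rw [key] at hx
    exact ⟨x, neg_injective (congrArg Prod.snd hx)⟩

end ComplexSquare

end Systems

/-! ### Affine maps of standard simplices -/

namespace stdSimplex

variable {m n q : ℕ}

/-- The affine map of standard simplices with given values at the vertices. -/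
noncomputable def affine (v : Fin (m + 1) → stdSimplex ℝ (Fin (q + 1)))
    (t : stdSimplex ℝ (Fin (m + 1))) : stdSimplex ℝ (Fin (q + 1)) :=
  ⟨fun k => ∑ i, t i * v i k, fun k => Finset.sum_nonneg fun i _ =>
      mul_nonneg (t.2.1 i) ((v i).2.1 k), by
    rw [Finset.sum_comm]
    simp_rw [← Finset.mul_sum, sum_eq_one, mul_one]
    exact t.2.2⟩

lemma affine_apply (v : Fin (m + 1) → stdSimplex ℝ (Fin (q + 1)))
    (t : stdSimplex ℝ (Fin (m + 1))) (k : Fin (q + 1)) : affine v t k = ∑ i, t i * v i k := rfl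

lemma vertex_apply (i k : Fin (q + 1)) :
    (vertex i : stdSimplex ℝ (Fin (q + 1))) k = if k = i then 1 else 0 := by
  rw [vertex_coe, Pi.single_apply]

lemma affine_vertex (v : Fin (m + 1) → stdSimplex ℝ (Fin (q + 1))) (i : Fin (m + 1)) :
    affine v (vertex i) = v i := by
  refine stdSimplex.ext (funext fun k => ?_)
  simp [affine_apply, vertex_apply]

lemma affine_vertices (t : stdSimplex ℝ (Fin (q + 1))) : affine vertex t = t := by
  refine stdSimplex.ext (funext fun k => ?_)
  simp [affine_apply, vertex_apply]

lemma affine_affine (v : Fin (m + 1) → stdSimplex ℝ (Fin (q + 1)))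
    (w : Fin (n + 1) → stdSimplex ℝ (Fin (m + 1))) (t : stdSimplex ℝ (Fin (n + 1))) :
    affine v (affine w t) = affine (affine v ∘ w) t := by
  refine stdSimplex.ext (funext fun k => ?_)
  simp only [affine_apply, Function.comp_apply, Finset.sum_mul, Finset.mul_sum, mul_assoc]
  exact Finset.sum_comm

lemma map_eq_affine (f : Fin (m + 1) → Fin (q + 1)) (t : stdSimplex ℝ (Fin (m + 1))) :
    map f t = affine (fun i => vertex (f i)) t := by
  refine stdSimplex.ext (funext fun k => ?_)
  rw [map_coe, FunOnFinite.linearMap_apply_apply, affine_apply, Finset.sum_filter]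
  simp [vertex_apply, eq_comm]

lemma map_affine (f : Fin (q + 1) → Fin (n + 1)) (v : Fin (m + 1) → stdSimplex ℝ (Fin (q + 1)))
    (t : stdSimplex ℝ (Fin (m + 1))) : map f (affine v t) = affine (map f ∘ v) t := by
  rw [map_eq_affine, affine_affine]
  congr 1
  funext i
  exact (map_eq_affine f (v i)).symm

lemma affine_map (f : Fin (n + 1) → Fin (m + 1)) (v : Fin (m + 1) → stdSimplex ℝ (Fin (q + 1)))
    (t : stdSimplex ℝ (Fin (n + 1))) : affine v (map f t) = affine (v ∘ f) t := by
  rw [map_eq_affine, affine_affine]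
  congr 1
  funext i
  exact affine_vertex v (f i)

lemma continuous_affine (v : Fin (m + 1) → stdSimplex ℝ (Fin (q + 1))) :
    Continuous (affine v) := by
  refine Continuous.subtype_mk (continuous_pi fun k => continuous_finsetSum _ fun i _ => ?_) _
  exact ((continuous_apply i).comp continuous_subtype_val).mul continuous_const

lemma bary_nonempty (t : stdSimplex ℝ (Fin (q + 1))) :
    (OpenFaceStructure.bary t).Nonempty := by
  by_contra h
  have h0 : ∀ i, t i = 0 := by
    simpa [OpenFaceStructure.bary, Finset.filter_eq_empty_iff] using h
  have := sum_eq_one t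
  simp [h0] at this

/-- A sum of nonnegative terms vanishes only if each term does, so supports cannot cancel.
Consequently an affine map sends the relative interior of a face into the relative interior of one
face, which controls both strata and allowability of subdivided simplices. -/
lemma bary_affine (v : Fin (m + 1) → stdSimplex ℝ (Fin (q + 1)))
    (t : stdSimplex ℝ (Fin (m + 1))) : OpenFaceStructure.bary (affine v t) =
      (OpenFaceStructure.bary t).biUnion fun i => OpenFaceStructure.bary (v i) := by
  ext k
  have h : affine v t k = 0 ↔ ∀ i, t i = 0 ∨ v i k = 0 := by
    rw [affine_apply, Finset.sum_eq_zero_iff_of_nonneg fun i _ =>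
      mul_nonneg (zero_le t i) (zero_le (v i) k)]
    simp
  simp only [OpenFaceStructure.bary, Finset.mem_filter, Finset.mem_univ, true_and,
    Finset.mem_biUnion, ne_eq, h]
  push Not
  rfl

/-- The value at `t` of the affine function with given values at the vertices. -/
noncomputable def eval (w : Fin (q + 1) → ℝ) (t : stdSimplex ℝ (Fin (q + 1))) : ℝ :=
  ∑ i, t i * w i

lemma eval_map (w : Fin (q + 1) → ℝ) (f : Fin (m + 1) → Fin (q + 1))
    (t : stdSimplex ℝ (Fin (m + 1))) : eval w (map f t) = eval (w ∘ f) t := by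
  rw [map_eq_affine]
  simp only [eval, affine_apply, Finset.sum_mul, mul_assoc, vertex_apply]
  rw [Finset.sum_comm]
  simp

lemma abs_sub_eval_le {w : Fin (q + 1) → ℝ} {c M : ℝ} (h : ∀ i, |c - w i| ≤ M)
    (t : stdSimplex ℝ (Fin (q + 1))) : |c - eval w t| ≤ M := by
  have h1 : c - eval w t = ∑ i, t i * (c - w i) := by
    simp_rw [mul_sub, Finset.sum_sub_distrib, ← Finset.sum_mul, sum_eq_one, one_mul]
    rfl
  rw [h1]
  calc |∑ i, t i * (c - w i)| ≤ ∑ i, |t i * (c - w i)| := Finset.abs_sum_le_sum_abs _ _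
    _ ≤ ∑ i, t i * M := Finset.sum_le_sum fun i _ => by
        rw [abs_mul, abs_of_nonneg (zero_le t i)]
        exact mul_le_mul_of_nonneg_left (h i) (t.2.1 i)
    _ = M := by rw [← Finset.sum_mul, sum_eq_one, one_mul]

/-- The difference is the average of q + 1 differences of vertex values. The one with index `i` is
zero, whence the contraction factor q / (q + 1). -/
lemma abs_eval_barycenter_sub_le {w : Fin (q + 1) → ℝ} {M : ℝ} (h : ∀ i j, |w i - w j| ≤ M)
    (i : Fin (q + 1)) : |eval w barycenter - w i| ≤ q / (q + 1) * M := by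
  have hb : eval w barycenter - w i = ∑ j, (w j - w i) / (q + 1) := by
    have : ((q : ℝ) + 1) ≠ 0 := by positivity
    have hb : ∀ j, (barycenter : stdSimplex ℝ (Fin (q + 1))) j = ((q : ℝ) + 1)⁻¹ := fun j => by
      refine (barycenter_apply j).trans ?_
      rw [Fintype.card_fin, Nat.cast_succ]
    simp only [eval, hb, ← Finset.sum_div, Finset.sum_sub_distrib,
      Finset.sum_const, Finset.card_univ, nsmul_eq_mul, ← Finset.mul_sum, Fintype.card_fin]
    push_cast
    field_simp
  rw [hb]
  calc |∑ j, (w j - w i) / (q + 1)| ≤ ∑ j, |(w j - w i) / (q + 1)| :=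
        Finset.abs_sum_le_sum_abs _ _
    _ ≤ ∑ j, if j = i then 0 else M / (q + 1) := Finset.sum_le_sum fun j _ => by
        split_ifs with hj
        · simp [hj]
        · rw [abs_div, abs_of_pos (by positivity : (0 : ℝ) < q + 1)]
          exact div_le_div_of_nonneg_right (h j i) (by positivity)
    _ = q / (q + 1) * M := by
        rw [Finset.sum_ite, Finset.sum_const_zero, zero_add, Finset.sum_const,
          Finset.filter_ne' , Finset.card_erase_of_mem (Finset.mem_univ _), nsmul_eq_mul]
        simp
        ring

end stdSimplex

/-! ### Affine chains and cones -/

/-- Formal integral combinations of `(m + 1)`-tuples of points: affine `m`-chains. -/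
abbrev AffineChain (E : Type*) (m : ℕ) : Type _ := (Fin (m + 1) → E) →₀ ℤ

namespace AffineChain

variable {E : Type*}

/-- The boundary of an affine chain. -/
noncomputable def bdry (E : Type*) (m : ℕ) : AffineChain E (m + 1) →ₗ[ℤ] AffineChain E m :=
  ∑ j : Fin (m + 2), (-1 : ℤ) ^ (j : ℕ) • Finsupp.lmapDomain ℤ ℤ fun v => v ∘ j.succAbove

/-- The cone over an affine chain, with the apex as the first vertex. -/
noncomputable def cone (b : E) (m : ℕ) : AffineChain E m →ₗ[ℤ] AffineChain E (m + 1) :=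
  Finsupp.lmapDomain ℤ ℤ fun v => (Fin.cons b v : Fin (m + 2) → E)

lemma cons_comp_succAbove (b : E) {m : ℕ} (v : Fin (m + 2) → E) (j : Fin (m + 2)) :
    (Fin.cons b v : Fin (m + 3) → E) ∘ j.succ.succAbove = Fin.cons b (v ∘ j.succAbove) := by
  funext i
  cases i using Fin.cases <;> simp

lemma bdry_single {m : ℕ} (v : Fin (m + 2) → E) (a : ℤ) : bdry E m (Finsupp.single v a) =
    ∑ j : Fin (m + 2), (-1 : ℤ) ^ (j : ℕ) • Finsupp.single (v ∘ j.succAbove) a := by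
  simp [bdry, LinearMap.sum_apply, Finsupp.mapDomain_single]

lemma cone_single (b : E) {m : ℕ} (v : Fin (m + 1) → E) (a : ℤ) :
    cone b m (Finsupp.single v a) = Finsupp.single (Fin.cons b v) a := by
  simp [cone, Finsupp.mapDomain_single]

/-- The apex being the first vertex, the face opposite to it returns the chain with sign +1, and the
other faces are cones with the index, hence the sign, shifted by one. -/
lemma bdry_cone (b : E) {m : ℕ} (c : AffineChain E (m + 1)) :
    bdry E (m + 1) (cone b (m + 1) c) = c - cone b m (bdry E m c) := by
  suffices h : bdry E (m + 1) ∘ₗ cone b (m + 1) = LinearMap.id - cone b m ∘ₗ bdry E m from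
    LinearMap.congr_fun h c
  refine Finsupp.lhom_ext fun v a => ?_
  simp only [LinearMap.comp_apply, LinearMap.sub_apply, LinearMap.id_apply, cone_single,
    bdry_single, map_sum, map_smul]
  rw [Fin.sum_univ_succ, sub_eq_add_neg, ← Finset.sum_neg_distrib]
  congr 1
  · simp only [Fin.val_zero, pow_zero, one_smul]
    congr 1
  · refine Finset.sum_congr rfl fun j _ => ?_
    rw [cons_comp_succAbove, Fin.val_succ, pow_succ, mul_neg_one, neg_smul]

/-- In degree 0 the second face of a cone is the apex itself, so the correction term is the
augmentation of the chain times the apex. -/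
lemma bdry_cone_zero (b : E) (c : AffineChain E 0) : bdry E 0 (cone b 0 c) =
    c - Finsupp.linearCombination ℤ (fun _ => Finsupp.single (fun _ => b) 1) c := by
  suffices h : bdry E 0 ∘ₗ cone b 0 = LinearMap.id -
      Finsupp.linearCombination ℤ (fun _ => Finsupp.single (fun _ => b) 1) from
    LinearMap.congr_fun h c
  refine Finsupp.lhom_ext fun v a => ?_
  rw [LinearMap.comp_apply, LinearMap.sub_apply, LinearMap.id_apply, cone_single, bdry_single,
    Finsupp.linearCombination_single, Fin.sum_univ_two]
  have h0 : (Fin.cons b v : Fin 2 → E) ∘ (0 : Fin 2).succAbove = v := by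
    funext i
    fin_cases i
    rfl
  have h1 : (Fin.cons b v : Fin 2 → E) ∘ (1 : Fin 2).succAbove = fun _ => b := by
    funext i
    fin_cases i
    rfl
  rw [h0, h1]
  simp [sub_eq_add_neg]

end AffineChain

/-! ### Barycentric subdivision of the standard simplex -/

namespace AffineChain

/-- The alternating sum of the pushforwards of an affine chain to the faces of the standard simplex
of the next dimension. -/
noncomputable def faceSum (q m : ℕ) : AffineChain (stdSimplex ℝ (Fin (q + 1))) m →ₗ[ℤ]
    AffineChain (stdSimplex ℝ (Fin (q + 2))) m :=
  ∑ j : Fin (q + 2), (-1 : ℤ) ^ (j : ℕ) •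
    Finsupp.lmapDomain ℤ ℤ fun v => stdSimplex.map j.succAbove ∘ v

lemma faceSum_single {q m : ℕ} (v : Fin (m + 1) → stdSimplex ℝ (Fin (q + 1))) (a : ℤ) :
    faceSum q m (Finsupp.single v a) = ∑ j : Fin (q + 2), (-1 : ℤ) ^ (j : ℕ) •
      Finsupp.single (stdSimplex.map j.succAbove ∘ v) a := by
  simp [faceSum, LinearMap.sum_apply, Finsupp.mapDomain_single]

lemma bdry_faceSum {q m : ℕ} (c : AffineChain (stdSimplex ℝ (Fin (q + 1))) (m + 1)) :
    bdry _ m (faceSum q (m + 1) c) = faceSum q m (bdry _ m c) := by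
  suffices h : bdry _ m ∘ₗ faceSum q (m + 1) = faceSum q m ∘ₗ bdry _ m from LinearMap.congr_fun h c
  refine Finsupp.lhom_ext fun v a => ?_
  simp only [LinearMap.comp_apply, faceSum_single, bdry_single, map_sum, map_smul,
    Finset.smul_sum]
  rw [Finset.sum_comm]
  exact Finset.sum_congr rfl fun i _ => Finset.sum_congr rfl fun j _ => smul_comm _ _ _

/-- The inclusions of faces satisfy the cosimplicial identities, in which compositions appear in the
opposite order. Precomposition with them reverses the order again and makes the alternating sum
lemma for face operators applicable. -/
lemma faceSum_faceSum {q m : ℕ} (c : AffineChain (stdSimplex ℝ (Fin (q + 1))) m) :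
    faceSum (q + 1) m (faceSum q m c) = 0 := by
  let d (k : ℕ) (j : Fin (k + 2)) : AffineChain (stdSimplex ℝ (Fin (k + 1))) m →ₗ[ℤ]
    AffineChain (stdSimplex ℝ (Fin (k + 2))) m :=
    Finsupp.lmapDomain ℤ ℤ fun v => stdSimplex.map j.succAbove ∘ v
  have h := alternating_sum_comp_eq_zero
    (fun j => LinearMap.lcomp ℤ (AffineChain (stdSimplex ℝ (Fin (q + 3))) m) (d (q + 1) j))
    (fun i => LinearMap.lcomp ℤ (AffineChain (stdSimplex ℝ (Fin (q + 3))) m) (d q i))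
    (fun i j hij x => by
      have : d (q + 1) j.succ ∘ₗ d q i = d (q + 1) i.castSucc ∘ₗ d q j := by
        refine Finsupp.lhom_ext fun v a => ?_
        simp only [d, LinearMap.comp_apply, Finsupp.lmapDomain_apply, Finsupp.mapDomain_single]
        congr 1
        funext l
        simp only [Function.comp_apply]
        rw [stdSimplex.map_comp_apply, stdSimplex.map_comp_apply]
        congr 1
        funext k
        exact congrArg (fun f => f.toOrderHom k) (SimplexCategory.δ_comp_δ hij)
      exact congrArg (fun f => x ∘ₗ f) this) LinearMap.id
  have h' := LinearMap.congr_fun h c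
  simp only [LinearMap.sum_apply, LinearMap.smul_apply, LinearMap.lcomp_apply,
    LinearMap.id_apply, LinearMap.zero_apply] at h'
  simpa only [faceSum, LinearMap.sum_apply, LinearMap.smul_apply, map_sum, map_smul] using h'

/-- The identity of the standard simplex as an affine chain. -/
noncomputable def ident (q : ℕ) : AffineChain (stdSimplex ℝ (Fin (q + 1))) q :=
  Finsupp.single stdSimplex.vertex 1

/-- Chains on simplices act on all singular simplices at once, so naturality of an operation is
expressed by `faceSum`. This is the case of the identity operation. -/
lemma bdry_ident (q : ℕ) : bdry _ q (ident (q + 1)) = faceSum q q (ident q) := by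
  rw [ident, bdry_single, ident, faceSum_single]
  refine Finset.sum_congr rfl fun j _ => ?_
  congr 2
  funext i
  exact (stdSimplex.map_vertex _ _).symm

/-- The barycentric subdivision of the standard simplex. -/
noncomputable def sd : (q : ℕ) → AffineChain (stdSimplex ℝ (Fin (q + 1))) q
  | 0 => ident 0
  -- The barycenter comes first, so the last vertex of every simplex of the subdivision is a vertex
  -- of the original simplex.
  | q + 1 => cone stdSimplex.barycenter q (faceSum q q (sd q))

/-- The chain homotopy from the barycentric subdivision to the identity. -/
noncomputable def sdHomotopy : (q : ℕ) → AffineChain (stdSimplex ℝ (Fin (q + 1))) (q + 1)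
  | 0 => 0
  | q + 1 => cone stdSimplex.barycenter (q + 1)
      (ident (q + 1) - faceSum q (q + 1) (sdHomotopy q))

/-- This makes subdivision a chain map. The chain that is coned is a cycle because `faceSum` squares
to zero; in the lowest degree the apex terms of the two endpoints cancel. -/
lemma bdry_sd : ∀ q : ℕ, bdry _ q (sd (q + 1)) = faceSum q q (sd q)
  | 0 => by
    refine (bdry_cone_zero _ _).trans (sub_eq_self.2 ?_)
    rw [sd, ident, faceSum_single, map_sum]
    simp [Fin.sum_univ_two]
  | q + 1 => by
    rw [sd, bdry_cone, bdry_faceSum, bdry_sd q, faceSum_faceSum, map_zero, sub_zero]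

lemma bdry_sdHomotopy_zero : bdry _ 0 (sdHomotopy 0) = ident 0 - sd 0 := by
  rw [sdHomotopy, map_zero, sd, sub_self]

/-- The chain that is coned has boundary `faceSum` of the previous subdivision, and the cone over
this is the next subdivision. -/
lemma bdry_sdHomotopy : ∀ q : ℕ, bdry _ (q + 1) (sdHomotopy (q + 1)) =
    ident (q + 1) - sd (q + 1) - faceSum q (q + 1) (sdHomotopy q)
  | 0 => by
    have h : sdHomotopy 1 = cone stdSimplex.barycenter 1 (ident 1 - faceSum 0 1 (sdHomotopy 0)) :=
      rfl
    rw [h, bdry_cone, map_sub, bdry_ident, bdry_faceSum, bdry_sdHomotopy_zero]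
    simp only [map_sub, sub_sub_cancel]
    exact sub_right_comm _ _ _
  | q + 1 => by
    rw [sdHomotopy, bdry_cone, map_sub, bdry_ident, bdry_faceSum, bdry_sdHomotopy q,
      map_sub (faceSum _ _), map_sub (faceSum _ _), faceSum_faceSum, sub_zero, sub_sub_cancel,
      sd]
    abel

lemma cone_mem_supported {E : Type*} {b : E} {m : ℕ} {c : AffineChain E m}
    {s : Set (Fin (m + 2) → E)} {t : Set (Fin (m + 1) → E)} (hc : c ∈ Finsupp.supported ℤ ℤ t)
    (h : ∀ v ∈ t, (Fin.cons b v : Fin (m + 2) → E) ∈ s) :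
    cone b m c ∈ Finsupp.supported ℤ ℤ s :=
  Finsupp.supported_comap_lmapDomain ℤ ℤ _ _ (Finsupp.supported_mono (fun v hv => h v hv) hc)

lemma faceSum_mem_supported {q m : ℕ} {c : AffineChain (stdSimplex ℝ (Fin (q + 1))) m}
    {s : Set (Fin (m + 1) → stdSimplex ℝ (Fin (q + 2)))}
    {t : Set (Fin (m + 1) → stdSimplex ℝ (Fin (q + 1)))} (hc : c ∈ Finsupp.supported ℤ ℤ t)
    (h : ∀ v ∈ t, ∀ j : Fin (q + 2), stdSimplex.map j.succAbove ∘ v ∈ s) :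
    faceSum q m c ∈ Finsupp.supported ℤ ℤ s := by
  rw [faceSum, LinearMap.sum_apply]
  refine Submodule.sum_mem _ fun j _ => ?_
  rw [LinearMap.smul_apply]
  exact Submodule.smul_mem _ _ (Finsupp.supported_comap_lmapDomain ℤ ℤ _ _
    (Finsupp.supported_mono (fun v hv => h v hv j) hc))

lemma ident_mem_supported (q : ℕ) : ident q ∈ Finsupp.supported ℤ ℤ {stdSimplex.vertex} :=
  Finsupp.single_mem_supported ℤ 1 rfl

/-- The vertices of the smallest face containing the points of a tuple with index in `s`. -/
noncomputable def carrier {m q : ℕ} (v : Fin (m + 1) → stdSimplex ℝ (Fin (q + 1)))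
    (s : Finset (Fin (m + 1))) : Finset (Fin (q + 1)) :=
  s.biUnion fun i => OpenFaceStructure.bary (v i)

lemma card_carrier_map {m q : ℕ} (v : Fin (m + 1) → stdSimplex ℝ (Fin (q + 1)))
    (j : Fin (q + 2)) (s : Finset (Fin (m + 1))) :
    (carrier (stdSimplex.map j.succAbove ∘ v) s).card = (carrier v s).card := by
  have : carrier (stdSimplex.map j.succAbove ∘ v) s = (carrier v s).map (Fin.succAboveEmb j) := by
    rw [carrier, carrier, Finset.map_eq_image, Finset.biUnion_image]
    refine Finset.biUnion_congr rfl fun i _ => ?_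
    rw [Function.comp_apply, OpenFaceStructure.Simplex.bary_map, Finset.map_eq_image]
  rw [this, Finset.card_map]

lemma carrier_vertex (q : ℕ) (s : Finset (Fin (q + 1))) :
    carrier (stdSimplex.vertex : Fin (q + 1) → stdSimplex ℝ (Fin (q + 1))) s = s := by
  ext k
  simp [carrier, OpenFaceStructure.bary, stdSimplex.vertex_apply]

lemma card_carrier_cons_of_mem {m q : ℕ} (v : Fin (m + 1) → stdSimplex ℝ (Fin (q + 1)))
    {s : Finset (Fin (m + 2))} (h : 0 ∈ s) :
    (carrier (Fin.cons stdSimplex.barycenter v : Fin (m + 2) → _) s).card = q + 1 := by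
  have : carrier (Fin.cons stdSimplex.barycenter v : Fin (m + 2) → _) s = Finset.univ := by
    refine Finset.eq_univ_of_forall fun k => Finset.mem_biUnion.2 ⟨0, h, ?_⟩
    rw [Fin.cons_zero, OpenFaceStructure.Simplex.bary_barycenter]
    exact Finset.mem_univ k
  rw [this, Finset.card_univ, Fintype.card_fin]

lemma exists_eq_map_succ {m : ℕ} {s : Finset (Fin (m + 2))} (h : 0 ∉ s) :
    ∃ s' : Finset (Fin (m + 1)), s = s'.map (Fin.succEmb _) := by
  refine ⟨Finset.univ.filter fun i => i.succ ∈ s, ?_⟩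
  ext k
  cases k using Fin.cases with
  | zero => simp [h]
  | succ k => simp

lemma carrier_cons_map {m q : ℕ} (b : stdSimplex ℝ (Fin (q + 1)))
    (v : Fin (m + 1) → stdSimplex ℝ (Fin (q + 1))) (s : Finset (Fin (m + 1))) :
    carrier (Fin.cons b v : Fin (m + 2) → _) (s.map (Fin.succEmb _)) = carrier v s := by
  rw [carrier, Finset.map_eq_image, Finset.image_biUnion]
  rfl

/-- The tuples of points of a simplex such that the dimensions of the faces of the tuple are at most
those of the faces of the simplex that carry them, and strictly less if the last point is
omitted. -/
def subdivided (q : ℕ) : Set (Fin (q + 1) → stdSimplex ℝ (Fin (q + 1))) :=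
  {v | ∀ s : Finset (Fin (q + 1)), s.Nonempty → s.card ≤ (carrier v s).card ∧
    (Fin.last q ∉ s → s.card + 1 ≤ (carrier v s).card)}

/-- A simplex of the subdivision corresponds to a descending flag of faces, with their barycenters
as vertices. The vertices with index in `s` span a simplex interior to the largest of their faces,
and a strictly descending chain of faces bounds its dimension from below. If the last member of the
flag, a point, is omitted, one dimension is gained. In the induction, either the barycenter belongs
to `s` and the carrier is everything, or the question lies in a facet. -/
lemma sd_mem_supported : ∀ q : ℕ, sd q ∈ Finsupp.supported ℤ ℤ (subdivided q)
  | 0 => by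
    refine Finsupp.supported_mono (Set.singleton_subset_iff.2 fun s hs => ?_) (ident_mem_supported 0)
    rw [carrier_vertex]
    refine ⟨le_rfl, fun h => absurd ?_ h⟩
    obtain ⟨i, hi⟩ := hs
    rwa [Fin.eq_zero i] at hi
  | q + 1 => by
    refine cone_mem_supported (t := {v | ∃ w ∈ subdivided q, ∃ j : Fin (q + 2),
      v = stdSimplex.map j.succAbove ∘ w})
      (faceSum_mem_supported (sd_mem_supported q) fun v hv j => ⟨v, hv, j, rfl⟩) ?_
    rintro _ ⟨w, hw, j, rfl⟩ s hs
    by_cases h0 : 0 ∈ s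
    · rw [card_carrier_cons_of_mem _ h0]
      refine ⟨(Finset.card_le_univ s).trans (Fintype.card_fin _).le, fun hl => ?_⟩
      have := Finset.card_lt_univ_of_notMem hl
      rw [Fintype.card_fin] at this
      exact this
    · obtain ⟨s, rfl⟩ := exists_eq_map_succ h0
      rw [carrier_cons_map, card_carrier_map, Finset.card_map]
      obtain ⟨h1, h2⟩ := hw s (Finset.map_nonempty.1 hs)
      refine ⟨h1, fun hl => h2 fun h => hl ?_⟩
      exact Finset.mem_map.2 ⟨_, h, Fin.succ_last q⟩

/-- Here simplices of dimension q + 1 lie in a simplex of dimension q. The loss of one dimension in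
the carrier is exactly what allowability tolerates, since the admissible skeleton also grows by one.
-/
lemma sdHomotopy_mem_supported : ∀ q : ℕ, sdHomotopy q ∈ Finsupp.supported ℤ ℤ
    {v | ∀ s : Finset (Fin (q + 2)), s.card ≤ (carrier v s).card + 1}
  | 0 => Submodule.zero_mem _
  | q + 1 => by
    refine cone_mem_supported (t := {v | ∀ s : Finset (Fin (q + 2)), s.card ≤
      (carrier v s).card + 1}) (Submodule.sub_mem _ ?_ ?_) ?_
    · refine Finsupp.supported_mono (Set.singleton_subset_iff.2 fun s => ?_)
        (ident_mem_supported (q + 1))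
      rw [carrier_vertex]
      exact Nat.le_succ _
    · refine faceSum_mem_supported (sdHomotopy_mem_supported q) fun v hv j s => ?_
      rw [card_carrier_map]
      exact hv s
    · intro v hv s
      by_cases h0 : 0 ∈ s
      · rw [card_carrier_cons_of_mem _ h0]
        exact (Finset.card_le_univ s).trans (Fintype.card_fin _).le
      · obtain ⟨s, rfl⟩ := exists_eq_map_succ h0
        rw [carrier_cons_map, Finset.card_map]
        exact hv s

/-- The simplices of the barycentric subdivision are smaller by a constant factor. -/
lemma sd_mem_supported_small : ∀ q : ℕ, sd q ∈ Finsupp.supported ℤ ℤ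
    {v | ∀ (w : Fin (q + 1) → ℝ) (M : ℝ), (∀ i j, |w i - w j| ≤ M) →
      ∀ i j, |stdSimplex.eval w (v i) - stdSimplex.eval w (v j)| ≤ q / (q + 1) * M}
  | 0 => by
    refine Finsupp.supported_mono (Set.singleton_subset_iff.2 fun w M hM i j => ?_)
      (ident_mem_supported 0)
    rw [Fin.eq_zero i, Fin.eq_zero j]
    simp
  | q + 1 => by
    refine cone_mem_supported (t := {v | ∀ (w : Fin (q + 2) → ℝ) (M : ℝ),
        (∀ i j, |w i - w j| ≤ M) → ∀ i j,
        |stdSimplex.eval w (v i) - stdSimplex.eval w (v j)| ≤ (q + 1) / (q + 2) * M})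
      (faceSum_mem_supported (sd_mem_supported_small q) fun v hv j w M hM i i' => ?_) ?_
    · have h := hv (w ∘ j.succAbove) M (fun _ _ => hM _ _) i i'
      rw [Function.comp_apply, Function.comp_apply, stdSimplex.eval_map, stdSimplex.eval_map]
      -- A facet contracts by q / (q + 1), which is at most the factor (q + 1) / (q + 2) required of
      -- the whole simplex.
      refine h.trans (mul_le_mul_of_nonneg_right ?_ ((abs_nonneg _).trans (hM 0 0)))
      rw [div_le_div_iff₀ (by positivity) (by positivity)]
      nlinarith
    · intro v hv w M hM
      have hM0 : 0 ≤ M := (abs_nonneg _).trans (hM 0 0)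
      have hb : ∀ t, |stdSimplex.eval w stdSimplex.barycenter - stdSimplex.eval w t| ≤
          ((q + 1 : ℕ) : ℝ) / ((q + 1 : ℕ) + 1) * M :=
        stdSimplex.abs_sub_eval_le (stdSimplex.abs_eval_barycenter_sub_le hM)
      have hq : ((q + 1 : ℕ) : ℝ) / ((q + 1 : ℕ) + 1) = (q + 1) / (q + 2) := by
        push_cast
        ring
      intro i j
      cases i using Fin.cases with
      | zero =>
        cases j using Fin.cases with
        | zero =>
          rw [sub_self, abs_zero]
          positivity
        | succ j => exact hb _
      | succ i =>
        cases j using Fin.cases with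
        | zero =>
          rw [abs_sub_comm]
          exact hb _
        | succ j =>
          rw [hq]
          exact hv w M hM i j

end AffineChain

/-! ### Composition of stratified simplices with affine maps -/

namespace OpenFaceStructure

open TropSpace

variable {X : Type u} [TopologicalSpace X] {𝒜 : PolyAtlas X} {𝒞 : OpenFaceStructure 𝒜}

namespace Simplex

variable {m n q : ℕ}

/-- The composition of a simplex with an affine map of standard simplices. -/
noncomputable def comp (δ : 𝒞.Simplex q) (v : Fin (m + 1) → stdSimplex ℝ (Fin (q + 1))) :
    𝒞.Simplex m where
  toFun := δ.toFun.comp ⟨stdSimplex.affine v, stdSimplex.continuous_affine v⟩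
  stratified s hs := by
    obtain ⟨τ, hτ, h⟩ := δ.stratified (s.biUnion fun i => bary (v i))
      (hs.biUnion fun i _ => stdSimplex.bary_nonempty (v i))
    exact ⟨τ, hτ, fun t ht => h _ (by rw [← ht]; exact stdSimplex.bary_affine v t)⟩

lemma comp_apply (δ : 𝒞.Simplex q) (v : Fin (m + 1) → stdSimplex ℝ (Fin (q + 1)))
    (t : stdSimplex ℝ (Fin (m + 1))) : (δ.comp v).toFun t = δ.toFun (stdSimplex.affine v t) := rfl

lemma face_apply (δ : 𝒞.Simplex (q + 1)) (j : Fin (q + 2)) (t : stdSimplex ℝ (Fin (q + 1))) :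
    (δ.face j).toFun t = δ.toFun (stdSimplex.map j.succAbove t) := rfl

lemma comp_face (δ : 𝒞.Simplex q) (v : Fin (m + 2) → stdSimplex ℝ (Fin (q + 1)))
    (j : Fin (m + 2)) : (δ.comp v).face j = δ.comp (v ∘ j.succAbove) :=
  ext' fun t => by rw [face_apply, comp_apply, comp_apply, stdSimplex.affine_map]

lemma face_comp (δ : 𝒞.Simplex (q + 1)) (v : Fin (m + 1) → stdSimplex ℝ (Fin (q + 1)))
    (j : Fin (q + 2)) : (δ.face j).comp v = δ.comp (stdSimplex.map j.succAbove ∘ v) :=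
  ext' fun t => by rw [comp_apply, face_apply, comp_apply, stdSimplex.map_affine]

lemma comp_vertex (δ : 𝒞.Simplex q) : δ.comp stdSimplex.vertex = δ :=
  ext' fun t => by rw [comp_apply, stdSimplex.affine_vertices]

lemma comp_comp (δ : 𝒞.Simplex q) (v : Fin (m + 1) → stdSimplex ℝ (Fin (q + 1)))
    (w : Fin (n + 1) → stdSimplex ℝ (Fin (m + 1))) :
    (δ.comp v).comp w = δ.comp (stdSimplex.affine v ∘ w) :=
  ext' fun t => by rw [comp_apply, comp_apply, comp_apply, stdSimplex.affine_affine]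

lemma image_comp_subset (δ : 𝒞.Simplex q) (v : Fin (m + 1) → stdSimplex ℝ (Fin (q + 1))) :
    (δ.comp v).image ⊆ δ.image := by
  rintro _ ⟨t, rfl⟩
  exact ⟨_, rfl⟩

lemma cell_comp_subset (δ : 𝒞.Simplex q) (v : Fin (m + 1) → stdSimplex ℝ (Fin (q + 1))) :
    ((δ.comp v).cell : Set X) ⊆ δ.cell :=
  subset_of_mem_relint ((δ.comp v).mem_relint_cell bary_barycenter)
    (δ.image_subset_cell (δ.image_comp_subset v ⟨_, rfl⟩))

/-- The last vertex of a simplex. -/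
noncomputable def lastVertex (δ : 𝒞.Simplex q) : X := δ.toFun (stdSimplex.vertex (Fin.last q))

/-- Only the face opposite to the last vertex loses it. Sorting simplices by their last vertex is
thus compatible with all face operators but one. -/
lemma lastVertex_face (δ : 𝒞.Simplex (q + 1)) {j : Fin (q + 2)} (hj : j ≠ Fin.last _) :
    (δ.face j).lastVertex = δ.lastVertex := by
  rw [lastVertex, face_apply, stdSimplex.map_vertex, Fin.succAbove_ne_last_last hj, lastVertex]

lemma lastVertex_comp (δ : 𝒞.Simplex q) (v : Fin (m + 1) → stdSimplex ℝ (Fin (q + 1))) :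
    (δ.comp v).lastVertex = δ.toFun (v (Fin.last m)) := by
  rw [lastVertex, comp_apply, stdSimplex.affine_vertex]

end Simplex

/-- The matrix of the transition from a chart to itself is an arbitrary choice and need not be the
identity. It acts as the identity on differences of points of a cell, hence on tangent spaces and on
the exterior products that span the coefficients. -/
lemma multiTangentMap_self (p : ℕ) (σ : 𝒞.cells) :
    𝒞.multiTangentMap p (subset_refl (σ : Set X)) = LinearMap.id := by
  have hσσ : ((σ : Set X) ∩ σ).Nonempty := by simpa using 𝒞.nonempty σ σ.2
  have hvec : ∀ σ' : 𝒞.cells, (σ : Set X) ⊆ σ' →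
      setSed (𝒞.img σ σ') = setSed (𝒞.img σ σ) → ∀ v ∈ tangent (𝒞.img σ σ'),
      𝒞.transLinear σ σ v = v := by
    intro σ' hσ' hsed v hv
    induction hv using Submodule.span_induction with
    | mem v hv =>
      obtain ⟨_, ⟨x, hx, rfl⟩, _, ⟨y, hy, rfl⟩, hxs, hys, rfl⟩ := hv
      rw [transLinear_sub (inter_of_subset' hσ') hσ' hx hy hxs hys]
      funext j
      by_cases hj : j ∈ setSed (𝒞.img σ σ)
      · have h1 : j ∈ sed ((𝒞.chart σ).toFun x) := by rw [hxs, hsed]; exact hj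
        have h2 : j ∈ sed ((𝒞.chart σ).toFun y) := by rw [hys, hsed]; exact hj
        simp [zeroOut, hj, re_of_mem h1, re_of_mem h2]
      · simp [zeroOut, hj]
    | zero => simp
    | add a b _ _ ha hb => simp only [map_add, ha, hb]
    | smul c a _ ha => simp only [map_smul, ha]
  have hreal : 𝒞.realMultiTangent p σ ≤ LinearMap.eqLocus
      (exteriorPower.map p (𝒞.transLinear σ σ)) LinearMap.id := by
    refine iSup₂_le fun σ' hσ' => Submodule.span_le.2 ?_
    rintro _ ⟨v, hv, rfl⟩
    change exteriorPower.map p _ _ = _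
    rw [exteriorPower.map_apply_ιMulti]
    exact congrArg (fun w => exteriorPower.ιMulti ℝ p w)
      (funext fun a => hvec σ' hσ'.1 hσ'.2 _ (hv a))
  ext ⟨ω, hω⟩ : 1
  exact Subtype.ext (hreal hω.1)

lemma coeffMap_self (Q : Subring ℝ) (p : ℕ) {σ : 𝒞.cells} (h : (σ : Set X) ⊆ σ)
    (a : 𝒞.Coeff Q p σ) : 𝒞.coeffMap Q p h a = a := by
  have := congrArg (LinearMap.baseChange Q) (𝒞.multiTangentMap_self p σ)
  rw [LinearMap.baseChange_id] at this
  exact LinearMap.congr_fun this a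

section Restriction

variable (Q : Subring ℝ) (D : Set X) (p : ℕ) {m q : ℕ}

open Classical in
/-- The chain `a|_δ δ` for a coefficient `a` of a cell `σ` that contains the cell of the simplex `δ`,
or zero if `δ` is contained in `D`. -/
noncomputable def restrictTo (δ : 𝒞.Simplex q) {σ : 𝒞.cells} (h : (δ.cell : Set X) ⊆ σ) :
    𝒞.Coeff Q p σ →ₗ[Q] 𝒞.Chain Q p q :=
  if δ.image ⊆ D then 0 else DFinsupp.lsingle δ ∘ₗ 𝒞.coeffMap Q p h

lemma restrictTo_of_subset {δ : 𝒞.Simplex q} {σ : 𝒞.cells} (h : (δ.cell : Set X) ⊆ σ)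
    (a : 𝒞.Coeff Q p σ) (hD : δ.image ⊆ D) : 𝒞.restrictTo Q D p δ h a = 0 := by
  rw [restrictTo, if_pos hD, LinearMap.zero_apply]

lemma restrictTo_of_not_subset [inst : DecidableEq (𝒞.Simplex q)] {δ : 𝒞.Simplex q} {σ : 𝒞.cells}
    (h : (δ.cell : Set X) ⊆ σ) (a : 𝒞.Coeff Q p σ) (hD : ¬ δ.image ⊆ D) :
    𝒞.restrictTo Q D p δ h a = DFinsupp.single δ (𝒞.coeffMap Q p h a) := by
  obtain rfl : inst = fun _ _ => Classical.propDecidable _ := Subsingleton.elim _ _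
  rw [restrictTo, if_neg hD]
  rfl

lemma restrictTo_congr {δ δ' : 𝒞.Simplex q} {σ : 𝒞.cells} (e : δ = δ')
    (h : (δ.cell : Set X) ⊆ σ) (a : 𝒞.Coeff Q p σ) :
    𝒞.restrictTo Q D p δ h a = 𝒞.restrictTo Q D p δ' (e ▸ h) a := by
  subst e
  rfl

/-- Faces of discarded simplices are contained in `D` as well, so discarding before or after taking
faces makes no difference. -/
lemma faceMap_restrictTo (δ : 𝒞.Simplex (q + 1)) {σ : 𝒞.cells} (h : (δ.cell : Set X) ⊆ σ)
    (a : 𝒞.Coeff Q p σ) (j : Fin (q + 2)) :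
    𝒞.faceMap Q D p q j (𝒞.restrictTo Q D p δ h a) =
      𝒞.restrictTo Q D p (δ.face j) ((δ.cell_face_subset j).trans h) a := by
  classical
  by_cases hD : δ.image ⊆ D
  · rw [restrictTo_of_subset _ _ _ _ _ hD, restrictTo_of_subset _ _ _ _ _
      ((δ.image_face_subset j).trans hD), map_zero]
  rw [restrictTo_of_not_subset _ _ _ _ _ hD]
  by_cases hj : (δ.face j).image ⊆ D
  · rw [faceMap_single_of_subset _ _ _ _ _ _ hj, restrictTo_of_subset _ _ _ _ _ hj]
  · rw [faceMap_single_of_not_subset _ _ _ _ _ _ hj, restrictTo_of_not_subset _ _ _ _ _ hj,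
      coeffMap_comp]

/-- The map of chains induced by the composition of simplices with an affine map of standard
simplices. -/
noncomputable def push (v : Fin (m + 1) → stdSimplex ℝ (Fin (q + 1))) :
    𝒞.Chain Q p q →ₗ[Q] 𝒞.Chain Q p m :=
  letI := Classical.decEq (𝒞.Simplex q)
  DFinsupp.lsum ℕ fun δ => 𝒞.restrictTo Q D p (δ.comp v) (δ.cell_comp_subset v)

lemma push_single [inst : DecidableEq (𝒞.Simplex q)]
    (v : Fin (m + 1) → stdSimplex ℝ (Fin (q + 1))) (δ : 𝒞.Simplex q) (a : 𝒞.Coeff Q p δ.cell) :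
    𝒞.push Q D p v (DFinsupp.single δ a) =
      𝒞.restrictTo Q D p (δ.comp v) (δ.cell_comp_subset v) a := by
  obtain rfl : inst = Classical.decEq _ := Subsingleton.elim _ _
  let := Classical.decEq (𝒞.Simplex q)
  exact DFinsupp.lsum_single ℕ
    (fun δ : 𝒞.Simplex q => 𝒞.restrictTo Q D p (δ.comp v) (δ.cell_comp_subset v)) δ a

lemma push_restrictTo (v : Fin (m + 1) → stdSimplex ℝ (Fin (q + 1))) (δ : 𝒞.Simplex q)
    {σ : 𝒞.cells} (h : (δ.cell : Set X) ⊆ σ) (a : 𝒞.Coeff Q p σ) :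
    𝒞.push Q D p v (𝒞.restrictTo Q D p δ h a) =
      𝒞.restrictTo Q D p (δ.comp v) ((δ.cell_comp_subset v).trans h) a := by
  classical
  by_cases hD : δ.image ⊆ D
  · rw [restrictTo_of_subset _ _ _ _ _ hD, restrictTo_of_subset _ _ _ _ _
      ((δ.image_comp_subset v).trans hD), map_zero]
  rw [restrictTo_of_not_subset _ _ _ _ _ hD, push_single]
  by_cases hv : (δ.comp v).image ⊆ D
  · rw [restrictTo_of_subset _ _ _ _ _ hv, restrictTo_of_subset _ _ _ _ _ hv]
  · rw [restrictTo_of_not_subset _ _ _ _ _ hv, restrictTo_of_not_subset _ _ _ _ _ hv,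
      coeffMap_comp]

lemma faceMap_push (v : Fin (m + 2) → stdSimplex ℝ (Fin (q + 1))) (j : Fin (m + 2))
    (ξ : 𝒞.Chain Q p q) :
    𝒞.faceMap Q D p m j (𝒞.push Q D p v ξ) = 𝒞.push Q D p (v ∘ j.succAbove) ξ := by
  classical
  suffices h : 𝒞.faceMap Q D p m j ∘ₗ 𝒞.push Q D p v = 𝒞.push Q D p (v ∘ j.succAbove) from
    LinearMap.congr_fun h ξ
  refine DFinsupp.lhom_ext fun δ a => ?_
  rw [LinearMap.comp_apply, push_single, push_single, faceMap_restrictTo]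
  exact restrictTo_congr Q D p (δ.comp_face v j) _ a

lemma push_faceMap (v : Fin (m + 1) → stdSimplex ℝ (Fin (q + 1))) (j : Fin (q + 2))
    (ξ : 𝒞.Chain Q p (q + 1)) : 𝒞.push Q D p v (𝒞.faceMap Q D p q j ξ) =
      𝒞.push Q D p (stdSimplex.map j.succAbove ∘ v) ξ := by
  classical
  suffices h : 𝒞.push Q D p v ∘ₗ 𝒞.faceMap Q D p q j =
      𝒞.push Q D p (stdSimplex.map j.succAbove ∘ v) from LinearMap.congr_fun h ξ
  refine DFinsupp.lhom_ext fun δ a => ?_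
  rw [LinearMap.comp_apply, faceMap_single, push_single]
  exact (push_restrictTo Q D p v (δ.face j) (δ.cell_face_subset j) a).trans
    (restrictTo_congr Q D p (δ.face_comp v j) _ a)

end Restriction

end OpenFaceStructure

/-! ### The action of affine chains on tropical chains -/

namespace ICData

open OpenFaceStructure

variable {X : Type u} [TopologicalSpace X] (𝒳 : ICData X) {m q : ℕ}

/-- The map of chains induced by an affine chain of the standard simplex. -/
noncomputable def act (q m : ℕ) : AffineChain (stdSimplex ℝ (Fin (q + 1))) m →ₗ[ℤ]
    (𝒳.Chain q →ₗ[𝒳.Q] 𝒳.Chain m) :=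
  Finsupp.linearCombination ℤ fun v => 𝒳.faces.push 𝒳.Q 𝒳.discard 𝒳.p v

variable {𝒳}

lemma act_single (v : Fin (m + 1) → stdSimplex ℝ (Fin (q + 1))) (n : ℤ) (ξ : 𝒳.Chain q) :
    𝒳.act q m (Finsupp.single v n) ξ = n • 𝒳.faces.push 𝒳.Q 𝒳.discard 𝒳.p v ξ := by
  rw [act, Finsupp.linearCombination_single, LinearMap.smul_apply]

lemma bdry_act (c : AffineChain (stdSimplex ℝ (Fin (q + 1))) (m + 1)) (ξ : 𝒳.Chain q) :
    𝒳.bdry m (𝒳.act q (m + 1) c ξ) = 𝒳.act q m (AffineChain.bdry _ m c) ξ := by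
  induction c using Finsupp.induction_linear with
  | zero => simp
  | add c c' h h' => simp only [map_add, LinearMap.add_apply, h, h']
  | single v n =>
    rw [act_single, AffineChain.bdry_single, map_sum, LinearMap.sum_apply, map_zsmul, bdry,
      boundary, LinearMap.sum_apply, Finset.smul_sum]
    refine Finset.sum_congr rfl fun j _ => ?_
    rw [map_smul, LinearMap.smul_apply, LinearMap.smul_apply, act_single, faceMap_push, smul_comm]

/-- Together with `bdry_act` this turns the formulas for affine chains into formulas for operators:
a boundary taken after the action is the boundary of the affine chain, one taken before it is
`faceSum`. -/
lemma act_bdry (c : AffineChain (stdSimplex ℝ (Fin (q + 1))) m) (ξ : 𝒳.Chain (q + 1)) :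
    𝒳.act q m c (𝒳.bdry q ξ) = 𝒳.act (q + 1) m (AffineChain.faceSum q m c) ξ := by
  induction c using Finsupp.induction_linear with
  | zero => simp
  | add c c' h h' => simp only [map_add, LinearMap.add_apply, h, h']
  | single v n =>
    rw [act_single, AffineChain.faceSum_single, map_sum, LinearMap.sum_apply, bdry,
      boundary, LinearMap.sum_apply, map_sum, Finset.smul_sum]
    refine Finset.sum_congr rfl fun j _ => ?_
    rw [map_smul, LinearMap.smul_apply, LinearMap.smul_apply, act_single, map_zsmul, push_faceMap,
      smul_comm]

lemma sum_single_mem {T : Set (𝒳.Simplex q)}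
    [DecidableEq (𝒳.Simplex q)] {M : Type*} [AddCommGroup M] [Module 𝒳.Q M]
    {f : 𝒳.Chain q →ₗ[𝒳.Q] M} {N : Submodule 𝒳.Q M}
    (h : ∀ δ ∈ T, ∀ a, f (DFinsupp.single δ a) ∈ N) {ξ : 𝒳.Chain q} (hξ : ξ ∈ 𝒳.chainsOn T) :
    f ξ ∈ N := by
  classical
  have hsum : ξ = ∑ δ ∈ ξ.support, DFinsupp.single δ (ξ δ) := (DFinsupp.sum_single (f := ξ)).symm
  rw [hsum, map_sum]
  exact Submodule.sum_mem _ fun δ hδ => h δ (hξ δ (DFinsupp.mem_support_iff.1 hδ)) _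

lemma single_mem_chainsOn [DecidableEq (𝒳.Simplex q)] {T : Set (𝒳.Simplex q)} {δ : 𝒳.Simplex q}
    (h : δ ∈ T) (a : 𝒳.faces.Coeff 𝒳.Q 𝒳.p δ.cell) :
    (DFinsupp.single δ a : 𝒳.Chain q) ∈ 𝒳.chainsOn T := by
  intro δ' hδ'
  by_cases he : δ = δ'
  · exact he ▸ h
  · exact absurd (DFinsupp.single_eq_of_ne (Ne.symm he)) hδ'

lemma restrictTo_mem_chainsOn {T : Set (𝒳.Simplex q)} {δ : 𝒳.Simplex q} {σ : 𝒳.faces.cells}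
    (h : (δ.cell : Set X) ⊆ σ) (a : 𝒳.faces.Coeff 𝒳.Q 𝒳.p σ)
    (hT : ¬ δ.image ⊆ 𝒳.discard → δ ∈ T) :
    𝒳.faces.restrictTo 𝒳.Q 𝒳.discard 𝒳.p δ h a ∈ 𝒳.chainsOn T := by
  classical
  by_cases hD : δ.image ⊆ 𝒳.discard
  · rw [restrictTo_of_subset _ _ _ _ _ hD]
    exact Submodule.zero_mem _
  · rw [restrictTo_of_not_subset _ _ _ _ _ hD]
    exact single_mem_chainsOn (hT hD) _

lemma act_mem_chainsOn {c : AffineChain (stdSimplex ℝ (Fin (q + 1))) m}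
    {s : Set (Fin (m + 1) → stdSimplex ℝ (Fin (q + 1)))} (hc : c ∈ Finsupp.supported ℤ ℤ s)
    {T : Set (𝒳.Simplex q)} {T' : Set (𝒳.Simplex m)}
    (h : ∀ v ∈ s, ∀ δ ∈ T, ¬ (δ.comp v).image ⊆ 𝒳.discard → δ.comp v ∈ T')
    {ξ : 𝒳.Chain q} (hξ : ξ ∈ 𝒳.chainsOn T) : 𝒳.act q m c ξ ∈ 𝒳.chainsOn T' := by
  classical
  rw [act, Finsupp.linearCombination_apply, Finsupp.sum, LinearMap.sum_apply]
  refine Submodule.sum_mem _ fun v hv => ?_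
  rw [LinearMap.smul_apply]
  refine zsmul_mem ?_ _
  refine sum_single_mem (fun δ hδ a => ?_) hξ
  rw [push_single]
  exact restrictTo_mem_chainsOn _ _ (h v (hc hv) δ hδ)

/-- The action drops simplices in the discarded locus, so it is the identity only on chains free of
them. -/
lemma act_ident {ξ : 𝒳.Chain q} (hξ : ξ ∈ 𝒳.chainsOn {δ | ¬ δ.image ⊆ 𝒳.discard}) :
    𝒳.act q q (AffineChain.ident q) ξ = ξ := by
  classical
  refine sub_eq_zero.1 ((Submodule.mem_bot 𝒳.Q).1 (sum_single_mem
    (f := 𝒳.act q q (AffineChain.ident q) - LinearMap.id) (fun δ hδ a => ?_) hξ))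
  rw [Submodule.mem_bot, LinearMap.sub_apply, LinearMap.id_apply, sub_eq_zero, AffineChain.ident,
    act_single, one_smul, push_single]
  rw [restrictTo_congr _ _ _ δ.comp_vertex, restrictTo_of_not_subset _ _ _ _ _ hδ, coeffMap_self]

end ICData

namespace ICData

open OpenFaceStructure

variable {X : Type u} [TopologicalSpace X] {𝒳 : ICData X} {m q : ℕ}

/-! ### Subdivision of intersection chains -/

/-- Allowability bounds the number of vertices of the face containing a point minus the dimension of
the simplex, in terms of the stratum alone. It is inherited if this difference does not increase
when a face of the new simplex is compared with its carrier. -/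
lemma isAllowable_comp {δ : 𝒳.Simplex q} (hδ : 𝒳.IsAllowable δ)
    {v : Fin (m + 1) → stdSimplex ℝ (Fin (q + 1))}
    (h : ∀ s : Finset (Fin (m + 1)), s.Nonempty →
      s.card + q ≤ (AffineChain.carrier v s).card + m) : 𝒳.IsAllowable (δ.comp v) := by
  intro S t ht
  have h1 := hδ S (stdSimplex.affine v t) ht
  rw [stdSimplex.bary_affine] at h1
  have h2 := h (bary t) (stdSimplex.bary_nonempty t)
  have h3 : (AffineChain.carrier v (bary t)).card =
      ((bary t).biUnion fun i => bary (v i)).card := rfl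
  rw [h3] at h2
  lia

lemma goodSimplices_of_IC {U : Opens X} : ∀ {q : ℕ} {ξ : 𝒳.Chain q}, ξ ∈ 𝒳.IC U q →
    ξ ∈ 𝒳.chainsOn (𝒳.goodSimplices U q)
  | 0, _, hξ => hξ
  | _ + 1, _, hξ => hξ.1

lemma isAllowable_of_IC {U : Opens X} {ξ : 𝒳.Chain q} (hξ : ξ ∈ 𝒳.IC U q) :
    ξ ∈ 𝒳.chainsOn {δ | 𝒳.IsAllowable δ} :=
  chainsOn_mono (fun _ h => h.2.2) (goodSimplices_of_IC hξ)

lemma act_sd_mem_goodSimplices {U : Opens X} {ξ : 𝒳.Chain q}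
    (hξ : ξ ∈ 𝒳.chainsOn (𝒳.goodSimplices U q)) :
    𝒳.act q q (AffineChain.sd q) ξ ∈ 𝒳.chainsOn (𝒳.goodSimplices U q) := by
  refine act_mem_chainsOn (AffineChain.sd_mem_supported q) (fun v hv δ hδ hD => ?_) hξ
  exact ⟨(δ.image_comp_subset v).trans hδ.1, hD,
    isAllowable_comp hδ.2.2 fun s hs => Nat.add_le_add_right (hv s hs).1 q⟩

lemma act_sdHomotopy_mem_goodSimplices {U : Opens X} {ξ : 𝒳.Chain q}
    (hξ : ξ ∈ 𝒳.chainsOn (𝒳.goodSimplices U q)) :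
    𝒳.act q (q + 1) (AffineChain.sdHomotopy q) ξ ∈ 𝒳.chainsOn (𝒳.goodSimplices U (q + 1)) := by
  refine act_mem_chainsOn (AffineChain.sdHomotopy_mem_supported q) (fun v hv δ hδ hD => ?_) hξ
  exact ⟨(δ.image_comp_subset v).trans hδ.1, hD, isAllowable_comp hδ.2.2 fun s _ => by
    have := hv s
    lia⟩

lemma bdry_act_sd (ξ : 𝒳.Chain (q + 1)) :
    𝒳.bdry q (𝒳.act (q + 1) (q + 1) (AffineChain.sd (q + 1)) ξ) =
      𝒳.act q q (AffineChain.sd q) (𝒳.bdry q ξ) := by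
  rw [bdry_act, AffineChain.bdry_sd, act_bdry]

lemma bdry_act_sdHomotopy {U : Opens X} {ξ : 𝒳.Chain (q + 1)}
    (hξ : ξ ∈ 𝒳.chainsOn (𝒳.goodSimplices U (q + 1))) :
    𝒳.bdry (q + 1) (𝒳.act (q + 1) (q + 2) (AffineChain.sdHomotopy (q + 1)) ξ) =
      ξ - 𝒳.act (q + 1) (q + 1) (AffineChain.sd (q + 1)) ξ -
        𝒳.act q (q + 1) (AffineChain.sdHomotopy q) (𝒳.bdry q ξ) := by
  rw [bdry_act, AffineChain.bdry_sdHomotopy, map_sub, map_sub, LinearMap.sub_apply,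
    LinearMap.sub_apply, act_bdry, act_ident (chainsOn_mono (fun _ h => h.2.1) hξ)]

/-- The boundary of the subdivision is the subdivision of the boundary, which is itself an
intersection chain and so consists of allowable simplices. -/
lemma act_sd_mem_IC {U : Opens X} : ∀ {q : ℕ} {ξ : 𝒳.Chain q}, ξ ∈ 𝒳.IC U q →
    𝒳.act q q (AffineChain.sd q) ξ ∈ 𝒳.IC U q
  | 0, _, hξ => act_sd_mem_goodSimplices hξ
  | q + 1, ξ, hξ => by
    refine ⟨act_sd_mem_goodSimplices hξ.1, ?_⟩
    change 𝒳.bdry q _ ∈ 𝒳.chainsOn {δ | 𝒳.IsAllowable δ}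
    rw [bdry_act_sd]
    exact chainsOn_mono (fun _ h => h.2.2)
      (act_sd_mem_goodSimplices (goodSimplices_of_IC (bdry_mem_IC hξ)))

/-- By the homotopy formula the boundary is a combination of the chain, its subdivision and the
homotopy applied to its boundary, all of which consist of allowable simplices. -/
lemma act_sdHomotopy_mem_IC {U : Opens X} : ∀ {q : ℕ} {ξ : 𝒳.Chain q}, ξ ∈ 𝒳.IC U q →
    𝒳.act q (q + 1) (AffineChain.sdHomotopy q) ξ ∈ 𝒳.IC U (q + 1)
  | 0, ξ, _ => by
    rw [AffineChain.sdHomotopy, map_zero]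
    exact Submodule.zero_mem _
  | q + 1, ξ, hξ => by
    refine ⟨act_sdHomotopy_mem_goodSimplices hξ.1, ?_⟩
    change 𝒳.bdry (q + 1) _ ∈ 𝒳.chainsOn {δ | 𝒳.IsAllowable δ}
    rw [bdry_act_sdHomotopy hξ.1]
    refine Submodule.sub_mem _ (Submodule.sub_mem _ (isAllowable_of_IC hξ)
      (isAllowable_of_IC (act_sd_mem_IC hξ))) (chainsOn_mono (fun _ h => h.2.2)
      (act_sdHomotopy_mem_goodSimplices (goodSimplices_of_IC (bdry_mem_IC hξ))))

/-! ### Splitting of chains along the last vertex -/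

/-- The part of a chain consisting of the simplices whose last vertex lies in `F`. -/
noncomputable def lastIn (F : Set X) (q : ℕ) : 𝒳.Chain q →ₗ[𝒳.Q] 𝒳.Chain q :=
  letI : DecidablePred fun δ : 𝒳.Simplex q => δ.lastVertex ∈ F := Classical.decPred _
  DFinsupp.filterLinearMap 𝒳.Q _ fun δ => δ.lastVertex ∈ F

lemma lastIn_apply_of_mem {F : Set X} (ξ : 𝒳.Chain q) {δ : 𝒳.Simplex q}
    (h : δ.lastVertex ∈ F) : lastIn F q ξ δ = ξ δ := if_pos h

lemma lastIn_apply_of_notMem {F : Set X} (ξ : 𝒳.Chain q) {δ : 𝒳.Simplex q}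
    (h : δ.lastVertex ∉ F) : lastIn F q ξ δ = 0 := if_neg h

lemma lastIn_eq_self {F : Set X} {ξ : 𝒳.Chain q}
    (h : ξ ∈ 𝒳.chainsOn {δ | δ.lastVertex ∈ F}) : lastIn F q ξ = ξ := by
  refine DFinsupp.ext fun δ => ?_
  by_cases hF : δ.lastVertex ∈ F
  · exact lastIn_apply_of_mem ξ hF
  · rw [lastIn_apply_of_notMem ξ hF]
    exact (not_not.1 fun h0 => hF (h δ h0)).symm

lemma lastIn_eq_zero {F : Set X} {ξ : 𝒳.Chain q}
    (h : ξ ∈ 𝒳.chainsOn {δ | δ.lastVertex ∉ F}) : lastIn F q ξ = 0 := by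
  refine DFinsupp.ext fun δ => ?_
  by_cases hF : δ.lastVertex ∈ F
  · rw [lastIn_apply_of_mem ξ hF]
    exact not_not.1 fun h0 => h δ h0 hF
  · exact lastIn_apply_of_notMem ξ hF

lemma lastIn_mem_chainsOn {F : Set X} {T : Set (𝒳.Simplex q)} {ξ : 𝒳.Chain q}
    (h : ξ ∈ 𝒳.chainsOn T) : lastIn F q ξ ∈ 𝒳.chainsOn {δ | δ ∈ T ∧ δ.lastVertex ∈ F} := by
  intro δ hδ
  by_cases hF : δ.lastVertex ∈ F
  · rw [lastIn_apply_of_mem ξ hF] at hδ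
    exact ⟨h δ hδ, hF⟩
  · exact absurd (lastIn_apply_of_notMem ξ hF) hδ

lemma sub_lastIn_mem_chainsOn {F : Set X} {T : Set (𝒳.Simplex q)} {ξ : 𝒳.Chain q}
    (h : ξ ∈ 𝒳.chainsOn T) : ξ - lastIn F q ξ ∈ 𝒳.chainsOn {δ | δ ∈ T ∧ δ.lastVertex ∉ F} := by
  intro δ hδ
  rw [DFinsupp.sub_apply] at hδ
  by_cases hF : δ.lastVertex ∈ F
  · rw [lastIn_apply_of_mem ξ hF, sub_self] at hδ
    exact absurd rfl hδ
  · rw [lastIn_apply_of_notMem ξ hF, sub_zero] at hδ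
    exact ⟨h δ hδ, hF⟩

lemma faceMap_mem_chainsOn {j : Fin (q + 2)} {T : Set (𝒳.Simplex (q + 1))}
    {T' : Set (𝒳.Simplex q)} (h : ∀ δ ∈ T, δ.face j ∈ T') {ξ : 𝒳.Chain (q + 1)}
    (hξ : ξ ∈ 𝒳.chainsOn T) :
    𝒳.faces.faceMap 𝒳.Q 𝒳.discard 𝒳.p q j ξ ∈ 𝒳.chainsOn T' := by
  classical
  refine sum_single_mem (fun δ hδ a => ?_) hξ
  rw [faceMap_single]
  exact restrictTo_mem_chainsOn (δ.cell_face_subset j) a fun _ => h δ hδ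

lemma lastIn_faceMap (F : Set X) {j : Fin (q + 2)} (hj : j ≠ Fin.last _) (ξ : 𝒳.Chain (q + 1)) :
    lastIn F q (𝒳.faces.faceMap 𝒳.Q 𝒳.discard 𝒳.p q j ξ) =
      𝒳.faces.faceMap 𝒳.Q 𝒳.discard 𝒳.p q j (lastIn F (q + 1) ξ) := by
  have h : ξ ∈ 𝒳.chainsOn Set.univ := fun _ _ => trivial
  have h1 := lastIn_mem_chainsOn (F := F) h
  have h2 := sub_lastIn_mem_chainsOn (F := F) h
  obtain ⟨a, b, ha, hb, rfl⟩ : ∃ a b : 𝒳.Chain (q + 1),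
      a ∈ 𝒳.chainsOn {δ | δ.lastVertex ∈ F} ∧ b ∈ 𝒳.chainsOn {δ | δ.lastVertex ∉ F} ∧
        ξ = a + b :=
    ⟨_, _, chainsOn_mono (fun _ h => h.2) h1, chainsOn_mono (fun _ h => h.2) h2, by abel⟩
  rw [map_add, map_add, map_add, lastIn_eq_self ha, lastIn_eq_zero hb, add_zero, lastIn_eq_self,
    lastIn_eq_zero, add_zero]
  · exact faceMap_mem_chainsOn (fun δ hδ => by
      change (δ.face j).lastVertex ∉ F
      rwa [δ.lastVertex_face hj]) hb
  · exact faceMap_mem_chainsOn (fun δ hδ => by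
      change (δ.face j).lastVertex ∈ F
      rwa [δ.lastVertex_face hj]) ha

/-- Selecting simplices by last vertex commutes with every face operator except the last. The defect
therefore consists of last faces, which are allowable one by one, so cancellations among
non-allowable faces of the whole chain persist in the selected part. -/
lemma bdry_lastIn_mem (F : Set X) {ξ : 𝒳.Chain (q + 1)}
    (hξ : ξ ∈ 𝒳.chainsOn {δ | 𝒳.IsAllowable (δ.face (Fin.last _))})
    (hd : 𝒳.bdry q ξ ∈ 𝒳.chainsOn {δ | 𝒳.IsAllowable δ}) :
    𝒳.bdry q (lastIn F (q + 1) ξ) ∈ 𝒳.chainsOn {δ | 𝒳.IsAllowable δ} := by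
  have h : 𝒳.bdry q (lastIn F (q + 1) ξ) - lastIn F q (𝒳.bdry q ξ) ∈
      𝒳.chainsOn {δ | 𝒳.IsAllowable δ} := by
    rw [bdry, boundary, LinearMap.sum_apply, LinearMap.sum_apply, map_sum,
      ← Finset.sum_sub_distrib]
    refine Submodule.sum_mem _ fun j _ => ?_
    rw [LinearMap.smul_apply, LinearMap.smul_apply, map_zsmul, ← smul_sub]
    refine zsmul_mem ?_ _
    by_cases hj : j = Fin.last _
    · subst hj
      refine Submodule.sub_mem _ ?_ ?_
      · exact faceMap_mem_chainsOn (fun δ hδ => hδ)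
          (chainsOn_mono (fun _ h => h.1) (lastIn_mem_chainsOn (F := F) hξ))
      · exact chainsOn_mono (fun _ h => h.1)
          (lastIn_mem_chainsOn (F := F) (faceMap_mem_chainsOn (fun δ hδ => hδ) hξ))
    · rw [lastIn_faceMap F hj, sub_self]
      exact Submodule.zero_mem _
  have h' := Submodule.add_mem _ h
    (chainsOn_mono (fun _ h => h.1) (lastIn_mem_chainsOn (F := F) hd))
  rwa [sub_add_cancel] at h'

/-- Subdivided intersection chains can be split along the position of the last vertex. -/
lemma lastIn_act_sd_mem_IC (F : Set X) {U : Opens X} : ∀ {q : ℕ} {ξ : 𝒳.Chain q},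
    ξ ∈ 𝒳.IC U q → lastIn F q (𝒳.act q q (AffineChain.sd q) ξ) ∈ 𝒳.IC U q
  | 0, _, hξ => chainsOn_mono (fun _ h => h.1) (lastIn_mem_chainsOn (act_sd_mem_IC hξ))
  | q + 1, ξ, hξ => by
    have hsd := act_sd_mem_IC hξ
    refine ⟨chainsOn_mono (fun _ h => h.1) (lastIn_mem_chainsOn hsd.1), ?_⟩
    refine bdry_lastIn_mem F ?_ hsd.2
    refine act_mem_chainsOn (AffineChain.sd_mem_supported (q + 1)) (fun v hv δ hδ _ => ?_)
      (isAllowable_of_IC hξ)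
    change 𝒳.IsAllowable ((δ.comp v).face _)
    rw [Simplex.comp_face]
    -- The face opposite to the last vertex has dimension one less than the original simplex; the
    -- extra dimension of the carriers in `subdivided` makes up for it.
    refine isAllowable_comp hδ fun s hs => ?_
    have h := (hv (s.map (Fin.succAboveEmb (Fin.last _))) hs.map).2 (by
      simp)
    rw [Finset.card_map] at h
    have hc : AffineChain.carrier v (s.map (Fin.succAboveEmb (Fin.last _))) =
        AffineChain.carrier (v ∘ (Fin.last (q + 1)).succAbove) s := by
      rw [AffineChain.carrier, Finset.map_eq_image, Finset.image_biUnion]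
      rfl
    rw [hc] at h
    lia

/-- Allowability of a simplex does not refer to the open subset, which enters only through the
images of the simplices. -/
lemma mem_IC_of_image_subset {U W : Opens X} : ∀ {q : ℕ} {ξ : 𝒳.Chain q}, ξ ∈ 𝒳.IC W q →
    ξ ∈ 𝒳.chainsOn {δ | δ.image ⊆ U} → ξ ∈ 𝒳.IC U q
  | 0, _, hξ, h => fun δ hδ => ⟨h δ hδ, (hξ δ hδ).2⟩
  | _ + 1, _, hξ, h => ⟨fun δ hδ => ⟨h δ hδ, (hξ.1 δ hδ).2⟩, hξ.2⟩

lemma IC_inf (U V : Opens X) (q : ℕ) : 𝒳.IC (U ⊓ V) q = 𝒳.IC U q ⊓ 𝒳.IC V q := by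
  refine le_antisymm (le_inf (IC_mono inf_le_left q) (IC_mono inf_le_right q)) fun ξ hξ => ?_
  exact mem_IC_of_image_subset hξ.1 fun δ hδ => Set.subset_inter
    (goodSimplices_of_IC hξ.1 δ hδ).1 (goodSimplices_of_IC hξ.2 δ hδ).1

/-! ### Small chains -/

/-- Each simplex of the iterated subdivision is kept as an affine piece of one of the finitely many
original simplices, with its size measured in their barycentric coordinates. A uniform estimate on
the original simplices then suffices. -/
lemma iterate_sd_mem_small {ξ : 𝒳.Chain q} (n : ℕ) :
    ((𝒳.act q q (AffineChain.sd q)) ^ n) ξ ∈ 𝒳.chainsOn {δ | ∃ δ₀ : 𝒳.Simplex q, ξ δ₀ ≠ 0 ∧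
      ∃ w : Fin (q + 1) → stdSimplex ℝ (Fin (q + 1)), δ = δ₀.comp w ∧
        ∀ k i j, |w i k - w j k| ≤ ((q : ℝ) / (q + 1)) ^ n} := by
  induction n with
  | zero =>
    intro δ hδ
    refine ⟨δ, hδ, stdSimplex.vertex, δ.comp_vertex.symm, fun k i j => ?_⟩
    rw [stdSimplex.vertex_apply, stdSimplex.vertex_apply, pow_zero]
    split_ifs <;> simp
  | succ n ih =>
    rw [pow_succ' (𝒳.act q q (AffineChain.sd q)), Module.End.mul_apply]
    refine act_mem_chainsOn (AffineChain.sd_mem_supported_small q) ?_ ih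
    rintro v hv _ ⟨δ₀, h₀, w, rfl, hw⟩ -
    refine ⟨δ₀, h₀, stdSimplex.affine w ∘ v, δ₀.comp_comp w v, fun k i j => ?_⟩
    rw [pow_succ']
    exact hv (fun l => w l k) _ (hw k) i j

/-- A Lebesgue number argument for the finitely many simplices of a chain, with a fixed set `F`
deciding in which of the two open subsets a small simplex is placed. -/
lemma exists_uniform_split [NormalSpace X] [T2Space X] {U V : Opens X} (ξ : 𝒳.Chain q)
    (hξ : ξ ∈ 𝒳.chainsOn {δ | δ.image ⊆ ((U ⊔ V : Opens X) : Set X)}) :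
    ∃ F : Set X, ∃ ε > 0, ∀ δ : 𝒳.Simplex q, ξ δ ≠ 0 →
      ∀ s t : stdSimplex ℝ (Fin (q + 1)), (∀ k, |s k - t k| ≤ ε) →
        (δ.toFun s ∈ F → δ.toFun t ∈ U) ∧ (δ.toFun s ∉ F → δ.toFun t ∈ V) := by
  classical
  have hcomp : ∀ δ : 𝒳.Simplex q, IsCompact δ.image := fun δ =>
    isCompact_range δ.toFun.continuous
  set K : Set X := ⋃ δ ∈ ξ.support, δ.image
  have hK : IsCompact K := ξ.support.isCompact_biUnion fun δ _ => hcomp δ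
  have hKU : K \ V ⊆ U := by
    rintro x ⟨hx, hxV⟩
    obtain ⟨δ, hδ, hxδ⟩ := Set.mem_iUnion₂.1 hx
    have := hξ δ (DFinsupp.mem_support_iff.1 hδ) hxδ
    rw [Opens.coe_sup] at this
    exact this.resolve_right hxV
  -- On `K` the closure of `F` lies in `U` and the complement of `F` lies in `V`. Both sets are
  -- closed, as required for a positive distance on the simplex.
  obtain ⟨F, hFo, hF, hFU⟩ := normal_exists_closure_subset
    (hK.isClosed.sdiff V.isOpen) U.isOpen hKU
  have step : ∀ δ : 𝒳.Simplex q, ξ δ ≠ 0 → ∃ ε > 0, ∀ s t : stdSimplex ℝ (Fin (q + 1)),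
      (∀ k, |s k - t k| ≤ ε) → (δ.toFun s ∈ F → δ.toFun t ∈ U) ∧
        (δ.toFun s ∉ F → δ.toFun t ∈ V) := by
    intro δ hδ
    have key : ∀ (C : Set X) (O : Opens X), IsClosed C → (∀ x ∈ δ.image, x ∈ C → x ∈ O) →
        ∃ ε > 0, ∀ s t : stdSimplex ℝ (Fin (q + 1)), (∀ k, |s k - t k| ≤ ε) →
          δ.toFun s ∈ C → δ.toFun t ∈ O := by
      intro C O hC hCO
      have h1 : IsCompact (δ.toFun ⁻¹' C) := (hC.preimage δ.toFun.continuous).isCompact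
      obtain ⟨ε, hε, h⟩ := h1.exists_thickening_subset_open
        (O.isOpen.preimage δ.toFun.continuous) fun s hs => hCO _ ⟨s, rfl⟩ hs
      refine ⟨ε / 2, half_pos hε, fun s t hst hs => h (Metric.mem_thickening_iff.2 ⟨s, hs, ?_⟩)⟩
      rw [dist_comm]
      have : dist s t ≤ ε / 2 := (dist_pi_le_iff (half_pos hε).le).2 hst
      linarith
    obtain ⟨ε₁, h₁, H₁⟩ := key (closure F) U isClosed_closure fun x _ hx => hFU hx
    obtain ⟨ε₂, h₂, H₂⟩ := key Fᶜ V hFo.isClosed_compl fun x hx hxF => by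
      by_contra hxV
      exact hxF (hF ⟨Set.mem_iUnion₂.2 ⟨δ, DFinsupp.mem_support_iff.2 hδ, hx⟩, hxV⟩)
    exact ⟨min ε₁ ε₂, lt_min h₁ h₂, fun s t hst =>
      ⟨fun hs => H₁ s t (fun k => (hst k).trans (min_le_left _ _)) (subset_closure hs),
        fun hs => H₂ s t (fun k => (hst k).trans (min_le_right _ _)) hs⟩⟩
  choose! ε hε H using step
  obtain ⟨e, he, hle⟩ : ∃ e > 0, ∀ δ ∈ ξ.support, e ≤ ε δ := by
    by_cases hne : ξ.support.Nonempty
    · obtain ⟨δ, hδ, hmin⟩ := ξ.support.exists_min_image ε hne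
      exact ⟨ε δ, hε δ (DFinsupp.mem_support_iff.1 hδ), hmin⟩
    · exact ⟨1, one_pos, fun δ hδ => absurd ⟨δ, hδ⟩ hne⟩
  exact ⟨F, e, he, fun δ hδ s t hst => H δ hδ s t fun k =>
    (hst k).trans (hle δ (DFinsupp.mem_support_iff.2 hδ))⟩

lemma exists_iterate_sd_mem_sup [NormalSpace X] [T2Space X] {U V : Opens X} {ξ : 𝒳.Chain q}
    (hξ : ξ ∈ 𝒳.IC (U ⊔ V) q) :
    ∃ n, ((𝒳.act q q (AffineChain.sd q)) ^ n) ξ ∈ 𝒳.IC U q ⊔ 𝒳.IC V q := by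
  obtain ⟨F, ε, hε, H⟩ := exists_uniform_split ξ
    (chainsOn_mono (fun _ h => h.1) (goodSimplices_of_IC hξ))
  obtain ⟨n, hn⟩ := exists_pow_lt_of_lt_one hε (y := (q : ℝ) / (q + 1))
    ((div_lt_one (by positivity)).2 (by linarith))
  have hn' : ((q : ℝ) / (q + 1)) ^ (n + 1) ≤ ε := by
    refine le_trans ?_ hn.le
    exact pow_le_pow_of_le_one (by positivity)
      ((div_le_one (by positivity)).2 (by linarith)) n.le_succ
  -- One subdivision more than smallness requires: the outermost one guarantees that splitting by
  -- last vertices yields intersection chains, even for n = 0.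
  refine ⟨n + 1, ?_⟩
  have hsmall := iterate_sd_mem_small (ξ := ξ) (n + 1)
  have hIC : ∀ m, ((𝒳.act q q (AffineChain.sd q)) ^ m) ξ ∈ 𝒳.IC (U ⊔ V) q := by
    intro m
    induction m with
    | zero => exact hξ
    | succ m ih =>
      rw [pow_succ', Module.End.mul_apply]
      exact act_sd_mem_IC ih
  have hlast : lastIn F q (((𝒳.act q q (AffineChain.sd q)) ^ (n + 1)) ξ) ∈ 𝒳.IC (U ⊔ V) q := by
    rw [pow_succ', Module.End.mul_apply]
    exact lastIn_act_sd_mem_IC F (hIC n)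
  have himage : ∀ (δ₀ : 𝒳.Simplex q) (w : Fin (q + 1) → stdSimplex ℝ (Fin (q + 1))),
      (∀ k i j, |w i k - w j k| ≤ ((q : ℝ) / (q + 1)) ^ (n + 1)) → ξ δ₀ ≠ 0 →
      ∀ t, ((δ₀.comp w).lastVertex ∈ F → (δ₀.comp w).toFun t ∈ U) ∧
        ((δ₀.comp w).lastVertex ∉ F → (δ₀.comp w).toFun t ∈ V) := by
    intro δ₀ w hw h₀ t
    rw [Simplex.lastVertex_comp]
    exact H δ₀ h₀ (w (Fin.last q)) (stdSimplex.affine w t) fun k =>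
      (stdSimplex.abs_sub_eval_le (w := fun i => w i k) (fun i => hw k (Fin.last q) i) t).trans hn'
  rw [← add_sub_cancel (lastIn F q (((𝒳.act q q (AffineChain.sd q)) ^ (n + 1)) ξ))
    (((𝒳.act q q (AffineChain.sd q)) ^ (n + 1)) ξ)]
  refine Submodule.add_mem_sup (mem_IC_of_image_subset hlast ?_)
    (mem_IC_of_image_subset (Submodule.sub_mem _ (hIC (n + 1)) hlast) ?_)
  · refine chainsOn_mono ?_ (lastIn_mem_chainsOn hsmall)
    rintro _ ⟨⟨δ₀, h₀, w, rfl, hw⟩, hF⟩ _ ⟨t, rfl⟩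
    exact (himage δ₀ w hw h₀ t).1 hF
  · refine chainsOn_mono ?_ (sub_lastIn_mem_chainsOn hsmall)
    rintro _ ⟨⟨δ₀, h₀, w, rfl, hw⟩, hF⟩ _ ⟨t, rfl⟩
    exact (himage δ₀ w hw h₀ t).2 hF

/-- The chains whose boundary, if any, is a sum of intersection chains of `U` and `V`. -/
noncomputable def relCycles (𝒳 : ICData X) (U V : Opens X) : (q : ℕ) → Submodule 𝒳.Q (𝒳.Chain q)
  | 0 => ⊤
  | q + 1 => (𝒳.IC U q ⊔ 𝒳.IC V q).comap (𝒳.bdry q)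

lemma act_mem_sup {U V : Opens X} {f : 𝒳.Chain q →ₗ[𝒳.Q] 𝒳.Chain m}
    (hf : ∀ {U : Opens X} {ξ : 𝒳.Chain q}, ξ ∈ 𝒳.IC U q → f ξ ∈ 𝒳.IC U m) {ξ : 𝒳.Chain q}
    (hξ : ξ ∈ 𝒳.IC U q ⊔ 𝒳.IC V q) : f ξ ∈ 𝒳.IC U m ⊔ 𝒳.IC V m := by
  obtain ⟨a, ha, b, hb, rfl⟩ := Submodule.mem_sup.1 hξ
  rw [map_add]
  exact Submodule.add_mem_sup (hf ha) (hf hb)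

/-- The difference is the boundary of the homotopy plus the homotopy applied to the boundary. The
latter is a sum of chains of the two open subsets because the boundary is one. -/
lemma sub_act_sd_mem {U V : Opens X} : ∀ {q : ℕ} {ξ : 𝒳.Chain q}, ξ ∈ 𝒳.IC (U ⊔ V) q →
    ξ ∈ 𝒳.relCycles U V q → ξ - 𝒳.act q q (AffineChain.sd q) ξ ∈
      (𝒳.IC (U ⊔ V) (q + 1)).map (𝒳.bdry q) ⊔ (𝒳.IC U q ⊔ 𝒳.IC V q)
  | 0, ξ, hξ, _ => by
    rw [AffineChain.sd, act_ident (chainsOn_mono (fun _ h => h.2.1) hξ), sub_self]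
    exact Submodule.zero_mem _
  | q + 1, ξ, hξ, hd => by
    have h := bdry_act_sdHomotopy (goodSimplices_of_IC hξ)
    rw [eq_sub_iff_add_eq] at h
    rw [← h]
    exact Submodule.add_mem_sup (Submodule.mem_map_of_mem (act_sdHomotopy_mem_IC hξ))
      (act_mem_sup act_sdHomotopy_mem_IC hd)

lemma act_sd_mem_relCycles {U V : Opens X} : ∀ {q : ℕ} {ξ : 𝒳.Chain q},
    ξ ∈ 𝒳.relCycles U V q → 𝒳.act q q (AffineChain.sd q) ξ ∈ 𝒳.relCycles U V q
  | 0, _, _ => trivial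
  | q + 1, ξ, hd => by
    change 𝒳.bdry q _ ∈ 𝒳.IC U q ⊔ 𝒳.IC V q
    rw [bdry_act_sd]
    exact act_mem_sup act_sd_mem_IC hd

/-- Small chains: every relative cycle is homologous to a sum of intersection chains of `U`
and `V`. -/
theorem mem_sup_of_mem_relCycles [NormalSpace X] [T2Space X] {U V : Opens X} {ξ : 𝒳.Chain q}
    (hξ : ξ ∈ 𝒳.IC (U ⊔ V) q) (hd : ξ ∈ 𝒳.relCycles U V q) :
    ξ ∈ (𝒳.IC (U ⊔ V) (q + 1)).map (𝒳.bdry q) ⊔ (𝒳.IC U q ⊔ 𝒳.IC V q) := by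
  obtain ⟨n, hn⟩ := exists_iterate_sd_mem_sup hξ
  induction n generalizing ξ with
  | zero => exact Submodule.mem_sup_right hn
  | succ n ih =>
    -- The innermost subdivision is peeled off: the subdivided chain is again a relative cycle and
    -- needs one subdivision less.
    rw [pow_succ, Module.End.mul_apply] at hn
    have h1 := ih (act_sd_mem_IC hξ) (act_sd_mem_relCycles hd) hn
    have h2 := Submodule.add_mem _ (sub_act_sd_mem hξ hd) h1
    rwa [sub_add_cancel] at h2

end ICData

/-! ### Criteria for exactness of squares: pullbacks and quotients -/

namespace HomologicalComplex

open CategoryTheory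

variable {R : Type} [CommRing R] {c : ComplexShape ℕ}

/-- A short exact sequence of complexes, described in terms of elements. -/
structure IsShortExact {C C' C'' : HomologicalComplex (ModuleCat.{u} R) c}
    (i : C ⟶ C') (π : C' ⟶ C'') : Prop where
  injective : ∀ q, Function.Injective (i.f q)
  surjective : ∀ q, Function.Surjective (π.f q)
  exact : ∀ q x, π.f q x = 0 ↔ ∃ y, i.f q y = x

namespace IsShortExact

variable {C C' C'' : HomologicalComplex (ModuleCat.{u} R) c} {i : C ⟶ C'} {π : C' ⟶ C''}
  (h : IsShortExact i π)

include h

lemma family_injective : Function.Injective (familyMap i) := fun _ _ hxy =>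
  funext fun q => h.injective q (congrFun hxy q)

lemma family_surjective : Function.Surjective (familyMap π) := by
  intro y
  choose x hx using fun q => h.surjective q (y q)
  exact ⟨x, funext hx⟩

lemma family_exact (x : C'.Family) : familyMap π x = 0 ↔ ∃ y, familyMap i y = x := by
  constructor
  · intro hx
    choose y hy using fun q => (h.exact q (x q)).1 (congrFun hx q)
    exact ⟨y, funext hy⟩
  · rintro ⟨y, rfl⟩
    exact funext fun q => (h.exact q _).2 ⟨y q, rfl⟩

end IsShortExact

end HomologicalComplex

namespace ComplexSquare

open CategoryTheory HomologicalComplex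

variable {R : Type} [CommRing R] {c : ComplexShape ℕ}

/-- A square of complexes is exact if it is a pullback with injective projections and every relative
cycle of the target is homologous to a sum of chains of the middle terms. -/
lemma exact_of_pullback {Sq : ComplexSquare.{u} R c}
    (hinj : ∀ q, Function.Injective (Sq.f₁.f q))
    (hpull : ∀ q (a : Sq.R₁.X q) (b : Sq.R₂.X q), Sq.g₁.f q a + Sq.g₂.f q b = 0 →
      ∃ p, Sq.f₁.f q p = a ∧ Sq.f₂.f q p = -b)
    (hsmall : ∀ (s : Sq.S.Family) (r₁ : Sq.R₁.Family) (r₂ : Sq.R₂.Family),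
      familyMap Sq.g₁ r₁ + familyMap Sq.g₂ r₂ + Sq.S.familyD s = 0 →
      ∃ s' u v, familyMap Sq.g₁ u + familyMap Sq.g₂ v + Sq.S.familyD s' = s) : Sq.Exact := by
  rintro ⟨p, r₁, r₂, s⟩ ht
  obtain ⟨-, h₁, h₂, h₃⟩ : Sq.P.familyD p = 0 ∧ familyMap Sq.f₁ p - Sq.R₁.familyD r₁ = 0 ∧
      -familyMap Sq.f₂ p - Sq.R₂.familyD r₂ = 0 ∧
      familyMap Sq.g₁ r₁ + familyMap Sq.g₂ r₂ + Sq.S.familyD s = 0 := by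
    simpa [totD, Prod.ext_iff] using ht
  -- After subtraction of the total boundary of (0, u, v, s') the last component is zero, and the
  -- corrected middle components form a pair that comes from the pullback.
  obtain ⟨s', u, v, rfl⟩ := hsmall s r₁ r₂ h₃
  have h₄ : familyMap Sq.g₁ (r₁ + Sq.R₁.familyD u) + familyMap Sq.g₂ (r₂ + Sq.R₂.familyD v) = 0 := by
    rw [map_add, map_add, familyD_familyD, familyD_familyMap, familyD_familyMap, add_zero] at h₃
    rw [map_add, map_add, ← h₃]
    abel
  choose p' hp₁ hp₂ using fun q => hpull q _ _ (congrFun h₄ q)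
  have hp₁' : familyMap Sq.f₁ p' = r₁ + Sq.R₁.familyD u := funext hp₁
  have hp₂' : familyMap Sq.f₂ p' = -(r₂ + Sq.R₂.familyD v) := funext hp₂
  refine ⟨(p', u, v, s'), Prod.ext ?_ (Prod.ext ?_ (Prod.ext ?_ rfl))⟩
  · refine funext fun q => hinj q (congrFun (?_ : familyMap Sq.f₁ (Sq.P.familyD p') =
      familyMap Sq.f₁ p) q)
    rw [← familyD_familyMap, hp₁', map_add, familyD_familyD, add_zero, sub_eq_zero.1 h₁]
  · change familyMap Sq.f₁ p' - Sq.R₁.familyD u = r₁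
    rw [hp₁', add_sub_cancel_right]
  · change -familyMap Sq.f₂ p' - Sq.R₂.familyD v = r₂
    rw [hp₂', neg_neg, add_sub_cancel_right]

/-- The quotient of an exact square by an exact square is exact. -/
lemma Exact.of_isShortExact {A B C : ComplexSquare.{u} R c} (i : Hom A B) (π : Hom B C)
    (hP : IsShortExact i.P π.P) (hR₁ : IsShortExact i.R₁ π.R₁) (hR₂ : IsShortExact i.R₂ π.R₂)
    (hS : IsShortExact i.S π.S) (hA : A.Exact) (hB : B.Exact) : C.Exact := by
  have hinj : Function.Injective i.tot := by
    intro x y hxy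
    simp only [Hom.tot_mk, Prod.mk.injEq] at hxy
    exact Prod.ext (hP.family_injective hxy.1) (Prod.ext (hR₁.family_injective hxy.2.1)
      (Prod.ext (hR₂.family_injective hxy.2.2.1) (hS.family_injective hxy.2.2.2)))
  have hsurj : Function.Surjective π.tot := by
    rintro ⟨p, r₁, r₂, s⟩
    obtain ⟨p', hp⟩ := hP.family_surjective p
    obtain ⟨r₁', hr₁⟩ := hR₁.family_surjective r₁
    obtain ⟨r₂', hr₂⟩ := hR₂.family_surjective r₂
    obtain ⟨s', hs⟩ := hS.family_surjective s
    exact ⟨(p', r₁', r₂', s'), Prod.ext hp (Prod.ext hr₁ (Prod.ext hr₂ hs))⟩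
  have hex : ∀ x, π.tot x = 0 ↔ ∃ y, i.tot y = x := by
    rintro ⟨p, r₁, r₂, s⟩
    simp only [Hom.tot_mk, Prod.mk_eq_zero, hP.family_exact, hR₁.family_exact, hR₂.family_exact,
      hS.family_exact, Prod.exists, Prod.mk.injEq]
    constructor
    · rintro ⟨⟨a, ha⟩, ⟨b, hb⟩, ⟨d, hd⟩, ⟨e, he⟩⟩
      exact ⟨a, b, d, e, ha, hb, hd, he⟩
    · rintro ⟨a, b, d, e, ha, hb, hd, he⟩
      exact ⟨⟨a, ha⟩, ⟨b, hb⟩, ⟨d, hd⟩, ⟨e, he⟩⟩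
  intro t ht
  obtain ⟨x, rfl⟩ := hsurj t
  -- The usual chase: a lift of the cycle has its boundary in `A`, where it is a cycle and hence a
  -- boundary; correcting the lift by the primitive makes it a cycle of `B`.
  obtain ⟨y, hy⟩ := (hex (B.totD x)).1 (by rw [Hom.tot_totD, ht])
  obtain ⟨y', rfl⟩ := hA y (hinj (by rw [Hom.tot_totD, hy, totD_totD, map_zero]))
  obtain ⟨w, hw⟩ := hB (x - i.tot y') (by rw [map_sub, ← Hom.tot_totD, hy, sub_self])
  exact ⟨π.tot w, by
    rw [← Hom.tot_totD, hw, map_sub, (hex (i.tot y')).2 ⟨y', rfl⟩, sub_zero]⟩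

end ComplexSquare

namespace ICData

open CategoryTheory HomologicalComplex

variable {X : Type u} [TopologicalSpace X] (𝒳 : ICData X)

/-! ### Squares of complexes of intersection chains -/

/-- The complex of tropical intersection chains of an open subset. -/
noncomputable def icComplex (U : Opens X) : ChainComplex (ModuleCat.{u} 𝒳.Q) ℕ :=
  ChainComplex.of (fun q => ModuleCat.of 𝒳.Q (𝒳.IC U q))
    (fun q => ModuleCat.ofHom (𝒳.bdryIC U q)) (fun q => by
      refine ModuleCat.hom_ext (LinearMap.ext fun x => Subtype.ext ?_)
      exact bdry_bdry q x.1)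

lemma icComplex_d (U : Opens X) (q : ℕ) :
    (𝒳.icComplex U).d (q + 1) q = ModuleCat.ofHom (𝒳.bdryIC U q) :=
  ChainComplex.of_d (fun q => ModuleCat.of 𝒳.Q (𝒳.IC U q))
    (fun q => ModuleCat.ofHom (𝒳.bdryIC U q)) q

/-- The inclusion of the complexes of intersection chains. -/
noncomputable def icMap {U U' : Opens X} (h : U ≤ U') : 𝒳.icComplex U ⟶ 𝒳.icComplex U' :=
  ChainComplex.ofHom (fun q => ModuleCat.ofHom (Submodule.inclusion (IC_mono h q))) (fun q => by
    rw [icComplex_d, icComplex_d]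
    rfl)

/-- The projection from intersection chains to relative intersection chains. -/
noncomputable def icToRel (U A : Opens X) : 𝒳.icComplex U ⟶ 𝒳.relComplex U A :=
  ChainComplex.ofHom (fun q => ModuleCat.ofHom (Submodule.mkQ _)) (fun q => by
    rw [icComplex_d, relComplex_d]
    rfl)

variable {𝒳}

/-- The chain underlying an element of the complex of intersection chains. -/
noncomputable def icVal {U : Opens X} {q : ℕ} : (𝒳.icComplex U).X q →ₗ[𝒳.Q] 𝒳.Chain q :=
  (𝒳.IC U q).subtype

lemma icVal_injective {U : Opens X} {q : ℕ} :
    Function.Injective (icVal : (𝒳.icComplex U).X q →ₗ[𝒳.Q] 𝒳.Chain q) :=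
  Subtype.val_injective

lemma icVal_mem {U : Opens X} {q : ℕ} (x : (𝒳.icComplex U).X q) : icVal x ∈ 𝒳.IC U q :=
  Subtype.property (p := (· ∈ 𝒳.IC U q)) x

lemma exists_icVal {U : Opens X} {q : ℕ} {ξ : 𝒳.Chain q} (h : ξ ∈ 𝒳.IC U q) :
    ∃ x : (𝒳.icComplex U).X q, icVal x = ξ := ⟨(⟨ξ, h⟩ : 𝒳.IC U q), rfl⟩

lemma icVal_d {U : Opens X} {q : ℕ} (x : (𝒳.icComplex U).X (q + 1)) :
    icVal ((𝒳.icComplex U).d (q + 1) q x) = 𝒳.bdry q (icVal x) := by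
  rw [icComplex_d]
  rfl

lemma icVal_icMap {U U' : Opens X} (h : U ≤ U') {q : ℕ} (x : (𝒳.icComplex U).X q) :
    icVal ((𝒳.icMap h).f q x) = icVal x := rfl

lemma icToRel_surjective (U A : Opens X) (q : ℕ) : Function.Surjective ((𝒳.icToRel U A).f q) :=
  Submodule.mkQ_surjective _

lemma icToRel_eq_zero_iff {U A : Opens X} {q : ℕ} (x : (𝒳.icComplex U).X q) :
    (𝒳.icToRel U A).f q x = 0 ↔ icVal x ∈ 𝒳.IC A q :=
  Submodule.Quotient.mk_eq_zero (M := 𝒳.IC U q) _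

lemma icToRel_relMap {U U' A A' : Opens X} (hU : U ≤ U') (hA : A ≤ A') :
    𝒳.icToRel U A ≫ 𝒳.relMap hU hA = 𝒳.icMap hU ≫ 𝒳.icToRel U' A' :=
  HomologicalComplex.hom_ext _ _ fun _ => rfl

lemma icMap_comp {U U' U'' : Opens X} (h : U ≤ U') (h' : U' ≤ U'') :
    𝒳.icMap h ≫ 𝒳.icMap h' = 𝒳.icMap (h.trans h') :=
  HomologicalComplex.hom_ext _ _ fun _ => rfl

lemma isShortExact_icMap_icToRel {U A : Opens X} (h : A ≤ U) :
    IsShortExact (𝒳.icMap h) (𝒳.icToRel U A) where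
  injective q x y hxy := icVal_injective (congrArg (icVal (U := U)) hxy :)
  surjective q := icToRel_surjective U A q
  exact q x := by
    rw [icToRel_eq_zero_iff]
    constructor
    · intro hx
      obtain ⟨y, hy⟩ := exists_icVal hx
      exact ⟨y, icVal_injective hy⟩
    · rintro ⟨y, rfl⟩
      exact icVal_mem y

variable (𝒳) in
/-- The square of the complexes of intersection chains of open subsets. -/
noncomputable def icSquare {I U V W : Opens X} (hIU : I ≤ U) (hIV : I ≤ V) (hUW : U ≤ W)
    (hVW : V ≤ W) : ComplexSquare.{u} 𝒳.Q (ComplexShape.down ℕ) where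
  P := 𝒳.icComplex I
  R₁ := 𝒳.icComplex U
  R₂ := 𝒳.icComplex V
  S := 𝒳.icComplex W
  f₁ := 𝒳.icMap hIU
  f₂ := 𝒳.icMap hIV
  g₁ := 𝒳.icMap hUW
  g₂ := 𝒳.icMap hVW
  comm := by rw [icMap_comp, icMap_comp]

/-- The pullback property is `IC_inf`, and the condition on the target is the theorem on small
chains, applied in each degree separately. -/
lemma icSquare_exact [NormalSpace X] [T2Space X] {I U V W : Opens X} (hI : I = U ⊓ V)
    (hW : W = U ⊔ V) (hIU : I ≤ U) (hIV : I ≤ V) (hUW : U ≤ W) (hVW : V ≤ W) :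
    (𝒳.icSquare hIU hIV hUW hVW).Exact := by
  subst hI hW
  refine ComplexSquare.exact_of_pullback (fun q x y hxy => icVal_injective (congrArg (icVal (U := U)) hxy :))
    (fun q (a : (𝒳.icComplex U).X q) (b : (𝒳.icComplex V).X q) h => ?_)
    (fun (s : (𝒳.icComplex (U ⊔ V)).Family) (r₁ : (𝒳.icComplex U).Family)
      (r₂ : (𝒳.icComplex V).Family) h => ?_)
  · have h' : icVal a + icVal b = 0 := (map_add icVal _ _).symm.trans (congrArg icVal h)
    have hab : icVal a = -icVal b := eq_neg_of_add_eq_zero_left h'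
    have ha : icVal a ∈ 𝒳.IC (U ⊓ V) q := by
      rw [IC_inf]
      exact ⟨icVal_mem a, hab ▸ Submodule.neg_mem _ (icVal_mem b)⟩
    obtain ⟨p, hp⟩ := exists_icVal ha
    exact ⟨p, icVal_injective hp, icVal_injective (hp.trans (hab.trans (map_neg icVal b).symm))⟩
  -- In every positive degree the boundary of `s` is minus a sum of chains of `U` and `V`; degree 0
  -- carries no condition.
  · have hcyc : ∀ q, icVal (s q) ∈ 𝒳.relCycles U V q := by
      intro q
      cases q with
      | zero => trivial
      | succ q =>
        change 𝒳.bdry q _ ∈ 𝒳.IC U q ⊔ 𝒳.IC V q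
        have hq := congrFun h q
        have hq' : icVal (r₁ q) + icVal (r₂ q) + 𝒳.bdry q (icVal (s (q + 1))) = 0 := by
          rw [← icVal_d, ← familyD_of_rel (c := ComplexShape.down ℕ) (i := q + 1) (j := q) rfl s]
          exact congrArg icVal hq
        rw [eq_neg_of_add_eq_zero_right hq']
        exact Submodule.neg_mem _ (Submodule.add_mem_sup (icVal_mem _) (icVal_mem _))
    have key : ∀ q, ∃ (η : (𝒳.icComplex (U ⊔ V)).X (q + 1)) (u : (𝒳.icComplex U).X q)
        (v : (𝒳.icComplex V).X q), 𝒳.bdry q (icVal η) + (icVal u + icVal v) = icVal (s q) := by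
      intro q
      obtain ⟨_, ⟨η, hη, rfl⟩, y, hy, h1⟩ := Submodule.mem_sup.1
        (mem_sup_of_mem_relCycles (icVal_mem (s q)) (hcyc q))
      obtain ⟨u, hu, v, hv, rfl⟩ := Submodule.mem_sup.1 hy
      obtain ⟨η, rfl⟩ := exists_icVal hη
      obtain ⟨u, rfl⟩ := exists_icVal hu
      obtain ⟨v, rfl⟩ := exists_icVal hv
      exact ⟨η, u, v, h1⟩
    choose η u v hη using key
    -- The chain whose boundary occurs in degree `q` lives in degree q + 1; nothing is needed in
    -- degree 0.
    let s' : (𝒳.icComplex (U ⊔ V)).Family := fun q => match q with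
      | 0 => 0
      | q + 1 => η q
    refine ⟨s', u, v, funext fun q => icVal_injective ?_⟩
    rw [← hη q]
    change icVal ((𝒳.icMap hUW).f q (u q) + (𝒳.icMap hVW).f q (v q) +
      (𝒳.icComplex (U ⊔ V)).familyD s' q) = _
    rw [map_add, map_add, familyD_of_rel (c := ComplexShape.down ℕ) (i := q + 1) (j := q) rfl s',
      icVal_d, icVal_icMap, icVal_icMap, add_comm]

variable (𝒳) in
/-- The square of the complexes of relative intersection chains of pairs of open subsets. -/
noncomputable def relSquare {I U V W I' A B C : Opens X} (hIU : I ≤ U) (hIV : I ≤ V) (hUW : U ≤ W)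
    (hVW : V ≤ W) (hIA : I' ≤ A) (hIB : I' ≤ B) (hAC : A ≤ C) (hBC : B ≤ C) :
    ComplexSquare.{u} 𝒳.Q (ComplexShape.down ℕ) where
  P := 𝒳.relComplex I I'
  R₁ := 𝒳.relComplex U A
  R₂ := 𝒳.relComplex V B
  S := 𝒳.relComplex W C
  f₁ := 𝒳.relMap hIU hIA
  f₂ := 𝒳.relMap hIV hIB
  g₁ := 𝒳.relMap hUW hAC
  g₂ := 𝒳.relMap hVW hBC
  comm := by rw [relMap_comp, relMap_comp]

/-- The relative square is the quotient of the absolute square of `U` and `V` by that of `A` and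
`B`; both are exact by `icSquare_exact`. -/
theorem relSquare_exact [NormalSpace X] [T2Space X] {I U V W I' A B C : Opens X}
    (hI : I = U ⊓ V) (hW : W = U ⊔ V) (hI' : I' = A ⊓ B) (hC : C = A ⊔ B) (hA : A ≤ U)
    (hB : B ≤ V) (hIU : I ≤ U) (hIV : I ≤ V) (hUW : U ≤ W) (hVW : V ≤ W) (hIA : I' ≤ A)
    (hIB : I' ≤ B) (hAC : A ≤ C) (hBC : B ≤ C) :
    (𝒳.relSquare hIU hIV hUW hVW hIA hIB hAC hBC).Exact := by
  have hII : I' ≤ I := by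
    rw [hI, hI']
    exact inf_le_inf hA hB
  have hCW : C ≤ W := by
    rw [hC, hW]
    exact sup_le_sup hA hB
  let i : ComplexSquare.Hom (𝒳.icSquare hIA hIB hAC hBC) (𝒳.icSquare hIU hIV hUW hVW) :=
    { P := 𝒳.icMap hII
      R₁ := 𝒳.icMap hA
      R₂ := 𝒳.icMap hB
      S := 𝒳.icMap hCW
      comm_f₁ := (icMap_comp hIA hA).trans (icMap_comp hII hIU).symm
      comm_f₂ := (icMap_comp hIB hB).trans (icMap_comp hII hIV).symm
      comm_g₁ := (icMap_comp hAC hCW).trans (icMap_comp hA hUW).symm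
      comm_g₂ := (icMap_comp hBC hCW).trans (icMap_comp hB hVW).symm }
  let π : ComplexSquare.Hom (𝒳.icSquare hIU hIV hUW hVW)
      (𝒳.relSquare hIU hIV hUW hVW hIA hIB hAC hBC) :=
    { P := 𝒳.icToRel I I'
      R₁ := 𝒳.icToRel U A
      R₂ := 𝒳.icToRel V B
      S := 𝒳.icToRel W C
      comm_f₁ := (icToRel_relMap _ _).symm
      comm_f₂ := (icToRel_relMap _ _).symm
      comm_g₁ := (icToRel_relMap _ _).symm
      comm_g₂ := (icToRel_relMap _ _).symm }
  exact ComplexSquare.Exact.of_isShortExact i π (isShortExact_icMap_icToRel hII)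
    (isShortExact_icMap_icToRel hA) (isShortExact_icMap_icToRel hB)
    (isShortExact_icMap_icToRel hCW) (icSquare_exact hI' hC _ _ _ _)
    (icSquare_exact hI hW _ _ _ _)

lemma subsingleton_relComplex (U : Opens X) (q : ℕ) : Subsingleton ((𝒳.relComplex U U).X q) := by
  refine ⟨fun x y => ?_⟩
  obtain ⟨x, rfl⟩ := icToRel_surjective U U q x
  obtain ⟨y, rfl⟩ := icToRel_surjective U U q y
  rw [(icToRel_eq_zero_iff x).2 (icVal_mem x), (icToRel_eq_zero_iff y).2 (icVal_mem y)]

/-- With the ambient open subset fixed, enlarging the relative part is a further quotient. This is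
the surjectivity which the limit argument needs for Borel–Moore chains. -/
lemma relMap_surjective {U A A' : Opens X} (hA : A ≤ A') (q : ℕ) :
    Function.Surjective ((𝒳.relMap (le_refl U) hA).f q) := by
  intro y
  obtain ⟨y, rfl⟩ := icToRel_surjective U A' q y
  exact ⟨(𝒳.icToRel U A).f q y, rfl⟩

/-! ### Projectivity of the modules of chains -/

/-- Expanding in the standard basis puts the lattice inside the ℤ-span of the finitely many products
of basis vectors, and ℤ is noetherian. -/
lemma _root_.TropSpace.wedgeLattice_fg {r p : ℕ} (I : Set (Fin r)) :
    (TropSpace.wedgeLattice p I).FG := by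
  let e : (Fin p → Fin r) → ⋀[ℝ]^p (Fin r → ℝ) := fun f =>
    exteriorPower.ιMulti ℝ p fun a => Pi.single (f a) (1 : ℝ)
  have hfg : (Submodule.span ℤ (Set.range e)).FG := Submodule.fg_span (Set.finite_range e)
  have hle : TropSpace.wedgeLattice p I ≤ Submodule.span ℤ (Set.range e) := by
    refine Submodule.span_le.2 ?_
    rintro _ ⟨v, -, rfl⟩
    have hv : (fun a i => (v a i : ℝ)) = fun a => ∑ i, (v a i : ℝ) • (Pi.single i 1 : Fin r → ℝ) := by
      funext a i
      simp [Finset.sum_apply, Pi.single_apply]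
    have h1 : exteriorPower.ιMulti ℝ p (fun a i => (v a i : ℝ)) =
        ∑ f : Fin p → Fin r, (∏ a, v a (f a)) • e f := by
      rw [hv]
      have := (exteriorPower.ιMulti ℝ p (M := Fin r → ℝ)).toMultilinearMap.map_sum
        (fun a i => (v a i : ℝ) • (Pi.single i 1 : Fin r → ℝ))
      refine this.trans (Finset.sum_congr rfl fun f _ => ?_)
      refine ((exteriorPower.ιMulti ℝ p (M := Fin r → ℝ)).toMultilinearMap.map_smul_univ
        (fun a => (v a (f a) : ℝ)) fun a => Pi.single (f a) 1).trans ?_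
      rw [← Int.cast_smul_eq_zsmul ℝ, Int.cast_prod]
      rfl
    change exteriorPower.ιMulti ℝ p (fun a i => (v a i : ℝ)) ∈ _
    rw [h1]
    exact Submodule.sum_mem _ fun f _ => Submodule.smul_mem _ _ (Submodule.subset_span ⟨f, rfl⟩)
  have : IsNoetherian ℤ (Submodule.span ℤ (Set.range e)) := isNoetherian_of_fg_of_noetherian _ hfg
  have h2 : ((TropSpace.wedgeLattice p I).submoduleOf (Submodule.span ℤ (Set.range e))).FG :=
    IsNoetherian.noetherian _
  have h3 := h2.map (Submodule.span ℤ (Set.range e)).subtype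
  rwa [Submodule.submoduleOf, Submodule.map_comap_subtype, inf_eq_right.2 hle] at h3

/-- A finitely generated abelian group that is torsion-free, being contained in a real vector space.
-/
instance (p : ℕ) (σ : 𝒳.faces.cells) : Module.Free ℤ (𝒳.faces.multiTangent p σ) := by
  have h1 : IsNoetherian ℤ (TropSpace.wedgeLattice p (TropSpace.setSed (𝒳.faces.img σ σ))) :=
    isNoetherian_of_fg_of_noetherian _ (TropSpace.wedgeLattice_fg _)
  have h2 : IsNoetherian ℤ (𝒳.faces.multiTangent p σ) := isNoetherian_of_le
    (inf_le_right : 𝒳.faces.multiTangent p σ ≤ _)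
  have h3 : Module.IsTorsionFree ℤ (𝒳.faces.multiTangent p σ) := by
    refine Module.IsTorsionFree.of_smul_eq_zero fun n m hm => ?_
    have h : (n : ℝ) • (m.1) = 0 :=
      (Int.cast_smul_eq_zsmul ℝ n m.1).trans (congrArg Subtype.val hm)
    rcases smul_eq_zero.1 h with h | h
    · exact Or.inl (Int.cast_eq_zero.1 h)
    · exact Or.inr (Subtype.ext h)
  exact Module.free_of_finite_type_torsion_free'

instance (σ : 𝒳.faces.cells) : Module.Free 𝒳.Q (𝒳.faces.Coeff 𝒳.Q 𝒳.p σ) :=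
  inferInstanceAs (Module.Free 𝒳.Q (𝒳.Q ⊗[ℤ] 𝒳.faces.multiTangent 𝒳.p σ))

instance (q : ℕ) : Module.Projective 𝒳.Q (𝒳.Chain q) := inferInstance

/-- Dropping the simplices contained in `A` embeds the relative chains into the module of all
chains: an intersection chain of `U` supported in `A` is an intersection chain of `A`. The module of
all chains is projective, being a direct sum of free coefficient modules. -/
lemma projective_relComplex [IsDedekindDomain 𝒳.Q] (U A : Opens X) (q : ℕ) :
    Module.Projective 𝒳.Q ((𝒳.relComplex U A).X q) := by
  classical
  let F : 𝒳.Chain q →ₗ[𝒳.Q] 𝒳.Chain q :=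
    DFinsupp.filterLinearMap 𝒳.Q _ fun δ => ¬ δ.image ⊆ (A : Set X)
  have hF : ∀ ξ : 𝒳.Chain q, F ξ = 0 ↔ ξ ∈ 𝒳.chainsOn {δ | δ.image ⊆ (A : Set X)} := by
    intro ξ
    constructor
    · intro h δ hδ
      by_contra hA
      exact hδ ((if_pos hA).symm.trans (DFunLike.congr_fun h δ))
    · intro h
      refine DFinsupp.ext fun δ => ?_
      by_cases hA : δ.image ⊆ (A : Set X)
      · exact if_neg (not_not.2 hA)
      · exact (if_pos hA).trans (not_not.1 fun h0 => hA (h δ h0))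
  let f : 𝒳.relChain U A q →ₗ[𝒳.Q] 𝒳.Chain q :=
    Submodule.liftQ _ (F ∘ₗ (𝒳.IC U q).subtype) fun ξ hξ => (hF _).2
      (chainsOn_mono (fun _ h => h.1) (goodSimplices_of_IC (U := A) hξ))
  have hf : Function.Injective f := by
    refine (injective_iff_map_eq_zero f).2 fun x hx => ?_
    obtain ⟨ξ, rfl⟩ := Submodule.Quotient.mk_surjective _ x
    rw [Submodule.Quotient.mk_eq_zero]
    exact mem_IC_of_image_subset ξ.2 ((hF _).1 hx)
  exact Module.Projective.of_injective_of_isDedekindDomain f hf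

end ICData

/-! ### Topology of rational polyhedral spaces -/

namespace PolyAtlas

variable {X : Type u} [TopologicalSpace X]

/-- The support of a locally finite collection of closed polyhedra is closed. The image of a chart
is thus locally closed in a locally compact space. -/
lemma locallyCompactSpace_source (𝒜 : PolyAtlas X) {φ : TropChart X} (hφ : φ ∈ 𝒜.charts) :
    LocallyCompactSpace φ.source := by
  obtain ⟨N, hN⟩ := 𝒜.polyhedral
  obtain ⟨C, hC, -, W, hW, himg⟩ := hN φ hφ
  have : LocallyCompactSpace Trop := isOpen_Iio.locallyCompactSpace
  have hcl : IsClosed (⋃₀ C) := by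
    rw [Set.sUnion_eq_iUnion]
    exact hC.locallyFinite.isClosed_iUnion fun σ => (hC.isPolyhedron σ σ.2).isClosed
  have hrange : Set.range (fun x : φ.source => φ.toFun x) = ⋃₀ C ∩ W := by
    rw [← himg]
    ext y
    constructor
    · rintro ⟨x, rfl⟩
      exact ⟨x, x.2, rfl⟩
    · rintro ⟨x, hx, rfl⟩
      exact ⟨⟨x, hx⟩, rfl⟩
  refine φ.isEmbedding.isInducing.locallyCompactSpace ?_
  rw [hrange]
  exact hcl.isLocallyClosed.inter hW.isLocallyClosed

lemma locallyCompactSpace [T2Space X] (𝒜 : PolyAtlas X) : LocallyCompactSpace X := by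
  have : WeaklyLocallyCompactSpace X := by
    refine ⟨fun x => ?_⟩
    obtain ⟨φ, hφ, hx⟩ := 𝒜.cover x
    have := 𝒜.locallyCompactSpace_source hφ
    obtain ⟨K, hK, hxK⟩ := exists_compact_mem_nhds (⟨x, hx⟩ : φ.source)
    exact ⟨Subtype.val '' K, hK.image continuous_subtype_val,
      φ.source.isOpen.isOpenEmbedding_subtypeVal.image_mem_nhds.2 hxK⟩
  infer_instance

end PolyAtlas

/-! ### Compact subsets of open subsets -/

namespace ICData

open CategoryTheory CategoryTheory.Limits Opposite HomologicalComplex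

variable {X : Type u} [TopologicalSpace X]

/-- An open subset of a locally compact second countable space has a cofinal sequence of compact
subsets. -/
lemma exists_cofinal_compactsIn [LocallyCompactSpace X] [SecondCountableTopology X] (W : Opens X) :
    ∃ κ : ℕ → CompactsIn W, Monotone κ ∧ ∀ K, ∃ n, K ≤ κ n := by
  have : LocallyCompactSpace W := W.isOpen.locallyCompactSpace
  let E := CompactExhaustion.choice W
  refine ⟨fun n => ⟨⟨Subtype.val '' E n, (E.isCompact n).image continuous_subtype_val⟩, ?_⟩,
    fun m n h => Set.image_mono (E.subset h), fun K => ?_⟩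
  · rintro _ ⟨x, -, rfl⟩
    exact x.2
  · have hK : IsCompact (Subtype.val ⁻¹' (K.1 : Set X) : Set W) := by
      refine Subtype.isCompact_iff.2 ?_
      have h : Subtype.val '' (Subtype.val ⁻¹' (K.1 : Set X) : Set W) = K.1 :=
        Set.image_preimage_eq_of_subset fun x hx => ⟨⟨x, K.2 hx⟩, rfl⟩
      rw [h]
      exact K.1.isCompact
    obtain ⟨n, hn⟩ := E.exists_superset_of_isCompact hK
    exact ⟨n, fun x hx => ⟨⟨x, K.2 hx⟩, hn hx, rfl⟩⟩

lemma exists_compactsIn_sup_of_le_sup [T2Space X] {W₁ W₂ : Opens X} (K : Compacts X)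
    (hK : (K : Set X) ⊆ W₁ ⊔ W₂) : ∃ (K₁ : CompactsIn W₁) (K₂ : CompactsIn W₂), K = K₁.1 ⊔ K₂.1 := by
  obtain ⟨K₁, K₂, h₁, h₂, hW₁, hW₂, h⟩ := K.isCompact.binary_compact_cover W₁.isOpen W₂.isOpen hK
  exact ⟨⟨⟨K₁, h₁⟩, hW₁⟩, ⟨⟨K₂, h₂⟩, hW₂⟩, SetLike.coe_injective h⟩

section Compacts

variable {W₁ W₂ W : Opens X}

/-- The union of compact subsets of `W₁` and `W₂`, as a compact subset of `W₁ ⊔ W₂`. -/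
def CompactsIn.sup (hW : W = W₁ ⊔ W₂) (K : CompactsIn W₁ × CompactsIn W₂) : CompactsIn W :=
  ⟨K.1.1 ⊔ K.2.1, by
    subst hW
    exact Set.union_subset_union K.1.2 K.2.2⟩

lemma CompactsIn.sup_mono (hW : W = W₁ ⊔ W₂) : Monotone (CompactsIn.sup hW) :=
  fun _ _ h => sup_le_sup (α := Compacts X) h.1 h.2

variable [T2Space X]

/-- The intersection of compact subsets of `W₁` and `W₂`, as a compact subset of `W₁ ⊓ W₂`. -/
def CompactsIn.inf (hW : W = W₁ ⊓ W₂) (K : CompactsIn W₁ × CompactsIn W₂) : CompactsIn W :=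
  ⟨K.1.1 ⊓ K.2.1, by
    subst hW
    exact Set.inter_subset_inter K.1.2 K.2.2⟩

lemma CompactsIn.inf_mono (hW : W = W₁ ⊓ W₂) : Monotone (CompactsIn.inf hW) :=
  fun _ _ h => inf_le_inf (α := Compacts X) h.1 h.2

lemma CompactsIn.exists_le_sup (hW : W = W₁ ⊔ W₂) (K : CompactsIn W) :
    ∃ L, K ≤ CompactsIn.sup hW L := by
  obtain ⟨K₁, K₂, h⟩ := exists_compactsIn_sup_of_le_sup (W₁ := W₁) (W₂ := W₂) K.1 (by
    subst hW
    exact K.2)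
  exact ⟨(K₁, K₂), h.le⟩

lemma CompactsIn.exists_le_inf (hW : W = W₁ ⊓ W₂) (K : CompactsIn W) :
    ∃ L, K ≤ CompactsIn.inf hW L := by
  subst hW
  exact ⟨(⟨K.1, K.2.trans inf_le_left⟩, ⟨K.1, K.2.trans inf_le_right⟩),
    le_inf (α := Compacts X) le_rfl le_rfl⟩

lemma sdiffOpens_sup (Y : Opens X) (K L : Compacts X) :
    sdiffOpens Y (K ⊔ L) = sdiffOpens Y K ⊓ sdiffOpens Y L :=
  SetLike.coe_injective Set.sdiff_inter_sdiff.symm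

lemma sdiffOpens_inf (Y : Opens X) (K L : Compacts X) :
    sdiffOpens Y (K ⊓ L) = sdiffOpens Y K ⊔ sdiffOpens Y L :=
  SetLike.coe_injective Set.sdiff_inter

lemma sdiffOpens_le (Y : Opens X) (K : Compacts X) : sdiffOpens Y K ≤ Y :=
  Set.sdiff_subset

/-- With `sdiffOpens_inf_of_subset` this puts the pairs (W, W ∖ K) and (Y, Y ∖ K) into the excision
situation: Y ∖ K and W cover Y and meet in W ∖ K. -/
lemma sdiffOpens_sup_of_subset {W Y : Opens X} (h : W ≤ Y) (K : CompactsIn W) :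
    Y = sdiffOpens Y K.1 ⊔ W := by
  refine SetLike.coe_injective (Set.Subset.antisymm (fun x hx => ?_) ?_)
  · by_cases hK : x ∈ K.1
    · exact Or.inr (K.2 hK)
    · exact Or.inl ⟨hx, hK⟩
  · exact Set.union_subset (sdiffOpens_le Y K.1) h

lemma sdiffOpens_inf_of_subset {W Y : Opens X} (h : W ≤ Y) (K : Compacts X) :
    sdiffOpens W K = sdiffOpens Y K ⊓ W := by
  refine SetLike.coe_injective (Set.Subset.antisymm ?_ ?_)
  · exact fun x hx => ⟨⟨h hx.1, hx.2⟩, hx.1⟩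
  · rintro x ⟨⟨-, hx⟩, hW⟩
    exact ⟨hW, hx⟩

end Compacts

end ICData

/-! ### Vanishing corners and duals of maps of squares -/

section Systems

open CategoryTheory HomologicalComplex

variable {R : Type} [CommRing R] {c : ComplexShape ℕ}

lemma HomologicalComplex.hom_eq_of_subsingleton_left {C D : HomologicalComplex (ModuleCat.{u} R) c}
    (hC : ∀ q, Subsingleton (C.X q)) (f g : C ⟶ D) : f = g := by
  refine HomologicalComplex.hom_ext _ _ fun q => ModuleCat.hom_ext (LinearMap.ext fun x => ?_)
  rw [(hC q).elim x 0, map_zero, map_zero]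

lemma HomologicalComplex.hom_eq_of_subsingleton_right
    {C D : HomologicalComplex (ModuleCat.{u} R) c}
    (hD : ∀ q, Subsingleton (D.X q)) (f g : C ⟶ D) : f = g :=
  HomologicalComplex.hom_ext _ _ fun q => ModuleCat.hom_ext (LinearMap.ext fun _ =>
    (hD q).elim _ _)

/-- This and its analogue for direct limits supply the vanishing corners of excision squares. -/
lemma IsSeqLimit.of_subsingleton {L : HomologicalComplex (ModuleCat.{u} R) c}
    {C : ℕ → HomologicalComplex (ModuleCat.{u} R) c} {π : ∀ n, L ⟶ C n}
    {ρ : ∀ n, C (n + 1) ⟶ C n} (hL : ∀ q, Subsingleton (L.X q))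
    (hC : ∀ n q, Subsingleton ((C n).X q)) : IsSeqLimit π ρ where
  comp _ := hom_eq_of_subsingleton_left hL _ _
  ext q _ _ _ := (hL q).elim _ _
  exists_lift q _ _ := ⟨0, fun n => (hC n q).elim _ _⟩
  surjective n q _ := ⟨0, (hC n q).elim _ _⟩

lemma IsDirLimit.of_subsingleton {I : Type u} [Preorder I] [Nonempty I]
    {L : HomologicalComplex (ModuleCat.{u} R) c} {C : I → HomologicalComplex (ModuleCat.{u} R) c}
    {ι : ∀ i, C i ⟶ L} {ρ : ∀ i j, i ≤ j → (C i ⟶ C j)} (hL : ∀ q, Subsingleton (L.X q))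
    (hC : ∀ i q, Subsingleton ((C i).X q)) : IsDirLimit ι ρ where
  comp _ _ _ := hom_eq_of_subsingleton_right hL _ _
  map_comp _ _ k _ _ := hom_eq_of_subsingleton_right (hC k) _ _
  exists_rep q _ := ⟨Classical.arbitrary I, 0, (hL q).elim _ _⟩
  eq_zero q i _ _ := ⟨i, le_rfl, (hC i q).elim _ _⟩

lemma subsingleton_dualComplex {C : ChainComplex (ModuleCat.{u} R) ℕ} {q : ℕ}
    (h : Subsingleton (C.X q)) : Subsingleton ((ICData.dualComplex C).X q) :=
  inferInstanceAs (Subsingleton (C.X q →ₗ[R] R))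

/-- The dual of a map of squares. -/
noncomputable def ComplexSquare.Hom.dual {A B : ComplexSquare.{u} R (ComplexShape.down ℕ)}
    (φ : Hom A B) : Hom B.dual A.dual where
  P := ICData.dualMap φ.S
  R₁ := ICData.dualMap φ.R₁
  R₂ := ICData.dualMap φ.R₂
  S := ICData.dualMap φ.P
  comm_f₁ := by
    change ICData.dualMap _ ≫ ICData.dualMap _ = ICData.dualMap _ ≫ ICData.dualMap _
    rw [← ICData.dualMap_comp, ← ICData.dualMap_comp, φ.comm_g₁]
  comm_f₂ := by
    change ICData.dualMap _ ≫ ICData.dualMap _ = ICData.dualMap _ ≫ ICData.dualMap _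
    rw [← ICData.dualMap_comp, ← ICData.dualMap_comp, φ.comm_g₂]
  comm_g₁ := by
    change ICData.dualMap _ ≫ ICData.dualMap _ = ICData.dualMap _ ≫ ICData.dualMap _
    rw [← ICData.dualMap_comp, ← ICData.dualMap_comp, φ.comm_f₁]
  comm_g₂ := by
    change ICData.dualMap _ ≫ ICData.dualMap _ = ICData.dualMap _ ≫ ICData.dualMap _
    rw [← ICData.dualMap_comp, ← ICData.dualMap_comp, φ.comm_f₂]

end Systems

/-! ### Squares of pairs with compact subsets removed -/

namespace ICData

open CategoryTheory CategoryTheory.Limits Opposite HomologicalComplex ComplexSquare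

variable {X : Type u} [TopologicalSpace X] {𝒳 : ICData X}

variable (𝒳) in
/-- The map between two squares of complexes of relative chains induced by inclusions. -/
noncomputable def relSquareHom {I U V W I' A B C J M N L J' D E F : Opens X} (hIU : I ≤ U)
    (hIV : I ≤ V) (hUW : U ≤ W) (hVW : V ≤ W) (hIA : I' ≤ A) (hIB : I' ≤ B) (hAC : A ≤ C)
    (hBC : B ≤ C) (hJM : J ≤ M) (hJN : J ≤ N) (hML : M ≤ L) (hNL : N ≤ L) (hJD : J' ≤ D)
    (hJE : J' ≤ E) (hDF : D ≤ F) (hEF : E ≤ F) (h₁ : I ≤ J) (h₂ : U ≤ M) (h₃ : V ≤ N) (h₄ : W ≤ L)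
    (h₅ : I' ≤ J') (h₆ : A ≤ D) (h₇ : B ≤ E) (h₈ : C ≤ F) :
    ComplexSquare.Hom (𝒳.relSquare hIU hIV hUW hVW hIA hIB hAC hBC)
      (𝒳.relSquare hJM hJN hML hNL hJD hJE hDF hEF) where
  P := 𝒳.relMap h₁ h₅
  R₁ := 𝒳.relMap h₂ h₆
  R₂ := 𝒳.relMap h₃ h₇
  S := 𝒳.relMap h₄ h₈
  comm_f₁ := (𝒳.relMap_comp _ _ _ _).trans (𝒳.relMap_comp _ _ _ _).symm
  comm_f₂ := (𝒳.relMap_comp _ _ _ _).trans (𝒳.relMap_comp _ _ _ _).symm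
  comm_g₁ := (𝒳.relMap_comp _ _ _ _).trans (𝒳.relMap_comp _ _ _ _).symm
  comm_g₂ := (𝒳.relMap_comp _ _ _ _).trans (𝒳.relMap_comp _ _ _ _).symm

lemma acyclic_dual_relSquare [NormalSpace X] [T2Space X] [IsDedekindDomain 𝒳.Q]
    {I U V W I' A B C : Opens X} {hIU : I ≤ U} {hIV : I ≤ V} {hUW : U ≤ W} {hVW : V ≤ W}
    {hIA : I' ≤ A} {hIB : I' ≤ B} {hAC : A ≤ C} {hBC : B ≤ C}
    (h : (𝒳.relSquare hIU hIV hUW hVW hIA hIB hAC hBC).Acyclic) :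
    (𝒳.relSquare hIU hIV hUW hVW hIA hIB hAC hBC).dual.Acyclic :=
  h.dual (projective_relComplex _ _) (projective_relComplex _ _) (projective_relComplex _ _)
    (projective_relComplex _ _)

section Squares

variable [T2Space X]

variable (𝒳) in
/-- The square of complexes of the pairs `(Y, Y ∖ K)` for `K ∪ L`, `K`, `L`, `K ∩ L`. -/
noncomputable abbrev compactsSquare (Y : Opens X) (K L : Compacts X) :=
  𝒳.relSquare (I' := sdiffOpens Y (K ⊔ L)) (A := sdiffOpens Y K) (B := sdiffOpens Y L)
    (C := sdiffOpens Y (K ⊓ L)) (le_refl Y) (le_refl Y) (le_refl Y) (le_refl Y)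
    (sdiffOpens_mono le_rfl (le_sup_left : K ≤ K ⊔ L))
    (sdiffOpens_mono le_rfl (le_sup_right : L ≤ K ⊔ L))
    (sdiffOpens_mono le_rfl (inf_le_left : K ⊓ L ≤ K))
    (sdiffOpens_mono le_rfl (inf_le_right : K ⊓ L ≤ L))

/-- The relative square of the trivial cover of `Y` by itself twice, with relative parts Y ∖ K and Y
∖ L: complements turn unions of compact subsets into intersections of open subsets and vice versa.
-/
lemma compactsSquare_exact [NormalSpace X] (Y : Opens X) (K L : Compacts X) :
    (𝒳.compactsSquare Y K L).Exact :=
  relSquare_exact (inf_idem _).symm (sup_idem _).symm (sdiffOpens_sup Y K L) (sdiffOpens_inf Y K L)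
    (sdiffOpens_le Y K) (sdiffOpens_le Y L) _ _ _ _ _ _ _ _

variable (𝒳) in
/-- The excision square of the pairs `(W, W ∖ K)` and `(Y, Y ∖ K)`. -/
noncomputable abbrev excisionSquare {W Y : Opens X} (h : W ≤ Y) (K : Compacts X) :=
  𝒳.relSquare (sdiffOpens_mono h le_rfl) (sdiffOpens_le W K) (sdiffOpens_le Y K) h
    (sdiffOpens_mono h (le_refl K)) (le_refl (sdiffOpens W K)) (le_refl (sdiffOpens Y K))
    (sdiffOpens_mono h (le_refl K))

/-- The square of the cover of Y by Y ∖ K and W, with two corners that are pairs of equal subsets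
and so vanish. Its acyclicity therefore means excision. -/
lemma excisionSquare_exact [NormalSpace X] {W Y : Opens X} (h : W ≤ Y) (K : CompactsIn W) :
    (𝒳.excisionSquare h K.1).Exact :=
  relSquare_exact (sdiffOpens_inf_of_subset h K.1) (sdiffOpens_sup_of_subset h K)
    (inf_eq_right.2 (sdiffOpens_mono h le_rfl)).symm (sup_eq_left.2 (sdiffOpens_mono h le_rfl)).symm
    le_rfl (sdiffOpens_le W K.1) _ _ _ _ _ _ _ _

/-! ### Borel–Moore chains -/

variable (𝒳) in
/-- The projection of the inverse limit of the complexes of the pairs `(Y, Y ∖ K)`. -/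
noncomputable def bmProj (Y : Opens X) {W : Opens X} (K : CompactsIn W) :
    𝒳.bmComplex Y W ⟶ 𝒳.relComplex Y (sdiffOpens Y K.1) :=
  limit.π (𝒳.bmSystem Y W) (op K)

lemma bmComplex_hom_ext {Y W : Opens X} {C : ChainComplex (ModuleCat.{u} 𝒳.Q) ℕ}
    {f g : C ⟶ 𝒳.bmComplex Y W} (h : ∀ K, f ≫ 𝒳.bmProj Y K = g ≫ 𝒳.bmProj Y K) : f = g :=
  limit.hom_ext fun K => h K.unop

lemma bmProj_relMap (Y : Opens X) {W : Opens X} {K L : CompactsIn W} (h : K ≤ L) :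
    𝒳.bmProj Y L ≫ 𝒳.relMap (le_refl Y) (sdiffOpens_mono le_rfl h) = 𝒳.bmProj Y K :=
  limit.w (𝒳.bmSystem Y W) (homOfLE h).op

lemma isSeqLimit_bmProj (Y : Opens X) {W : Opens X} {κ : ℕ → CompactsIn W} (hm : Monotone κ)
    (hκ : ∀ K, ∃ n, K ≤ κ n) :
    IsSeqLimit (fun n => 𝒳.bmProj Y (κ n))
      (fun n => 𝒳.relMap (le_refl Y) (sdiffOpens_mono le_rfl (hm n.le_succ))) where
  comp n := bmProj_relMap Y (hm n.le_succ)
  ext _ _ _ h := limit_element_ext (𝒳.bmSystem Y W) hκ h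
  exists_lift _ y hy := exists_limit_element (𝒳.bmSystem Y W) hm hκ y hy
  surjective _ q := relMap_surjective _ q

lemma bmRestrict_bmProj (Y : Opens X) {W' W : Opens X} (h : W' ≤ W) (K : CompactsIn W') :
    𝒳.bmRestrict Y h ≫ 𝒳.bmProj Y K = 𝒳.bmProj Y (⟨K.1, K.2.trans h⟩ : CompactsIn W) :=
  limit.lift_π _ _

lemma bmExtend_bmProj {Y' Y : Opens X} (h : Y' ≤ Y) {W : Opens X} (K : CompactsIn W) :
    𝒳.bmExtend h W ≫ 𝒳.bmProj Y K =
      𝒳.bmProj Y' K ≫ 𝒳.relMap h (sdiffOpens_mono h le_rfl) :=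
  limMap_π _ _

lemma bmRestrict_comp (Y : Opens X) {W W' W'' : Opens X} (h : W' ≤ W) (h' : W'' ≤ W') :
    𝒳.bmRestrict Y h ≫ 𝒳.bmRestrict Y h' = 𝒳.bmRestrict Y (h'.trans h) :=
  bmComplex_hom_ext fun K => by
    rw [Category.assoc, bmRestrict_bmProj, bmRestrict_bmProj, bmRestrict_bmProj]

lemma bmExtend_comp {Y Y' Y'' : Opens X} (h : Y'' ≤ Y') (h' : Y' ≤ Y) (W : Opens X) :
    𝒳.bmExtend h W ≫ 𝒳.bmExtend h' W = 𝒳.bmExtend (h.trans h') W :=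
  bmComplex_hom_ext fun K => by
    rw [Category.assoc, bmExtend_bmProj, ← Category.assoc, bmExtend_bmProj, bmExtend_bmProj,
      Category.assoc, relMap_comp]

lemma bmRestrict_bmExtend {Y' Y W' W : Opens X} (h : Y' ≤ Y) (hW : W' ≤ W) :
    𝒳.bmRestrict Y' hW ≫ 𝒳.bmExtend h W' = 𝒳.bmExtend h W ≫ 𝒳.bmRestrict Y hW :=
  bmComplex_hom_ext fun K => by
    rw [Category.assoc, Category.assoc, bmExtend_bmProj, bmRestrict_bmProj, bmExtend_bmProj,
      ← Category.assoc, bmRestrict_bmProj]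

variable (𝒳) in
/-- The square of restrictions of Borel–Moore chains. -/
noncomputable def bmSquare (Y : Opens X) {W₁ W₂ W W' : Opens X} (h₁ : W₁ ≤ W) (h₂ : W₂ ≤ W)
    (h₁' : W' ≤ W₁) (h₂' : W' ≤ W₂) : ComplexSquare.{u} 𝒳.Q (ComplexShape.down ℕ) where
  P := 𝒳.bmComplex Y W
  R₁ := 𝒳.bmComplex Y W₁
  R₂ := 𝒳.bmComplex Y W₂
  S := 𝒳.bmComplex Y W'
  f₁ := 𝒳.bmRestrict Y h₁
  f₂ := 𝒳.bmRestrict Y h₂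
  g₁ := 𝒳.bmRestrict Y h₁'
  g₂ := 𝒳.bmRestrict Y h₂'
  comm := by rw [bmRestrict_comp, bmRestrict_comp]

/-- Unions of cofinal compact subsets of W₁ and W₂ are cofinal in their union, because a compact
subset of the union splits; intersections are cofinal in the intersection. The square is thus a
limit over one sequence of exact squares. Local compactness and second countability provide the
sequence on which the Mittag-Leffler argument relies. -/
theorem bmSquare_exact [NormalSpace X] [LocallyCompactSpace X] [SecondCountableTopology X]
    (Y : Opens X) {W₁ W₂ W W' : Opens X} (hW : W = W₁ ⊔ W₂) (hW' : W' = W₁ ⊓ W₂) (h₁ : W₁ ≤ W)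
    (h₂ : W₂ ≤ W) (h₁' : W' ≤ W₁) (h₂' : W' ≤ W₂) : (𝒳.bmSquare Y h₁ h₂ h₁' h₂').Exact := by
  obtain ⟨κ₁, hm₁, hκ₁⟩ := exists_cofinal_compactsIn W₁
  obtain ⟨κ₂, hm₂, hκ₂⟩ := exists_cofinal_compactsIn W₂
  let κ : ℕ → CompactsIn W₁ × CompactsIn W₂ := fun n => (κ₁ n, κ₂ n)
  have hm : Monotone κ := fun m n h => ⟨hm₁ h, hm₂ h⟩
  have hκ : ∀ L, ∃ n, L ≤ κ n := by
    rintro ⟨L₁, L₂⟩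
    obtain ⟨m, hm'⟩ := hκ₁ L₁
    obtain ⟨n, hn⟩ := hκ₂ L₂
    exact ⟨max m n, hm'.trans (hm₁ (le_max_left _ _)), hn.trans (hm₂ (le_max_right _ _))⟩
  have hs : ∀ K, ∃ n, K ≤ CompactsIn.sup hW (κ n) := by
    intro K
    obtain ⟨L, hL⟩ := CompactsIn.exists_le_sup hW K
    obtain ⟨n, hn⟩ := hκ L
    exact ⟨n, hL.trans (CompactsIn.sup_mono hW hn)⟩
  have hi : ∀ K, ∃ n, K ≤ CompactsIn.inf hW' (κ n) := by
    intro K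
    obtain ⟨L, hL⟩ := CompactsIn.exists_le_inf hW' K
    obtain ⟨n, hn⟩ := hκ L
    exact ⟨n, hL.trans (CompactsIn.inf_mono hW' hn)⟩
  let π : ∀ n, Hom (𝒳.bmSquare Y h₁ h₂ h₁' h₂') (𝒳.compactsSquare Y (κ₁ n).1 (κ₂ n).1) := fun n =>
    { P := 𝒳.bmProj Y (CompactsIn.sup hW (κ n))
      R₁ := 𝒳.bmProj Y (κ₁ n)
      R₂ := 𝒳.bmProj Y (κ₂ n)
      S := 𝒳.bmProj Y (CompactsIn.inf hW' (κ n))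
      comm_f₁ := (bmRestrict_bmProj Y h₁ (κ₁ n)).trans (bmProj_relMap Y
        (K := ⟨(κ₁ n).1, (κ₁ n).2.trans h₁⟩) (L := CompactsIn.sup hW (κ n)) (le_sup_left (α := Compacts X))).symm
      comm_f₂ := (bmRestrict_bmProj Y h₂ (κ₂ n)).trans (bmProj_relMap Y
        (K := ⟨(κ₂ n).1, (κ₂ n).2.trans h₂⟩) (L := CompactsIn.sup hW (κ n)) (le_sup_right (α := Compacts X))).symm
      comm_g₁ := (bmRestrict_bmProj Y h₁' (CompactsIn.inf hW' (κ n))).trans (bmProj_relMap Y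
        (K := ⟨_, (CompactsIn.inf hW' (κ n)).2.trans h₁'⟩) (L := κ₁ n) (inf_le_left (α := Compacts X))).symm
      comm_g₂ := (bmRestrict_bmProj Y h₂' (CompactsIn.inf hW' (κ n))).trans (bmProj_relMap Y
        (K := ⟨_, (CompactsIn.inf hW' (κ n)).2.trans h₂'⟩) (L := κ₂ n) (inf_le_right (α := Compacts X))).symm }
  let ρ : ∀ n, Hom (𝒳.compactsSquare Y (κ₁ (n + 1)).1 (κ₂ (n + 1)).1)
      (𝒳.compactsSquare Y (κ₁ n).1 (κ₂ n).1) := fun n =>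
    𝒳.relSquareHom _ _ _ _ _ _ _ _ _ _ _ _ _ _ _ _ le_rfl le_rfl le_rfl le_rfl
      (sdiffOpens_mono le_rfl (CompactsIn.sup_mono hW (hm n.le_succ)))
      (sdiffOpens_mono le_rfl (hm₁ n.le_succ)) (sdiffOpens_mono le_rfl (hm₂ n.le_succ))
      (sdiffOpens_mono le_rfl (CompactsIn.inf_mono hW' (hm n.le_succ)))
  exact Exact.of_isSeqLimit π ρ
    (isSeqLimit_bmProj Y (fun _ _ h => CompactsIn.sup_mono hW (hm h)) hs)
    (isSeqLimit_bmProj Y hm₁ hκ₁) (isSeqLimit_bmProj Y hm₂ hκ₂)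
    (isSeqLimit_bmProj Y (fun _ _ h => CompactsIn.inf_mono hW' (hm h)) hi)
    fun n => compactsSquare_exact Y _ _

/-- The map is one side of a limit of excision squares whose opposite side vanishes, and the limit
square is exact. -/
theorem mapBMExtend_bijective [NormalSpace X] [LocallyCompactSpace X] [SecondCountableTopology X]
    {W Y : Opens X} (h : W ≤ Y) (q : ℕ) : Function.Bijective (𝒳.mapBMExtend h q) := by
  obtain ⟨κ, hm, hκ⟩ := exists_cofinal_compactsIn W
  have h0 : ∀ q, Subsingleton ((𝒳.relComplex ⊥ ⊥).X q) := subsingleton_relComplex ⊥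
  -- The chains of the empty pair serve as the zero complex in the two vanishing corners.
  let Sq : ComplexSquare.{u} 𝒳.Q (ComplexShape.down ℕ) :=
    { P := 𝒳.relComplex ⊥ ⊥
      R₁ := 𝒳.relComplex ⊥ ⊥
      R₂ := 𝒳.bmComplex W W
      S := 𝒳.bmComplex Y W
      f₁ := 0
      f₂ := 0
      g₁ := 0
      g₂ := 𝒳.bmExtend h W
      comm := hom_eq_of_subsingleton_left h0 _ _ }
  let π : ∀ n, Hom Sq (𝒳.excisionSquare h (κ n).1) := fun n =>
    { P := 𝒳.relMap bot_le bot_le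
      R₁ := 𝒳.relMap bot_le bot_le
      R₂ := 𝒳.bmProj W (κ n)
      S := 𝒳.bmProj Y (κ n)
      comm_f₁ := hom_eq_of_subsingleton_left h0 _ _
      comm_f₂ := hom_eq_of_subsingleton_left h0 _ _
      comm_g₁ := hom_eq_of_subsingleton_left h0 _ _
      comm_g₂ := bmExtend_bmProj h (κ n) }
  let ρ : ∀ n, Hom (𝒳.excisionSquare h (κ (n + 1)).1) (𝒳.excisionSquare h (κ n).1) := fun n =>
    𝒳.relSquareHom _ _ _ _ _ _ _ _ _ _ _ _ _ _ _ _
      (sdiffOpens_mono le_rfl (hm n.le_succ)) (sdiffOpens_mono le_rfl (hm n.le_succ)) le_rfl le_rfl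
      (sdiffOpens_mono le_rfl (hm n.le_succ)) (sdiffOpens_mono le_rfl (hm n.le_succ))
      (sdiffOpens_mono le_rfl (hm n.le_succ)) (sdiffOpens_mono le_rfl (hm n.le_succ))
  have hSq : Sq.Exact := Exact.of_isSeqLimit π ρ
    (IsSeqLimit.of_subsingleton h0 fun n => subsingleton_relComplex _)
    (IsSeqLimit.of_subsingleton h0 fun n => subsingleton_relComplex _)
    (isSeqLimit_bmProj W hm hκ) (isSeqLimit_bmProj Y hm hκ)
    fun n => excisionSquare_exact h (κ n)
  exact hSq.acyclic.bijective_of_subsingleton h0 h0 q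

end Squares

end ICData

namespace ICData

open CategoryTheory CategoryTheory.Limits Opposite HomologicalComplex ComplexSquare

variable {X : Type u} [TopologicalSpace X] {𝒳 : ICData X} [T2Space X]

instance (W : Opens X) : IsDirected (CompactsIn W) (· ≤ ·) :=
  ⟨fun K L => ⟨⟨K.1 ⊔ L.1, Set.union_subset K.2 L.2⟩, le_sup_left (α := Compacts X),
    le_sup_right (α := Compacts X)⟩⟩

instance (W : Opens X) : Nonempty (CompactsIn W) := ⟨⟨⊥, Set.empty_subset _⟩⟩

/-! ### Cochains with compact supports -/

variable (𝒳) in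
/-- The map to the direct limit of the cochain complexes of the pairs `(Y, Y ∖ K)`. -/
noncomputable def ccIncl (Y : Opens X) {W : Opens X} (K : CompactsIn W) :
    dualComplex (𝒳.relComplex Y (sdiffOpens Y K.1)) ⟶ 𝒳.ccComplex Y W :=
  colimit.ι (𝒳.ccSystem Y W) K

lemma ccComplex_hom_ext {Y W : Opens X} {C : CochainComplex (ModuleCat.{u} 𝒳.Q) ℕ}
    {f g : 𝒳.ccComplex Y W ⟶ C} (h : ∀ K, 𝒳.ccIncl Y K ≫ f = 𝒳.ccIncl Y K ≫ g) : f = g :=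
  colimit.hom_ext h

lemma relMap_ccIncl (Y : Opens X) {W : Opens X} {K L : CompactsIn W} (h : K ≤ L) :
    dualMap (𝒳.relMap (le_refl Y) (sdiffOpens_mono le_rfl h)) ≫ 𝒳.ccIncl Y L = 𝒳.ccIncl Y K :=
  colimit.w (𝒳.ccSystem Y W) (homOfLE h)

/-- The index set is an arbitrary directed set with a cofinal monotone map to the compact subsets.
All four corners of a square can then share one index set. -/
lemma isDirLimit_ccIncl (Y : Opens X) {W : Opens X} {I : Type u} [Preorder I]
    [IsDirected I (· ≤ ·)] {κ : I → CompactsIn W} (hm : Monotone κ) (hκ : ∀ K, ∃ i, K ≤ κ i) :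
    IsDirLimit (fun i => 𝒳.ccIncl Y (κ i))
      (fun _ _ h => dualMap (𝒳.relMap (le_refl Y) (sdiffOpens_mono le_rfl (hm h)))) where
  comp _ _ h := relMap_ccIncl Y (hm h)
  map_comp _ _ _ _ _ := by rw [← dualMap_comp, relMap_comp]
  exists_rep q x := by
    obtain ⟨K, y, rfl⟩ := exists_colimit_rep (𝒳.ccSystem Y W) x
    obtain ⟨i, hi⟩ := hκ K
    exact ⟨i, (dualMap (𝒳.relMap (le_refl Y) (sdiffOpens_mono le_rfl hi))).f q y,
      LinearMap.congr_fun (congrArg (fun f => (f.f q).hom) (relMap_ccIncl Y hi)) y⟩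
  eq_zero q i y hy := by
    obtain ⟨K, hK, h⟩ := exists_map_eq_zero_of_colimit (𝒳.ccSystem Y W) hy
    obtain ⟨j', hj'⟩ := hκ K
    obtain ⟨j, hij, hj⟩ := exists_ge_ge i j'
    have hKj : K ≤ κ j := hj'.trans (hm hj)
    refine ⟨j, hij, ?_⟩
    have hc : dualMap (𝒳.relMap (le_refl Y) (sdiffOpens_mono (le_refl Y) (hm hij))) =
        dualMap (𝒳.relMap (le_refl Y) (sdiffOpens_mono (le_refl Y) hK)) ≫
          dualMap (𝒳.relMap (le_refl Y) (sdiffOpens_mono (le_refl Y) hKj)) := by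
      rw [← dualMap_comp, relMap_comp]
    exact (LinearMap.congr_fun (congrArg (fun f => (f.f q).hom) hc) y).trans
      ((congrArg ((dualMap (𝒳.relMap (le_refl Y) (sdiffOpens_mono (le_refl Y) hKj))).f q).hom h).trans
        (map_zero _))

lemma ccIncl_ccExtend (Y : Opens X) {W W' : Opens X} (h : W ≤ W') (K : CompactsIn W) :
    𝒳.ccIncl Y K ≫ 𝒳.ccExtend Y h = 𝒳.ccIncl Y (⟨K.1, K.2.trans h⟩ : CompactsIn W') :=
  colimit.ι_desc _ _

lemma ccIncl_ccRestrict {Y' Y : Opens X} (h : Y' ≤ Y) {W : Opens X} (K : CompactsIn W) :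
    𝒳.ccIncl Y K ≫ 𝒳.ccRestrict h W =
      dualMap (𝒳.relMap h (sdiffOpens_mono h le_rfl)) ≫ 𝒳.ccIncl Y' K :=
  ι_colimMap _ _

lemma ccExtend_comp (Y : Opens X) {W W' W'' : Opens X} (h : W ≤ W') (h' : W' ≤ W'') :
    𝒳.ccExtend Y h ≫ 𝒳.ccExtend Y h' = 𝒳.ccExtend Y (h.trans h') :=
  ccComplex_hom_ext fun K => by
    rw [← Category.assoc, ccIncl_ccExtend, ccIncl_ccExtend, ccIncl_ccExtend]

lemma ccRestrict_comp {Y Y' Y'' : Opens X} (h : Y'' ≤ Y') (h' : Y' ≤ Y) (W : Opens X) :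
    𝒳.ccRestrict h' W ≫ 𝒳.ccRestrict h W = 𝒳.ccRestrict (h.trans h') W :=
  ccComplex_hom_ext fun K => by
    rw [← Category.assoc, ccIncl_ccRestrict, Category.assoc, ccIncl_ccRestrict, ccIncl_ccRestrict,
      ← Category.assoc, ← dualMap_comp, relMap_comp]

lemma ccRestrict_ccExtend {Y' Y W W' : Opens X} (h : Y' ≤ Y) (hW : W ≤ W') :
    𝒳.ccRestrict h W ≫ 𝒳.ccExtend Y' hW = 𝒳.ccExtend Y hW ≫ 𝒳.ccRestrict h W' :=
  ccComplex_hom_ext fun K => by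
    rw [← Category.assoc, ← Category.assoc, ccIncl_ccRestrict, ccIncl_ccExtend, ccIncl_ccRestrict,
      Category.assoc, ccIncl_ccExtend]

variable (𝒳) in
/-- The square of extensions of cochains with compact supports. -/
noncomputable def ccSquare (Y : Opens X) {W₁ W₂ W W' : Opens X} (h₁ : W₁ ≤ W) (h₂ : W₂ ≤ W)
    (h₁' : W' ≤ W₁) (h₂' : W' ≤ W₂) : ComplexSquare.{u} 𝒳.Q (ComplexShape.up ℕ) where
  P := 𝒳.ccComplex Y W'
  R₁ := 𝒳.ccComplex Y W₁
  R₂ := 𝒳.ccComplex Y W₂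
  S := 𝒳.ccComplex Y W
  f₁ := 𝒳.ccExtend Y h₁'
  f₂ := 𝒳.ccExtend Y h₂'
  g₁ := 𝒳.ccExtend Y h₁
  g₂ := 𝒳.ccExtend Y h₂
  comm := by rw [ccExtend_comp, ccExtend_comp]

/-- The square is the colimit, over pairs of compact subsets of W₁ and W₂, of duals of exact
squares. Directed colimits need no countability, whereas dualizing uses that `𝒳.Q` is Dedekind. -/
theorem ccSquare_acyclic [NormalSpace X] [IsDedekindDomain 𝒳.Q]
    (Y : Opens X) {W₁ W₂ W W' : Opens X} (hW : W = W₁ ⊔ W₂) (hW' : W' = W₁ ⊓ W₂) (h₁ : W₁ ≤ W)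
    (h₂ : W₂ ≤ W) (h₁' : W' ≤ W₁) (h₂' : W' ≤ W₂) : (𝒳.ccSquare Y h₁ h₂ h₁' h₂').Acyclic := by
  let ι : ∀ K : CompactsIn W₁ × CompactsIn W₂,
      Hom (𝒳.compactsSquare Y K.1.1 K.2.1).dual (𝒳.ccSquare Y h₁ h₂ h₁' h₂') := fun K =>
    { P := 𝒳.ccIncl Y (CompactsIn.inf hW' K)
      R₁ := 𝒳.ccIncl Y K.1
      R₂ := 𝒳.ccIncl Y K.2
      S := 𝒳.ccIncl Y (CompactsIn.sup hW K)
      comm_f₁ := (relMap_ccIncl Y (K := ⟨_, (CompactsIn.inf hW' K).2.trans h₁'⟩) (L := K.1)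
        (inf_le_left (α := Compacts X))).trans (ccIncl_ccExtend Y h₁' (CompactsIn.inf hW' K)).symm
      comm_f₂ := (relMap_ccIncl Y (K := ⟨_, (CompactsIn.inf hW' K).2.trans h₂'⟩) (L := K.2)
        (inf_le_right (α := Compacts X))).trans (ccIncl_ccExtend Y h₂' (CompactsIn.inf hW' K)).symm
      comm_g₁ := (relMap_ccIncl Y (K := ⟨K.1.1, K.1.2.trans h₁⟩) (L := CompactsIn.sup hW K)
        (le_sup_left (α := Compacts X))).trans (ccIncl_ccExtend Y h₁ K.1).symm
      comm_g₂ := (relMap_ccIncl Y (K := ⟨K.2.1, K.2.2.trans h₂⟩) (L := CompactsIn.sup hW K)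
        (le_sup_right (α := Compacts X))).trans (ccIncl_ccExtend Y h₂ K.2).symm }
  let ρ : ∀ K L : CompactsIn W₁ × CompactsIn W₂, K ≤ L →
      Hom (𝒳.compactsSquare Y K.1.1 K.2.1).dual (𝒳.compactsSquare Y L.1.1 L.2.1).dual :=
    fun K L h => (𝒳.relSquareHom _ _ _ _ _ _ _ _ _ _ _ _ _ _ _ _ le_rfl le_rfl le_rfl le_rfl
      (sdiffOpens_mono le_rfl (CompactsIn.sup_mono hW h))
      (sdiffOpens_mono le_rfl h.1) (sdiffOpens_mono le_rfl h.2)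
      (sdiffOpens_mono le_rfl (CompactsIn.inf_mono hW' h))).dual
  have : IsDirected (CompactsIn W₁ × CompactsIn W₂) (· ≤ ·) := ⟨fun K L => by
    obtain ⟨M₁, h₁, h₁'⟩ := exists_ge_ge K.1 L.1
    obtain ⟨M₂, h₂, h₂'⟩ := exists_ge_ge K.2 L.2
    exact ⟨(M₁, M₂), ⟨h₁, h₂⟩, ⟨h₁', h₂'⟩⟩⟩
  exact Acyclic.of_isDirLimit ι ρ
    (isDirLimit_ccIncl Y (CompactsIn.inf_mono hW') (CompactsIn.exists_le_inf hW'))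
    -- A projection from the pairs is cofinal, as every compact subset occurs as a component of some
    -- pair.
    (isDirLimit_ccIncl Y (κ := Prod.fst) monotone_fst fun K =>
      ⟨(K, Classical.arbitrary _), le_rfl⟩)
    (isDirLimit_ccIncl Y (κ := Prod.snd) monotone_snd fun K =>
      ⟨(Classical.arbitrary _, K), le_rfl⟩)
    (isDirLimit_ccIncl Y (CompactsIn.sup_mono hW) (CompactsIn.exists_le_sup hW))
    fun K => acyclic_dual_relSquare (compactsSquare_exact Y _ _).acyclic

/-- The colimit of the dual excision squares is acyclic. Since dualizing reverses arrows, it is now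
the target and one middle term that vanish. -/
theorem mapCcRestrict_bijective [NormalSpace X] [IsDedekindDomain 𝒳.Q] {W Y : Opens X} (h : W ≤ Y)
    (q : ℕ) : Function.Bijective (𝒳.mapCcRestrict h q) := by
  have h0 : ∀ q, Subsingleton ((dualComplex (𝒳.relComplex ⊥ ⊥)).X q) := fun q =>
    subsingleton_dualComplex (subsingleton_relComplex ⊥ q)
  let Sq : ComplexSquare.{u} 𝒳.Q (ComplexShape.up ℕ) :=
    { P := 𝒳.ccComplex Y W
      R₁ := dualComplex (𝒳.relComplex ⊥ ⊥)
      R₂ := 𝒳.ccComplex W W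
      S := dualComplex (𝒳.relComplex ⊥ ⊥)
      f₁ := 0
      f₂ := 𝒳.ccRestrict h W
      g₁ := 0
      g₂ := 0
      comm := hom_eq_of_subsingleton_right h0 _ _ }
  let ι : ∀ K : CompactsIn W, Hom (𝒳.excisionSquare h K.1).dual Sq := fun K =>
    { P := 𝒳.ccIncl Y K
      R₁ := dualMap (𝒳.relMap bot_le bot_le)
      R₂ := 𝒳.ccIncl W K
      S := dualMap (𝒳.relMap bot_le bot_le)
      comm_f₁ := hom_eq_of_subsingleton_right h0 _ _
      comm_f₂ := (ccIncl_ccRestrict h K).symm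
      comm_g₁ := hom_eq_of_subsingleton_right h0 _ _
      comm_g₂ := hom_eq_of_subsingleton_right h0 _ _ }
  let ρ : ∀ K L : CompactsIn W, K ≤ L →
      Hom (𝒳.excisionSquare h K.1).dual (𝒳.excisionSquare h L.1).dual := fun K L hKL =>
    (𝒳.relSquareHom _ _ _ _ _ _ _ _ _ _ _ _ _ _ _ _
      (sdiffOpens_mono le_rfl hKL) (sdiffOpens_mono le_rfl hKL) le_rfl le_rfl
      (sdiffOpens_mono le_rfl hKL) (sdiffOpens_mono le_rfl hKL)
      (sdiffOpens_mono le_rfl hKL) (sdiffOpens_mono le_rfl hKL)).dual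
  have hSq : Sq.Acyclic := Acyclic.of_isDirLimit ι ρ
    (isDirLimit_ccIncl Y monotone_id fun K => ⟨K, le_rfl⟩)
    (IsDirLimit.of_subsingleton h0 fun _ q =>
      subsingleton_dualComplex (subsingleton_relComplex _ q))
    (isDirLimit_ccIncl W monotone_id fun K => ⟨K, le_rfl⟩)
    (IsDirLimit.of_subsingleton h0 fun _ q =>
      subsingleton_dualComplex (subsingleton_relComplex _ q))
    fun K => acyclic_dual_relSquare (excisionSquare_exact h K).acyclic
  exact hSq.bijective_of_subsingleton' h0 h0 q

end ICData

/-! ### Transport of long exact sequences along isomorphisms -/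

section LongExact

variable {R : Type} [CommRing R] {A B C A' B' C' : ℕ → Type u}
  [∀ q, AddCommGroup (A q)] [∀ q, AddCommGroup (B q)] [∀ q, AddCommGroup (C q)]
  [∀ q, Module R (A q)] [∀ q, Module R (B q)] [∀ q, Module R (C q)]
  [∀ q, AddCommGroup (A' q)] [∀ q, AddCommGroup (B' q)] [∀ q, AddCommGroup (C' q)]
  [∀ q, Module R (A' q)] [∀ q, Module R (B' q)] [∀ q, Module R (C' q)]
  {f : ∀ q, A q →ₗ[R] B q} {g : ∀ q, B q →ₗ[R] C q}
  {f' : ∀ q, A' q →ₗ[R] B' q} {g' : ∀ q, B' q →ₗ[R] C' q}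

/-- Long exact sequences can be transported along isomorphisms. -/
lemma IsLongExactDown.exists_of_equiv {δ : ∀ q, C (q + 1) →ₗ[R] A q} (h : IsLongExactDown f g δ)
    (a : ∀ q, A' q ≃ₗ[R] A q) (b : ∀ q, B' q ≃ₗ[R] B q) (c : ∀ q, C' q ≃ₗ[R] C q)
    (hf : ∀ q x, b q (f' q x) = f q (a q x)) (hg : ∀ q x, c q (g' q x) = g q (b q x)) :
    ∃ δ', IsLongExactDown f' g' δ' := by
  refine ⟨fun q => (a q).symm.toLinearMap ∘ₗ δ q ∘ₗ (c (q + 1)).toLinearMap, fun q => ?_,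
    fun q => ?_, fun q => ?_, ?_⟩
  · refine (Function.Exact.iff_of_ladder_linearEquiv (e₁ := a q) (e₂ := b q) (e₃ := c q)
      (LinearMap.ext fun x => (hf q x).symm) (LinearMap.ext fun x => (hg q x).symm)).1
      (h.exact_fg q)
  · refine (Function.Exact.iff_of_ladder_linearEquiv (e₁ := b (q + 1)) (e₂ := c (q + 1))
      (e₃ := a q) (LinearMap.ext fun x => (hg _ x).symm) (LinearMap.ext fun x => ?_)).1
      (h.exact_gδ q)
    exact ((a q).apply_symm_apply _).symm
  · refine (Function.Exact.iff_of_ladder_linearEquiv (e₁ := c (q + 1)) (e₂ := a q)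
      (e₃ := b q) (LinearMap.ext fun x => ?_) (LinearMap.ext fun x => (hf _ x).symm)).1
      (h.exact_δf q)
    exact ((a q).apply_symm_apply _).symm
  · intro y
    obtain ⟨x, hx⟩ := h.surjective (c 0 y)
    refine ⟨(b 0).symm x, (c 0).injective ?_⟩
    rw [hg, LinearEquiv.apply_symm_apply, hx]

/-- Long exact sequences can be transported along isomorphisms. -/
lemma IsLongExactUp.exists_of_equiv {δ : ∀ q, C q →ₗ[R] A (q + 1)} (h : IsLongExactUp f g δ)
    (a : ∀ q, A q ≃ₗ[R] A' q) (b : ∀ q, B q ≃ₗ[R] B' q) (c : ∀ q, C q ≃ₗ[R] C' q)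
    (hf : ∀ q x, f' q (a q x) = b q (f q x)) (hg : ∀ q x, g' q (b q x) = c q (g q x)) :
    ∃ δ', IsLongExactUp f' g' δ' := by
  refine ⟨fun q => (a (q + 1)).toLinearMap ∘ₗ δ q ∘ₗ (c q).symm.toLinearMap, ?_, fun q => ?_,
    fun q => ?_, fun q => ?_⟩
  · intro x y hxy
    obtain ⟨x, rfl⟩ := (a 0).surjective x
    obtain ⟨y, rfl⟩ := (a 0).surjective y
    rw [hf, hf] at hxy
    rw [h.injective ((b 0).injective hxy)]
  · exact (Function.Exact.iff_of_ladder_linearEquiv (e₁ := a q) (e₂ := b q) (e₃ := c q)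
      (LinearMap.ext (hf q)) (LinearMap.ext (hg q))).2 (h.exact_fg q)
  · refine (Function.Exact.iff_of_ladder_linearEquiv (e₁ := b q) (e₂ := c q)
      (e₃ := a (q + 1)) (LinearMap.ext (hg q)) (LinearMap.ext fun x => ?_)).2 (h.exact_gδ q)
    exact congrArg (fun y => a (q + 1) (δ q y)) ((c q).symm_apply_apply x)
  · refine (Function.Exact.iff_of_ladder_linearEquiv (e₁ := c q) (e₂ := a (q + 1))
      (e₃ := b (q + 1)) (LinearMap.ext fun x => ?_) (LinearMap.ext (hf _))).2 (h.exact_δf q)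
    exact congrArg (fun y => a (q + 1) (δ q y)) ((c q).symm_apply_apply x)

end LongExact

/-! ### Excision and the Mayer–Vietoris sequences -/

namespace ICData

open CategoryTheory CategoryTheory.Limits Opposite HomologicalComplex ComplexSquare

variable {X : Type u} [TopologicalSpace X] {𝒳 : ICData X} [T2Space X] [NormalSpace X]

/-- In the relative square with A = U and B = U ∩ V, two corners are pairs of equal subsets and
vanish. -/
theorem mapIH_bijective_of_sup_eq_top {U V : Opens X} (hUV : U ⊔ V = ⊤) (q : ℕ) :
    Function.Bijective
      (𝒳.mapIH (U := V) (U' := ⊤) (A := U ⊓ V) (A' := U) le_top inf_le_left q) := by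
  have h := relSquare_exact (𝒳 := 𝒳) (I := U ⊓ V) (U := U) (V := V) (W := ⊤) (I' := U ⊓ V)
    (A := U) (B := U ⊓ V) (C := U) rfl hUV.symm (inf_eq_right.2 inf_le_left).symm
    (sup_eq_left.2 inf_le_left).symm le_rfl inf_le_right inf_le_left inf_le_right le_top le_top
    inf_le_left le_rfl le_rfl inf_le_left
  exact h.acyclic.bijective_of_subsingleton (subsingleton_relComplex _) (subsingleton_relComplex _)
    q

variable {U V A B : Opens X}

theorem exists_isLongExactDown_mapIH (hUV : U ⊔ V = ⊤) (hA : A ≤ U) (hB : B ≤ V) :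
    ∃ δ, IsLongExactDown
      (fun q => LinearMap.prod
        (𝒳.mapIH (U := U ⊓ V) (U' := U) (A := A ⊓ B) (A' := A) inf_le_left inf_le_left q)
        (-𝒳.mapIH (U := U ⊓ V) (U' := V) (A := A ⊓ B) (A' := B) inf_le_right inf_le_right q))
      (fun q => LinearMap.coprod
        (𝒳.mapIH (U := U) (U' := ⊤) (A := A) (A' := A ⊔ B) le_top le_sup_left q)
        (𝒳.mapIH (U := V) (U' := ⊤) (A := B) (A' := A ⊔ B) le_top le_sup_right q))
      δ :=
  (relSquare_exact (𝒳 := 𝒳) rfl hUV.symm rfl rfl hA hB inf_le_left inf_le_right le_top le_top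
    inf_le_left inf_le_right le_sup_left le_sup_right).acyclic.exists_isLongExactDown

theorem exists_isLongExactUp_mapCoIH [IsDedekindDomain 𝒳.Q] (hUV : U ⊔ V = ⊤) (hA : A ≤ U)
    (hB : B ≤ V) :
    ∃ δ, IsLongExactUp
      (fun q => LinearMap.prod
        (𝒳.mapCoIH (U := U) (U' := ⊤) (A := A) (A' := A ⊔ B) le_top le_sup_left q)
        (-𝒳.mapCoIH (U := V) (U' := ⊤) (A := B) (A' := A ⊔ B) le_top le_sup_right q))
      (fun q => LinearMap.coprod
        (𝒳.mapCoIH (U := U ⊓ V) (U' := U) (A := A ⊓ B) (A' := A) inf_le_left inf_le_left q)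
        (𝒳.mapCoIH (U := U ⊓ V) (U' := V) (A := A ⊓ B) (A' := B) inf_le_right inf_le_right q))
      δ :=
  (acyclic_dual_relSquare (relSquare_exact (𝒳 := 𝒳) rfl hUV.symm rfl rfl hA hB inf_le_left
    inf_le_right le_top le_top inf_le_left inf_le_right le_sup_left
    le_sup_right).acyclic).exists_isLongExactUp

section BorelMoore

variable [LocallyCompactSpace X] [SecondCountableTopology X]

variable (𝒳) in
/-- The isomorphism between the Borel–Moore homology of `W` and the homology of the inverse limit
of the complexes of the pairs `(Y, Y ∖ K)`, `K ⊆ W` compact. -/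
noncomputable def bmExtendEquiv {W Y : Opens X} (h : W ≤ Y) (q : ℕ) :
    𝒳.BM W q ≃ₗ[𝒳.Q] 𝒳.BMPair Y W q :=
  LinearEquiv.ofBijective (𝒳.mapBMExtend h q) (mapBMExtend_bijective h q)

variable (𝒳) in
/-- Restriction of Borel–Moore homology to an open subset. -/
noncomputable def bmRes (W Y : Opens X) (h : W ≤ Y) (q : ℕ) : 𝒳.BM Y q →ₗ[𝒳.Q] 𝒳.BM W q :=
  (𝒳.bmExtendEquiv h q).symm.toLinearMap ∘ₗ 𝒳.mapBMRestrict h q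

lemma mapBMExtend_bmRes {W Y : Opens X} (h : W ≤ Y) (q : ℕ) (x : 𝒳.BM Y q) :
    𝒳.mapBMExtend h q (𝒳.bmRes W Y h q x) = 𝒳.mapBMRestrict h q x :=
  (𝒳.bmExtendEquiv h q).apply_symm_apply _

/-- Restriction from `U` to `W` becomes a mere restriction of the index set once both groups are
computed in a common larger ambient `Y`. The reason is that enlarging the ambient subset commutes
with shrinking the index set. -/
lemma mapBMExtend_bmRes_of_le {W U Y : Opens X} (h : W ≤ U) (hU : U ≤ Y) (q : ℕ) (x : 𝒳.BM U q) :
    𝒳.mapBMExtend (h.trans hU) q (𝒳.bmRes W U h q x) =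
      (homologyMap (𝒳.bmRestrict Y h) q).hom (𝒳.mapBMExtend hU q x) := by
  have h1 : 𝒳.mapBMExtend (h.trans hU) q =
      (homologyMap (𝒳.bmExtend hU W) q).hom ∘ₗ 𝒳.mapBMExtend h q := by
    rw [mapBMExtend, ← bmExtend_comp h hU, homologyMap_comp]
    rfl
  rw [h1, LinearMap.comp_apply, mapBMExtend_bmRes]
  refine LinearMap.congr_fun (f := (homologyMap (𝒳.bmExtend hU W) q).hom ∘ₗ 𝒳.mapBMRestrict h q)
    (g := (homologyMap (𝒳.bmRestrict Y h) q).hom ∘ₗ 𝒳.mapBMExtend hU q) ?_ x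
  have h2 := congrArg (fun f : 𝒳.bmComplex U U ⟶ 𝒳.bmComplex Y W => (homologyMap f q).hom)
    (bmRestrict_bmExtend (𝒳 := 𝒳) hU h)
  rw [homologyMap_comp, homologyMap_comp] at h2
  exact h2

/-- The sequence is exact with all chains taken in the ambient space `X` and only the index sets
varying. The extension isomorphisms transport it to the intrinsic groups and to the maps `bmRes`. -/
theorem exists_isLongExactDown_bmRes (hUV : U ⊔ V = ⊤) :
    ∃ δ, IsLongExactDown
      (fun q => LinearMap.prod (𝒳.bmRes U ⊤ le_top q) (-𝒳.bmRes V ⊤ le_top q))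
      (fun q => LinearMap.coprod (𝒳.bmRes (U ⊓ V) U inf_le_left q)
        (𝒳.bmRes (U ⊓ V) V inf_le_right q))
      δ := by
  obtain ⟨δ, hδ⟩ := (bmSquare_exact (𝒳 := 𝒳) ⊤ (W₁ := U) (W₂ := V) hUV.symm rfl le_top le_top
    inf_le_left inf_le_right).acyclic.exists_isLongExactDown
  refine hδ.exists_of_equiv (fun q => LinearEquiv.refl _ _)
    (fun q => (𝒳.bmExtendEquiv le_top q).prodCongr (𝒳.bmExtendEquiv le_top q))
    (fun q => 𝒳.bmExtendEquiv le_top q) (fun q x => ?_) (fun q x => ?_)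
  · exact Prod.ext (mapBMExtend_bmRes le_top q x)
      ((map_neg (𝒳.mapBMExtend le_top q) _).trans
        (congrArg Neg.neg (mapBMExtend_bmRes le_top q x)))
  · exact (map_add (𝒳.mapBMExtend le_top q) _ _).trans (congrArg₂ (· + ·)
      (mapBMExtend_bmRes_of_le inf_le_left le_top q x.1)
      (mapBMExtend_bmRes_of_le inf_le_right le_top q x.2))

end BorelMoore

section CompactSupports

variable [IsDedekindDomain 𝒳.Q]

variable (𝒳) in
/-- The isomorphism between the cohomology of the direct limit of the cochain complexes of the
pairs `(Y, Y ∖ K)`, `K ⊆ W` compact, and the compactly supported cohomology of `W`. -/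
noncomputable def ccRestrictEquiv {W Y : Opens X} (h : W ≤ Y) (q : ℕ) :
    𝒳.CcPair Y W q ≃ₗ[𝒳.Q] 𝒳.Cc W q :=
  LinearEquiv.ofBijective (𝒳.mapCcRestrict h q) (mapCcRestrict_bijective h q)

variable (𝒳) in
/-- Extension of compactly supported cohomology from an open subset. -/
noncomputable def ccExt (W Y : Opens X) (h : W ≤ Y) (q : ℕ) : 𝒳.Cc W q →ₗ[𝒳.Q] 𝒳.Cc Y q :=
  𝒳.mapCcExtend h q ∘ₗ (𝒳.ccRestrictEquiv h q).symm.toLinearMap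

lemma ccExt_mapCcRestrict {W Y : Opens X} (h : W ≤ Y) (q : ℕ) (x : 𝒳.CcPair Y W q) :
    𝒳.ccExt W Y h q (𝒳.mapCcRestrict h q x) = 𝒳.mapCcExtend h q x :=
  congrArg (𝒳.mapCcExtend h q) ((𝒳.ccRestrictEquiv h q).symm_apply_apply x)

/-- Dually, extension from `W` to `U` is an enlargement of the index set in a common ambient `Y`,
because restricting the ambient subset commutes with enlarging the index set. -/
lemma ccExt_mapCcRestrict_of_le {W U Y : Opens X} (h : W ≤ U) (hU : U ≤ Y) (q : ℕ)
    (x : 𝒳.CcPair Y W q) : 𝒳.ccExt W U h q (𝒳.mapCcRestrict (h.trans hU) q x) =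
      𝒳.mapCcRestrict hU q ((homologyMap (𝒳.ccExtend Y h) q).hom x) := by
  have h1 : 𝒳.mapCcRestrict (h.trans hU) q =
      𝒳.mapCcRestrict h q ∘ₗ (homologyMap (𝒳.ccRestrict hU W) q).hom := by
    rw [mapCcRestrict, ← ccRestrict_comp h hU, homologyMap_comp]
    rfl
  rw [h1, LinearMap.comp_apply, ccExt_mapCcRestrict]
  refine LinearMap.congr_fun (f := 𝒳.mapCcExtend h q ∘ₗ (homologyMap (𝒳.ccRestrict hU W) q).hom)
    (g := 𝒳.mapCcRestrict hU q ∘ₗ (homologyMap (𝒳.ccExtend Y h) q).hom) ?_ x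
  have h2 := congrArg (fun f : 𝒳.ccComplex Y W ⟶ 𝒳.ccComplex U U => (homologyMap f q).hom)
    (ccRestrict_ccExtend (𝒳 := 𝒳) hU h)
  rw [homologyMap_comp, homologyMap_comp] at h2
  exact h2

theorem exists_isLongExactUp_ccExt (hUV : U ⊔ V = ⊤) :
    ∃ δ, IsLongExactUp
      (fun q => LinearMap.prod (𝒳.ccExt (U ⊓ V) U inf_le_left q)
        (-𝒳.ccExt (U ⊓ V) V inf_le_right q))
      (fun q => LinearMap.coprod (𝒳.ccExt U ⊤ le_top q) (𝒳.ccExt V ⊤ le_top q))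
      δ := by
  obtain ⟨δ, hδ⟩ := (ccSquare_acyclic (𝒳 := 𝒳) ⊤ (W₁ := U) (W₂ := V) hUV.symm rfl le_top le_top
    inf_le_left inf_le_right).exists_isLongExactUp
  refine hδ.exists_of_equiv (fun q => 𝒳.ccRestrictEquiv le_top q)
    (fun q => (𝒳.ccRestrictEquiv le_top q).prodCongr (𝒳.ccRestrictEquiv le_top q))
    (fun q => LinearEquiv.refl _ _) (fun q x => ?_) (fun q x => ?_)
  · exact Prod.ext (ccExt_mapCcRestrict_of_le inf_le_left le_top q x)
      ((congrArg Neg.neg (ccExt_mapCcRestrict_of_le inf_le_right le_top q x)).trans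
        (map_neg (𝒳.mapCcRestrict le_top q) _).symm)
  · exact congrArg₂ (· + ·) (ccExt_mapCcRestrict le_top q x.1) (ccExt_mapCcRestrict le_top q x.2)

end CompactSupports

end ICData

theorem proposition3p4 {X : Type u} [TopologicalSpace X] [T2Space X] [SecondCountableTopology X]
    [ParacompactSpace X] (𝒳 : ICData X) [IsDedekindDomain 𝒳.Q] (U V A B : Opens X)
    (hUV : U ⊔ V = ⊤) (hA : A ≤ U) (hB : B ≤ V) :
    -- excision
    (∀ q, Function.Bijective
      (𝒳.mapIH (U := V) (U' := ⊤) (A := U ⊓ V) (A' := U) le_top inf_le_left q)) ∧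
    -- homology
    (∃ δ, IsLongExactDown
      (fun q => LinearMap.prod
        (𝒳.mapIH (U := U ⊓ V) (U' := U) (A := A ⊓ B) (A' := A) inf_le_left inf_le_left q)
        (-𝒳.mapIH (U := U ⊓ V) (U' := V) (A := A ⊓ B) (A' := B) inf_le_right inf_le_right q))
      (fun q => LinearMap.coprod
        (𝒳.mapIH (U := U) (U' := ⊤) (A := A) (A' := A ⊔ B) le_top le_sup_left q)
        (𝒳.mapIH (U := V) (U' := ⊤) (A := B) (A' := A ⊔ B) le_top le_sup_right q))
      δ) ∧
    -- cohomology
    (∃ δ, IsLongExactUp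
      (fun q => LinearMap.prod
        (𝒳.mapCoIH (U := U) (U' := ⊤) (A := A) (A' := A ⊔ B) le_top le_sup_left q)
        (-𝒳.mapCoIH (U := V) (U' := ⊤) (A := B) (A' := A ⊔ B) le_top le_sup_right q))
      (fun q => LinearMap.coprod
        (𝒳.mapCoIH (U := U ⊓ V) (U' := U) (A := A ⊓ B) (A' := A) inf_le_left inf_le_left q)
        (𝒳.mapCoIH (U := U ⊓ V) (U' := V) (A := A ⊓ B) (A' := B) inf_le_right inf_le_right q))
      δ) ∧
    -- Borel–Moore homology, where `r` are the restriction maps to open subsets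
    (∀ (W Y : Opens X) (h : W ≤ Y) (q : ℕ), Function.Bijective (𝒳.mapBMExtend h q)) ∧
    (∃ r : ∀ (W Y : Opens X) (_ : W ≤ Y) (q : ℕ), 𝒳.BM Y q →ₗ[𝒳.Q] 𝒳.BM W q,
      (∀ (W Y : Opens X) (h : W ≤ Y) (q : ℕ),
        𝒳.mapBMExtend h q ∘ₗ r W Y h q = 𝒳.mapBMRestrict h q) ∧
      ∃ δ, IsLongExactDown
        (fun q => LinearMap.prod (r U ⊤ le_top q) (-r V ⊤ le_top q))
        (fun q => LinearMap.coprod (r (U ⊓ V) U inf_le_left q) (r (U ⊓ V) V inf_le_right q))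
        δ) ∧
    -- compactly supported cohomology, where `e` are the extension maps from open subsets
    (∀ (W Y : Opens X) (h : W ≤ Y) (q : ℕ), Function.Bijective (𝒳.mapCcRestrict h q)) ∧
    (∃ e : ∀ (W Y : Opens X) (_ : W ≤ Y) (q : ℕ), 𝒳.Cc W q →ₗ[𝒳.Q] 𝒳.Cc Y q,
      (∀ (W Y : Opens X) (h : W ≤ Y) (q : ℕ),
        e W Y h q ∘ₗ 𝒳.mapCcRestrict h q = 𝒳.mapCcExtend h q) ∧
      ∃ δ, IsLongExactUp
        (fun q => LinearMap.prod (e (U ⊓ V) U inf_le_left q) (-e (U ⊓ V) V inf_le_right q))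
        (fun q => LinearMap.coprod (e U ⊤ le_top q) (e V ⊤ le_top q))
        δ) := by
  -- Local compactness comes from the charts and gives the exhaustions by compact subsets;
  -- normality, used to split small chains, comes from paracompactness and the Hausdorff property.
  have : LocallyCompactSpace X := 𝒳.atlas.locallyCompactSpace
  exact ⟨ICData.mapIH_bijective_of_sup_eq_top hUV, ICData.exists_isLongExactDown_mapIH hUV hA hB,
    ICData.exists_isLongExactUp_mapCoIH hUV hA hB, fun _ _ h => ICData.mapBMExtend_bijective h,
    ⟨𝒳.bmRes, fun _ _ h q => LinearMap.ext (ICData.mapBMExtend_bmRes h q),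
      ICData.exists_isLongExactDown_bmRes hUV⟩,
    fun _ _ h => ICData.mapCcRestrict_bijective h,
    ⟨𝒳.ccExt, fun _ _ h q => LinearMap.ext (ICData.ccExt_mapCcRestrict h q),
      ICData.exists_isLongExactUp_ccExt hUV⟩⟩
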